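/- **Spectral data.** Let $g\ge 0$ be an integer. Consider pairs $(a,b)$ of complex polynomials with $\deg a=2g$, $\deg b=g+1$, $\lambda^{2g}\overline{a(\bar\lambda^{-1})}=a(\lambda)$ and $\lambda^{g+1}\overline{b(\bar\lambda^{-1})}=-b(\lambda)$ ("real pairs"). Write $\nu^2=a(\lambda)/\lambda$ for the spectral curve $\Sigma$, with involution $\sigma(\lambda,\nu)=(\lambda,-\nu)$. The set $\mathcal M_g$ of *spectral data* consists of the real pairs such that: $|a(0)|=\frac1{16}$; $\lambda^{-g}a(\lambda)\le 0$ for $|\lambda|=1$; $b(0)\in e^{i\Theta/2}\mathbb R$, where $a(0)=-\frac1{16}e^{i\Theta}$; $\mathrm{Re}\int_{\alpha}^{1/\bar\alpha}\frac{b\,d\lambda}{\nu\lambda^2}=0$ along the straight segment $[\alpha,1/\bar\alpha]$ for every root $\alpha$ of $a$; there is a function $h$ on $\Sigma$ cut along the cycles over these segments (with the points over $0$ and $\infty$ removed) such that $\sigma^*h=-h$, $dh=\frac{b\,d\lambda}{\nu\lambda^2}$, and the (boundary) values of $h$ at all roots of $(\lambda-1)a$ lie in $i\pi\mathbb Z$;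 and, if $a$ has a root of higher order, $e^{h}=f\nu+k$ with $f,k$ holomorphic on $\mathbb C^*$. The *period* of $(a,b)$ is the number $\tau\ne0$ with $b(0)=-\frac{\tau e^{i\Theta}}{32}$, that is $\tau=2b(0)/a(0)$. **Minimal annuli.** A potential is a Laurent polynomial $\xi_\lambda=\sum_{d=-1}^{g}\hat\xi_d\lambda^d$ with $\hat\xi_d\in\mathfrak{sl}_2(\mathbb C)$, $\hat\xi_d=-\overline{\hat\xi_{g-1-d}}^{\,t}$, $\hat\xi_{-1}=\begin{pmatrix}0&\beta_{-1}\\0&0\end{pmatrix}$, $\beta_{-1}\in i\mathbb R^+$, $\mathrm{tr}(\hat\xi_{-1}\hat\xi_0)\ne0$; $I(a)$ is the set of potentials with $\lambda\det\xi_\lambda=-a(\lambda)$. It induces a polynomial Killing field $\zeta_\lambda$ with $d\zeta_\lambda=[\zeta_\lambda,\alpha_\lambda(\omega)]$, $\zeta_\lambda(0)=\xi_\lambda$, $4\beta_{-1}(z)=ie^{\omega(z)}$, and an extended frame $F_\lambda$ with $F_\lambda^{-1}dF_\lambda=\alpha_\lambda(\omega)$, $F_\lambda(0)=1$, where $$\alpha_\lambda(\omega)=\tfrac14\begin{pmatrix}2\omega_z&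 i\lambda^{-1}e^{\omega}\\ ie^{i\Theta}e^{-\omega}&-2\omega_z\end{pmatrix}dz+\tfrac14\begin{pmatrix}-2\omega_{\bar z}& ie^{-i\Theta}e^{-\omega}\\ i\lambda e^{\omega}&2\omega_{\bar z}\end{pmatrix}d\bar z .$$ A *minimal annulus with spectral data* $(a,b)\in\mathcal M_g$ is a conformal minimal immersion $X:\mathbb C/\tau\mathbb Z\to\mathbb S^2\times\mathbb R$ of the form $X(z)=\bigl(F_1(z)\sigma_3F_1(z)^{-1},\mathrm{Re}(-ie^{i\Theta/2}z)\bigr)$ for some $\xi\in I(a)$, with $\sigma_3=\mathrm{diag}(i,-i)$ and $\mathbb S^2\subset\mathfrak{su}(2)\cong\mathbb R^3$, with $\tau$ the period of $(a,b)$, $\zeta_\lambda(z+\tau)=\zeta_\lambda(z)$, and such that the eigenvalues $\mu^{\pm1}$ of $F_\lambda(\tau)$ satisfy $d\ln\mu=\frac{b\,d\lambda}{\nu\lambda^2}$. Its flux is $F_3=\int\eta_3\,ds$, the integral of the vertical component of the unit conormal over the generator of the annulus. **Theorem.** Let $W$ be an open set of real pairs $(a,b)$ (in the finite-dimensional real vector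 space of coefficients) such that $a$ and $b$ have no common roots, and let $U=W\cap\mathcal M_g$, an open subset of $\mathcal M_g$. Polynomials $c$ of degree $g+1$ with $\lambda^{g+1}\overline{c(\bar\lambda^{-1})}=c(\lambda)$ exist. Let $c=c_{(a,b)}$ be any polynomial of degree at most $g+1$ with this reality condition, depending smoothly on $(a,b)\in W$. Then the equation $$-2\dot b\,a+b\,\dot a=-2\lambda a c'+ac+\lambda a'c ,$$ together with the infinitesimal normalization $\mathrm{Re}\bigl(\dot a(0)\overline{a(0)}\bigr)=0$ (that is, $|a(0)|$ is preserved), has for every $(a,b)\in W$ exactly one solution $(\dot a,\dot b)$ satisfying the linear reality conditions of $(a,b)$, with $\deg\dot a\le 2g$ and $\deg\dot b\le g+1$, and it defines a smooth vector field on $W$. Suppose that (i) $c(1)=0$ and (ii) $\mathrm{Im}(c(0)/b(0))=0$ for all $(a,b)\in U$. Then through every point of $U$ passes an integral curve with values in $U$, and for every integral curve $(a(t),b(t))_{t\in I}$ in $W$ on an interval $I$ which meets $\mathcal M_g$, all $(a(t),b(t))$ are spectral data of minimal annuli $X_t$ in $\mathbb S^2\times\mathbb R$ that depend continuously on $t\in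 I$ (in the topology of uniform convergence on compact sets, with potentials depending continuously on $t$). If in addition $\mathrm{Re}(c(0)/b(0))<0$ on $U$, then the flux of these annuli is bounded away from zero in forward time: for every $t_0\in I$ there is $\delta>0$ with $|F_3(X_t)|\ge\delta$ for all $t\in I$, $t\ge t_0$. -/

import Mathlib

open Polynomial Set Filter Topology
open scoped ContDiff ComplexConjugate

noncomputable section

namespace Whitham

/-! ### Real polynomials and pairs of polynomials -/

/-- The polynomial `∑ i, v i * X ^ i` with coefficient vector `v`, of degree at most `n - 1`. -/
def polyOf {n : ℕ} (v : Fin n → ℂ) : ℂ[X] := ∑ i : Fin n, C (v i) * X ^ (i : ℕ)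

/-- Polynomials `c` of degree at most `g + 1` with `l ^ (g + 1) * conj (c (1 / conj l)) = c l`,
given by their coefficient vectors. -/
def RealPoly (g : ℕ) : Submodule ℝ (Fin (g + 2) → ℂ) where
  carrier := {c | ∀ i, c i.rev = conj (c i)}
  add_mem' := by
    intro x y hx hy i
    simp [hx i, hy i]
  zero_mem' := by
    intro i
    simp
  smul_mem' := by
    intro r x hx i
    simp [hx i]

/-- Pairs `(a, b)` of polynomials of degree at most `2 * g` and `g + 1`, given by their
coefficient vectors, with `l ^ (2 * g) * conj (a (1 / conj l)) = a l` and
`l ^ (g + 1) * conj (b (1 / conj l)) = - b l`. -/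
def RealPair (g : ℕ) : Submodule ℝ ((Fin (2 * g + 1) → ℂ) × (Fin (g + 2) → ℂ)) where
  carrier := {x | (∀ i, x.1 i.rev = conj (x.1 i)) ∧ (∀ i, x.2 i.rev = -conj (x.2 i))}
  add_mem' := by
    rintro x y ⟨hx, hx'⟩ ⟨hy, hy'⟩
    refine ⟨fun i => ?_, fun i => ?_⟩
    · simp [hx i, hy i]
    · simp [hx' i, hy' i]
      ring
  zero_mem' := by
    refine ⟨fun i => ?_, fun i => ?_⟩ <;> simp
  smul_mem' := by
    rintro r x ⟨hx, hx'⟩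
    refine ⟨fun i => ?_, fun i => ?_⟩
    · simp [hx i]
    · simp [hx' i]

/-- The polynomial `c`. -/
def cPoly {g : ℕ} (c : RealPoly g) : ℂ[X] := polyOf c.1

/-- The polynomial `a` of a pair `(a, b)`. -/
def aPoly {g : ℕ} (x : RealPair g) : ℂ[X] := polyOf x.1.1

/-- The polynomial `b` of a pair `(a, b)`. -/
def bPoly {g : ℕ} (x : RealPair g) : ℂ[X] := polyOf x.1.2

/-! ### The spectral curve `ν ^ 2 = a l / l` and the function `h = ln μ` -/

/-- The `l`-plane without `0` and without the straight segments `[α, 1 / conj α]` that join a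
root `α` of `a` to the reflected root. -/
def cutPlane (a : ℂ[X]) : Set ℂ :=
  {l | l ≠ 0 ∧ ∀ α, a.eval α = 0 → l ∉ segment ℝ α (conj α)⁻¹}

/-- The spectral curve without the points over `l = 0, ∞` and without the closed cycles over
the segments `[α, 1 / conj α]`; its points are written `(l, ν)`. -/
def cutCurve (a : ℂ[X]) : Set (ℂ × ℂ) :=
  {p | p.1 ∈ cutPlane a ∧ p.2 ^ 2 * p.1 = a.eval p.1}

/-- `h` is a function on the cut spectral curve which is odd under the hyperelliptic involution
`(l, ν) ↦ (l, -ν)` and has the differential `dh = b dl / (ν l ^ 2)`. The projection to `l` is a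
local coordinate of the cut curve, so the differential is computed along the continuous
local branches `l ↦ (l, s l)`. -/
def IsLogMu (a b : ℂ[X]) (h : ℂ × ℂ → ℂ) : Prop :=
  (∀ l ν : ℂ, (l, ν) ∈ cutCurve a → h (l, -ν) = -h (l, ν)) ∧
  ∀ (V : Set ℂ) (s : ℂ → ℂ), IsOpen V → V ⊆ cutPlane a → ContinuousOn s V →
    (∀ l ∈ V, s l ^ 2 * l = a.eval l) →
    ∀ l ∈ V, HasDerivAt (fun w => h (w, s w)) (b.eval l / (s l * l ^ 2)) l

/-- The subset `i π ℤ` of the complex plane. -/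
def iPiZ : Set ℂ := range fun n : ℤ => (n : ℂ) * (Complex.I * (Real.pi : ℂ))

/-- The boundary values of `h` over the point `α` of the `l`-plane lie in `i π ℤ`. -/
def TakesValuesInIPiZAt (a : ℂ[X]) (h : ℂ × ℂ → ℂ) (α : ℂ) : Prop :=
  Tendsto (fun p => Metric.infDist (h p) iPiZ)
    (comap Prod.fst (𝓝 α) ⊓ 𝓟 (cutCurve a)) (𝓝 0)

/-- The real part of the integral of `b dl / (ν l ^ 2)` along the straight segment
`[α, 1 / conj α]` vanishes, for every continuous choice of `ν` along the segment. -/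
def SegmentIntegralReZero (a b : ℂ[X]) (α : ℂ) : Prop :=
  ∀ s : ℝ → ℂ, ContinuousOn s (Icc 0 1) →
    (∀ t ∈ Icc (0 : ℝ) 1,
      s t ^ 2 * AffineMap.lineMap α (conj α)⁻¹ t = a.eval (AffineMap.lineMap α (conj α)⁻¹ t)) →
    (∫ t in (0 : ℝ)..1, b.eval (AffineMap.lineMap α (conj α)⁻¹ t) /
      (s t * (AffineMap.lineMap α (conj α)⁻¹ t : ℂ) ^ 2) * ((conj α)⁻¹ - α)).re = 0

/-- Spectral data `(a, b)` of minimal cylinders of finite type. The reality conditions on `a`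
and `b` are part of the type `RealPair g`, and by them `normalized` and `b_zero_ne` say that the
degrees are exactly `2 * g` and `g + 1`. -/
structure IsSpectralData {g : ℕ} (x : RealPair g) : Prop where
  normalized : ‖(aPoly x).eval 0‖ = 1 / 16
  b_zero_ne : (bPoly x).eval 0 ≠ 0
  nonpos : ∀ l : ℂ, ‖l‖ = 1 → ∃ r : ℝ, r ≤ 0 ∧ (aPoly x).eval l / l ^ g = r
  b_zero : ∃ Θ r : ℝ, (aPoly x).eval 0 = -(1 / 16) * Complex.exp (Θ * Complex.I) ∧
    (bPoly x).eval 0 = r * Complex.exp (Θ / 2 * Complex.I)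
  segment_integral : ∀ α, (aPoly x).eval α = 0 → SegmentIntegralReZero (aPoly x) (bPoly x) α
  closing : ∃ h : ℂ × ℂ → ℂ, IsLogMu (aPoly x) (bPoly x) h ∧
    (∀ α, ((X - 1) * aPoly x).eval α = 0 → TakesValuesInIPiZAt (aPoly x) h α) ∧
    ((∃ α, 2 ≤ (aPoly x).rootMultiplicity α) →
      ∃ f k : ℂ → ℂ, DifferentiableOn ℂ f {0}ᶜ ∧ DifferentiableOn ℂ k {0}ᶜ ∧
        ∀ l ν : ℂ, (l, ν) ∈ cutCurve (aPoly x) → Complex.exp (h (l, ν)) = f l * ν + k l)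

/-- The set of spectral data `(a, b)` of spectral genus `g`. -/
def spectralData (g : ℕ) : Set (RealPair g) := {x | IsSpectralData x}

/-- The period `τ` of spectral data, defined by `b 0 = - τ * exp (i Θ) / 32` where
`a 0 = - exp (i Θ) / 16`. -/
def period {g : ℕ} (x : RealPair g) : ℂ := 2 * (bPoly x).eval 0 / (aPoly x).eval 0

/-! ### The Whitham vector field -/

/-- `y = (ȧ, ḃ)` is a tangent vector at `x = (a, b)` which solves the Whitham equation
`-2 ḃ a + b ȧ = -2 l a c' + a c + l a' c` and is tangent to the level sets of `|a 0|`, which is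
normalized to `1 / 16` on spectral data. -/
def IsWhithamVector {g : ℕ} (x : RealPair g) (c : RealPoly g) (y : RealPair g) : Prop :=
  -2 * bPoly y * aPoly x + bPoly x * aPoly y =
    -2 * X * aPoly x * derivative (cPoly c) + aPoly x * cPoly c
      + X * derivative (aPoly x) * cPoly c ∧
  ((aPoly y).eval 0 * conj ((aPoly x).eval 0)).re = 0

/-- `γ` is, on the set of times `I`, an integral curve with values in `S` of the vector
field `V`. -/
def IsIntegralCurveIn {g : ℕ} (V : RealPair g → RealPair g) (S : Set (RealPair g))
    (I : Set ℝ) (γ : ℝ → RealPair g) : Prop :=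
  ∀ t ∈ I, γ t ∈ S ∧ HasDerivWithinAt γ (V (γ t)) I t

/-! ### Minimal annuli in `S² × ℝ` -/

/-- Euclidean three-space, which contains the sphere `S²`. -/
abbrev E3 := EuclideanSpace ℝ (Fin 3)

/-- The inner product in `S² × ℝ` of the images of the vectors `v` and `w` under the differential
at `z` of the map `(G, h)`. -/
def pullbackMetric (G : ℂ → E3) (h : ℂ → ℝ) (z v w : ℂ) : ℝ :=
  inner ℝ (fderiv ℝ G z v) (fderiv ℝ G z w) + fderiv ℝ h z v * fderiv ℝ h z w

/-- `X = (G, h) : ℂ / τ ℤ → S² × ℝ` is a conformally immersed minimal annulus: a `τ`-periodic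
conformal immersion of `ℂ` whose components `G` and `h` are harmonic (a conformal immersion is
minimal if and only if it is harmonic). -/
structure IsMinimalAnnulus (τ : ℂ) (G : ℂ → E3) (h : ℂ → ℝ) : Prop where
  period_ne : τ ≠ 0
  smooth_G : ContDiff ℝ ∞ G
  smooth_h : ContDiff ℝ ∞ h
  sphere : ∀ z, G z ∈ Metric.sphere (0 : E3) 1
  harmonic_G : ∀ z, Laplacian.laplacian G z =
    -(‖fderiv ℝ G z 1‖ ^ 2 + ‖fderiv ℝ G z Complex.I‖ ^ 2) • G z
  harmonic_h : ∀ z, Laplacian.laplacian h z = 0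
  conformal_norm : ∀ z, pullbackMetric G h z 1 1 = pullbackMetric G h z Complex.I Complex.I
  conformal_angle : ∀ z, pullbackMetric G h z 1 Complex.I = 0
  immersion : ∀ z v, v ≠ 0 → 0 < pullbackMetric G h z v v
  periodic_G : ∀ z, G (z + τ) = G z
  periodic_h : ∀ z, h (z + τ) = h z

/-- The third coordinate `F₃ = ∫ η₃ ds` of the flux of the annulus along the image of the
generator `s ↦ s τ`, `0 ≤ s ≤ 1`. In a conformal parametrization the unit conormal `η` is
the normalized image of `i τ`, and `ds` is the length of the image of `τ`. -/
def verticalFlux (τ : ℂ) (G : ℂ → E3) (h : ℂ → ℝ) : ℝ :=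
  ∫ s in (0 : ℝ)..1,
    fderiv ℝ h (s * τ) (Complex.I * τ) /
        √(pullbackMetric G h (s * τ) (Complex.I * τ) (Complex.I * τ))
      * √(pullbackMetric G h (s * τ) τ τ)

/-! ### Potentials, polynomial Killing fields and extended frames -/

/-- Complex `2 × 2` matrices. -/
abbrev M2 := Matrix (Fin 2) (Fin 2) ℂ

/-- The Laurent polynomial `ξ_l = ∑ d ∈ {-1, …, g}, l ^ d * ξ̂_d`; the coefficient `ξ̂_d` is stored
at the index `d + 1`. -/
def laurent {g : ℕ} (ξ : Fin (g + 2) → M2) (l : ℂ) : M2 :=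
  ∑ j : Fin (g + 2), l ^ ((j : ℤ) - 1) • ξ j

/-- The set of potentials. The index `j.rev` belongs to the degree `g - 1 - d` if `j` belongs to
the degree `d`. -/
structure IsPotential {g : ℕ} (ξ : Fin (g + 2) → M2) : Prop where
  residue : ∃ r : ℝ, 0 < r ∧ ξ 0 = !![0, (r : ℂ) * Complex.I; 0, 0]
  trace_ne : (ξ 0 * ξ 1).trace ≠ 0
  symm : ∀ j, ξ j = -(ξ j.rev).conjTranspose
  traceless : ∀ j, (ξ j).trace = 0

/-- The isospectral set `I(a)`. -/
def isospectral (g : ℕ) (a : ℂ[X]) : Set (Fin (g + 2) → M2) :=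
  {ξ | IsPotential ξ ∧ (∀ l : ℂ, l ≠ 0 → l * (laurent ξ l).det = -a.eval l) ∧
    ξ 0 0 1 * ξ 1 1 0 = a.eval 0}

/-- The derivative `w_z = (w_x - i w_y) / 2` of a real function. -/
def dz (w : ℂ → ℝ) (z : ℂ) : ℂ :=
  ((fderiv ℝ w z 1 : ℝ) - Complex.I * (fderiv ℝ w z Complex.I : ℝ)) / 2

/-- The value on the tangent vector `v` at the point `z` of the matrix valued one-form
`α_l(w) = A dz + B dz̄`, with unimodular constant `κ`. -/
def alphaForm (κ : ℂ) (w : ℂ → ℝ) (l z v : ℂ) : M2 :=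
  (v / 4) • !![2 * dz w z, Complex.I * l⁻¹ * Real.exp (w z);
               Complex.I * κ * Real.exp (-w z), -2 * dz w z] +
  (conj v / 4) • !![-2 * conj (dz w z), Complex.I * conj κ * Real.exp (-w z);
                    Complex.I * l * Real.exp (w z), 2 * conj (dz w z)]

/-- The matrix valued function `f` is differentiable, with derivative `f' z v` at the point `z` in
the direction `v`. -/
def HasMatrixDifferential (f : ℂ → M2) (f' : ℂ → ℂ → M2) : Prop :=
  ∀ i j, Differentiable ℝ (fun z => f z i j) ∧
    ∀ z v, fderiv ℝ (fun w => f w i j) z v = f' z v i j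

/-- `ζ` is the polynomial Killing field with initial value `ξ` and `F` the extended frame:
`dζ_l = [ζ_l, α_l(w)]` with `ζ_l(0) = ξ_l` and `4 β_{-1} = i exp w` (so `w` is the solution of the sinh-Gordon equation), and `dF_l = F_l α_l(w)`
with `F_l(0) = 1`. -/
structure IsExtendedFrame {g : ℕ} (κ : ℂ) (ξ : Fin (g + 2) → M2) (w : ℂ → ℝ)
    (ζ : ℂ → Fin (g + 2) → M2) (F : ℂ → ℂ → M2) : Prop where
  smooth : ContDiff ℝ ∞ w
  potential : ∀ z, IsPotential (ζ z)
  initial : ζ 0 = ξ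
  metric : ∀ z, 4 * ζ z 0 0 1 = Complex.I * Real.exp (w z)
  lax : ∀ l : ℂ, l ≠ 0 → HasMatrixDifferential (fun z => laurent (ζ z) l)
    (fun z v => laurent (ζ z) l * alphaForm κ w l z v - alphaForm κ w l z v * laurent (ζ z) l)
  frame_initial : ∀ l : ℂ, l ≠ 0 → F l 0 = 1
  frame : ∀ l : ℂ, l ≠ 0 → HasMatrixDifferential (F l) (fun z v => F l z * alphaForm κ w l z v)

/-- The point `(x, y, w)` of Euclidean three-space which corresponds to the matrix
`i * !![w, x - i y; x + i y, -w]` of the Lie algebra `su(2)`. -/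
def toE3 (M : M2) : E3 := !₂[(M 1 0).im, -(M 1 0).re, (M 0 0).im]

/-- The matrix `σ₃`. -/
def sigma3 : M2 := !![Complex.I, 0; 0, -Complex.I]

/-- `X = (G, h)` is a minimal annulus with spectral data `x = (a, b)`. It is the immersion
`(F_1 σ₃ F_1⁻¹, Re (-i exp (i Θ / 2) z))` induced by the potential `ξ` in the isospectral
set `I(a)`, its period is the period `τ` of `(a, b)`, and the eigenvalues `μ` and `μ⁻¹` of its
monodromy `F_l(τ)` satisfy `d ln μ = b dl / (ν l ^ 2)`. -/
structure HasSpectralData {g : ℕ} (x : RealPair g) (Θ : ℝ) (ξ : Fin (g + 2) → M2)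
    (G : ℂ → E3) (h : ℂ → ℝ) : Prop where
  minimal : IsMinimalAnnulus (period x) G h
  phase : (aPoly x).eval 0 = -(1 / 16) * Complex.exp (Θ * Complex.I)
  potential : ξ ∈ isospectral g (aPoly x)
  induced : ∃ (w : ℂ → ℝ) (ζ : ℂ → Fin (g + 2) → M2) (F : ℂ → ℂ → M2),
    IsExtendedFrame (Complex.exp (Θ * Complex.I)) ξ w ζ F ∧
    (∀ z, G z = toE3 (F 1 z * sigma3 * (F 1 z)⁻¹)) ∧
    (∀ z, h z = (-Complex.I * Complex.exp (Θ / 2 * Complex.I) * z).re) ∧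
    (∀ z, ζ (z + period x) = ζ z) ∧
    ∃ lnμ : ℂ × ℂ → ℂ, IsLogMu (aPoly x) (bPoly x) lnμ ∧
      ∀ l ν : ℂ, (l, ν) ∈ cutCurve (aPoly x) →
        (F l (period x)).trace = Complex.exp (lnμ (l, ν)) + Complex.exp (-lnμ (l, ν))

/-- `(γ t)` are, for `t ∈ I`, spectral data of the minimal annuli `(G t, h t)`, which depend
continuously on `t`, in the topology of uniform convergence on compact sets, as do the
potentials `ξ t` that induce them. -/
structure IsContinuousFamily {g : ℕ} (I : Set ℝ) (γ : ℝ → RealPair g) (Θ : ℝ → ℝ)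
    (ξ : ℝ → Fin (g + 2) → M2) (G : ℝ → ℂ → E3) (h : ℝ → ℂ → ℝ) : Prop where
  spectral : ∀ t ∈ I, γ t ∈ spectralData g
  annuli : ∀ t ∈ I, HasSpectralData (γ t) (Θ t) (ξ t) (G t) (h t)
  continuous_Θ : ContinuousOn Θ I
  continuous_ξ : ContinuousOn ξ I
  continuous_G : ContinuousOn (fun p : ℝ × ℂ => G p.1 p.2) (I ×ˢ univ)
  continuous_h : ContinuousOn (fun p : ℝ × ℂ => h p.1 p.2) (I ×ˢ univ)

end Whitham

end

noncomputable section

namespace Whitham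

open Complex Metric NNReal

set_option maxSynthPendingDepth 3

variable {g n : ℕ} {x y : RealPair g} {c : RealPoly g} {a b : ℂ[X]} {U : Set ℂ} {J : Set ℝ}
  {l p α : ℂ} {t : ℝ}

local notation "𝕀" => Icc (0 : ℝ) 1

section ODE

variable {E : Type*} [NormedAddCommGroup E] [NormedSpace ℝ E]

/-- `u` solves `u' = f t u` on the unit interval. -/
def SolvesOn (f : ℝ → E → E) (u : ℝ → E) : Prop := ∀ t ∈ 𝕀, HasDerivWithinAt u (f t (u t)) 𝕀 t

theorem SolvesOn.continuousOn {f : ℝ → E → E} {u : ℝ → E} (h : SolvesOn f u) :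
    ContinuousOn u 𝕀 := fun t ht => (h t ht).continuousWithinAt

theorem hasDerivWithinAt_Ici_of_Icc {u : ℝ → E} {u' : E}
    (h : HasDerivWithinAt u u' 𝕀 t) (ht : t ∈ Ico (0 : ℝ) 1) :
    HasDerivWithinAt u u' (Ici t) t :=
  h.mono_of_mem_nhdsWithin (Icc_mem_nhdsGE_of_mem ht)

theorem SolvesOn.unique {f : ℝ → E → E} {u v : ℝ → E} (hu : SolvesOn f u) (hv : SolvesOn f v)
    {K : ℝ≥0} {S : Set E} (hK : ∀ t ∈ 𝕀, LipschitzOnWith K (f t) S)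
    (hus : ∀ t ∈ 𝕀, u t ∈ S) (hvs : ∀ t ∈ 𝕀, v t ∈ S)
    (h0 : u 0 = v 0) : EqOn u v 𝕀 :=
  ODE_solution_unique_of_mem_Icc_right (fun t ht => hK t (Ico_subset_Icc_self ht)) hu.continuousOn
    (fun t ht => hasDerivWithinAt_Ici_of_Icc (hu t (Ico_subset_Icc_self ht)) ht)
    (fun t ht => hus t (Ico_subset_Icc_self ht)) hv.continuousOn
    (fun t ht => hasDerivWithinAt_Ici_of_Icc (hv t (Ico_subset_Icc_self ht)) ht)
    (fun t ht => hvs t (Ico_subset_Icc_self ht)) h0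

theorem exists_solvesOn_of_bounded [CompleteSpace E] (f : ℝ → E → E) (K L : ℝ≥0)
    (hK : ∀ t ∈ 𝕀, LipschitzWith K (f t))
    (hc : ∀ x, ContinuousOn (fun t => f t x) 𝕀)
    (hL : ∀ t ∈ 𝕀, ∀ x, ‖f t x‖ ≤ L) (x0 : E) :
    ∃ u, u 0 = x0 ∧ SolvesOn f u := by
  have h : IsPicardLindelof f (⟨0, by simp⟩ : 𝕀) x0 L 0 L K :=
    { lipschitzOnWith := fun t ht => (hK t ht).lipschitzOnWith, continuousOn := fun x _ => hc x
      norm_le := fun t ht x _ => hL t ht x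
      mul_max_le := by simp }
  obtain ⟨u, h0, hu⟩ := h.exists_eq_forall_mem_Icc_hasDerivWithinAt₀
  exact ⟨u, h0, hu⟩

end ODE

section Cutoff

variable {E : Type*} [NormedAddCommGroup E]

/-- A Lipschitz cutoff function, equal to `1` on the ball of radius `R` and to `0` outside of the
ball of radius `R + 1`. -/
def cutoff (R : ℝ) (x : E) : ℝ := max 0 (min 1 (R + 1 - ‖x‖))

theorem abs_cutoff_sub_le (R : ℝ) (x y : E) : |cutoff R x - cutoff R y| ≤ ‖x - y‖ := by
  unfold cutoff
  refine (abs_max_sub_max_le_max _ _ _ _).trans (max_le (by simp) ?_)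
  refine (abs_min_sub_min_le_max _ _ _ _).trans (max_le (by simp) ?_)
  have := abs_norm_sub_norm_le y x
  rw [norm_sub_rev] at this
  rwa [show R + 1 - ‖x‖ - (R + 1 - ‖y‖) = ‖y‖ - ‖x‖ by ring]

end Cutoff

section ODE

variable {E : Type*} [NormedAddCommGroup E] [NormedSpace ℝ E]

theorem exists_solvesOn_of_apriori [CompleteSpace E] (f : ℝ → E → E) (R : ℝ) (K M : ℝ≥0)
    (hK : ∀ t ∈ 𝕀, LipschitzOnWith K (f t) (closedBall 0 (R + 1)))
    (hM : ∀ t ∈ 𝕀, ∀ x ∈ closedBall (0 : E) (R + 1), ‖f t x‖ ≤ M)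
    (hc : ∀ x, ContinuousOn (fun t => f t x) 𝕀) (x0 : E)
    (hR : ∀ χ : ℝ → ℝ, (∀ s, 0 ≤ χ s ∧ χ s ≤ 1) → ∀ u, u 0 = x0 →
      SolvesOn (fun t x => χ t • f t x) u → ∀ t ∈ 𝕀, ‖u t‖ ≤ R) :
    ∃ u, u 0 = x0 ∧ SolvesOn f u ∧ ∀ t ∈ 𝕀, ‖u t‖ ≤ R := by
  have hχ : ∀ x : E, 0 ≤ cutoff R x ∧ cutoff R x ≤ 1 := fun x =>
    ⟨le_max_left _ _, max_le zero_le_one (min_le_left _ _)⟩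
  have hout : ∀ x, x ∉ closedBall (0 : E) (R + 1) → cutoff R x = 0 := by
    intro x hx
    simp at hx
    exact max_eq_left ((min_le_right _ _).trans (by linarith))
  have hL : ∀ t ∈ 𝕀, LipschitzWith (M + K) (fun x => cutoff R x • f t x) := by
    intro t ht
    have key : ∀ x ∈ closedBall (0 : E) (R + 1), ∀ y,
        ‖cutoff R x • f t x - cutoff R y • f t y‖ ≤ (M + K) * ‖x - y‖ := by
      intro x hx y
      have h1 := mul_le_mul (abs_cutoff_sub_le R x y) (hM t ht x hx) (norm_nonneg _) (norm_nonneg _)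
      by_cases hy : y ∈ closedBall (0 : E) (R + 1)
      · have h2 := (hK t ht).norm_sub_le hx hy
        calc ‖cutoff R x • f t x - cutoff R y • f t y‖
            = ‖(cutoff R x - cutoff R y) • f t x + cutoff R y • (f t x - f t y)‖ := by
              congr 1; rw [sub_smul, smul_sub]; abel
          _ ≤ |cutoff R x - cutoff R y| * ‖f t x‖ + |cutoff R y| * ‖f t x - f t y‖ := by
              refine (norm_add_le _ _).trans ?_
              rw [norm_smul, norm_smul, Real.norm_eq_abs, Real.norm_eq_abs]
          _ ≤ ‖x - y‖ * M + 1 * (K * ‖x - y‖) := by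
              refine add_le_add h1 (mul_le_mul ?_ h2 (norm_nonneg _) zero_le_one)
              rw [abs_of_nonneg (hχ y).1]; exact (hχ y).2
          _ = _ := by ring
      · rw [hout y hy, zero_smul, sub_zero, norm_smul, Real.norm_eq_abs]
        rw [hout y hy, sub_zero] at h1
        refine h1.trans ?_
        nlinarith [norm_nonneg (x - y), K.2, mul_nonneg K.2 (norm_nonneg (x - y))]
    refine LipschitzWith.of_dist_le_mul fun x y => ?_
    rw [dist_eq_norm, dist_eq_norm]
    by_cases hx : x ∈ closedBall (0 : E) (R + 1)
    · exact key x hx y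
    · by_cases hy : y ∈ closedBall (0 : E) (R + 1)
      · rw [norm_sub_rev, norm_sub_rev x]; exact key y hy x
      · rw [hout x hx, hout y hy]; simp; positivity
  obtain ⟨u, h0, hu⟩ := exists_solvesOn_of_bounded (fun t x => cutoff R x • f t x) (M + K) M hL
    (fun x => (hc x).const_smul _) (by
      intro t ht x
      rw [norm_smul, Real.norm_eq_abs, abs_of_nonneg (hχ x).1]
      by_cases hx : x ∈ closedBall (0 : E) (R + 1)
      · exact (mul_le_mul (hχ x).2 (hM t ht x hx) (norm_nonneg _) zero_le_one).trans
          (by rw [one_mul])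
      · rw [hout x hx, zero_mul]; exact M.2) x0
  have hb := hR (fun t => cutoff R (u t)) (fun s => hχ _) u h0 hu
  refine ⟨u, h0, fun t ht => ?_, hb⟩
  have h1 : cutoff R (u t) = 1 := by
    have := hb t ht
    unfold cutoff
    rw [min_eq_left (by linarith), max_eq_right zero_le_one]
  simpa [h1] using hu t ht

theorem norm_le_exp_of_deriv {u : ℝ → E} {u' : ℝ → E} {M δ ε : ℝ} (hM : 1 ≤ M)
    (hδ : 0 ≤ δ) (hε : 0 ≤ ε)
    (hu : ∀ t ∈ 𝕀, HasDerivWithinAt u (u' t) 𝕀 t) (h0 : ‖u 0‖ ≤ δ)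
    (hb : ∀ t ∈ 𝕀, ‖u' t‖ ≤ M * ‖u t‖ + ε) :
    ∀ t ∈ 𝕀, ‖u t‖ ≤ (δ + ε) * Real.exp M := by
  intro t ht
  have h := norm_le_gronwallBound_of_norm_deriv_right_le (fun t ht => (hu t ht).continuousWithinAt)
    (fun t ht => hasDerivWithinAt_Ici_of_Icc (hu t (Ico_subset_Icc_self ht)) ht) h0
    (fun t ht => hb t (Ico_subset_Icc_self ht)) t ht
  refine h.trans ?_
  rw [gronwallBound_of_K_ne_0 (by linarith), sub_zero]
  have h1 : Real.exp (M * t) ≤ Real.exp M := Real.exp_le_exp.2 (by nlinarith [ht.1, ht.2])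
  have h2 := div_le_self hε hM
  have h4 : 1 ≤ Real.exp (M * t) := Real.one_le_exp (by nlinarith [ht.1])
  nlinarith [mul_le_mul_of_nonneg_left h1 hδ, mul_le_mul h2 (sub_le_self (Real.exp (M * t)) zero_le_one) (by linarith) hε, mul_le_mul_of_nonneg_left h1 hε]

theorem exists_solvesOn_linear [CompleteSpace E] (L : ℝ → E →L[ℝ] E)
    (hL : ContinuousOn L 𝕀) (x0 : E) :
    ∃ u, u 0 = x0 ∧ SolvesOn (fun t x => L t x) u := by
  obtain ⟨M0, hM0⟩ := isCompact_Icc.exists_bound_of_continuousOn hL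
  set M : ℝ≥0 := (max M0 1).toNNReal
  have hM1 : M = max M0 1 := Real.coe_toNNReal _ (by positivity)
  have hM : ∀ t ∈ 𝕀, ‖L t‖ ≤ M := fun t ht => by rw [hM1]; exact (hM0 t ht).trans (le_max_left _ _)
  set R := ‖x0‖ * Real.exp M
  obtain ⟨u, h0, hu, -⟩ := exists_solvesOn_of_apriori (fun t x => L t x) R M (M * (R + 1).toNNReal)
    (fun t ht => ((L t).lipschitz.weaken (by exact_mod_cast hM t ht)).lipschitzOnWith)
    (fun t ht x hx => by
      push_cast
      rw [Real.coe_toNNReal (R + 1) (by positivity)]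
      simp at hx
      exact ((L t).le_opNorm x).trans (mul_le_mul (hM t ht) hx (norm_nonneg _) (by positivity)))
    (fun x => hL.clm_apply continuousOn_const) x0 (by
      intro χ hχ u h0 hu t ht
      have := norm_le_exp_of_deriv (M := M) (by rw [hM1]; exact le_max_right _ _) (norm_nonneg _) le_rfl hu
        (by rw [h0]) (by
          intro t ht
          rw [norm_smul, Real.norm_eq_abs, abs_of_nonneg (hχ t).1, add_zero]
          have h1 := ((L t).le_opNorm (u t)).trans
            (mul_le_mul_of_nonneg_right (hM t ht) (norm_nonneg _))
          exact (mul_le_of_le_one_left (norm_nonneg _) (hχ t).2).trans h1) t ht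
      simpa using this)
  exact ⟨u, h0, hu⟩

theorem SolvesOn.eq_of_linear {L : ℝ → E →L[ℝ] E} (hL : ContinuousOn L 𝕀) {u v : ℝ → E}
    (hu : SolvesOn (fun t x => L t x) u) (hv : SolvesOn (fun t x => L t x) v) (h0 : u 0 = v 0) :
    EqOn u v 𝕀 := by
  obtain ⟨M0, hM0⟩ := isCompact_Icc.exists_bound_of_continuousOn hL
  refine hu.unique hv (K := M0.toNNReal) (S := univ) (fun t ht => ?_) (by simp) (by simp) h0
  refine ((L t).lipschitz.weaken ?_).lipschitzOnWith
  rw [← NNReal.coe_le_coe]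
  simp_all

theorem eq_exp_smul_of_deriv {m : ℝ → ℝ} (hm : ContinuousOn m 𝕀) {u : ℝ → E}
    (hu : SolvesOn (fun t x => m t • x) u) :
    ∃ p : ℝ → ℝ, (∀ t, 0 < p t) ∧ ∀ t ∈ 𝕀, u t = p t • u 0 := by
  have hd : ∀ t ∈ 𝕀, HasDerivWithinAt (fun t => ∫ s in 0..t, m s) (m t) 𝕀 t := by
    intro t ht
    have : Fact (t ∈ 𝕀) := ⟨ht⟩
    refine intervalIntegral.integral_hasDerivWithinAt_right
      ((hm.mono (by rw [uIcc_of_le ht.1]; exact Icc_subset_Icc le_rfl ht.2)).intervalIntegrable)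
      ?_ (hm t ht)
    exact hm.stronglyMeasurableAtFilter_nhdsWithin measurableSet_Icc t
  refine ⟨fun t => Real.exp (∫ s in 0..t, m s), fun t => Real.exp_pos _, ?_⟩
  have hw : SolvesOn (fun t x => m t • x) (fun t => Real.exp (∫ s in 0..t, m s) • u 0) := by
    intro t ht
    have := ((hd t ht).exp).smul_const (u 0)
    convert this using 1
    simp only [smul_smul, mul_comm]
  refine SolvesOn.eq_of_linear (L := fun t => m t • ContinuousLinearMap.id ℝ E)
    (hm.smul continuousOn_const) ?_ ?_ ?_
  · simpa using hu
  · simpa using hw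
  · simp

end ODE

section Holomorphic

variable {E : Type*} [NormedAddCommGroup E] [NormedSpace ℂ E]

theorem hasDerivAt_of_linear_ode {L L' : ℝ → ℂ → E →L[ℂ] E} (hU : IsOpen U)
    (hL : ∀ s ∈ 𝕀, ∀ l ∈ U, HasDerivAt (L s) (L' s l) l)
    (hLc : ∀ l ∈ U, ContinuousOn (fun s => L s l) 𝕀)
    (hL' : ContinuousOn (fun p : ℝ × ℂ => L' p.1 p.2) (Icc 0 1 ×ˢ U))
    {u : ℂ → ℝ → E} (hu : ∀ l ∈ U, SolvesOn (fun s x => L s l x) (u l))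
    {l0 : ℂ} (hl₀ : l0 ∈ U) {D : ℝ → E}
    (hD : SolvesOn (fun s x => L s l0 x + L' s l0 (u l0 s)) D)
    (h0 : HasDerivAt (fun l => u l 0) (D 0) l0) :
    ∀ s ∈ 𝕀, HasDerivAt (fun l => u l s) (D s) l0 := by
  obtain ⟨Cu, hCu⟩ := isCompact_Icc.exists_bound_of_continuousOn (hu l0 hl₀).continuousOn
  obtain ⟨Cd, hCd⟩ := isCompact_Icc.exists_bound_of_continuousOn hD.continuousOn
  obtain ⟨M0, hM₀⟩ := isCompact_Icc.exists_bound_of_continuousOn (hLc l0 hl₀)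
  have hL'0 : ContinuousOn (fun s => L' s l0) 𝕀 :=
    hL'.comp (f := fun s : ℝ => (s, l0)) (by fun_prop) (fun s hs => ⟨hs, hl₀⟩)
  obtain ⟨N, hN⟩ := isCompact_Icc.exists_bound_of_continuousOn hL'0
  have hCu0 := (norm_nonneg _).trans (hCu 0 (by simp))
  have hCd0 : 0 ≤ Cd := (norm_nonneg _).trans (hCd 0 (by simp))
  have hM0 : 0 ≤ M0 := (norm_nonneg _).trans (hM₀ 0 (by simp))
  have hN0 : 0 ≤ N := (norm_nonneg _).trans (hN 0 (by simp))
  have hunif : ∀ η > 0, ∀ᶠ l in 𝓝 l0, l ∈ U ∧ ∀ s ∈ 𝕀,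
      ‖L s l - L s l0 - (l - l0) • L' s l0‖ ≤ η * ‖l - l0‖ := by
    intro η hη
    have hev : ∀ᶠ l in 𝓝 l0, ∀ s ∈ 𝕀, s ∈ 𝕀 → l ∈ U → ‖L' s l - L' s l0‖ < η := by
      refine isCompact_Icc.eventually_forall_of_forall_eventually (fun s hs => ?_)
      have h1 : ContinuousWithinAt (fun p => ‖L' p.2 p.1 - L' p.2 l0‖) (U ×ˢ Icc 0 1) (l0, s) := by
        refine (ContinuousWithinAt.sub ?_ ?_).norm
        · exact ContinuousWithinAt.comp (x := (l0, s)) (f := fun p : ℂ × ℝ => (p.2, p.1))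
            (hL' (s, l0) ⟨hs, hl₀⟩) (by fun_prop) (fun p hp => ⟨hp.2, hp.1⟩)
        · exact ContinuousWithinAt.comp (g := fun s => L' s l0)
            (hL'0 s hs) (by fun_prop) (fun p hp => hp.2)
      have h2 := eventually_nhdsWithin_iff.1
        (h1.tendsto.eventually_lt_const (u := η) (by simpa using hη))
      filter_upwards [h2] with p hp h3 h4 using hp ⟨h4, h3⟩
    obtain ⟨ρ, hρ, hball⟩ := Metric.eventually_nhds_iff_ball.1 (hev.and (hU.mem_nhds hl₀))
    refine Metric.eventually_nhds_iff_ball.2 ⟨ρ, hρ, fun l hl => ⟨(hball l hl).2, fun s hs => ?_⟩⟩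
    have := (convex_ball l0 ρ).norm_image_sub_le_of_norm_hasDerivWithin_le (C := η)
      (fun x hx => ((hL s hs x (hball x hx).2).sub
        ((hasDerivAt_id x).smul_const _)).hasDerivWithinAt)
      (fun x hx => by rw [one_smul]; exact ((hball x hx).1 s hs hs (hball x hx).2).le)
      (mem_ball_self hρ) hl
    have e : L s l - L s l0 - (l - l0) • L' s l0
        = L s l - l • L' s l0 - (L s l0 - l0 • L' s l0) := by
      rw [sub_smul]; abel
    rw [e]; exact this
  intro s hs
  rw [hasDerivAt_iff_isLittleO, Asymptotics.isLittleO_iff]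
  intro c hc
  set M := M0 + N + 2
  set η := c / ((1 + Cu + Cd) * Real.exp M) with hη
  have hη0 : 0 < η := by positivity
  rw [hasDerivAt_iff_isLittleO, Asymptotics.isLittleO_iff] at h0
  have hη1 : 0 < min (min η 1) (η / (N + 1)) := by positivity
  filter_upwards [hunif (min η 1) (by positivity), h0 hη0,
    Metric.ball_mem_nhds l0 hη1] with l hl hl0 hlb
  obtain ⟨hlU, hl⟩ := hl
  have hd1 : ‖l - l0‖ < min (min η 1) (η / (N + 1)) := by simpa [dist_eq_norm] using hlb
  have hd2 : ‖l - l0‖ * (N + 1) ≤ η := by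
    have := hd1.le.trans (min_le_right _ _)
    rwa [le_div_iff₀ (by positivity)] at this
  have hd3 := hd1.le.trans ((min_le_left _ _).trans (min_le_right _ _))
  have hdiff : ∀ s ∈ 𝕀, ‖L s l - L s l0‖ ≤ (N + 1) * ‖l - l0‖ := by
    intro s hs
    have h1 := hl s hs
    have h2 : L s l - L s l0 = (L s l - L s l0 - (l - l0) • L' s l0) + (l - l0) • L' s l0 := by abel
    rw [h2]
    refine (norm_add_le _ _).trans ?_
    rw [norm_smul]
    nlinarith [hN s hs, min_le_right η 1, norm_nonneg (l - l0)]
  have key := norm_le_exp_of_deriv (E := E) (u := fun s => u l s - u l0 s - (l - l0) • D s)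
    (u' := fun s => L s l (u l s) - L s l0 (u l0 s) - (l - l0) • (L s l0 (D s) + L' s l0 (u l0 s)))
    (M := M) (ε := η * ‖l - l0‖ * (Cu + Cd)) (by simp only [M]; linarith)
    (by positivity) (by positivity)
    (fun t ht => ((hu l hlU t ht).sub (hu l0 hl₀ t ht)).sub ((hD t ht).const_smul _))
    hl0 (by
      intro t ht
      have e1 : L t l (u l t) - L t l0 (u l0 t) - (l - l0) • (L t l0 (D t) + L' t l0 (u l0 t))
          = L t l (u l t - u l0 t - (l - l0) • D t) + (L t l - L t l0 - (l - l0) • L' t l0) (u l0 t)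
            + (l - l0) • (L t l - L t l0) (D t) := by
        simp only [map_sub, map_smul, sub_apply, smul_apply, smul_add, smul_sub]
        abel
      rw [e1]
      refine (norm_add₃_le).trans ?_
      rw [norm_smul]
      have b1 : ‖L t l (u l t - u l0 t - (l - l0) • D t)‖ ≤ M * ‖u l t - u l0 t - (l - l0) • D t‖ := by
        refine ((L t l).le_opNorm _).trans (mul_le_mul_of_nonneg_right ?_ (norm_nonneg _))
        have h2 : L t l = (L t l - L t l0) + L t l0 := by abel
        rw [h2]
        refine (norm_add_le _ _).trans ?_
        nlinarith [hdiff t ht, hM₀ t ht]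
      have b2 : ‖(L t l - L t l0 - (l - l0) • L' t l0) (u l0 t)‖ ≤ η * ‖l - l0‖ * Cu := by
        refine (ContinuousLinearMap.le_opNorm _ _).trans
          (mul_le_mul ((hl t ht).trans ?_) (hCu t ht) (norm_nonneg _) (by positivity))
        exact mul_le_mul_of_nonneg_right (min_le_left _ _) (norm_nonneg _)
      have b3 : ‖l - l0‖ * ‖(L t l - L t l0) (D t)‖ ≤ η * ‖l - l0‖ * Cd := by
        have h1 : ‖(L t l - L t l0) (D t)‖ ≤ η * Cd := by
          refine (ContinuousLinearMap.le_opNorm _ _).trans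
            (mul_le_mul ((hdiff t ht).trans ?_) (hCd t ht) (norm_nonneg _) hη0.le)
          linarith
        calc ‖l - l0‖ * ‖(L t l - L t l0) (D t)‖ ≤ ‖l - l0‖ * (η * Cd) :=
              mul_le_mul_of_nonneg_left h1 (norm_nonneg _)
          _ = _ := by ring
      linarith) s hs
  refine key.trans (le_of_eq ?_)
  have : c = η * ((1 + Cu + Cd) * Real.exp M) := by rw [hη]; field_simp
  rw [this]; ring

end Holomorphic

section Quadratic

variable {V A : Type*} [NormedAddCommGroup V] [NormedSpace ℝ V] [NormedAddCommGroup A]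
  [NormedSpace ℝ A]

theorem norm_trilinear_le (B : V →L[ℝ] A →L[ℝ] A →L[ℝ] A) (v : V) (x y : A) :
    ‖B v x y‖ ≤ ‖B‖ * ‖v‖ * ‖x‖ * ‖y‖ := by
  refine ((B v).le_opNorm₂ x y).trans ?_
  gcongr
  exact B.le_opNorm v

theorem norm_quadratic_sub_le (B : V →L[ℝ] A →L[ℝ] A →L[ℝ] A) (v : V) (x y : A) :
    ‖B v x x - B v y y‖ ≤ ‖B‖ * ‖v‖ * (‖x‖ + ‖y‖) * ‖x - y‖ := by
  have e : B v x x - B v y y = B v x (x - y) + B v (x - y) y := by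
    simp only [map_sub, sub_apply]; abel
  rw [e]
  refine (norm_add_le _ _).trans ?_
  have h1 := norm_trilinear_le B v x (x - y)
  have h2 := norm_trilinear_le B v (x - y) y
  calc _ ≤ _ := add_le_add h1 h2
    _ = _ := by ring

theorem lipschitzOnWith_quadratic (B : V →L[ℝ] A →L[ℝ] A →L[ℝ] A) {v : V} {ρ r : ℝ}
    (hv : ‖v‖ ≤ ρ) (hr : 0 ≤ r) :
    LipschitzOnWith (‖B‖ * ρ * (r + r)).toNNReal (fun x => B v x x) (closedBall 0 r) := by
  have hρ := (norm_nonneg _).trans hv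
  refine LipschitzOnWith.of_dist_le_mul fun x hx y hy => ?_
  rw [dist_eq_norm, dist_eq_norm, Real.coe_toNNReal _ (by positivity)]
  refine (norm_quadratic_sub_le B v x y).trans ?_
  simp at hx hy
  gcongr

theorem exists_commuting_flow [CompleteSpace A] (K : Submodule ℝ A) [CompleteSpace K]
    (B : V →L[ℝ] A →L[ℝ] A →L[ℝ] A) (hK : ∀ v, ∀ u ∈ K, B v u u ∈ K)
    (hcomm : ∀ v w, ∀ u ∈ K, B w (B v u u) u + B w u (B v u u) = B v (B w u u) u + B v u (B w u u))
    {u0 : A} (hu0 : u0 ∈ K) (R : ℝ → ℝ)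
    (hR : ∀ ρ v, ‖v‖ ≤ ρ → ∀ χ : ℝ → ℝ, (∀ s, 0 ≤ χ s ∧ χ s ≤ 1) → ∀ u : ℝ → A, u 0 = u0 →
      (∀ t ∈ 𝕀, u t ∈ K) → SolvesOn (fun t x => χ t • B v x x) u →
      ∀ t ∈ 𝕀, ‖u t‖ ≤ R ρ) :
    ∃ Z : V → A, Z 0 = u0 ∧ (∀ z, Z z ∈ K) ∧ (∀ ρ z, ‖z‖ ≤ ρ → ‖Z z‖ ≤ R ρ) ∧
      ∀ z, HasFDerivAt Z ((B.flip (Z z)).flip (Z z)) z := by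
  have hex : ∀ v : V, ∃ u, u 0 = u0 ∧ (∀ t, u t ∈ K) ∧ SolvesOn (fun _ x => B v x x) u := by
    intro v
    have hR0 : 0 ≤ R ‖v‖ + 1 := by
      by_contra hcon
      have := hR ‖v‖ v le_rfl (fun _ => 0) (by simp) (fun _ => u0) rfl (fun _ _ => hu0)
        (fun t _ => by simpa using hasDerivWithinAt_const t 𝕀 u0) 0 (by simp)
      linarith [norm_nonneg u0]
    obtain ⟨u, h0, hu, -⟩ := exists_solvesOn_of_apriori (E := K)
      (fun _ x => ⟨B v x x, hK v x x.2⟩) (R ‖v‖)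
      (‖B‖ * ‖v‖ * ((R ‖v‖ + 1) + (R ‖v‖ + 1))).toNNReal
      (‖B‖ * ‖v‖ * (R ‖v‖ + 1) * (R ‖v‖ + 1)).toNNReal
      (fun t _ x hx y hy => lipschitzOnWith_quadratic B le_rfl hR0
        (by simpa using hx) (by simpa using hy))
      (fun t _ x hx => by
        rw [Real.coe_toNNReal _ (by positivity)]
        refine (norm_trilinear_le B v x x).trans ?_
        simp at hx
        gcongr)
      (fun x => continuousOn_const) ⟨u0, hu0⟩ (by
        intro χ hχ u h0 hu t ht
        exact hR ‖v‖ v le_rfl χ hχ (fun t => (u t : A)) (by simp [h0]) (fun t _ => (u t).2)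
          (fun t ht => K.subtypeL.hasFDerivAt.comp_hasDerivWithinAt t (hu t ht)) t ht)
    exact ⟨fun t => (u t : A), by simp [h0], fun t => (u t).2,
      fun t ht => K.subtypeL.hasFDerivAt.comp_hasDerivWithinAt t (hu t ht)⟩
  choose u h0 hmem hu using hex
  have hbd := fun ρ v hv => hR ρ v hv (fun _ => 1) (by simp) (u v) (h0 v) (fun t _ => hmem v t)
      (by simpa using hu v)
  have hray : ∀ v, ∀ s ∈ 𝕀, u (s • v) 1 = u v s := by
    intro v s hs
    have hmaps : MapsTo (fun t => s * t) 𝕀 𝕀 := fun t ht =>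
      ⟨mul_nonneg hs.1 ht.1, mul_le_one₀ hs.2 ht.1 ht.2⟩
    have h1 : SolvesOn (fun _ x => B (s • v) x x) (fun t => u v (s * t)) := by
      intro t ht
      have := (hu v (s * t) (hmaps ht)).scomp t
        (((hasDerivAt_id t).const_mul s).hasDerivWithinAt) hmaps
      refine HasDerivWithinAt.congr_deriv this ?_
      simp
    have hs1 : ‖s • v‖ ≤ ‖v‖ := by
      rw [norm_smul, Real.norm_eq_abs, abs_of_nonneg hs.1]
      exact mul_le_of_le_one_left (norm_nonneg _) hs.2
    have hR0 := (norm_nonneg _).trans (hbd ‖v‖ v le_rfl 0 (by simp))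
    have := (hu (s • v)).unique h1 (fun t _ => lipschitzOnWith_quadratic B hs1 hR0)
      (by simpa using hbd _ _ hs1)
      (fun t ht => by simpa using hbd _ _ le_rfl _ (hmaps ht)) (by simp [h0])
      (show 1 ∈ 𝕀 by simp)
    simpa using this
  refine ⟨fun z => u z 1, ?_, fun z => hmem z 1, fun ρ z hz => hbd ρ z hz 1 (by simp), ?_⟩
  · have := hray 0 0 (by simp)
    simpa [h0] using this
  intro z
  set ρ := ‖z‖ + 1
  set R0 := R ρ
  have hR0 := (norm_nonneg _).trans (hbd ρ z (by simp [ρ]) 0 (by simp))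
  set C := ‖B‖ * (‖B‖ * R0 * R0 * R0) + ‖B‖ * (‖B‖ * R0 * R0 * R0)
    + ‖B‖ * ρ * (‖B‖ * R0 * R0) * (‖B‖ * R0 * R0)
  set M := max 1 (‖B‖ * ρ * (R0 + (R0 + ‖B‖ * R0 * R0)))
  have key : ∀ w : V, ‖w‖ ≤ 1 →
      ‖u (z + w) 1 - u z 1 - B w (u z 1) (u z 1)‖ ≤ C * Real.exp M * ‖w‖ * ‖w‖ := by
    intro w hw
    have hzw : ‖z + w‖ ≤ ρ := (norm_add_le _ _).trans (by simp only [ρ]; linarith)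
    have hz : ‖z‖ ≤ ρ := by simp [ρ]
    have hδ : ∀ t ∈ 𝕀, ‖B w (u z t) (u z t)‖ ≤ ‖B‖ * R0 * R0 * ‖w‖ := by
      intro t ht
      have h1 := hbd ρ z hz t ht
      calc _ ≤ _ := norm_trilinear_le B w (u z t) (u z t)
        _ ≤ ‖B‖ * ‖w‖ * R0 * R0 := by gcongr
        _ = _ := by ring
    have hp : ∀ t ∈ 𝕀, HasDerivWithinAt (fun t => u z t + t • B w (u z t) (u z t))
        (B z (u z t) (u z t) + (t • (B w (u z t) (B z (u z t) (u z t))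
          + B w (B z (u z t) (u z t)) (u z t)) + (1 : ℝ) • B w (u z t) (u z t))) 𝕀 t := by
      intro t ht
      have h2 : HasDerivWithinAt (fun t => B w (u z t) (u z t))
          (B w (u z t) (B z (u z t) (u z t)) + B w (B z (u z t) (u z t)) (u z t)) 𝕀 t := by
        exact (B w).hasFDerivWithinAt_of_bilinear (hu z t ht).hasFDerivWithinAt
          (hu z t ht).hasFDerivWithinAt |>.hasDerivWithinAt |> fun h => by simpa using h
      exact (hu z t ht).add ((hasDerivWithinAt_id t _).smul h2)
    have := norm_le_exp_of_deriv (u := fun t => u (z + w) t - (u z t + t • B w (u z t) (u z t)))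
      (M := M) (ε := C * ‖w‖ * ‖w‖) (le_max_left _ _) le_rfl
      (by positivity) (fun t ht => (hu (z + w) t ht).sub (hp t ht)) (by simp [h0]) (by
        intro t ht
        have hX := hbd ρ z hz t ht
        have hq := hbd ρ (z + w) hzw t ht
        have hd := hδ t ht
        have hcm := hcomm z w (u z t) (hmem z t)
        set X := u z t
        set q := u (z + w) t
        set d := B w X X with hdd
        have ht1 : ‖(t : ℝ)‖ ≤ 1 := by rw [Real.norm_eq_abs, abs_of_nonneg ht.1]; exact ht.2
        have hXd : ‖X + t • d‖ ≤ R0 + ‖B‖ * R0 * R0 := by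
          refine (norm_add_le _ _).trans (add_le_add hX ?_)
          rw [norm_smul]
          calc ‖t‖ * ‖d‖ ≤ 1 * (‖B‖ * R0 * R0 * 1) := by
                refine mul_le_mul ht1 (hd.trans ?_) (norm_nonneg _) zero_le_one
                gcongr
            _ = _ := by ring
        have e : B (z + w) q q - (B z X X + (t • (B w X (B z X X) + B w (B z X X) X) + (1 : ℝ) • d))
            = (B (z + w) q q - B (z + w) (X + t • d) (X + t • d))
              + (t • B w d X + t • B w X d + (t * t) • B (z + w) d d) := by
          have hcm' : B w X (B z X X) + B w (B z X X) X = B z d X + B z X d := by rw [add_comm, hcm]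
          rw [hcm']
          simp only [map_add, add_apply, map_smul, smul_apply, smul_add, smul_smul, one_smul, ← hdd]
          abel
        rw [e]
        refine (norm_add_le _ _).trans (add_le_add ?_ ?_)
        · refine (norm_quadratic_sub_le B (z + w) q (X + t • d)).trans ?_
          gcongr
          refine le_trans ?_ (le_max_right _ _)
          gcongr
        · refine norm_add₃_le.trans ?_
          rw [norm_smul, norm_smul, norm_smul, norm_mul]
          have b1 : ‖B w d X‖ ≤ ‖B‖ * ‖w‖ * (‖B‖ * R0 * R0 * ‖w‖) * R0 :=
            (norm_trilinear_le B w d X).trans (by gcongr)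
          have b2 : ‖B w X d‖ ≤ ‖B‖ * ‖w‖ * R0 * (‖B‖ * R0 * R0 * ‖w‖) :=
            (norm_trilinear_le B w X d).trans (by gcongr)
          have b3 : ‖B (z + w) d d‖ ≤ ‖B‖ * ρ * (‖B‖ * R0 * R0 * ‖w‖) * (‖B‖ * R0 * R0 * ‖w‖) :=
            (norm_trilinear_le B (z + w) d d).trans (by gcongr)
          calc _ ≤ 1 * (‖B‖ * ‖w‖ * (‖B‖ * R0 * R0 * ‖w‖) * R0)
                + 1 * (‖B‖ * ‖w‖ * R0 * (‖B‖ * R0 * R0 * ‖w‖))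
                + (1 * 1) * (‖B‖ * ρ * (‖B‖ * R0 * R0 * ‖w‖) * (‖B‖ * R0 * R0 * ‖w‖)) := by
                gcongr
            _ = _ := by simp only [C]; ring) 1 (by simp)
    simp at this
    rw [sub_sub]
    exact this.trans (le_of_eq (by ring))
  rw [hasFDerivAt_iff_isLittleO_nhds_zero, Asymptotics.isLittleO_iff]
  intro c hc
  have hpos : 0 < min 1 (c / (C * Real.exp M + 1)) := by positivity
  filter_upwards [Metric.ball_mem_nhds (0 : V) hpos] with w hw
  have hw1 : ‖w‖ < min 1 (c / (C * Real.exp M + 1)) := by simpa using hw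
  refine (key w (hw1.le.trans (min_le_left _ _))).trans ?_
  have h2 := hw1.le.trans (min_le_right _ _)
  rw [le_div_iff₀ (by positivity)] at h2
  refine mul_le_mul_of_nonneg_right ?_ (norm_nonneg _)
  nlinarith [norm_nonneg w]

theorem quadratic_flow_close (B : V →L[ℝ] A →L[ℝ] A →L[ℝ] A) {Z Z' : V → A}
    (hZ : ∀ z, HasFDerivAt Z ((B.flip (Z z)).flip (Z z)) z)
    (hZ' : ∀ z, HasFDerivAt Z' ((B.flip (Z' z)).flip (Z' z)) z) {ρ R : ℝ} (hR : 0 ≤ R)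
    {z z' : V} (hz : ‖z‖ ≤ ρ) (hz' : ‖z'‖ ≤ ρ) (hb : ∀ w, ‖w‖ ≤ ρ → ‖Z w‖ ≤ R)
    (hb' : ∀ w, ‖w‖ ≤ ρ → ‖Z' w‖ ≤ R) :
    ‖Z z - Z' z'‖ ≤ (‖Z 0 - Z' 0‖ + ‖B‖ * R * R * ‖z - z'‖)
      * Real.exp (max 1 (‖B‖ * ρ * (R + R))) := by
  have hρ := (norm_nonneg _).trans hz
  have hline : ∀ (Y : V → A) (_ : ∀ z, HasFDerivAt Y ((B.flip (Y z)).flip (Y z)) z) (v : V),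
      SolvesOn (fun _ x => B v x x) (fun t => Y (t • v)) := by
    intro Y hY v t ht
    have h1 : HasDerivAt (fun t => t • v) v t := by simpa using (hasDerivAt_id t).smul_const v
    have := (hY (t • v)).comp_hasDerivAt t h1
    exact this.hasDerivWithinAt
  have hin : ∀ t ∈ 𝕀, ∀ v : V, ‖v‖ ≤ ρ → ‖t • v‖ ≤ ρ := by
    intro t ht v hv
    rw [norm_smul, Real.norm_eq_abs, abs_of_nonneg ht.1]
    exact (mul_le_of_le_one_left (norm_nonneg _) ht.2).trans hv
  have := norm_le_exp_of_deriv (u := fun t => Z (t • z) - Z' (t • z')) (M := max 1 (‖B‖ * ρ * (R + R))) (δ := ‖Z 0 - Z' 0‖)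
    (ε := ‖B‖ * R * R * ‖z - z'‖) (le_max_left _ _) (norm_nonneg _) (by positivity)
    (fun t ht => (hline Z hZ z t ht).sub (hline Z' hZ' z' t ht)) (by simp) (by
      intro t ht
      have h1 := hb _ (hin t ht z hz)
      have h2 := hb' _ (hin t ht z' hz')
      set x := Z (t • z)
      set y := Z' (t • z')
      have e : B z x x - B z' y y = (B z x x - B z y y) + B (z - z') y y := by
        simp only [map_sub, sub_apply]; abel
      rw [e]
      refine (norm_add_le _ _).trans (add_le_add ?_ ?_)
      · refine (norm_quadratic_sub_le B z x y).trans ?_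
        gcongr
        refine le_trans ?_ (le_max_right _ _)
        gcongr
      · refine (norm_trilinear_le B (z - z') y y).trans ?_
        calc _ ≤ ‖B‖ * ‖z - z'‖ * R * R := by gcongr
          _ = _ := by ring) 1 (by simp)
  simpa using this

theorem quadratic_flow_unique (B : V →L[ℝ] A →L[ℝ] A →L[ℝ] A) {Z Z' : V → A}
    (hZ : ∀ z, HasFDerivAt Z ((B.flip (Z z)).flip (Z z)) z)
    (hZ' : ∀ z, HasFDerivAt Z' ((B.flip (Z' z)).flip (Z' z)) z) (h0 : Z 0 = Z' 0)
    [ProperSpace V] : Z = Z' := by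
  funext z
  have hc := continuous_iff_continuousAt.2 fun z => (hZ z).continuousAt
  have hc' := continuous_iff_continuousAt.2 fun z => (hZ' z).continuousAt
  obtain ⟨R, hR⟩ := (isCompact_closedBall (0 : V) ‖z‖).exists_bound_of_continuousOn hc.continuousOn
  obtain ⟨R', hR'⟩ :=
    (isCompact_closedBall (0 : V) ‖z‖).exists_bound_of_continuousOn hc'.continuousOn
  have := quadratic_flow_close B hZ hZ' (le_max_right _ _) le_rfl le_rfl
    (fun w hw => (hR w (by simpa using hw)).trans ((le_max_left _ _).trans (le_max_left _ _)))
    (fun w hw => (hR' w (by simpa using hw)).trans ((le_max_right _ _).trans (le_max_left _ _)))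
  rw [h0] at this
  simpa [sub_eq_zero] using this

end Quadratic

theorem exists_eq_add_mul_deriv (hU : IsOpen U) (hp : StarConvex ℝ p U)
    {q : ℂ → ℂ} (hq : DifferentiableOn ℂ q U) (hn : n ≠ 0) :
    ∃ y : ℂ → ℂ, DifferentiableOn ℂ y U ∧ y p = q p ∧
      ∀ l ∈ U, y l + n * (l - p) * deriv y l = q l := by
  have hmem : ∀ l ∈ U, ∀ s ∈ 𝕀, p + s ^ n * (l - p) ∈ U := by
    intro l hl s hs
    have := hp.add_smul_sub_mem hl (pow_nonneg hs.1 n) (pow_le_one₀ hs.1 hs.2)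
    simpa using this
  have hq' := (hq.deriv hU).continuousOn
  have hcont : ∀ {f : ℂ → ℂ}, ContinuousOn f U →
      ContinuousOn (fun x : ℂ × ℝ => f (p + (x.2 : ℂ) ^ n * (x.1 - p))) (U ×ˢ Icc 0 1) := by
    intro f hf
    exact hf.comp (by fun_prop) (fun x hx => hmem x.1 hx.1 x.2 hx.2)
  have hder : ∀ l ∈ U, HasDerivAt (fun l => ∫ s in 0..1, q (p + s ^ n * (l - p)))
      (∫ s in 0..1, s ^ n * deriv q (p + s ^ n * (l - p))) l := by
    intro l hl
    obtain ⟨ε, hε, hball⟩ := Metric.nhds_basis_closedBall.mem_iff.1 (hU.mem_nhds hl)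
    have hcomp : IsCompact (closedBall l ε ×ˢ 𝕀) := (isCompact_closedBall l ε).prod isCompact_Icc
    obtain ⟨C, hC⟩ := hcomp.exists_bound_of_continuousOn
      ((hcont hq').mono (prod_mono hball Subset.rfl))
    have hint : ∀ x ∈ U, ∀ {f : ℂ → ℂ}, ContinuousOn f U →
        ContinuousOn (fun s : ℝ => f (p + s ^ n * (x - p))) (uIcc 0 1) := by
      intro x hx f hf
      rw [uIcc_of_le zero_le_one]
      exact (hcont hf).comp (f := fun s => (x, s)) (by fun_prop) (fun s hs => ⟨hx, hs⟩)
    have hsub : ∀ s ∈ uIoc 0 1, s ∈ 𝕀 := by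
      intro s hs
      rw [uIoc_of_le zero_le_one] at hs
      exact ⟨hs.1.le, hs.2⟩
    refine (intervalIntegral.hasDerivAt_integral_of_dominated_loc_of_deriv_le
      (F := fun l s => q (p + s ^ n * (l - p)))
      (F' := fun l s => s ^ n * deriv q (p + s ^ n * (l - p)))
      (bound := fun _ => C) (ball_mem_nhds l hε) ?_ ?_ ?_ ?_ ?_ ?_).2
    · filter_upwards [hU.mem_nhds hl] with x hx
      exact (hint x hx hq.continuousOn).intervalIntegrable.def'.1
    · exact (hint l hl hq.continuousOn).intervalIntegrable
    · exact (ContinuousOn.mul (by fun_prop) (hint l hl hq')).intervalIntegrable.def'.1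
    · refine Filter.Eventually.of_forall fun s hs x hx => ?_
      have hs' := hsub s hs
      rw [norm_mul, norm_pow, norm_real, Real.norm_eq_abs, abs_of_nonneg hs'.1]
      have h1 := hC (x, s) ⟨ball_subset_closedBall hx, hs'⟩
      exact (mul_le_of_le_one_left (norm_nonneg _) (pow_le_one₀ hs'.1 hs'.2)).trans h1
    · exact intervalIntegrable_const
    · refine Filter.Eventually.of_forall fun s hs x hx => ?_
      have hm := hmem x (hball (ball_subset_closedBall hx)) s (hsub s hs)
      have h1 : HasDerivAt (fun l => p + s ^ n * (l - p)) (s ^ n) x := by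
        simpa using (((hasDerivAt_id x).sub_const p).const_mul ((s : ℂ) ^ n)).const_add p
      have := ((hq.differentiableAt (hU.mem_nhds hm)).hasDerivAt).comp x h1
      rw [mul_comm]; exact this
  refine ⟨fun l => ∫ s in 0..1, q (p + s ^ n * (l - p)),
    fun l hl => (hder l hl).differentiableAt.differentiableWithinAt, by simp, fun l hl => ?_⟩
  rw [(hder l hl).deriv, ← intervalIntegral.integral_const_mul, ← intervalIntegral.integral_add]
  · have hd : ∀ s ∈ uIcc (0 : ℝ) 1, HasDerivAt (fun s : ℝ => s * q (p + s ^ n * (l - p)))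
        (q (p + s ^ n * (l - p)) + n * (l - p) * (s ^ n * deriv q (p + s ^ n * (l - p)))) s := by
      intro s hs
      rw [uIcc_of_le zero_le_one] at hs
      have h1 : HasDerivAt (fun s : ℂ => p + s ^ n * (l - p)) (n * (s : ℂ) ^ (n - 1) * (l - p)) s := by
        simpa using ((hasDerivAt_pow n (s : ℂ)).mul_const (l - p)).const_add p
      have h2 := ((hq.differentiableAt (hU.mem_nhds (hmem l hl s hs))).hasDerivAt).comp (s : ℂ) h1
      have h3 := ((hasDerivAt_id (s : ℂ)).mul h2).comp_ofReal
      refine HasDerivAt.congr_deriv h3 ?_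
      obtain ⟨m, rfl⟩ := Nat.exists_eq_succ_of_ne_zero hn
      simp
      ring
    have hc2 : ∀ {f : ℂ → ℂ}, ContinuousOn f U →
        ContinuousOn (fun s : ℝ => f (p + (s : ℂ) ^ n * (l - p))) (uIcc 0 1) := by
      intro f hf
      rw [uIcc_of_le zero_le_one]
      exact (hcont hf).comp (f := fun s : ℝ => (l, s)) (by fun_prop) (fun s hs => ⟨hl, hs⟩)
    rw [intervalIntegral.integral_eq_sub_of_hasDerivAt hd]
    · simp
    · exact ((hc2 hq.continuousOn).add (continuousOn_const.mul
        (ContinuousOn.mul (by fun_prop) (hc2 hq')))).intervalIntegrable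
  · refine ContinuousOn.intervalIntegrable ?_
    rw [uIcc_of_le zero_le_one]
    exact (hcont hq.continuousOn).comp (f := fun s : ℝ => (l, s)) (by fun_prop) (fun s hs => ⟨hl, hs⟩)
  · refine ContinuousOn.intervalIntegrable (continuousOn_const.mul
      (ContinuousOn.mul (by fun_prop) ?_))
    rw [uIcc_of_le zero_le_one]
    exact (hcont hq').comp (f := fun s => (l, s)) (by fun_prop) (fun s hs => ⟨hl, hs⟩)

theorem polyOf_eval (v : Fin n → ℂ) (l : ℂ) : (polyOf v).eval l = ∑ i, v i * l ^ (i : ℕ) := by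
  simp [polyOf, eval_finsetSum]

theorem polyOf_coeff (v : Fin n → ℂ) (i : Fin n) : (polyOf v).coeff i = v i := by
  simp only [polyOf, finsetSum_coeff, coeff_C_mul, coeff_X_pow]
  rw [Finset.sum_eq_single i]
  · simp
  · grind
  · simp

theorem polyOf_coeff_of_le (v : Fin n → ℂ) {m : ℕ} (hm : n ≤ m) : (polyOf v).coeff m = 0 := by
  simp only [polyOf, finsetSum_coeff, coeff_C_mul, coeff_X_pow]
  refine Finset.sum_eq_zero fun i _ => ?_
  grind

theorem natDegree_polyOf_le {n : ℕ} (v : Fin (n + 1) → ℂ) : (polyOf v).natDegree ≤ n :=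
  natDegree_le_iff_coeff_eq_zero.2 fun m hm => polyOf_coeff_of_le v (by omega)

theorem polyOf_coeffs {n : ℕ} {p : ℂ[X]} (hp : p.natDegree ≤ n) :
    polyOf (fun i : Fin (n + 1) => p.coeff i) = p := by
  ext m
  by_cases hm : m < n + 1
  · exact polyOf_coeff (fun i : Fin (n + 1) => p.coeff i) ⟨m, hm⟩
  · rw [polyOf_coeff_of_le _ (by omega), coeff_eq_zero_of_natDegree_lt (by omega)]

theorem polyOf_eval_zero {n : ℕ} (v : Fin (n + 1) → ℂ) : (polyOf v).eval 0 = v 0 := by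
  rw [← coeff_zero_eq_eval_zero]
  exact polyOf_coeff v 0

theorem polyOf_add (v w : Fin n → ℂ) : polyOf (v + w) = polyOf v + polyOf w := by
  simp [polyOf, add_mul, Finset.sum_add_distrib]

theorem polyOf_smul (r : ℝ) (v : Fin n → ℂ) : polyOf (r • v) = C (r : ℂ) * polyOf v := by
  simp [polyOf, Finset.mul_sum, mul_assoc]

theorem polyOf_reflect {n : ℕ} {v w : Fin (n + 1) → ℂ} (h : ∀ i, w i.rev = conj (v i))
    (hl : l ≠ 0) : (polyOf w).eval l = l ^ n * conj ((polyOf v).eval (conj l)⁻¹) := by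
  rw [polyOf_eval, polyOf_eval, map_sum, Finset.mul_sum, ← Equiv.sum_comp Fin.revPerm]
  refine Finset.sum_congr rfl fun i _ => ?_
  have hi : n = ((i.rev : Fin (n + 1)) : ℕ) + (i : ℕ) := by rw [Fin.val_rev]; omega
  rw [Fin.revPerm_apply, h i, map_mul, map_pow, map_inv₀, conj_conj, inv_pow]
  have hln : l ^ n = l ^ ((i.rev : Fin (n + 1)) : ℕ) * l ^ (i : ℕ) := by rw [← pow_add, ← hi]
  rw [hln]
  field_simp

theorem poly_eq_of_eval_eq {p q : ℂ[X]} (h : ∀ l : ℂ, l ≠ 0 → p.eval l = q.eval l) : p = q := by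
  refine eq_of_infinite_eval_eq p q (Set.Infinite.mono (h) ?_)
  exact (Set.finite_singleton 0).infinite_compl

section RealPair

theorem aPoly_reflect (x : RealPair g) (hl : l ≠ 0) :
    (aPoly x).eval l = l ^ (2 * g) * conj ((aPoly x).eval (conj l)⁻¹) :=
  polyOf_reflect x.2.1 hl

theorem bPoly_reflect (x : RealPair g) {l : ℂ} (hl : l ≠ 0) :
    (bPoly x).eval l = -(l ^ (g + 1) * conj ((bPoly x).eval (conj l)⁻¹)) := by
  have := polyOf_reflect (v := x.1.2) (w := -x.1.2) (fun i => by simp [x.2.2 i]) hl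
  rw [show polyOf (-x.1.2) = -bPoly x by simp [polyOf, bPoly]] at this
  rw [eval_neg] at this
  rw [← neg_eq_iff_eq_neg]; exact this

theorem cPoly_reflect (c : RealPoly g) (hl : l ≠ 0) :
    (cPoly c).eval l = l ^ (g + 1) * conj ((cPoly c).eval (conj l)⁻¹) :=
  polyOf_reflect c.2 hl

theorem deriv_reflect {p : ℂ[X]} {n : ℕ}
    (h : ∀ l : ℂ, l ≠ 0 → p.eval l = l ^ n * conj (p.eval (conj l)⁻¹)) (hl : l ≠ 0) :
    l ^ n * conj ((derivative p).eval (conj l)⁻¹) =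
      l * (n * p.eval l - l * (derivative p).eval l) := by
  have hc : ∀ (q : ℂ[X]) w, conj (q.eval (conj w)⁻¹) = (q.map (starRingEnd ℂ)).eval w⁻¹ := by
    intro q w
    rw [← conj_conj w⁻¹, eval_map_apply, map_inv₀]
  have h1 := (hasDerivAt_pow n l).mul (((p.map (starRingEnd ℂ)).hasDerivAt l⁻¹).comp l (hasDerivAt_inv hl))
  have h2 : HasDerivAt (fun w => w ^ n * (p.map (starRingEnd ℂ)).eval w⁻¹)
      ((derivative p).eval l) l := by
    refine (p.hasDerivAt l).congr_of_eventuallyEq ?_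
    filter_upwards [isOpen_ne.mem_nhds hl] with w hw
    rw [h w hw, hc]
  have h3 := h2.unique h1
  rw [h3, hc, h l hl, hc, derivative_map]
  rcases n with _ | m
  · simp; field_simp
  · simp
    field_simp
    ring

theorem aPoly_add (x y : RealPair g) : aPoly (x + y) = aPoly x + aPoly y := polyOf_add _ _
theorem bPoly_add (x y : RealPair g) : bPoly (x + y) = bPoly x + bPoly y := polyOf_add _ _
theorem cPoly_add (x y : RealPoly g) : cPoly (x + y) = cPoly x + cPoly y := polyOf_add _ _
theorem aPoly_smul (r : ℝ) (x : RealPair g) : aPoly (r • x) = C (r : ℂ) * aPoly x := polyOf_smul _ _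
theorem bPoly_smul (r : ℝ) (x : RealPair g) : bPoly (r • x) = C (r : ℂ) * bPoly x := polyOf_smul _ _
theorem cPoly_smul (r : ℝ) (x : RealPoly g) : cPoly (r • x) = C (r : ℂ) * cPoly x := polyOf_smul _ _

theorem natDegree_aPoly_le (x : RealPair g) : (aPoly x).natDegree ≤ 2 * g := natDegree_polyOf_le _
theorem natDegree_bPoly_le (x : RealPair g) : (bPoly x).natDegree ≤ g + 1 := natDegree_polyOf_le _
theorem natDegree_cPoly_le (c : RealPoly g) : (cPoly c).natDegree ≤ g + 1 := natDegree_polyOf_le _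

theorem aPoly_coeff_rev (x : RealPair g) : (aPoly x).coeff (2 * g) = conj ((aPoly x).eval 0) := by
  have h := x.2.1 0
  have e1 : (aPoly x).coeff (2 * g) = x.1.1 (Fin.rev 0) := by
    have := polyOf_coeff x.1.1 (Fin.rev 0)
    simpa [aPoly] using this
  rw [e1, h]
  congr 1
  exact (polyOf_eval_zero _).symm

theorem bPoly_coeff_rev (x : RealPair g) : (bPoly x).coeff (g + 1) = -conj ((bPoly x).eval 0) := by
  have h := x.2.2 0
  have e1 : (bPoly x).coeff (g + 1) = x.1.2 (Fin.rev 0) := by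
    have := polyOf_coeff x.1.2 (Fin.rev 0)
    simpa [bPoly] using this
  rw [e1, h]
  congr 2
  exact (polyOf_eval_zero _).symm

/-- Pairs of polynomials of maximal degree without common roots. -/
structure IsRegular (x : RealPair g) : Prop where
  natDegree_a : (aPoly x).natDegree = 2 * g
  a_ne : aPoly x ≠ 0
  natDegree_b : (bPoly x).natDegree = g + 1
  coprime : ∀ l : ℂ, ¬((aPoly x).eval l = 0 ∧ (bPoly x).eval l = 0)

theorem IsRegular.a_zero_ne (hx : IsRegular x) : (aPoly x).eval 0 ≠ 0 := by
  intro h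
  have := aPoly_coeff_rev x
  rw [h, map_zero] at this
  have h2 := leadingCoeff_ne_zero.2 hx.a_ne
  rw [leadingCoeff, hx.natDegree_a] at h2
  exact h2 this

theorem IsRegular.b_zero_ne (hx : IsRegular x) : (bPoly x).eval 0 ≠ 0 := by
  intro h
  have := bPoly_coeff_rev x
  rw [h, map_zero, neg_zero] at this
  have hb : bPoly x ≠ 0 := by
    intro h0
    have := hx.natDegree_b
    rw [h0, natDegree_zero] at this
    omega
  have h2 := leadingCoeff_ne_zero.2 hb
  rw [leadingCoeff, hx.natDegree_b] at h2
  exact h2 this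

theorem IsRegular.isCoprime (hx : IsRegular x) : IsCoprime (aPoly x) (bPoly x) := by
  refine (isCoprime_iff_aeval_ne_zero_of_isAlgClosed ℂ ℂ (aPoly x) (bPoly x)).2 fun l => ?_
  have := hx.coprime l
  tauto

def whithamRhs (x : RealPair g) (c : RealPoly g) : ℂ[X] :=
  -2 * X * aPoly x * derivative (cPoly c) + aPoly x * cPoly c + X * derivative (aPoly x) * cPoly c

theorem natDegree_whithamRhs_le (x : RealPair g) (c : RealPoly g) :
    (whithamRhs x c).natDegree ≤ 3 * g + 1 := by
  have ha := natDegree_aPoly_le x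
  have hc := natDegree_cPoly_le c
  have ha' := (natDegree_derivative_le (aPoly x))
  have hc' := (natDegree_derivative_le (cPoly c))
  have e2 : (-2 : ℂ[X]) = C (-2) := by rw [map_neg, map_ofNat]
  have hX1 : (X * derivative (cPoly c)).natDegree ≤ g + 1 := by
    by_cases h : derivative (cPoly c) = 0
    · simp [h]
    · have h1 : (cPoly c).natDegree ≠ 0 := fun h0 => h (derivative_of_natDegree_zero h0)
      refine natDegree_mul_le.trans ?_
      rw [natDegree_X]; omega
  have hX2 : (X * derivative (aPoly x)).natDegree ≤ 2 * g := by
    by_cases h : derivative (aPoly x) = 0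
    · simp [h]
    · have h1 : (aPoly x).natDegree ≠ 0 := fun h0 => h (derivative_of_natDegree_zero h0)
      refine natDegree_mul_le.trans ?_
      rw [natDegree_X]; omega
  have e : whithamRhs x c = C (-2) * (aPoly x * (X * derivative (cPoly c))) + aPoly x * cPoly c
      + (X * derivative (aPoly x)) * cPoly c := by
    rw [whithamRhs, e2]; ring
  rw [e]
  refine (natDegree_add_le _ _).trans (max_le ((natDegree_add_le _ _).trans (max_le ?_ ?_)) ?_)
  · exact (natDegree_C_mul_le _ _).trans (natDegree_mul_le.trans (by omega))
  · exact natDegree_mul_le.trans (by omega)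
  · exact natDegree_mul_le.trans (by omega)

theorem whithamRhs_eval (x : RealPair g) (c : RealPoly g) (l : ℂ) :
    (whithamRhs x c).eval l = -2 * l * (aPoly x).eval l * (derivative (cPoly c)).eval l
      + (aPoly x).eval l * (cPoly c).eval l
      + l * (derivative (aPoly x)).eval l * (cPoly c).eval l := by
  simp [whithamRhs]

theorem whithamRhs_reflect (x : RealPair g) (c : RealPoly g) {l : ℂ} (hl : l ≠ 0) :
    (whithamRhs x c).eval l = -(l ^ (3 * g + 1) * conj ((whithamRhs x c).eval (conj l)⁻¹)) := by
  have hA := aPoly_reflect x hl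
  have hC := cPoly_reflect c hl
  have hA' := deriv_reflect (fun l hl => aPoly_reflect x hl) hl
  have hC' := deriv_reflect (fun l hl => cPoly_reflect c hl) hl
  rw [whithamRhs_eval, whithamRhs_eval]
  simp
  rw [show conj (2 : ℂ) = 2 from conj_ofNat 2]
  have e : (3 * g + 1) = 2 * g + (g + 1) := by ring
  rw [e, pow_add]
  grind

theorem whitham_homogeneous (hx : IsRegular x) (h1 : -2 * bPoly y * aPoly x + bPoly x * aPoly y = 0)
    (h2 : ((aPoly y).eval 0 * conj ((aPoly x).eval 0)).re = 0) : y = 0 := by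
  have hdvd : aPoly x ∣ aPoly y := by
    refine hx.isCoprime.dvd_of_dvd_mul_left ⟨2 * bPoly y, ?_⟩
    linear_combination h1
  obtain ⟨r, hr⟩ := hdvd
  have hr0 : r.natDegree = 0 := by
    by_cases h0 : r = 0
    · simp [h0]
    · have := natDegree_aPoly_le y
      rw [hr, natDegree_mul hx.a_ne h0, hx.natDegree_a] at this
      omega
  obtain ⟨s, rfl⟩ := natDegree_eq_zero.1 hr0
  have ha0 := hx.a_zero_ne
  have hlast := aPoly_coeff_rev y
  rw [hr, coeff_mul_C, aPoly_coeff_rev, eval_mul, eval_C, map_mul] at hlast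
  have hsr : conj s = s := by
    have : conj ((aPoly x).eval 0) ≠ 0 := by simpa using ha0
    exact (mul_left_cancel₀ this hlast).symm
  have hs : s = 0 := by
    rw [hr, eval_mul, eval_C] at h2
    have e : (aPoly x).eval 0 * s * conj ((aPoly x).eval 0)
        = s * (normSq ((aPoly x).eval 0) : ℂ) := by
      rw [normSq_eq_conj_mul_self]; ring
    rw [e, re_mul_ofReal] at h2
    have hn : normSq ((aPoly x).eval 0) ≠ 0 := by simpa using ha0
    have hre : s.re = 0 := by simpa [hn] using h2
    have him := conj_eq_iff_im.1 hsr
    exact ext hre him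
  have hya : aPoly y = 0 := by rw [hr, hs]; simp
  have hyb : bPoly y = 0 := by
    rw [hya, mul_zero, add_zero] at h1
    rcases mul_eq_zero.1 h1 with h | h
    · rcases mul_eq_zero.1 h with h | h
      · norm_num at h
      · exact h
    · exact absurd h hx.a_ne
  ext i
  · have := polyOf_coeff y.1.1 i
    rw [show polyOf y.1.1 = 0 from hya] at this
    simpa using this.symm
  · have := polyOf_coeff y.1.2 i
    rw [show polyOf y.1.2 = 0 from hyb] at this
    simpa using this.symm

theorem IsWhithamVector.sub {c c' : RealPoly g} {y y' : RealPair g}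
    (h : IsWhithamVector x c y) (h' : IsWhithamVector x c' y') :
    -2 * bPoly (y - y') * aPoly x + bPoly x * aPoly (y - y') = whithamRhs x c - whithamRhs x c' ∧
      ((aPoly (y - y')).eval 0 * conj ((aPoly x).eval 0)).re = 0 := by
  have ha : aPoly (y - y') = aPoly y - aPoly y' := by
    rw [eq_sub_iff_add_eq, ← aPoly_add, sub_add_cancel]
  have hb : bPoly (y - y') = bPoly y - bPoly y' := by
    rw [eq_sub_iff_add_eq, ← bPoly_add, sub_add_cancel]
  refine ⟨?_, ?_⟩
  · rw [ha, hb, whithamRhs, whithamRhs, ← h.1, ← h'.1]; ring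
  · rw [ha, eval_sub, sub_mul, sub_re, h.2, h'.2, sub_zero]

theorem IsWhithamVector.unique (hx : IsRegular x)
    {y y' : RealPair g} (h : IsWhithamVector x c y) (h' : IsWhithamVector x c y') : y = y' := by
  have := h.sub h'
  rw [sub_self] at this
  exact sub_eq_zero.1 (whitham_homogeneous hx this.1 this.2)

theorem exists_isWhithamVector (hx : IsRegular x) (c : RealPoly g) :
    ∃ y, IsWhithamVector x c y := by
  obtain ⟨u, v, huv⟩ := hx.isCoprime
  set R := whithamRhs x c with hR
  set p := (R * v) % aPoly x with hp
  set s := u * R + bPoly x * ((R * v) / aPoly x) with hs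
  have hdiv : aPoly x * ((R * v) / aPoly x) + p = R * v := EuclideanDomain.div_add_mod _ _
  have hps : bPoly x * p + aPoly x * s = R := by
    rw [hs]
    linear_combination bPoly x * hdiv + R * huv
  have hpdeg : p.natDegree ≤ 2 * g := by
    have h1 := degree_mod_lt (R * v) hx.a_ne
    have h2 := natDegree_le_natDegree h1.le
    rwa [hx.natDegree_a] at h2
  have hsdeg : s.natDegree ≤ g + 1 := by
    by_cases h0 : s = 0
    · simp [h0]
    · have h1 : (aPoly x * s).natDegree ≤ 3 * g + 1 := by
        have : aPoly x * s = R - bPoly x * p := by rw [← hps]; ring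
        rw [this]
        refine (natDegree_sub_le _ _).trans (max_le (natDegree_whithamRhs_le x c) ?_)
        refine natDegree_mul_le.trans ?_
        rw [hx.natDegree_b]
        omega
      rw [natDegree_mul hx.a_ne h0, hx.natDegree_a] at h1
      omega
  let pv : Fin (2 * g + 1) → ℂ := fun i => p.coeff i
  let qv : Fin (g + 2) → ℂ := fun i => (C (-1 / 2) * s).coeff i
  let ps : Fin (2 * g + 1) → ℂ := fun i => conj (pv i.rev)
  let qs : Fin (g + 2) → ℂ := fun i => conj (qv i.rev)
  have hpv : polyOf pv = p := polyOf_coeffs hpdeg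
  have hqv : polyOf qv = C (-1 / 2) * s := polyOf_coeffs ((natDegree_C_mul_le _ _).trans hsdeg)
  have h1 : -2 * polyOf qv * aPoly x + bPoly x * polyOf pv = R := by
    rw [hpv, hqv, ← hps]
    have : (-2 : ℂ[X]) * (C (-1 / 2) * s) = s := by
      rw [← mul_assoc, show (-2 : ℂ[X]) = C (-2) by rw [map_neg, map_ofNat], ← C_mul]; norm_num
    rw [this]; ring
  have h2 : -2 * (-polyOf qs) * aPoly x + bPoly x * polyOf ps = R := by
    refine poly_eq_of_eval_eq fun l hl => ?_
    have e1 := polyOf_reflect (v := pv) (w := ps) (fun i => by simp [ps]) hl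
    have e2 := polyOf_reflect (v := qv) (w := qs) (fun i => by simp [qs]) hl
    have e3 := congrArg (fun P => conj (P.eval (conj l)⁻¹)) h1
    simp only [eval_add, eval_mul, eval_neg, eval_ofNat, map_add, map_mul, map_neg] at e3
    rw [show conj (2 : ℂ) = 2 from conj_ofNat 2] at e3
    rw [hR, whithamRhs_reflect x c hl, ← hR, ← e3]
    simp only [eval_add, eval_mul, eval_neg, eval_ofNat]
    rw [e1, e2, aPoly_reflect x hl, bPoly_reflect x hl,
      show (3 * g + 1) = 2 * g + (g + 1) by ring, pow_add]
    ring
  let y0 : RealPair g := ⟨((1 / 2 : ℝ) • (pv + ps), (1 / 2 : ℝ) • (qv + -qs)), by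
    refine ⟨fun i => ?_, fun i => ?_⟩
    · simp [ps, add_comm, show conj (2 : ℂ) = 2 from conj_ofNat 2]
    · simp [qs, show conj (2 : ℂ) = 2 from conj_ofNat 2]⟩
  have hy0 : -2 * bPoly y0 * aPoly x + bPoly x * aPoly y0 = R := by
    have e1 : aPoly y0 = C (((1 / 2 : ℝ) : ℝ) : ℂ) * (polyOf pv + polyOf ps) := by
      simp only [aPoly, y0]; rw [polyOf_smul, polyOf_add]
    have e2 : bPoly y0 = C (((1 / 2 : ℝ) : ℝ) : ℂ) * (polyOf qv + -polyOf qs) := by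
      simp only [bPoly, y0]
      rw [polyOf_smul, polyOf_add, show polyOf (-qs) = -polyOf qs by simp [polyOf]]
    have e3 : C (((1 / 2 : ℝ) : ℝ) : ℂ) * (R + R) = R := by
      rw [← two_mul, ← mul_assoc, show (2 : ℂ[X]) = C 2 by rw [map_ofNat], ← C_mul]; norm_num
    rw [e1, e2]
    linear_combination C (((1 / 2 : ℝ) : ℝ) : ℂ) * h1 + C (((1 / 2 : ℝ) : ℝ) : ℂ) * h2 + e3
  let k : RealPair g := ⟨((2 : ℝ) • x.1.1, x.1.2),
    ⟨fun i => by simp [x.2.1 i, show conj (2 : ℂ) = 2 from conj_ofNat 2], x.2.2⟩⟩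
  have hka : aPoly k = C 2 * aPoly x := by simp only [aPoly, k]; rw [polyOf_smul]; simp
  have hkb : bPoly k = bPoly x := rfl
  set r : ℝ := -((aPoly y0).eval 0 * conj ((aPoly x).eval 0)).re
    / (2 * normSq ((aPoly x).eval 0)) with hr
  have hn : normSq ((aPoly x).eval 0) ≠ 0 := by simpa using hx.a_zero_ne
  refine ⟨y0 + r • k, ?_, ?_⟩
  · change _ = R
    rw [aPoly_add, bPoly_add, aPoly_smul, bPoly_smul, hka, hkb, ← hy0]
    simp only [map_ofNat]
    ring
  · rw [aPoly_add, aPoly_smul, hka, eval_add, eval_mul, eval_mul, eval_C, eval_C, add_mul, add_re]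
    have e : (r : ℂ) * (2 * (aPoly x).eval 0) * conj ((aPoly x).eval 0)
        = ((r * (2 * normSq ((aPoly x).eval 0)) : ℝ) : ℂ) := by
      push_cast
      rw [normSq_eq_conj_mul_self]; ring
    rw [e, ofReal_re, hr]
    field_simp
    ring

/-- The polynomial part of the left hand side of the Whitham system, in coefficients. -/
def whithamLhs (g : ℕ) : RealPair g →ₗ[ℝ] RealPair g →ₗ[ℝ] (Fin (3 * g + 2) → ℂ) × ℝ :=
  LinearMap.mk₂ ℝ (fun x y => (fun j => (-2 * bPoly y * aPoly x + bPoly x * aPoly y).coeff j,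
      ((aPoly y).eval 0 * conj ((aPoly x).eval 0)).re))
    (by
      intro x x' y
      refine Prod.ext (funext fun j => ?_) ?_
      · simp only [aPoly_add, bPoly_add, Prod.fst_add, Pi.add_apply, ← coeff_add]
        congr 1; ring
      · simp [aPoly_add, mul_add])
    (by
      intro r x y
      refine Prod.ext (funext fun j => ?_) ?_
      · simp only [aPoly_smul, bPoly_smul, Prod.smul_fst, Pi.smul_apply, real_smul, ← coeff_C_mul]
        congr 1; ring
      · simp [aPoly_smul]; ring)
    (by
      intro x y y'
      refine Prod.ext (funext fun j => ?_) ?_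
      · simp only [aPoly_add, bPoly_add, Prod.fst_add, Pi.add_apply, ← coeff_add]
        congr 1; ring
      · simp [aPoly_add, add_mul])
    (by
      intro r x y
      refine Prod.ext (funext fun j => ?_) ?_
      · simp only [aPoly_smul, bPoly_smul, Prod.smul_fst, Pi.smul_apply, real_smul, ← coeff_C_mul]
        congr 1; ring
      · simp [aPoly_smul]; ring)

def whithamRhsCoeff (g : ℕ) : RealPair g →ₗ[ℝ] RealPoly g →ₗ[ℝ] (Fin (3 * g + 2) → ℂ) × ℝ :=
  LinearMap.mk₂ ℝ (fun x c => (fun j => (whithamRhs x c).coeff j, 0)) (by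
      intro x x' y
      refine Prod.ext (funext fun j => ?_) (by simp)
      simp only [whithamRhs, aPoly_add, Prod.fst_add, Pi.add_apply, ← coeff_add, derivative_add]
      congr 1; ring)
    (by
      intro r x y
      refine Prod.ext (funext fun j => ?_) (by simp)
      simp only [whithamRhs, aPoly_smul, Prod.smul_fst, Pi.smul_apply, real_smul,
          ← coeff_C_mul, derivative_C_mul]
      congr 1; ring)
    (by
      intro x y y'
      refine Prod.ext (funext fun j => ?_) (by simp)
      simp only [whithamRhs, cPoly_add, Prod.fst_add, Pi.add_apply, ← coeff_add, derivative_add]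
      congr 1; ring)
    (by
      intro r x y
      refine Prod.ext (funext fun j => ?_) (by simp)
      simp only [whithamRhs, cPoly_smul, Prod.smul_fst, Pi.smul_apply, real_smul,
          ← coeff_C_mul, derivative_C_mul]
      congr 1; ring)

theorem isWhithamVector_iff : IsWhithamVector x c y ↔ whithamLhs g x y = whithamRhsCoeff g x c := by
  constructor
  · rintro ⟨h1, h2⟩
    refine Prod.ext (funext fun j => ?_) h2
    simp only [whithamLhs, whithamRhsCoeff, LinearMap.mk₂_apply]
    rw [h1]; rfl
  · intro h
    have h1 := congrArg Prod.fst h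
    have h2 := congrArg Prod.snd h
    refine ⟨?_, h2⟩
    change _ = whithamRhs x c
    have hd : (-2 * bPoly y * aPoly x + bPoly x * aPoly y).natDegree ≤ 3 * g + 1 := by
      have := natDegree_aPoly_le x
      have := natDegree_aPoly_le y
      have := natDegree_bPoly_le x
      have := natDegree_bPoly_le y
      rw [show (-2 * bPoly y * aPoly x + bPoly x * aPoly y)
        = C (-2) * (bPoly y * aPoly x) + bPoly x * aPoly y by rw [map_neg, map_ofNat]; ring]
      refine (natDegree_add_le _ _).trans (max_le ((natDegree_C_mul_le _ _).trans ?_) ?_)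
      · exact natDegree_mul_le.trans (by omega)
      · exact natDegree_mul_le.trans (by omega)
    ext m
    by_cases hm : m < 3 * g + 2
    · exact congrFun h1 ⟨m, hm⟩
    · rw [coeff_eq_zero_of_natDegree_lt (by omega),
        coeff_eq_zero_of_natDegree_lt (by have := natDegree_whithamRhs_le x c; omega)]

/-- The Whitham vector field of the function `c`. -/
def whithamField (c : RealPair g → RealPoly g) (x : RealPair g) : RealPair g :=
  open Classical in if h : ∃ y, IsWhithamVector x (c x) y then h.choose else 0

theorem isWhithamVector_whithamField (hx : IsRegular x)
    (c : RealPair g → RealPoly g) : IsWhithamVector x (c x) (whithamField c x) := by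
  rw [whithamField, dif_pos (exists_isWhithamVector hx _)]
  grind

theorem contDiffOn_whithamField {W : Set (RealPair g)} (hW : IsOpen W)
    (hreg : ∀ x ∈ W, IsRegular x) {c : RealPair g → RealPoly g} (hc : ContDiffOn ℝ ∞ c W) :
    ContDiffOn ℝ ∞ (whithamField c) W := by
  intro x0 hx0
  refine ContDiffAt.contDiffWithinAt ?_
  let L : RealPair g →L[ℝ] RealPair g →L[ℝ] (Fin (3 * g + 2) → ℂ) × ℝ :=
    (whithamLhs g).toContinuousBilinearMap
  let T : RealPair g →L[ℝ] RealPoly g →L[ℝ] (Fin (3 * g + 2) → ℂ) × ℝ :=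
    (whithamRhsCoeff g).toContinuousBilinearMap
  have hinj : LinearMap.ker (whithamLhs g x0) = ⊥ := by
    rw [LinearMap.ker_eq_bot']
    intro y hy
    have h0 := isWhithamVector_iff.2 (by rw [hy, map_zero])
    refine whitham_homogeneous (hreg x0 hx0) ?_ h0.2
    have hz : cPoly (0 : RealPoly g) = 0 := by simp [cPoly, polyOf]
    simpa [hz] using h0.1
  obtain ⟨K0, hK0⟩ := LinearMap.exists_leftInverse_of_injective (whithamLhs g x0) hinj
  let K : ((Fin (3 * g + 2) → ℂ) × ℝ) →L[ℝ] RealPair g := LinearMap.toContinuousLinearMap K0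
  have hK : K.comp (L x0) = ContinuousLinearMap.id ℝ (RealPair g) := by
    ext1 y
    exact LinearMap.congr_fun hK0 y
  have hN : ContDiff ℝ ∞ (fun x => K.comp (L x)) := by
    have : (fun x => K.comp (L x)) = fun x =>
      (ContinuousLinearMap.compL ℝ (RealPair g) ((Fin (3 * g + 2) → ℂ) × ℝ) (RealPair g) K) (L x) :=
      rfl
    rw [this]
    exact ((ContinuousLinearMap.contDiff _).comp L.contDiff)
  have hinv : ContDiffAt ℝ ∞ (fun x => ContinuousLinearMap.inverse (K.comp (L x))) x0 := by
    have h1 : ContDiffAt ℝ ∞ (ContinuousLinearMap.inverse :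
        (RealPair g →L[ℝ] RealPair g) → (RealPair g →L[ℝ] RealPair g)) (K.comp (L x0)) := by
      rw [hK]
      exact contDiffAt_map_inverse (ContinuousLinearEquiv.refl ℝ (RealPair g))
    exact h1.comp x0 hN.contDiffAt
  have hcx : ContDiffAt ℝ ∞ c x0 := (hc x0 hx0).contDiffAt (hW.mem_nhds hx0)
  have hR : ContDiffAt ℝ ∞ (fun x => K (T x (c x))) x0 :=
    K.contDiff.contDiffAt.comp x0 ((T.contDiff.contDiffAt).clm_apply hcx)
  refine (hinv.clm_apply hR).congr_of_eventuallyEq ?_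
  have hev : ∀ᶠ x in 𝓝 x0, ∃ e : RealPair g ≃L[ℝ] RealPair g, (e : RealPair g →L[ℝ] RealPair g)
      = K.comp (L x) := by
    have h2 : ContinuousAt (fun x => K.comp (L x)) x0 := hN.continuous.continuousAt
    have h3 := ContinuousLinearEquiv.nhds (ContinuousLinearEquiv.refl ℝ (RealPair g))
    have h4 := h2.eventually (p := fun f => f ∈ range ((↑) : (RealPair g ≃L[ℝ] RealPair g) → _))
      (by change range _ ∈ 𝓝 (K.comp (L x0)); rw [hK]; exact h3)
    exact h4
  filter_upwards [hev, hW.mem_nhds hx0] with x hx hxW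
  obtain ⟨e, he⟩ := hx
  have hw := isWhithamVector_iff.1 (isWhithamVector_whithamField (hreg x hxW) c)
  have h5 : K (T x (c x)) = e (whithamField c x) := by
    have : e (whithamField c x) = (K.comp (L x)) (whithamField c x) := by rw [← he]; rfl
    rw [this]
    change K (whithamRhsCoeff g x (c x)) = K (whithamLhs g x _)
    rw [hw]
  rw [h5, ← he, ContinuousLinearMap.inverse_equiv]
  simp

theorem exists_natDegree_cPoly (g : ℕ) : ∃ c : RealPoly g, (cPoly c).natDegree = g + 1 := by
  refine ⟨⟨fun _ => 1, fun i => by simp⟩, natDegree_eq_of_le_of_coeff_ne_zero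
    (natDegree_cPoly_le _) ?_⟩
  change (polyOf (fun _ : Fin (g + 2) => (1 : ℂ))).coeff ((Fin.last (g + 1) : Fin (g + 2)) : ℕ) ≠ 0
  rw [polyOf_coeff]
  exact one_ne_zero

end RealPair

theorem eqOn_of_eqOn_diff_finite {O S : Set ℂ} (hO : IsOpen O) (hS : S.Finite) {u v : ℂ → ℂ}
    (hu : ContinuousOn u O) (hv : ContinuousOn v O) (h : ∀ l ∈ O, l ∉ S → u l = v l) :
    ∀ l ∈ O, u l = v l := by
  intro l hl
  have h1 : Tendsto u (𝓝[≠] l) (𝓝 (u l)) :=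
    (hu.continuousAt (hO.mem_nhds hl)).tendsto.mono_left nhdsWithin_le_nhds
  have h2 : Tendsto v (𝓝[≠] l) (𝓝 (v l)) :=
    (hv.continuousAt (hO.mem_nhds hl)).tendsto.mono_left nhdsWithin_le_nhds
  refine tendsto_nhds_unique_of_eventuallyEq h1 h2 ?_
  have h3 : ∀ᶠ x in 𝓝[≠] l, x ∈ O := nhdsWithin_le_nhds (hO.mem_nhds hl)
  have h4 : ∀ᶠ x in 𝓝[≠] l, x ∈ (S \ {l})ᶜ := nhdsWithin_le_nhds
    ((hS.subset sdiff_subset).isClosed.isOpen_compl.mem_nhds (by simp))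
  filter_upwards [h3, h4, self_mem_nhdsWithin] with x hx hx' hx2
  grind

theorem finite_setOf_eval_eq_zero (ha : a ≠ 0) : {l | a.eval l = 0}.Finite := by
  have : {l | a.eval l = 0} = (a.roots.toFinset : Set ℂ) := by ext l; simp [ha]
  simp_all

theorem exists_sq_eq (hU : IsOpen U) (hp : StarConvex ℝ p U) (hpU : p ∈ U)
    {q : ℂ → ℂ} (hq : DifferentiableOn ℂ q U) (hq0 : ∀ l ∈ U, q l ≠ 0) :
    ∃ v : ℂ → ℂ, DifferentiableOn ℂ v U ∧ ∀ l ∈ U, v l ^ 2 = q l := by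
  obtain ⟨y, hy, -, hy'⟩ := exists_eq_add_mul_deriv hU hp
    (q := fun l => deriv q l / q l) ((hq.deriv hU).div hq hq0) one_ne_zero
  have hL : ∀ l ∈ U, HasDerivAt (fun l => (l - p) * y l) (deriv q l / q l) l := by
    intro l hl
    have h1 := (hy.differentiableAt (hU.mem_nhds hl)).hasDerivAt
    refine (((hasDerivAt_id l).sub_const p).mul h1).congr_deriv ?_
    rw [← hy' l hl]; simp
  have hc : ∀ l ∈ U, q l * exp (-((l - p) * y l)) = q p := by
    intro l hl
    have hd : ∀ w ∈ U, HasDerivAt (fun w => q w * exp (-((w - p) * y w))) 0 w := by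
      intro w hw
      have h1 := (hq.differentiableAt (hU.mem_nhds hw)).hasDerivAt
      refine (h1.mul (hL w hw).neg.cexp).congr_deriv ?_
      have := hq0 w hw
      field_simp
      ring
    have := hU.is_const_of_deriv_eq_zero (hp.isPathConnected hpU).isConnected.isPreconnected
      (fun w hw => (hd w hw).differentiableAt.differentiableWithinAt)
      (fun w hw => (hd w hw).deriv) hl hpU
    simpa using this
  refine ⟨fun l => q p ^ (1 / 2 : ℂ) * exp ((l - p) * y l / 2), ?_, ?_⟩
  · intro l hl
    refine DifferentiableAt.differentiableWithinAt ?_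
    exact ((hL l hl).differentiableAt.div_const 2).cexp.const_mul _
  · intro l hl
    rw [mul_pow, ← exp_nat_mul, ← hc l hl]
    have e1 : ((q l * exp (-((l - p) * y l))) ^ (1 / 2 : ℂ)) ^ 2
        = q l * exp (-((l - p) * y l)) := by
      rw [one_div, ← Nat.cast_ofNat, cpow_nat_inv_pow _ two_ne_zero]
    rw [e1, mul_assoc, ← exp_add]
    have : -((l - p) * y l) + ((2 : ℕ) : ℂ) * ((l - p) * y l / 2) = 0 := by push_cast; ring
    rw [this, exp_zero, mul_one]

/-- The pair `(k, f)` has the properties of `(cosh h, sinh h / ν)`, where `ν ^ 2 = a l / l` and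
`dh = b dl / (ν l ^ 2)`. -/
structure IsPellPair (a b : ℂ[X]) (O : Set ℂ) (k f : ℂ → ℂ) : Prop where
  diff_k : DifferentiableOn ℂ k O
  diff_f : DifferentiableOn ℂ f O
  pell : ∀ l ∈ O, l * k l ^ 2 - f l ^ 2 * a.eval l = l
  deriv_k : ∀ l ∈ O, l ^ 2 * deriv k l = f l * b.eval l
  deriv_f : ∀ l ∈ O, 2 * l * a.eval l * deriv f l =
    2 * k l * b.eval l - f l * (l * (derivative a).eval l - a.eval l)

section Pell

variable {O O' : Set ℂ} {k f k1 f1 : ℂ → ℂ}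

theorem IsPellPair.mono (h : IsPellPair a b O k f) (hO : O' ⊆ O) : IsPellPair a b O' k f :=
  ⟨h.diff_k.mono hO, h.diff_f.mono hO, fun l hl => h.pell l (hO hl),
    fun l hl => h.deriv_k l (hO hl), fun l hl => h.deriv_f l (hO hl)⟩

theorem IsPellPair.neg (h : IsPellPair a b O k f) : IsPellPair a b O (fun l => -k l) (fun l => -f l) := by
  refine ⟨h.diff_k.neg, h.diff_f.neg, fun l hl => ?_, fun l hl => ?_, fun l hl => ?_⟩
  · rw [neg_sq, neg_sq]; exact h.pell l hl
  · rw [deriv.fun_neg]; linear_combination -h.deriv_k l hl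
  · rw [deriv.fun_neg]; linear_combination -h.deriv_f l hl

theorem IsPellPair.of_nhds
    (h : ∀ l ∈ O, ∃ O', IsOpen O' ∧ l ∈ O' ∧ ∃ k1 f1, IsPellPair a b O' k1 f1 ∧
      (∀ w ∈ O', k w = k1 w) ∧ ∀ w ∈ O', f w = f1 w) : IsPellPair a b O k f := by
  have key : ∀ l ∈ O, DifferentiableAt ℂ k l ∧ DifferentiableAt ℂ f l ∧
      l * k l ^ 2 - f l ^ 2 * a.eval l = l ∧ l ^ 2 * deriv k l = f l * b.eval l ∧
      2 * l * a.eval l * deriv f l =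
        2 * k l * b.eval l - f l * (l * (derivative a).eval l - a.eval l) := by
    intro l hl
    obtain ⟨O', hO', hlO', k1, f1, hp, hk, hf⟩ := h l hl
    have ek : k =ᶠ[𝓝 l] k1 := by filter_upwards [hO'.mem_nhds hlO'] with w hw using hk w hw
    have ef : f =ᶠ[𝓝 l] f1 := by filter_upwards [hO'.mem_nhds hlO'] with w hw using hf w hw
    rw [ek.differentiableAt_iff, ef.differentiableAt_iff, ek.deriv_eq, ef.deriv_eq, hk l hlO',
      hf l hlO']
    exact ⟨hp.diff_k.differentiableAt (hO'.mem_nhds hlO'),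
      hp.diff_f.differentiableAt (hO'.mem_nhds hlO'), hp.pell l hlO', hp.deriv_k l hlO',
      hp.deriv_f l hlO'⟩
  exact ⟨fun l hl => (key l hl).1.differentiableWithinAt,
    fun l hl => (key l hl).2.1.differentiableWithinAt, fun l hl => (key l hl).2.2.1,
    fun l hl => (key l hl).2.2.2.1, fun l hl => (key l hl).2.2.2.2⟩

theorem IsPellPair.congr (h : IsPellPair a b O k1 f1) (hO : IsOpen O) (hk : ∀ l ∈ O, k l = k1 l)
    (hf : ∀ l ∈ O, f l = f1 l) : IsPellPair a b O k f :=
  IsPellPair.of_nhds fun _ hl => ⟨O, hO, hl, k1, f1, h, hk, hf⟩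

theorem IsPellPair.of_diff_finite (hO : IsOpen O) {S : Set ℂ} (hS : S.Finite)
    (hk : DifferentiableOn ℂ k O) (hf : DifferentiableOn ℂ f O)
    (h : IsPellPair a b (O \ S) k f) : IsPellPair a b O k f := by
  have hk' := (hk.deriv hO).continuousOn
  have hf' := (hf.deriv hO).continuousOn
  have hkc := hk.continuousOn
  have hfc := hf.continuousOn
  refine ⟨hk, hf, ?_, ?_, ?_⟩
  · exact eqOn_of_eqOn_diff_finite hO hS (by fun_prop) (by fun_prop)
      fun l hl hlS => h.pell l ⟨hl, hlS⟩
  · exact eqOn_of_eqOn_diff_finite hO hS (by fun_prop) (by fun_prop)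
      fun l hl hlS => h.deriv_k l ⟨hl, hlS⟩
  · exact eqOn_of_eqOn_diff_finite hO hS (by fun_prop) (by fun_prop)
      fun l hl hlS => h.deriv_f l ⟨hl, hlS⟩

theorem IsPellPair.exists_const (hO : IsOpen O) (hO' : IsPreconnected O) (h0 : ∀ l ∈ O, l ≠ 0)
    (h : IsPellPair a b O k f) (h1 : IsPellPair a b O k1 f1) :
    ∃ p : ℂ, (∀ l ∈ O, l * (k l * k1 l) - f l * f1 l * a.eval l = p * l) ∧
      ∀ l ∈ O, (f l * k1 l - k l * f1 l) ^ 2 * a.eval l = (p ^ 2 - 1) * l := by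
  have hd : ∀ l ∈ O, HasDerivAt (fun l => k l * k1 l - f l * f1 l * a.eval l / l) 0 l := by
    intro l hl
    have hl0 := h0 l hl
    have d1 := (h.diff_k.differentiableAt (hO.mem_nhds hl)).hasDerivAt
    have d2 := (h1.diff_k.differentiableAt (hO.mem_nhds hl)).hasDerivAt
    have d3 := (h.diff_f.differentiableAt (hO.mem_nhds hl)).hasDerivAt
    have d4 := (h1.diff_f.differentiableAt (hO.mem_nhds hl)).hasDerivAt
    have d5 := a.hasDerivAt l
    refine ((d1.mul d2).sub (((d3.mul d4).mul d5).div (hasDerivAt_id l) hl0)).congr_deriv ?_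
    have e1 := h.deriv_k l hl
    have e2 := h1.deriv_k l hl
    have e3 := h.deriv_f l hl
    have e4 := h1.deriv_f l hl
    simp
    field_simp
    rw [← mul_right_inj' (two_ne_zero)]
    linear_combination 2 * k1 l * e1 + 2 * k l * e2 - f1 l * e3 - f l * e4
  obtain ⟨p, hp⟩ := hO.exists_is_const_of_deriv_eq_zero hO'
    (fun w hw => (hd w hw).differentiableAt.differentiableWithinAt) (fun w hw => (hd w hw).deriv)
  have hp' : ∀ l ∈ O, l * (k l * k1 l) - f l * f1 l * a.eval l = p * l := by grind
  refine ⟨p, hp', fun l hl => ?_⟩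
  have hl0 := h0 l hl
  have e1 := hp' l hl
  have e2 := h.pell l hl
  have e3 := h1.pell l hl
  rw [← mul_right_inj' hl0]
  linear_combination (l * (k l * k1 l) - f l * f1 l * a.eval l + p * l) * e1
    - l * e2 - (l * k l ^ 2 - f l ^ 2 * a.eval l) * e3

theorem IsPellPair.recover (h1 : IsPellPair a b O k1 f1) {p l : ℂ} (hl : l ∈ O) (hl0 : l ≠ 0)
    (hp : l * (k l * k1 l) - f l * f1 l * a.eval l = p * l) :
    l * k l = l * (p * k1 l) + a.eval l * f1 l * (f l * k1 l - k l * f1 l) ∧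
      f l = k1 l * (f l * k1 l - k l * f1 l) + f1 l * p := by
  have e := h1.pell l hl
  constructor
  · linear_combination k1 l * hp - k l * e
  · grind

theorem IsPellPair.eq_smul (ha : a ≠ 0) (hO : IsOpen O) (h0 : ∀ l ∈ O, l ≠ 0)
    (h : IsPellPair a b O k f) (h1 : IsPellPair a b O k1 f1) {p : ℂ}
    (hp : ∀ l ∈ O, l * (k l * k1 l) - f l * f1 l * a.eval l = p * l)
    (hq : ∀ l ∈ O, (f l * k1 l - k l * f1 l) ^ 2 * a.eval l = (p ^ 2 - 1) * l)
    (hp1 : p ^ 2 = 1) : ∀ l ∈ O, k l = p * k1 l ∧ f l = p * f1 l := by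
  have hQ : ∀ l ∈ O, f l * k1 l - k l * f1 l = 0 := by
    have c1 := h.diff_k.continuousOn
    have c2 := h.diff_f.continuousOn
    have c3 := h1.diff_k.continuousOn
    have c4 := h1.diff_f.continuousOn
    refine eqOn_of_eqOn_diff_finite hO (finite_setOf_eval_eq_zero ha) (by fun_prop)
      continuousOn_const fun l hl hla => ?_
    have := hq l hl
    rw [hp1, sub_self, zero_mul, mul_eq_zero] at this
    exact pow_eq_zero_iff two_ne_zero |>.1 (this.resolve_right hla)
  intro l hl
  obtain ⟨e1, e2⟩ := h1.recover hl (h0 l hl) (hp l hl)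
  rw [hQ l hl] at e1 e2
  refine ⟨mul_left_cancel₀ (h0 l hl) (by rw [e1]; ring), by rw [e2]; ring⟩

theorem hasDerivAt_branch (hO : IsOpen O) {s : ℂ → ℂ} (hs : ContinuousOn s O)
    (hsq : ∀ l ∈ O, s l ^ 2 * l = a.eval l) {l : ℂ} (hl : l ∈ O) (h0 : l ≠ 0)
    (ha : a.eval l ≠ 0) :
    HasDerivAt s ((l * (derivative a).eval l - a.eval l) / (2 * s l * l ^ 2)) l := by
  have hs0 : s l ≠ 0 := by
    intro h; have := hsq l hl; rw [h] at this; simp at this; exact ha this.symm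
  have hsc := hs.continuousAt (hO.mem_nhds hl)
  have hq : HasDerivAt (fun w => a.eval w / w)
      ((l * (derivative a).eval l - a.eval l) / l ^ 2) l := by
    refine ((a.hasDerivAt l).div (hasDerivAt_id l) h0).congr_deriv ?_
    simp; ring
  rw [hasDerivAt_iff_tendsto_slope] at hq ⊢
  have h2 : Tendsto (fun w => s w + s l) (𝓝[≠] l) (𝓝 (s l + s l)) :=
    (hsc.tendsto.add tendsto_const_nhds).mono_left nhdsWithin_le_nhds
  have hne : s l + s l ≠ 0 := by rw [← two_mul]; exact mul_ne_zero two_ne_zero hs0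
  have h3 := hq.div h2 hne
  have e : (l * (derivative a).eval l - a.eval l) / l ^ 2 / (s l + s l)
      = (l * (derivative a).eval l - a.eval l) / (2 * s l * l ^ 2) := by
    field_simp; ring
  rw [e] at h3
  refine h3.congr' ?_
  have h4 := h2.eventually_ne hne
  have h5 : ∀ᶠ w in 𝓝[≠] l, w ∈ O := nhdsWithin_le_nhds (hO.mem_nhds hl)
  have h6 : ∀ᶠ w in 𝓝[≠] l, w ≠ 0 := nhdsWithin_le_nhds (isOpen_ne.mem_nhds h0)
  filter_upwards [h4, h5, h6, self_mem_nhdsWithin] with w h4 h5 h6 h7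
  simp only [slope_def_field, Pi.div_apply]
  rw [← hsq w h5, ← hsq l hl]
  field_simp
  ring

theorem IsPellPair.of_log (hO : IsOpen O) {s H : ℂ → ℂ} (hs : ContinuousOn s O)
    (hsq : ∀ l ∈ O, s l ^ 2 * l = a.eval l) (h0 : ∀ l ∈ O, l ≠ 0) (ha : ∀ l ∈ O, a.eval l ≠ 0)
    (hH : ∀ l ∈ O, HasDerivAt H (b.eval l / (s l * l ^ 2)) l) :
    IsPellPair a b O (fun l => cosh (H l)) (fun l => sinh (H l) / s l) := by
  have hs0 : ∀ l ∈ O, s l ≠ 0 := by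
    intro l hl h; have := hsq l hl; rw [h] at this; simp at this; exact ha l hl this.symm
  have dk := fun l hl => (hH l hl).ccosh
  have df := fun l (hl : l ∈ O) => ((hH l hl).csinh).div
    (hasDerivAt_branch hO hs hsq hl (h0 l hl) (ha l hl)) (hs0 l hl)
  refine ⟨fun l hl => (dk l hl).differentiableAt.differentiableWithinAt,
    fun l hl => (df l hl).differentiableAt.differentiableWithinAt, fun l hl => ?_, fun l hl => ?_,
    fun l hl => ?_⟩
  · have e := cosh_sq_sub_sinh_sq (H l)
    have := hs0 l hl
    rw [← hsq l hl]
    field_simp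
    linear_combination l * e
  · have := hs0 l hl
    have := h0 l hl
    rw [(dk l hl).deriv]
    field_simp
  · have h1 := hs0 l hl
    have h2 := h0 l hl
    have e : deriv (fun l => sinh (H l) / s l) l = _ := (df l hl).deriv
    rw [e]
    rw [← hsq l hl]
    field_simp

end Pell

section Local

def sinhc (z : ℂ) : ℂ := dslope sinh 0 z

theorem mul_sinhc (z : ℂ) : z * sinhc z = sinh z := by
  have := sub_smul_dslope sinh 0 z
  simpa [sinhc] using this

theorem sinhc_neg (z : ℂ) : sinhc (-z) = sinhc z := by
  rcases eq_or_ne z 0 with rfl | hz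
  · simp
  · have h1 := mul_sinhc (-z)
    rw [sinh_neg, ← mul_sinhc z] at h1
    refine mul_left_cancel₀ hz ?_
    linear_combination -h1

theorem differentiable_sinhc : Differentiable ℂ sinhc := by
  have := (differentiableOn_dslope (c := 0) univ_mem).2 differentiable_sinh.differentiableOn
  exact differentiableOn_univ.1 this

theorem exists_local_sqrt_sub {p l0 : ℂ} (h : l0 ≠ p) :
    ∃ y : ℂ → ℂ, ∀ l ∈ ball l0 ‖l0 - p‖, y l ^ 2 = l - p ∧ HasDerivAt y (1 / (2 * y l)) l := by
  have hne := sub_ne_zero.2 h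
  have hslit : ∀ l ∈ ball l0 ‖l0 - p‖, (l - p) / (l0 - p) ∈ slitPlane := by
    intro l hl
    refine Or.inl ?_
    have e : (l - p) / (l0 - p) = 1 + (l - l0) / (l0 - p) := by field_simp; ring
    have h1 : ‖(l - l0) / (l0 - p)‖ < 1 := by
      rw [norm_div, div_lt_one (norm_pos_iff.2 hne)]
      simpa [dist_eq_norm] using hl
    have h2 := (abs_le.1 (abs_re_le_norm ((l - l0) / (l0 - p)))).1
    rw [e, add_re, one_re]
    linarith
  have hsq : ∀ l, ((l0 - p) ^ (1 / 2 : ℂ) * ((l - p) / (l0 - p)) ^ (1 / 2 : ℂ)) ^ 2 = l - p := by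
    intro l
    rw [mul_pow, one_div, ← Nat.cast_ofNat, cpow_nat_inv_pow _ two_ne_zero,
      cpow_nat_inv_pow _ two_ne_zero]
    field_simp
  refine ⟨fun l => (l0 - p) ^ (1 / 2 : ℂ) * ((l - p) / (l0 - p)) ^ (1 / 2 : ℂ), fun l hl =>
    ⟨hsq l, ?_⟩⟩
  have hl0 : l - p ≠ 0 := by
    intro h0
    have := hslit l hl
    rw [h0, zero_div] at this
    exact zero_notMem_slitPlane this
  have hd : DifferentiableAt ℂ
      (fun l => (l0 - p) ^ (1 / 2 : ℂ) * ((l - p) / (l0 - p)) ^ (1 / 2 : ℂ)) l :=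
    (((differentiableAt_id.sub_const p).div_const _).cpow_const (hslit l hl)).const_mul _
  have hy := hd.hasDerivAt
  set y := (fun l => (l0 - p) ^ (1 / 2 : ℂ) * ((l - p) / (l0 - p)) ^ (1 / 2 : ℂ))
  have hy0 : y l ≠ 0 := by grind
  have h1 : HasDerivAt (fun w => y w ^ 2) (2 * y l * deriv y l) l := by
    exact (hy.pow 2).congr_deriv (by simp)
  have h2 : HasDerivAt (fun w => y w ^ 2) 1 l := by
    rw [show (fun w => y w ^ 2) = fun w => w - p from funext hsq]
    exact (hasDerivAt_id l).sub_const p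
  refine hy.congr_deriv ?_
  have := h1.unique h2
  field_simp
  linear_combination this

theorem exists_pellPair_of_starConvex (hU : IsOpen U) (hconv : StarConvex ℝ p U)
    (hpU : p ∈ U) {u : ℂ[X]} (hu : a = (X - C p) * u) (hball : ∀ l ∈ U, l ≠ 0 ∧ u.eval l ≠ 0) :
    ∃ k f, IsPellPair a b U k f := by
  obtain ⟨v, hv, hvsq⟩ := exists_sq_eq hU hconv hpU (q := fun l => u.eval l / l)
    (u.differentiable.differentiableOn.div differentiableOn_id fun l hl => (hball l hl).1)
    (fun l hl => div_ne_zero (hball l hl).2 (hball l hl).1)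
  have hv0 : ∀ l ∈ U, v l ≠ 0 := by
    intro l hl h0
    have := hvsq l hl
    rw [h0, zero_pow two_ne_zero] at this
    exact div_ne_zero (hball l hl).2 (hball l hl).1 this.symm
  obtain ⟨G, hG, -, hG'⟩ := exists_eq_add_mul_deriv hU hconv
    (q := fun l => 2 * b.eval l / (v l * l ^ 2))
    ((b.differentiable.differentiableOn.const_mul 2).div
      (hv.mul (differentiableOn_id.pow 2)) fun l hl => mul_ne_zero (hv0 l hl)
        (pow_ne_zero 2 (hball l hl).1)) two_ne_zero
  let x : ℂ → ℂ := fun l => (l - p) ^ (1 / 2 : ℂ)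
  have hx : ∀ l, x l ^ 2 = l - p := by
    intro l
    simp only [x]
    rw [one_div, ← Nat.cast_ofNat, cpow_nat_inv_pow _ two_ne_zero]
  let k : ℂ → ℂ := fun l => cosh (x l * G l)
  let f : ℂ → ℂ := fun l => G l / v l * sinhc (x l * G l)
  have hpunct : IsPellPair a b (U \ {p}) k f := by
    refine IsPellPair.of_nhds fun l0 hl₀ => ?_
    obtain ⟨y, hy⟩ := exists_local_sqrt_sub (p := p) (l0 := l0) hl₀.2
    have hpos : 0 < ‖l0 - p‖ := norm_pos_iff.2 (sub_ne_zero.2 hl₀.2)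
    have hO : IsOpen (U ∩ ball l0 ‖l0 - p‖) := hU.inter isOpen_ball
    have hl0 : ∀ l ∈ U ∩ ball l0 ‖l0 - p‖, l - p ≠ 0 := by
      intro l hl h0
      rw [sub_eq_zero] at h0
      rw [h0] at hl
      have := hl.2
      rw [mem_ball, dist_eq_norm, norm_sub_rev] at this
      exact lt_irrefl _ this
    have hy0 : ∀ l ∈ U ∩ ball l0 ‖l0 - p‖, y l ≠ 0 := by
      intro l hl h0
      have := (hy l hl.2).1
      rw [h0] at this; simp at this
      exact hl0 l hl this.symm
    refine ⟨U ∩ ball l0 ‖l0 - p‖, hO, ⟨hl₀.1, mem_ball_self hpos⟩,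
      _, _, IsPellPair.of_log hO (s := fun l => v l * y l) (H := fun l => y l * G l)
        ?_ ?_ (fun l hl => (hball l hl.1).1) ?_ ?_, ?_, ?_⟩
    · exact (hv.continuousOn.mono inter_subset_left).mul
        fun l hl => (hy l hl.2).2.continuousAt.continuousWithinAt
    · intro l hl
      have := (hball l hl.1).1
      rw [mul_pow, hvsq l hl.1, (hy l hl.2).1, hu, eval_mul]
      simp
      field_simp
    · intro l hl
      rw [hu, eval_mul]
      exact mul_ne_zero (by simpa using hl0 l hl) (hball l hl.1).2
    · intro l hl
      have h1 := (hG.differentiableAt (hU.mem_nhds hl.1)).hasDerivAt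
      refine ((hy l hl.2).2.mul h1).congr_deriv ?_
      have e1 := hG' l hl.1
      have e2 := (hy l hl.2).1
      have e3 := hy0 l hl
      have e4 := hv0 l hl.1
      have e5 := (hball l hl.1).1
      rw [← e2] at e1
      push_cast at e1
      rw [eq_div_iff (by positivity)] at e1
      field_simp
      linear_combination e1
    · intro l hl
      rcases sq_eq_sq_iff_eq_or_eq_neg.1 ((hx l).trans (hy l hl.2).1.symm) with h | h
      · simp only [k, h]
      · simp only [k, h, neg_mul, cosh_neg]
    · intro l hl
      have e3 := hy0 l hl
      have e4 := hv0 l hl.1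
      have hs : sinhc (x l * G l) = sinhc (y l * G l) := by
        rcases sq_eq_sq_iff_eq_or_eq_neg.1 ((hx l).trans (hy l hl.2).1.symm) with h | h
        · rw [h]
        · rw [h, neg_mul, sinhc_neg]
      simp only [f]
      rw [hs, ← mul_sinhc (y l * G l)]
      field_simp
  have hxc : ContinuousAt x p := by
    have h1 : ContinuousAt (fun z : ℂ => z ^ (1 / 2 : ℂ)) (p - p) := by
      rw [sub_self]
      exact continuousAt_cpow_const_of_re_pos (by simp) (by norm_num)
    exact h1.comp (f := fun l => l - p) (continuousAt_id.sub continuousAt_const)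
  have hnh : U ∈ 𝓝 p := hU.mem_nhds hpU
  have hGc : ContinuousAt G p := hG.continuousOn.continuousAt hnh
  have hvc : ContinuousAt v p := hv.continuousOn.continuousAt hnh
  have hk : DifferentiableOn ℂ k (U) :=
    (differentiableOn_compl_singleton_and_continuousAt_iff hnh).1 ⟨hpunct.diff_k,
      continuous_cosh.continuousAt.comp (hxc.mul hGc)⟩
  have hf : DifferentiableOn ℂ f (U) :=
    (differentiableOn_compl_singleton_and_continuousAt_iff hnh).1 ⟨hpunct.diff_f,
      (hGc.div hvc (hv0 p hpU)).mul
        (differentiable_sinhc.continuous.continuousAt.comp (hxc.mul hGc))⟩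
  exact ⟨k, f, IsPellPair.of_diff_finite hU (finite_singleton p) hk hf hpunct⟩

theorem exists_pellPair_of_root (hp : p ≠ 0) (hroot : a.eval p = 0)
    (hsimple : (derivative a).eval p ≠ 0) :
    ∃ r > 0, ∃ k f, IsPellPair a b (ball p r) k f := by
  obtain ⟨u, hu⟩ := dvd_iff_isRoot.2 (show a.IsRoot p from hroot)
  have hup : u.eval p ≠ 0 := by
    intro h; apply hsimple
    rw [hu]; simp [h]
  have hev := (isOpen_ne.eventually_mem hp).and (u.continuous.continuousAt.eventually_ne hup)
  obtain ⟨r, hr, hball⟩ := Metric.eventually_nhds_iff_ball.1 hev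
  have hconv := (convex_ball p r).starConvex (mem_ball_self hr)
  exact ⟨r, hr, exists_pellPair_of_starConvex isOpen_ball hconv (mem_ball_self hr) hu hball⟩

theorem exists_log_of_ne_root (hp : p ≠ 0) (hroot : a.eval p ≠ 0) :
    ∃ r > 0, ∃ s H : ℂ → ℂ, ContinuousOn s (ball p r) ∧
      ∀ l ∈ ball p r, l ≠ 0 ∧ a.eval l ≠ 0 ∧ s l ^ 2 * l = a.eval l ∧
        HasDerivAt H (b.eval l / (s l * l ^ 2)) l := by
  have hev := (isOpen_ne.eventually_mem hp).and (a.continuous.continuousAt.eventually_ne hroot)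
  obtain ⟨r, hr, hball⟩ := Metric.eventually_nhds_iff_ball.1 hev
  have hconv := (convex_ball p r).starConvex (mem_ball_self hr)
  obtain ⟨v, hv, hvsq⟩ := exists_sq_eq isOpen_ball hconv (mem_ball_self hr)
    (q := fun l => a.eval l / l)
    (a.differentiable.differentiableOn.div differentiableOn_id fun l hl => (hball l hl).1)
    (fun l hl => div_ne_zero (hball l hl).2 (hball l hl).1)
  have hv0 : ∀ l ∈ ball p r, v l ≠ 0 := by
    intro l hl h0
    have := hvsq l hl
    rw [h0, zero_pow two_ne_zero] at this
    exact div_ne_zero (hball l hl).2 (hball l hl).1 this.symm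
  have hq := b.differentiable.differentiableOn.div (hv.mul (differentiableOn_id.pow 2))
      fun l hl => mul_ne_zero (hv0 l hl) (pow_ne_zero 2 (hball l hl).1)
  obtain ⟨H, hH⟩ := hq.isExactOn_ball
  refine ⟨r, hr, v, H, hv.continuousOn, fun l hl => ⟨(hball l hl).1, (hball l hl).2, ?_, hH l hl⟩⟩
  rw [hvsq l hl, div_mul_cancel₀ _ (hball l hl).1]

end Local

section CutPlane

theorem isClosed_segment_complex (x y : ℂ) : IsClosed (segment ℝ x y) := by
  rw [segment_eq_image]
  exact (isCompact_Icc.image (by fun_prop)).isClosed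

theorem isBounded_segment_complex (x y : ℂ) : Bornology.IsBounded (segment ℝ x y) := by
  rw [segment_eq_image]
  exact (isCompact_Icc.image (by fun_prop)).isBounded

theorem eq_mul_of_mem_segment (hα : α ≠ 0) (hl : l ∈ segment ℝ α (conj α)⁻¹) :
    ∃ r : ℝ, 0 < r ∧ l = r * α := by
  obtain ⟨x, y, hx, hy, hxy, rfl⟩ := hl
  have hn := normSq_pos.2 hα
  refine ⟨x + y / normSq α, ?_, ?_⟩
  · rcases hx.eq_or_lt with h | h
    · have : y = 1 := by linarith
      rw [this]; positivity
    · positivity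
  · have hc : (conj α)⁻¹ = α / normSq α := by
      rw [normSq_eq_conj_mul_self]
      field_simp
    rw [hc]
    simp
    field_simp

theorem mem_cutPlane_ne_zero (hl : l ∈ cutPlane a) : l ≠ 0 := hl.1

theorem mem_cutPlane_eval_ne (hl : l ∈ cutPlane a) : a.eval l ≠ 0 :=
  fun h => hl.2 l h (left_mem_segment ℝ _ _)

theorem isOpen_cutPlane (ha : a ≠ 0) : IsOpen (cutPlane a) := by
  have : cutPlane a = {0}ᶜ ∩ (⋃ α ∈ {α | a.eval α = 0}, segment ℝ α (conj α)⁻¹)ᶜ := by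
    ext l; simp [cutPlane]
  rw [this]
  exact isOpen_compl_singleton.inter ((finite_setOf_eval_eq_zero ha).isClosed_biUnion
      fun α _ => isClosed_segment_complex _ _).isOpen_compl

theorem exists_mul_mem_cutPlane (ha : a ≠ 0) {q : ℂ} (hq : q ≠ 0) :
    ∃ r : ℝ, 0 < r ∧ (r : ℂ) * q ∈ cutPlane a := by
  have hb : Bornology.IsBounded (⋃ α ∈ {α | a.eval α = 0}, segment ℝ α (conj α)⁻¹) :=
    (Bornology.isBounded_biUnion (finite_setOf_eval_eq_zero ha)).2
      fun α _ => isBounded_segment_complex _ _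
  obtain ⟨R, hR, hsub⟩ := hb.subset_ball_lt 0 0
  have hq' := norm_pos_iff.2 hq
  have hne : ((R / ‖q‖ : ℝ) : ℂ) * q ≠ 0 := mul_ne_zero (by exact_mod_cast (div_pos hR hq').ne') hq
  refine ⟨R / ‖q‖, div_pos hR hq', hne, fun α hα hl => ?_⟩
  have := hsub (mem_biUnion hα hl)
  rw [mem_ball_zero_iff, norm_mul, norm_real, Real.norm_eq_abs,
    abs_of_pos (div_pos hR hq'), div_mul_cancel₀ _ hq'.ne'] at this
  exact lt_irrefl _ this

theorem eventually_mem_cutPlane (ha : a ≠ 0) (ha0 : a.eval 0 ≠ 0) {q : ℂ} (hq : q ≠ 0) :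
    ∀ᶠ l in 𝓝 q, l ≠ 0 ∧ ((l / q).im ≠ 0 → l ∈ cutPlane a) := by
  have hfin : {α | a.eval α = 0 ∧ q ∉ segment ℝ α (conj α)⁻¹}.Finite :=
    (finite_setOf_eval_eq_zero ha).subset fun α h => h.1
  have hcl : IsClosed (⋃ α ∈ {α | a.eval α = 0 ∧ q ∉ segment ℝ α (conj α)⁻¹},
      segment ℝ α (conj α)⁻¹) :=
    hfin.isClosed_biUnion fun α _ => isClosed_segment_complex _ _
  have hmem := hcl.isOpen_compl.eventually_mem (show q ∈ _ from fun h => by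
      obtain ⟨α, hα, h⟩ := mem_iUnion₂.1 h
      exact hα.2 h)
  filter_upwards [hmem, isOpen_ne.eventually_mem hq] with l hl hl0
  refine ⟨hl0, fun him => ⟨hl0, fun α hα hseg => ?_⟩⟩
  by_cases hqs : q ∈ segment ℝ α (conj α)⁻¹
  · have hα0 : α ≠ 0 := by rintro rfl; exact ha0 hα
    obtain ⟨r, hr, h1⟩ := eq_mul_of_mem_segment hα0 hseg
    obtain ⟨r', hr', h2⟩ := eq_mul_of_mem_segment hα0 hqs
    apply him
    rw [h1, h2, mul_div_mul_right _ _ hα0, ← ofReal_div, ofReal_im]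
  · exact hl (mem_iUnion₂.2 ⟨α, ⟨hα, hqs⟩, hseg⟩)

theorem eqOn_of_eqOn_im_ne {O : Set ℂ} (hO : IsOpen O) {q : ℂ} (hq : q ≠ 0) {u v : ℂ → ℂ}
    (hu : ContinuousOn u O) (hv : ContinuousOn v O)
    (h : ∀ l ∈ O, (l / q).im ≠ 0 → u l = v l) : ∀ l ∈ O, u l = v l := by
  intro l hl
  by_cases him : (l / q).im = 0
  · have ht : Tendsto (fun δ : ℝ => l + δ * (I * q)) (𝓝[>] 0) (𝓝 l) := by
      have : Tendsto (fun δ : ℝ => l + δ * (I * q)) (𝓝 0)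
          (𝓝 (l + 0 * (I * q))) := Continuous.tendsto (by fun_prop) 0
      simp at this
      exact this.mono_left nhdsWithin_le_nhds
    refine tendsto_nhds_unique_of_eventuallyEq ((hu.continuousAt (hO.mem_nhds hl)).tendsto.comp ht)
      ((hv.continuousAt (hO.mem_nhds hl)).tendsto.comp ht) ?_
    filter_upwards [ht.eventually (hO.mem_nhds hl), self_mem_nhdsWithin] with δ h1 h2
    refine h _ h1 ?_
    have e : (l + δ * (I * q)) / q = l / q + δ * I := by field_simp
    rw [e, add_im, him]
    simpa using (ne_of_gt h2 : δ ≠ 0)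
  · exact h l hl him

theorem mem_closure_cutPlane (ha : a ≠ 0) (ha0 : a.eval 0 ≠ 0) {q : ℂ} (hq : q ≠ 0) :
    q ∈ closure (cutPlane a) := by
  have ht : Tendsto (fun δ : ℝ => q + δ * (I * q)) (𝓝[>] 0) (𝓝 q) := by
    have : Tendsto (fun δ : ℝ => q + δ * (I * q)) (𝓝 0)
        (𝓝 (q + 0 * (I * q))) := Continuous.tendsto (by fun_prop) 0
    simp at this
    exact this.mono_left nhdsWithin_le_nhds
  refine mem_closure_of_tendsto ht ?_
  filter_upwards [ht.eventually (eventually_mem_cutPlane ha ha0 hq), self_mem_nhdsWithin]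
    with δ h1 h2
  refine h1.2 ?_
  have e : (q + δ * (I * q)) / q = 1 + δ * I := by field_simp
  rw [e]
  simpa using (ne_of_gt h2 : δ ≠ 0)

end CutPlane

section Extension

variable {k0 f0 : ℂ → ℂ}

theorem IsPellPair.glue {D T : Set ℂ} (hT : ∀ p ∈ T, p ∈ closure D)
    (hloc : ∀ p ∈ T, ∃ O, IsOpen O ∧ p ∈ O ∧ O ⊆ T ∧ ∃ k f, IsPellPair a b O k f ∧
      ∀ l ∈ O ∩ D, k l = k0 l ∧ f l = f0 l) :
    ∃ k f, IsPellPair a b T k f ∧ ∀ l ∈ T ∩ D, k l = k0 l ∧ f l = f0 l := by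
  choose! O hO hpO hOT k f hkf hagree using hloc
  refine ⟨fun l => k l l, fun l => f l l, ?_, fun l hl => hagree l hl.1 l ⟨hpO l hl.1, hl.2⟩⟩
  refine IsPellPair.of_nhds fun p hp => ⟨O p, hO p hp, hpO p hp, k p, f p, hkf p hp, ?_⟩
  have key : ∀ w ∈ O p, k w w = k p w ∧ f w w = f p w := by
    intro w hw
    have hwT := hOT p hp hw
    have hne := mem_closure_iff_nhdsWithin_neBot.1 (hT w hwT)
    have n1 := (hO p hp).mem_nhds hw
    have n2 := (hO w hwT).mem_nhds (hpO w hwT)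
    have hev : ∀ᶠ l in 𝓝[D] w, l ∈ O p ∧ l ∈ O w ∧ l ∈ D := by
      filter_upwards [nhdsWithin_le_nhds n1, nhdsWithin_le_nhds n2, self_mem_nhdsWithin]
        with l h1 h2 h3 using ⟨h1, h2, h3⟩
    have hlim : ∀ {u : ℂ → ℂ} {O' : Set ℂ}, ContinuousOn u O' → O' ∈ 𝓝 w →
        Tendsto u (𝓝[D] w) (𝓝 (u w)) := fun hu hO' =>
      (hu.continuousAt hO').tendsto.mono_left nhdsWithin_le_nhds
    constructor
    · refine tendsto_nhds_unique_of_eventuallyEq (hlim (hkf w hwT).diff_k.continuousOn n2)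
        (hlim (hkf p hp).diff_k.continuousOn n1) ?_
      filter_upwards [hev] with l hl
      grind
    · refine tendsto_nhds_unique_of_eventuallyEq (hlim (hkf w hwT).diff_f.continuousOn n2)
        (hlim (hkf p hp).diff_f.continuousOn n1) ?_
      filter_upwards [hev] with l hl
      grind
  exact ⟨fun w hw => (key w hw).1, fun w hw => (key w hw).2⟩

theorem exists_cosh_sinh_eq {p q : ℂ} (h : q ^ 2 = p ^ 2 - 1) : ∃ δ, cosh δ = p ∧ sinh δ = q := by
  have hmul : (p + q) * (p - q) = 1 := by linear_combination -h
  have hne := left_ne_zero_of_mul_eq_one hmul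
  obtain ⟨δ, hδ⟩ : ∃ δ, exp δ = p + q := ⟨_, exp_log hne⟩
  have hδ' : exp (-δ) = p - q := by rw [exp_neg, hδ]; exact inv_eq_of_mul_eq_one_right hmul
  refine ⟨δ, ?_, ?_⟩
  · rw [cosh, hδ, hδ']; ring
  · rw [sinh, hδ, hδ']; ring

theorem IsPellPair.exists_eq_of_log {D B : Set ℂ} (hD : IsOpen D) (hDc : IsPreconnected D)
    (hDB : D ⊆ B) (hB : IsOpen B) {k f s H : ℂ → ℂ} (h : IsPellPair a b D k f)
    (hs : ContinuousOn s B)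
    (hsH : ∀ l ∈ B, l ≠ 0 ∧ a.eval l ≠ 0 ∧ s l ^ 2 * l = a.eval l ∧
        HasDerivAt H (b.eval l / (s l * l ^ 2)) l) :
    ∃ δ : ℂ, ∀ l ∈ D, k l = cosh (H l + δ) ∧ f l = sinh (H l + δ) / s l := by
  have h1 := IsPellPair.of_log hB hs (fun l hl => (hsH l hl).2.2.1) (fun l hl => (hsH l hl).1)
      (fun l hl => (hsH l hl).2.1) (fun l hl => (hsH l hl).2.2.2)
  have hs0 : ∀ l ∈ B, s l ≠ 0 := by
    intro l hl h; have := (hsH l hl).2.2.1; rw [h] at this; simp at this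
    exact (hsH l hl).2.1 this.symm
  obtain ⟨p, hp, hq⟩ := h.exists_const hD hDc (fun l hl => (hsH l (hDB hl)).1) (h1.mono hDB)
  set Q : ℂ → ℂ := fun l => f l * cosh (H l) - k l * (sinh (H l) / s l) with hQ
  obtain ⟨r, hr⟩ : ∃ r, r ^ 2 = p ^ 2 - 1 :=
    ⟨(p ^ 2 - 1) ^ ((2 : ℕ) : ℂ)⁻¹, cpow_nat_inv_pow _ two_ne_zero⟩
  have hsq : ∀ l ∈ D, (Q l * s l) ^ 2 = r ^ 2 := by
    intro l hl
    have e1 := hq l hl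
    have e2 := (hsH l (hDB hl)).2.2.1
    rw [← e2] at e1
    rw [hr]
    refine mul_right_cancel₀ (hsH l (hDB hl)).1 ?_
    rw [← e1]; simp only [hQ]; ring
  have hQc : ContinuousOn (fun l => Q l * s l) D := by
    have c1 := h.diff_k.continuousOn
    have c2 := h.diff_f.continuousOn
    have c3 := (h1.mono hDB).diff_k.continuousOn
    have c4 := (h1.mono hDB).diff_f.continuousOn
    exact ((c2.mul c3).sub (c1.mul c4)).mul (hs.mono hDB)
  obtain ⟨r', hr', hrs⟩ : ∃ r', r' ^ 2 = p ^ 2 - 1 ∧ ∀ l ∈ D, Q l * s l = r' := by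
    by_cases h0 : r = 0
    · refine ⟨r, hr, fun l hl => ?_⟩
      have := hsq l hl
      rw [h0] at this ⊢
      exact pow_eq_zero_iff two_ne_zero |>.1 (by simpa using this)
    · rcases hDc.eq_or_eq_neg_of_sq_eq hQc continuousOn_const hsq (fun _ => h0) with h | h
      · exact ⟨r, hr, h⟩
      · exact ⟨-r, by rw [neg_sq, hr], h⟩
  obtain ⟨δ, hc, hsn⟩ := exists_cosh_sinh_eq hr'
  refine ⟨δ, fun l hl => ?_⟩
  have e := (h1.mono hDB).recover hl (hsH l (hDB hl)).1 (hp l hl)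
  have e1 := hrs l hl
  have hsl := hs0 l (hDB hl)
  have hl0 := (hsH l (hDB hl)).1
  have e2 : f l * cosh (H l) - k l * (sinh (H l) / s l) = r' / s l := by
    rw [← e1]; simp only [hQ]; field_simp
  rw [e2] at e
  rw [cosh_add, sinh_add, hc, hsn]
  constructor
  · refine mul_left_cancel₀ hl0 ?_
    rw [e.1, ← (hsH l (hDB hl)).2.2.1]
    field_simp
  · rw [e.2]; field_simp; ring

theorem IsPellPair.exists_eq_of_root {D B : Set ℂ} (hD : IsOpen D) (hDc : IsPreconnected D)
    (hDB : D ⊆ B) (hB : IsOpen B) (hα : α ∈ B) (hα0 : α ≠ 0) (hroot : a.eval α = 0)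
    (ha : a ≠ 0) (hD0 : ∀ l ∈ D, l ≠ 0)
    {k f k1 f1 : ℂ → ℂ} (h : IsPellPair a b D k f) (h₁ : IsPellPair a b B k1 f1) {A : Set ℂ}
    (hA : A ⊆ D) (hAα : α ∈ closure A)
    (hlim : Tendsto (fun l => f l ^ 2 * a.eval l) (𝓝[A] α) (𝓝 0)) :
    ∃ p : ℂ, p ^ 2 = 1 ∧ ∀ l ∈ D, k l = p * k1 l ∧ f l = p * f1 l := by
  obtain ⟨p, hp, hq⟩ := h.exists_const hD hDc hD0 (h₁.mono hDB)
  have hne : (𝓝[A] α).NeBot := mem_closure_iff_nhdsWithin_neBot.1 hAα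
  have hl : Tendsto (fun l : ℂ => l) (𝓝[A] α) (𝓝 α) := tendsto_id.mono_left nhdsWithin_le_nhds
  have ta : Tendsto (fun l : ℂ => a.eval l) (𝓝[A] α) (𝓝 0) := by
    rw [← hroot]; exact (a.continuous.tendsto α).mono_left nhdsWithin_le_nhds
  have tk : Tendsto k1 (𝓝[A] α) (𝓝 (k1 α)) :=
    (h₁.diff_k.continuousOn.continuousAt (hB.mem_nhds hα)).tendsto.mono_left nhdsWithin_le_nhds
  have tf : Tendsto f1 (𝓝[A] α) (𝓝 (f1 α)) :=
    (h₁.diff_f.continuousOn.continuousAt (hB.mem_nhds hα)).tendsto.mono_left nhdsWithin_le_nhds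
  have hmA : ∀ᶠ l in 𝓝[A] α, l ∈ A := self_mem_nhdsWithin
  have tk2 : Tendsto (fun l => k l ^ 2) (𝓝[A] α) (𝓝 1) := by
    have h1 : Tendsto (fun l => 1 + (f l ^ 2 * a.eval l) / l) (𝓝[A] α) (𝓝 (1 + 0 / α)) :=
      tendsto_const_nhds.add (hlim.div hl hα0)
    rw [zero_div, add_zero] at h1
    refine h1.congr' ?_
    filter_upwards [hmA] with l hl
    have e := h.pell l (hA hl)
    have := hD0 l (hA hl)
    field_simp
    linear_combination -e
  have hbound : Tendsto (fun l => 2 * (‖f l ^ 2 * a.eval l‖ * ‖k1 l‖ ^ 2 +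
      ‖k l ^ 2‖ * (‖f1 l‖ ^ 2 * ‖a.eval l‖))) (𝓝[A] α) (𝓝 0) := by
    have := ((hlim.norm.mul (tk.norm.pow 2)).add
      (tk2.norm.mul ((tf.norm.pow 2).mul ta.norm))).const_mul 2
    simpa using this
  have h3 : Tendsto (fun l => (p ^ 2 - 1) * l) (𝓝[A] α) (𝓝 0) := by
    refine squeeze_zero_norm' ?_ hbound
    filter_upwards [hmA] with l hl
    rw [← hq l (hA hl)]
    have h5 : ‖f l * k1 l - k l * f1 l‖ ^ 2 ≤ 2 * (‖f l * k1 l‖ ^ 2 + ‖k l * f1 l‖ ^ 2) := by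
      have := norm_sub_le (f l * k1 l) (k l * f1 l)
      have h6 := norm_nonneg (f l * k1 l - k l * f1 l)
      nlinarith [sq_nonneg (‖f l * k1 l‖ - ‖k l * f1 l‖)]
    calc ‖(f l * k1 l - k l * f1 l) ^ 2 * a.eval l‖
        = ‖f l * k1 l - k l * f1 l‖ ^ 2 * ‖a.eval l‖ := by rw [norm_mul, norm_pow]
      _ ≤ 2 * (‖f l * k1 l‖ ^ 2 + ‖k l * f1 l‖ ^ 2) * ‖a.eval l‖ := by gcongr
      _ = _ := by simp; ring
  have h4 := tendsto_nhds_unique h3 (hl.const_mul (p ^ 2 - 1))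
  have hp1 : p ^ 2 = 1 := by
    rcases mul_eq_zero.1 h4.symm with h | h
    · linear_combination h
    · exact absurd h hα0
  exact ⟨p, hp1, h.eq_smul ha hD hD0 (h₁.mono hDB) hp hq hp1⟩

end Extension

section Extension

variable {k0 f0 : ℂ → ℂ}

/-- The open half of a disc around `p` on one side of the line through `0` and `p`. -/
def halfDisc (p : ℂ) (r e : ℝ) : Set ℂ := ball p r ∩ {l | 0 < e * (l / p).im}

theorem convex_halfDisc (p : ℂ) (r e : ℝ) : Convex ℝ (halfDisc p r e) := by
  refine (convex_ball p r).inter ?_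
  have : IsLinearMap ℝ (fun l => e * (l / p).im) := ⟨fun x y => by rw [add_div, add_im, mul_add],
      fun c x => by rw [real_smul, mul_div_assoc, im_ofReal_mul, smul_eq_mul]; ring⟩
  exact convex_halfSpace_gt this 0

theorem isOpen_halfDisc (p : ℂ) (r e : ℝ) : IsOpen (halfDisc p r e) :=
  isOpen_ball.inter (isOpen_lt continuous_const
    (continuous_const.mul (continuous_im.comp (continuous_id.div_const p))))

theorem exists_mem_halfDisc (hp : p ≠ 0) {r e t ε : ℝ} (he : e ≠ 0) (hε : 0 < ε)
    (ht : ball ((t : ℂ) * p) ε ⊆ ball p r) :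
    (halfDisc p r e ∩ ball ((t : ℂ) * p) ε).Nonempty := by
  have hmem : t * p + ((ε / (2 * |e| * ‖p‖) * e : ℝ) : ℂ) * (I * p) ∈ ball (t * p) ε := by
    rw [mem_ball, dist_eq_norm, add_sub_cancel_left, norm_mul, norm_real,
      norm_mul I, norm_I, one_mul, Real.norm_eq_abs, abs_mul,
      abs_of_pos (show 0 < ε / (2 * |e| * ‖p‖) by positivity)]
    field_simp
    linarith
  refine ⟨_, ⟨ht hmem, ?_⟩, hmem⟩
  have e1 : (t * p + ((ε / (2 * |e| * ‖p‖) * e : ℝ) : ℂ) * (I * p)) / p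
      = t + ((ε / (2 * |e| * ‖p‖) * e : ℝ) : ℂ) * I := by field_simp
  simp only [mem_ofPred_eq]
  rw [e1, add_im, ofReal_im, zero_add, im_ofReal_mul, I_im, mul_one]
  have := mul_self_pos.2 he
  have : e * (ε / (2 * |e| * ‖p‖) * e) = (e * e) * (ε / (2 * |e| * ‖p‖)) := by ring
  rw [this]; positivity

theorem exists_pellPair_extension (ha : a ≠ 0) (ha0 : a.eval 0 ≠ 0)
    (hsimple : ∀ α, a.eval α = 0 → (derivative a).eval α ≠ 0)
    (h : IsPellPair a b (cutPlane a) k0 f0)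
    (hlim : ∀ α, a.eval α = 0 → Tendsto (fun l => f0 l ^ 2 * a.eval l) (𝓝[cutPlane a] α) (𝓝 0)) :
    ∃ k f, IsPellPair a b {0}ᶜ k f ∧ ∀ l ∈ cutPlane a, k l = k0 l ∧ f l = f0 l := by
  let T : Set ℂ := {p | ∃ O, IsOpen O ∧ p ∈ O ∧ O ⊆ {0}ᶜ ∧ ∃ k f, IsPellPair a b O k f ∧
      ∀ l ∈ O ∩ cutPlane a, k l = k0 l ∧ f l = f0 l}
  have hTopen : IsOpen T := by
    refine isOpen_iff_mem_nhds.2 fun p ⟨O, hO, hp, h0, hkf⟩ => ?_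
    filter_upwards [hO.mem_nhds hp] with w hw using ⟨O, hO, hw, h0, hkf⟩
  have hT0 : T ⊆ {0}ᶜ := fun p ⟨O, _, hp, h0, _⟩ => h0 hp
  have hcut : cutPlane a ⊆ T := fun p hp => ⟨cutPlane a, isOpen_cutPlane ha, hp,
    fun l hl => mem_cutPlane_ne_zero hl, k0, f0, h, fun l _ => ⟨rfl, rfl⟩⟩
  obtain ⟨k, f, hkf, hagree⟩ := IsPellPair.glue (k0 := k0) (f0 := f0) (a := a) (b := b)
    (D := cutPlane a) (T := T)
    (fun p hp => mem_closure_cutPlane ha ha0 (hT0 hp))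
    (fun p hp => by
      obtain ⟨O, hO, hpO, h0, k, f, hkf, hag⟩ := hp
      exact ⟨O, hO, hpO, fun w hw => ⟨O, hO, hw, h0, k, f, hkf, hag⟩, k, f, hkf, hag⟩)
  have step : ∀ p : ℂ, p ≠ 0 → (∀ ε > 0, ∃ t : ℝ, (t : ℂ) * p ∈ T ∩ ball p ε) → p ∈ T := by
    intro p hp hnear
    obtain ⟨r0, hr0, hball⟩ := Metric.eventually_nhds_iff_ball.1 (eventually_mem_cutPlane ha ha0 hp)
    have key : ∀ r ≤ r0, 0 < r → (∃ k2 f2, IsPellPair a b (ball p r) k2 f2 ∧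
        ∃ D, halfDisc p r 1 ⊆ D ∧ halfDisc p r (-1) ⊆ D ∧ D ⊆ T ∧
          ∀ l ∈ D, k l = k2 l ∧ f l = f2 l) → p ∈ T := by
      rintro r hrr hr ⟨k2, f2, h₂, D, hD1, hD2, hDT, heq⟩
      refine ⟨ball p r, isOpen_ball, mem_ball_self hr,
        fun l hl => (hball l (ball_subset_ball hrr hl)).1, k2, f2, h₂, ?_⟩
      have hO : IsOpen (ball p r ∩ cutPlane a) := isOpen_ball.inter (isOpen_cutPlane ha)
      have hD : ∀ l ∈ ball p r ∩ cutPlane a, (l / p).im ≠ 0 → k2 l = k0 l ∧ f2 l = f0 l := by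
        intro l hl him
        have hlD : l ∈ D := by
          rcases him.lt_or_gt with h | h
          · exact hD2 ⟨hl.1, by simpa using h⟩
          · exact hD1 ⟨hl.1, by simpa using h⟩
        have h1 := heq l hlD
        have h2 := hagree l ⟨hDT hlD, hl.2⟩
        exact ⟨h1.1.symm.trans h2.1, h1.2.symm.trans h2.2⟩
      intro l hl
      exact ⟨eqOn_of_eqOn_im_ne hO hp (h₂.diff_k.continuousOn.mono inter_subset_left)
          (h.diff_k.continuousOn.mono inter_subset_right) (fun l hl hi => (hD l hl hi).1) l hl,
        eqOn_of_eqOn_im_ne hO hp (h₂.diff_f.continuousOn.mono inter_subset_left)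
          (h.diff_f.continuousOn.mono inter_subset_right) (fun l hl hi => (hD l hl hi).2) l hl⟩
    have dom : ∀ r ≤ r0, 0 < r → ∃ D, IsOpen D ∧ IsPreconnected D ∧ D ⊆ ball p r ∧ D ⊆ T ∧
        halfDisc p r 1 ⊆ D ∧ halfDisc p r (-1) ⊆ D ∧ p ∈ closure (halfDisc p r 1) := by
      intro r hrr hr
      obtain ⟨t, htT, htr⟩ := hnear r hr
      obtain ⟨ε, hε, hsub⟩ := Metric.isOpen_iff.1 (hTopen.inter (isOpen_ball (x := p) (ε := r)))
        _ ⟨htT, htr⟩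
      have hb : ball ((t : ℂ) * p) ε ⊆ ball p r := fun l hl => (hsub hl).2
      have hhalf : ∀ e : ℝ, e ≠ 0 → halfDisc p r e ⊆ T := fun e he l hl =>
        hcut ((hball l (ball_subset_ball hrr hl.1)).2 fun h0 => by
          have := hl.2; simp only [mem_ofPred_eq] at this; rw [h0, mul_zero] at this
          exact lt_irrefl _ this)
      have c1 : IsPreconnected (halfDisc p r 1 ∪ ball ((t : ℂ) * p) ε) :=
        IsPreconnected.union' (exists_mem_halfDisc hp one_ne_zero hε hb)
          (convex_halfDisc p r 1).isPreconnected (convex_ball _ _).isPreconnected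
      have c2 : IsPreconnected ((halfDisc p r 1 ∪ ball ((t : ℂ) * p) ε) ∪ halfDisc p r (-1)) := by
        refine IsPreconnected.union' ?_ c1 (convex_halfDisc p r (-1)).isPreconnected
        obtain ⟨w, h1, h2⟩ := exists_mem_halfDisc hp (neg_ne_zero.2 (one_ne_zero (α := ℝ))) hε hb
        exact ⟨w, Or.inr h2, h1⟩
      refine ⟨_, ((isOpen_halfDisc p r 1).union isOpen_ball).union (isOpen_halfDisc p r (-1)), c2,
        union_subset (union_subset inter_subset_left hb) inter_subset_left,
        union_subset (union_subset (hhalf 1 one_ne_zero) fun l hl => (hsub hl).1)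
          (hhalf (-1) (neg_ne_zero.2 one_ne_zero)),
        subset_union_left.trans subset_union_left, subset_union_right, ?_⟩
      refine Metric.mem_closure_iff.2 fun ε' hε' => ?_
      have hmin : ball ((1 : ℝ) * p : ℂ) (min r ε') ⊆ ball p r := by
        rw [ofReal_one, one_mul]; exact ball_subset_ball (min_le_left _ _)
      obtain ⟨w, h1, h2⟩ := exists_mem_halfDisc hp (one_ne_zero (α := ℝ)) (lt_min hr hε') hmin
      refine ⟨w, h1, ?_⟩
      rw [ofReal_one, one_mul, mem_ball'] at h2
      exact h2.trans_le (min_le_right _ _)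
    by_cases hroot : a.eval p = 0
    · obtain ⟨r1, hr1, k1, f1, h₁⟩ := exists_pellPair_of_root (b := b) hp hroot (hsimple p hroot)
      have hr : 0 < min r0 r1 := lt_min hr0 hr1
      obtain ⟨D, hDo, hDc, hDB, hDT, hD1, hD2, hcl⟩ := dom _ (min_le_left r0 r1) hr
      have h₁' := h₁.mono (ball_subset_ball (min_le_right r0 r1))
      have hsubcut : halfDisc p (min r0 r1) 1 ⊆ cutPlane a := fun l hl =>
        (hball l (ball_subset_ball (min_le_left _ _) hl.1)).2 fun h0 => by
          have := hl.2; simp only [mem_ofPred_eq] at this; rw [h0, mul_zero] at this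
          exact lt_irrefl _ this
      have hl : Tendsto (fun l => f l ^ 2 * a.eval l) (𝓝[halfDisc p (min r0 r1) 1] p) (𝓝 0) := by
        refine ((hlim p hroot).mono_left (nhdsWithin_mono p hsubcut)).congr' ?_
        filter_upwards [self_mem_nhdsWithin] with l hl
        rw [(hagree l ⟨hDT (hD1 hl), hsubcut hl⟩).2]
      obtain ⟨q, hq, heq⟩ := (hkf.mono hDT).exists_eq_of_root hDo hDc hDB isOpen_ball
        (mem_ball_self hr) hp hroot ha (fun l hl => hT0 (hDT hl)) h₁' hD1 hcl hl
      refine key _ (min_le_left r0 r1) hr ⟨fun l => q * k1 l, fun l => q * f1 l, ?_, D, hD1, hD2,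
        hDT, heq⟩
      rcases sq_eq_sq_iff_eq_or_eq_neg.1 (hq.trans (one_pow 2).symm) with rfl | rfl
      · simpa using h₁'
      · simpa using h₁'.neg
    · obtain ⟨r1, hr1, s, H, hs, hsH⟩ := exists_log_of_ne_root (b := b) hp hroot
      have hr : 0 < min r0 r1 := lt_min hr0 hr1
      obtain ⟨D, hDo, hDc, hDB, hDT, hD1, hD2, hcl⟩ := dom _ (min_le_left r0 r1) hr
      have hsub : ball p (min r0 r1) ⊆ ball p r1 := ball_subset_ball (min_le_right r0 r1)
      obtain ⟨δ, hδ⟩ := (hkf.mono hDT).exists_eq_of_log hDo hDc hDB isOpen_ball (hs.mono hsub)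
        fun l hl => hsH l (hsub hl)
      exact key _ (min_le_left r0 r1) hr ⟨_, _, IsPellPair.of_log (H := fun l => H l + δ)
        isOpen_ball (hs.mono hsub)
        (fun l hl => (hsH l (hsub hl)).2.2.1) (fun l hl => (hsH l (hsub hl)).1)
        (fun l hl => (hsH l (hsub hl)).2.1) (fun l hl => (hsH l (hsub hl)).2.2.2.add_const δ),
        D, hD1, hD2, hDT, hδ⟩
  have hall : ∀ q : ℂ, q ≠ 0 → q ∈ T := by
    intro q hq
    let u : Set ℝ := {r | 0 < r ∧ (r : ℂ) * q ∈ T}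
    have hu : IsOpen u := by
      have : u = Ioi 0 ∩ (fun r : ℝ => (r : ℂ) * q) ⁻¹' T := rfl
      rw [this]
      exact isOpen_Ioi.inter (hTopen.preimage (by fun_prop))
    have hsub := (isPreconnected_Ioi (a := (0 : ℝ))).subset_of_closure_inter_subset hu (by
        obtain ⟨r, hr, hmem⟩ := exists_mul_mem_cutPlane ha hq
        exact ⟨r, hr, hr, hcut hmem⟩)
      (by
        rintro r ⟨hrcl, hr⟩
        have hr' : (0 : ℝ) < r := hr
        refine ⟨hr', step _ (mul_ne_zero (by exact_mod_cast hr'.ne') hq) fun ε hε => ?_⟩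
        have hq' : 0 < ‖q‖ := norm_pos_iff.2 hq
        obtain ⟨r1, hr1, hd⟩ := Metric.mem_closure_iff.1 hrcl (ε / ‖q‖) (div_pos hε hq')
        have e : ((r1 / r : ℝ) : ℂ) * ((r : ℂ) * q) = r1 * q := by
          have : (r : ℂ) ≠ 0 := by exact_mod_cast hr'.ne'
          push_cast; field_simp
        refine ⟨r1 / r, ?_⟩
        rw [e]
        refine ⟨hr1.2, ?_⟩
        rw [mem_ball, dist_eq_norm, ← sub_mul, norm_mul, ← ofReal_sub, norm_real,
          Real.norm_eq_abs, abs_sub_comm]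
        rw [Real.dist_eq, lt_div_iff₀ hq'] at hd
        exact hd)
    have := hsub (show (1 : ℝ) ∈ Ioi 0 from zero_lt_one (α := ℝ))
    simpa [u] using this.2
  have hTeq : T = {0}ᶜ := Subset.antisymm hT0 fun q hq => hall q hq
  rw [hTeq] at hkf hagree
  exact ⟨k, f, hkf, fun l hl => hagree l ⟨mem_cutPlane_ne_zero hl, hl⟩⟩

end Extension

section LogMu

variable {h : ℂ × ℂ → ℂ}

/-- A (discontinuous) branch of `ν`. -/
def nuBranch (a : ℂ[X]) (l : ℂ) : ℂ := (a.eval l / l) ^ (((2 : ℕ) : ℂ)⁻¹)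

theorem nuBranch_sq (a : ℂ[X]) (l : ℂ) : nuBranch a l ^ 2 = a.eval l / l :=
  cpow_nat_inv_pow _ two_ne_zero

theorem nuBranch_mem {l : ℂ} (hl : l ∈ cutPlane a) : (l, nuBranch a l) ∈ cutCurve a := by
  refine ⟨hl, ?_⟩
  rw [nuBranch_sq, div_mul_cancel₀ _ hl.1]

theorem cutCurve_snd_ne {l ν : ℂ} (hl : (l, ν) ∈ cutCurve a) : ν ≠ 0 := by
  rintro rfl
  have := hl.2
  simp at this
  exact mem_cutPlane_eval_ne hl.1 this.symm

theorem cutCurve_eq_or_neg {l ν ν' : ℂ} (h1 : (l, ν) ∈ cutCurve a) (h2 : (l, ν') ∈ cutCurve a) :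
    ν = ν' ∨ ν = -ν' := by
  have h0 := h1.1.1
  have e1 := h1.2
  have e2 := h2.2
  grind

/-- The even part `cosh h` of `exp h`. -/
def logCosh (a : ℂ[X]) (h : ℂ × ℂ → ℂ) (l : ℂ) : ℂ := cosh (h (l, nuBranch a l))

/-- The quotient `sinh h / ν`. -/
def logSinh (a : ℂ[X]) (h : ℂ × ℂ → ℂ) (l : ℂ) : ℂ := sinh (h (l, nuBranch a l)) / nuBranch a l

theorem IsLogMu.logCosh_eq (hh : IsLogMu a b h) {l ν : ℂ} (hl : (l, ν) ∈ cutCurve a) :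
    logCosh a h l = cosh (h (l, ν)) := by
  rcases cutCurve_eq_or_neg (nuBranch_mem hl.1) hl with e | e
  · rw [logCosh, e]
  · rw [logCosh, e, hh.1 l ν hl, cosh_neg]

theorem IsLogMu.logSinh_eq (hh : IsLogMu a b h) {l ν : ℂ} (hl : (l, ν) ∈ cutCurve a) :
    logSinh a h l = sinh (h (l, ν)) / ν := by
  rcases cutCurve_eq_or_neg (nuBranch_mem hl.1) hl with e | e
  · rw [logSinh, e]
  · rw [logSinh, e, hh.1 l ν hl, sinh_neg, neg_div_neg_eq]

theorem IsLogMu.isPellPair (ha : a ≠ 0) (hh : IsLogMu a b h) :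
    IsPellPair a b (cutPlane a) (logCosh a h) (logSinh a h) := by
  refine IsPellPair.of_nhds fun p hp => ?_
  obtain ⟨r, hr, s, _, hs, hsq⟩ :=
    exists_log_of_ne_root (b := b) (mem_cutPlane_ne_zero hp) (mem_cutPlane_eval_ne hp)
  have hO : IsOpen (ball p r ∩ cutPlane a) := isOpen_ball.inter (isOpen_cutPlane ha)
  have hs' := hs.mono (inter_subset_left (t := cutPlane a))
  have hmem : ∀ l ∈ ball p r ∩ cutPlane a, (l, s l) ∈ cutCurve a :=
    fun l hl => ⟨hl.2, (hsq l hl.1).2.2.1⟩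
  refine ⟨ball p r ∩ cutPlane a, hO, ⟨mem_ball_self hr, hp⟩, _, _,
    IsPellPair.of_log hO hs' (fun l hl => (hsq l hl.1).2.2.1)
      (fun l hl => (hsq l hl.1).1) (fun l hl => (hsq l hl.1).2.1)
      (hh.2 _ s hO inter_subset_right hs' fun l hl => (hsq l hl.1).2.2.1),
    fun l hl => hh.logCosh_eq (hmem l hl), fun l hl => hh.logSinh_eq (hmem l hl)⟩

theorem sinh_sub_int_mul_pi_I (z : ℂ) (n : ℤ) :
    ‖sinh (z - n * (I * (Real.pi : ℂ)))‖ = ‖sinh z‖ := by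
  have e1 : sinh (n * (I * (Real.pi : ℂ))) = 0 := by
    have : n * (I * (Real.pi : ℂ)) = (n * (Real.pi : ℂ)) * I := by ring
    rw [this, sinh_mul_I, sin_int_mul_pi, zero_mul]
  have e2 : ‖cosh (n * (I * (Real.pi : ℂ)))‖ = 1 := by
    have h1 := cosh_sq_sub_sinh_sq (n * (I * (Real.pi : ℂ)))
    rw [e1] at h1
    have h2 : ‖cosh (n * (I * (Real.pi : ℂ)))‖ ^ 2 = 1 := by
      rw [← norm_pow, show cosh (n * (I * (Real.pi : ℂ))) ^ 2 = 1 by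
        linear_combination h1, norm_one]
    exact (pow_eq_one_iff_of_nonneg (norm_nonneg _) two_ne_zero).1 h2
  rw [sinh_sub, e1, mul_zero, sub_zero, norm_mul, e2, mul_one]

theorem tendsto_logSinh_of_takesValues (hα : TakesValuesInIPiZAt a h α) :
    Tendsto (fun l => logSinh a h l ^ 2 * a.eval l) (𝓝[cutPlane a] α) (𝓝 0) := by
  have hsec : Tendsto (fun l => (l, nuBranch a l)) (𝓝[cutPlane a] α)
      (comap Prod.fst (𝓝 α) ⊓ 𝓟 (cutCurve a)) := by
    refine tendsto_inf.2 ⟨tendsto_comap_iff.2 ?_, tendsto_principal.2 ?_⟩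
    · exact tendsto_id.mono_left nhdsWithin_le_nhds
    · filter_upwards [self_mem_nhdsWithin] with l hl using nuBranch_mem hl
  have h1 : Tendsto (fun l => infDist (h (l, nuBranch a l)) iPiZ) (𝓝[cutPlane a] α) (𝓝 0) :=
    hα.comp hsec
  have h2 : Tendsto (fun l => ‖sinh (h (l, nuBranch a l))‖) (𝓝[cutPlane a] α) (𝓝 0) := by
    rw [Metric.tendsto_nhds]
    intro ε hε
    have hc : ContinuousAt sinh 0 := continuous_sinh.continuousAt
    obtain ⟨δ, hδ, hd⟩ := Metric.continuousAt_iff.1 hc ε hε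
    filter_upwards [(Metric.tendsto_nhds.1 h1) δ hδ] with l hl
    have hne : iPiZ.Nonempty := ⟨_, ⟨0, rfl⟩⟩
    rw [Real.dist_eq, sub_zero, abs_of_nonneg infDist_nonneg, infDist_lt_iff hne] at hl
    obtain ⟨_, ⟨n, rfl⟩, hn⟩ := hl
    have := hd (x := h (l, nuBranch a l) - n * (I * (Real.pi : ℂ)))
      (by rw [dist_zero_right, ← dist_eq_norm]; exact hn)
    rw [sinh_zero, dist_zero_right, sinh_sub_int_mul_pi_I] at this
    rw [dist_zero_right, norm_norm]
    exact this
  have h3 : Tendsto (fun l => sinh (h (l, nuBranch a l)) ^ 2 * l) (𝓝[cutPlane a] α) (𝓝 0) := by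
    have := ((tendsto_zero_iff_norm_tendsto_zero.2 h2).pow 2).mul
      (tendsto_id |>.mono_left (nhdsWithin_le_nhds))
    simpa using this
  refine h3.congr' ?_
  filter_upwards [self_mem_nhdsWithin] with l hl
  have hn := cutCurve_snd_ne (nuBranch_mem hl)
  have e := (nuBranch_mem hl).2.symm
  rw [logSinh, e]
  field_simp

end LogMu

section PellData

/-- Spectral data with simple roots of `a`, in terms of Pell pairs on the punctured plane. -/
structure HasPellData (x : RealPair g) : Prop where
  normalized : ‖(aPoly x).eval 0‖ = 1 / 16
  simple : ∀ α, (aPoly x).eval α = 0 → (derivative (aPoly x)).eval α ≠ 0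
  neg : ∀ l : ℂ, ‖l‖ = 1 → ∃ r : ℝ, r < 0 ∧ (aPoly x).eval l / l ^ g = r
  b_zero : ∃ r : ℝ, r < 0 ∧ (bPoly x).eval 0 ^ 2 / (aPoly x).eval 0 = r
  pell : ∃ k f : ℂ → ℂ, IsPellPair (aPoly x) (bPoly x) {0}ᶜ k f ∧ f 1 = 0

theorem two_le_rootMultiplicity (ha : a ≠ 0) (h : a.eval α = 0)
    (h' : (derivative a).eval α = 0) : 2 ≤ a.rootMultiplicity α :=
  (one_lt_rootMultiplicity_iff_isRoot ha).2 ⟨h, h'⟩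

theorem IsSpectralData.simple (hx : IsRegular x) (hs : IsSpectralData x)
    (hα : (aPoly x).eval α = 0) : (derivative (aPoly x)).eval α ≠ 0 := by
  intro hα'
  obtain ⟨h, hh, -, hmul⟩ := hs.closing
  obtain ⟨f, k, hf, hk, he⟩ := hmul ⟨α, two_le_rootMultiplicity hx.a_ne hα hα'⟩
  have hα0 : α ≠ 0 := by rintro rfl; exact hx.a_zero_ne hα
  have hO : IsOpen ({0}ᶜ : Set ℂ) := isOpen_compl_singleton
  have hcut : ∀ l ∈ cutPlane (aPoly x), k l = logCosh (aPoly x) h l ∧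
      f l = logSinh (aPoly x) h l := by
    intro l hl
    have hm := nuBranch_mem hl
    have hm' : (l, -nuBranch (aPoly x) l) ∈ cutCurve (aPoly x) :=
      ⟨hl, by have := hm.2; simpa using this⟩
    have e1 := he l _ hm
    have e2 := he l _ hm'
    rw [hh.1 l _ hm] at e2
    have hn := cutCurve_snd_ne hm
    constructor
    · rw [logCosh, cosh, e1, e2]; ring
    · rw [logSinh, sinh, e1, e2]; field_simp; ring
  have hp := (hh.isPellPair hx.a_ne).congr (isOpen_cutPlane hx.a_ne) (fun l hl => (hcut l hl).1)
      (fun l hl => (hcut l hl).2)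
  have hlim : ∀ {u : ℂ → ℂ}, ContinuousOn u {0}ᶜ → (∀ l ∈ cutPlane (aPoly x), u l = 0) →
      u α = 0 := by
    intro u hu h0
    have hne : (𝓝[cutPlane (aPoly x)] α).NeBot :=
      mem_closure_iff_nhdsWithin_neBot.1 (mem_closure_cutPlane hx.a_ne hx.a_zero_ne hα0)
    refine tendsto_nhds_unique_of_eventuallyEq
      ((hu.continuousAt (hO.mem_nhds hα0)).tendsto.mono_left nhdsWithin_le_nhds)
      (tendsto_const_nhds (x := (0 : ℂ)) (f := 𝓝[cutPlane (aPoly x)] α)) ?_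
    filter_upwards [self_mem_nhdsWithin] with l hl using h0 l hl
  have hkc := hk.continuousOn
  have hfc := hf.continuousOn
  have hfc' := (hf.deriv hO).continuousOn
  have e1 := hlim (by fun_prop) fun l hl => sub_eq_zero.2 (hp.pell l hl)
  have e2 := hlim (u := fun l => 2 * l * (aPoly x).eval l * deriv f l - (2 * k l * (bPoly x).eval l -
      f l * (l * (derivative (aPoly x)).eval l - (aPoly x).eval l))) (by fun_prop)
      fun l hl => sub_eq_zero.2 (hp.deriv_f l hl)
  rw [hα, hα'] at e2
  rw [hα] at e1
  have hb : (bPoly x).eval α ≠ 0 := fun hb => hx.coprime α ⟨hα, hb⟩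
  grind

theorem eval_ne_zero_of_nonpos (hs : ∀ α, a.eval α = 0 → (derivative a).eval α ≠ 0)
    (hn : ∀ l : ℂ, ‖l‖ = 1 → ∃ r : ℝ, r ≤ 0 ∧ a.eval l / l ^ g = r) (hl : ‖l‖ = 1) :
    a.eval l ≠ 0 := by
  intro h0
  have hl0 : l ≠ 0 := by rintro rfl; simp at hl
  let e : ℝ → ℂ := fun t => l * exp (t * I)
  have he : ∀ t, ‖e t‖ = 1 := fun t => by
    simp only [e]; rw [norm_mul, hl, norm_exp_ofReal_mul_I, mul_one]
  have hde : HasDerivAt e (l * I) 0 := by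
    have h1 : HasDerivAt (fun z => l * exp (z * I)) (l * I) 0 := by
      refine ((((hasDerivAt_id _).mul_const I).cexp).const_mul l).congr_deriv ?_
      simp
    exact h1.comp_ofReal
  have he0 : e 0 = l := by simp [e]
  have hu : HasDerivAt (fun t => a.eval (e t) / e t ^ g)
      ((derivative a).eval l * (l * I) / l ^ g) 0 := by
    have h1 : HasDerivAt (fun w => a.eval w / w ^ g) ((derivative a).eval l / l ^ g) (e 0) := by
      rw [he0]
      refine ((a.hasDerivAt l).div (hasDerivAt_pow g l) (pow_ne_zero g hl0)).congr_deriv ?_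
      rw [h0]
      field_simp
      ring
    have := h1.comp 0 hde
    refine this.congr_deriv ?_
    ring
  have hre := reCLM.hasFDerivAt.comp_hasDerivAt 0 hu
  have him : HasDerivAt (fun t => (a.eval (e t) / e t ^ g).im)
      ((derivative a).eval l * (l * I) / l ^ g).im 0 :=
    imCLM.hasFDerivAt.comp_hasDerivAt 0 hu
  have hmax : IsLocalMax (fun t => (a.eval (e t) / e t ^ g).re) 0 := by
    refine Eventually.of_forall fun t => ?_
    simp only
    rw [he0, h0, zero_div, zero_re]
    obtain ⟨r, hr, h1⟩ := hn (e t) (he t)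
    rw [h1, ofReal_re]; exact hr
  have r0 := hmax.hasDerivAt_eq_zero hre
  have i0 : ((derivative a).eval l * (l * I) / l ^ g).im = 0 := by
    have : (fun t => (a.eval (e t) / e t ^ g).im) = fun _ => 0 := by
      funext t
      obtain ⟨r, hr, h1⟩ := hn (e t) (he t)
      rw [h1, ofReal_im]
    rw [this] at him
    exact him.unique (hasDerivAt_const _ _)
  have hz : (derivative a).eval l * (l * I) / l ^ g = 0 := ext r0 i0
  have := hs l h0
  rw [div_eq_zero_iff] at hz
  rcases hz with h | h
  · exact (mul_ne_zero this (mul_ne_zero hl0 I_ne_zero)) h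
  · exact pow_ne_zero g hl0 h

theorem IsSpectralData.hasPellData (hx : IsRegular x) (hs : IsSpectralData x) : HasPellData x := by
  have hsimple : ∀ α, (aPoly x).eval α = 0 → (derivative (aPoly x)).eval α ≠ 0 :=
    fun α hα => hs.simple hx hα
  refine ⟨hs.normalized, hsimple, fun l hl => ?_, ?_, ?_⟩
  · obtain ⟨r, hr, h1⟩ := hs.nonpos l hl
    refine ⟨r, lt_of_le_of_ne hr ?_, h1⟩
    rintro rfl
    have hl0 : l ≠ 0 := by rintro rfl; simp at hl
    rw [ofReal_zero, div_eq_zero_iff] at h1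
    exact h1.elim (eval_ne_zero_of_nonpos hsimple hs.nonpos hl) (pow_ne_zero g hl0)
  · obtain ⟨Θ, r, h1, h2⟩ := hs.b_zero
    have hr : r ≠ 0 := by
      rintro rfl
      apply hs.b_zero_ne
      rw [h2]; simp
    refine ⟨-16 * r ^ 2, by have : 0 < r ^ 2 := by positivity
                            linarith, ?_⟩
    rw [h1, h2, mul_pow, ← exp_nat_mul]
    have : ((2 : ℕ) : ℂ) * (Θ / 2 * I) = Θ * I := by push_cast; ring
    push_cast
    field_simp
  · obtain ⟨h, hh, htv, -⟩ := hs.closing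
    have hp := hh.isPellPair hx.a_ne
    obtain ⟨k, f, hkf, hag⟩ := exists_pellPair_extension hx.a_ne hx.a_zero_ne hsimple hp
      fun α hα => tendsto_logSinh_of_takesValues (htv α (by simp [hα]))
    refine ⟨k, f, hkf, ?_⟩
    have h1 := tendsto_logSinh_of_takesValues (htv 1 (by simp))
    have hne := mem_closure_iff_nhdsWithin_neBot.1 (mem_closure_cutPlane hx.a_ne hx.a_zero_ne one_ne_zero)
    have h2 : Tendsto (fun l => f l ^ 2 * (aPoly x).eval l) (𝓝[cutPlane (aPoly x)] 1)
        (𝓝 (f 1 ^ 2 * (aPoly x).eval 1)) := by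
      have hc := hkf.diff_f.continuousOn.continuousAt (isOpen_compl_singleton.mem_nhds one_ne_zero)
      exact ((hc.pow 2).mul (aPoly x).continuous.continuousAt).tendsto.mono_left nhdsWithin_le_nhds
    have h3 : f 1 ^ 2 * (aPoly x).eval 1 = 0 := by
      refine tendsto_nhds_unique h2 (h1.congr' ?_)
      filter_upwards [self_mem_nhdsWithin] with l hl
      rw [(hag l hl).2]
    have ha1 : (aPoly x).eval 1 ≠ 0 := eval_ne_zero_of_nonpos hsimple hs.nonpos (by simp)
    exact pow_eq_zero_iff two_ne_zero |>.1 ((mul_eq_zero.1 h3).resolve_right ha1)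

end PellData

section Tools

theorem isPreconnected_of_radial {S : Set ℂ} {ε : ℝ} (hε : 0 < ε) (hsph : sphere p ε ⊆ S)
    (hp : p ∉ S)
    (hrad : ∀ y ∈ S, ∀ t : ℝ, t ∈ uIcc 1 (ε / ‖y - p‖) → p + t * (y - p) ∈ S) :
    IsPreconnected S := by
  have hrank : 1 < Module.rank ℝ ℂ := by rw [rank_real_complex]; norm_num
  have hx : p + ε ∈ sphere p ε := by simp [abs_of_pos hε]
  refine isPreconnected_of_forall (p + ε : ℂ) fun y hy => ?_
  have hy0 : 0 < ‖y - p‖ := norm_pos_iff.2 (sub_ne_zero.2 fun h => hp (h ▸ hy))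
  have hc : IsPreconnected ((fun t : ℝ => p + t * (y - p)) '' uIcc 1 (ε / ‖y - p‖)) :=
    isPreconnected_uIcc.image _ (by fun_prop)
  refine ⟨sphere p ε ∪ (fun t : ℝ => p + t * (y - p)) '' uIcc 1 (ε / ‖y - p‖), ?_, Or.inl hx,
    Or.inr ⟨1, left_mem_uIcc, by simp⟩, ?_⟩
  · refine union_subset hsph ?_
    grind
  · refine IsPreconnected.union' ?_ (isPreconnected_sphere hrank p ε) hc
    refine ⟨_, ?_, ⟨ε / ‖y - p‖, right_mem_uIcc, rfl⟩⟩
    simp_all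

theorem isPreconnected_diff_zero {U : Set ℂ} (hU : IsOpen U) (h0 : (0 : ℂ) ∈ U)
    (hs : StarConvex ℝ 0 U) : IsPreconnected (U \ {0}) := by
  obtain ⟨ε, hε, hball⟩ := Metric.isOpen_iff.1 hU 0 h0
  have hhalf := half_pos hε
  refine isPreconnected_of_radial hhalf ?_ (fun h => h.2 rfl) ?_
  · intro l hl
    rw [mem_sphere_zero_iff_norm] at hl
    refine ⟨hball (by rw [mem_ball_zero_iff]; linarith), ?_⟩
    rintro rfl
    rw [norm_zero] at hl; linarith
  · rintro y ⟨hyU, hy0⟩ t ht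
    have hy := norm_pos_iff.2 hy0
    rw [sub_zero] at ht ⊢
    rw [zero_add]
    have hmin : 0 < min 1 (ε / 2 / ‖y‖) := lt_min one_pos (by positivity)
    have ht0 := hmin.trans_le ht.1
    refine ⟨?_, mul_ne_zero (by exact_mod_cast ht0.ne') hy0⟩
    rcases le_or_gt t 1 with h | h
    · simpa using hs.smul_mem hyU ht0.le h
    · have h2 := (le_max_iff.1 ht.2).resolve_left (not_le.2 h)
      refine hball ?_
      rw [mem_ball_zero_iff, norm_mul, norm_real, Real.norm_eq_abs, abs_of_pos ht0]
      rw [le_div_iff₀ hy] at h2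
      linarith

theorem eq_zero_of_sq_eq_on_sphere {ε : ℝ} (hε : 0 < ε) {R : ℂ → ℂ} {c : ℂ}
    (hR : ContinuousOn R (sphere p ε)) (hsq : ∀ l ∈ sphere p ε, R l ^ 2 = c * (l - p)) :
    c = 0 := by
  by_contra hc
  let e : ℝ → ℂ := fun t => p + ε * exp (t * I)
  have hmem : ∀ t, e t ∈ sphere p ε := by
    intro t
    rw [mem_sphere, dist_eq_norm, add_sub_cancel_left, norm_mul, norm_real,
      norm_exp_ofReal_mul_I, mul_one, Real.norm_eq_abs, abs_of_pos hε]
  have he : Continuous e := by fun_prop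
  let y : ℝ → ℂ := fun t => R (e t) * exp (-(t / 2 * I))
  have hy : Continuous y := by
    refine Continuous.mul ?_ (by fun_prop)
    exact hR.comp_continuous he hmem
  have hysq : ∀ t, y t ^ 2 = c * ε := by
    intro t
    rw [mul_pow, hsq _ (hmem t), ← exp_nat_mul]
    have : exp (t * I) * exp (((2 : ℕ) : ℂ) * -(t / 2 * I)) = 1 := by
      rw [← exp_add, ← exp_zero]; congr 1; push_cast; ring
    linear_combination c * ε * this
  have hne : c * ε ≠ 0 := mul_ne_zero hc (by exact_mod_cast hε.ne')
  have hy0 : ∀ t, y t ≠ 0 := by grind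
  have hconst : ∀ t, y t = y 0 := by
    have := isPreconnected_univ.eq_of_sq_eq hy.continuousOn
      continuousOn_const (fun t _ => by simp [hysq]) (fun _ => hy0 0) (mem_univ 0) rfl
    exact fun t => this (mem_univ t)
  have h1 := hconst (2 * Real.pi)
  have h2 : y (2 * Real.pi) = -y 0 := by
    simp only [y, e]
    simp
  rw [h2] at h1
  exact hy0 0 (self_eq_neg.1 h1.symm)

theorem hasDerivAt_of_sq {𝕜 : Type*} [RCLike 𝕜] [NormedSpace 𝕜 ℂ] {s : 𝕜 → ℂ} {x : 𝕜} {d : ℂ}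
    (hs : ContinuousAt s x) (hd : HasDerivAt (fun w => s w ^ 2) d x) (h0 : s x ≠ 0)
    [IsScalarTower 𝕜 ℂ ℂ] [SMulCommClass 𝕜 ℂ ℂ] :
    HasDerivAt s (d / (2 * s x)) x := by
  rw [hasDerivAt_iff_tendsto_slope] at hd ⊢
  have h2 : Tendsto (fun w => s w + s x) (𝓝[≠] x) (𝓝 (s x + s x)) :=
    (hs.tendsto.add tendsto_const_nhds).mono_left nhdsWithin_le_nhds
  have hne : s x + s x ≠ 0 := by rw [← two_mul]; exact mul_ne_zero two_ne_zero h0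
  have h3 := hd.div h2 hne
  rw [← two_mul] at h3
  refine h3.congr' ?_
  filter_upwards [h2.eventually_ne hne] with w h4
  simp only [slope, vsub_eq_sub, Pi.div_apply]
  rw [show s w ^ 2 - s x ^ 2 = (s w - s x) * (s w + s x) by ring, ← smul_mul_assoc,
    mul_div_cancel_right₀ _ h4]

theorem hasDerivAt_of_exp {H : ℂ → ℂ} {x d : ℂ} (hH : ContinuousAt H x)
    (hd : HasDerivAt (fun w => exp (H w)) d x) :
    HasDerivAt H (d / exp (H x)) x := by
  have h1 : HasDerivAt (fun w => exp (H w) / exp (H x)) (d / exp (H x)) x := hd.div_const _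
  have hone : exp (H x) / exp (H x) = 1 := div_self (exp_ne_zero _)
  have h2 : HasDerivAt (fun w => H x + log (exp (H w) / exp (H x))) (d / exp (H x)) x := by
    have := (h1.clog (by rw [hone]; exact one_mem_slitPlane)).const_add (H x)
    rwa [hone, div_one] at this
  refine h2.congr_of_eventuallyEq ?_
  have hn : ∀ᶠ w in 𝓝 x, ‖H w - H x‖ < 1 := by
    have : Tendsto (fun w => ‖H w - H x‖) (𝓝 x) (𝓝 0) := by
      have := (hH.tendsto.sub (tendsto_const_nhds (x := H x))).norm
      simpa using this
    exact this.eventually (gt_mem_nhds one_pos)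
  filter_upwards [hn] with w hw
  have him := abs_lt.1 ((abs_im_le_norm (H w - H x)).trans_lt hw)
  rw [← exp_sub, log_exp (by linarith [Real.pi_gt_three])
    (by linarith [Real.pi_gt_three]), add_sub_cancel]

theorem infDist_iPiZ_le (z : ℂ) : infDist z iPiZ ≤ 3 * ‖sinh z‖ := by
  set n : ℤ := round (z.im / Real.pi)
  have hpi := Real.pi_pos
  have hbd : |z.im - n * Real.pi| ≤ Real.pi / 2 := by
    have h1 := abs_sub_round (z.im / Real.pi)
    have e : z.im - n * Real.pi = (z.im / Real.pi - n) * Real.pi := by field_simp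
    rw [e, abs_mul, abs_of_pos hpi]
    nlinarith
  have hmem : n * (I * (Real.pi : ℂ)) ∈ iPiZ := ⟨n, rfl⟩
  refine (infDist_le_dist_of_mem hmem).trans ?_
  rw [← sinh_sub_int_mul_pi_I z n, dist_eq_norm]
  set w := z - n * (I * (Real.pi : ℂ)) with hw
  have hwim : w.im = z.im - n * Real.pi := by simp [hw]
  rw [← hwim] at hbd
  have hsin := Real.mul_abs_le_abs_sin hbd
  have hsinh : |w.re| ≤ |Real.sinh w.re| := by
    rw [Real.abs_sinh]
    exact Real.self_le_sinh_iff.2 (abs_nonneg _)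
  have hsq : ‖sinh w‖ ^ 2 = Real.sinh w.re ^ 2 + Real.sin w.im ^ 2 := by
    rw [← normSq_eq_norm_sq, normSq_apply]
    have e : sinh w = (Real.sinh w.re * Real.cos w.im : ℝ)
        + (Real.cosh w.re * Real.sin w.im : ℝ) * I := by
      conv_lhs => rw [← re_add_im w]
      rw [sinh_add, cosh_mul_I, sinh_mul_I]
      push_cast
      ring
    have e1 : (sinh w).re = Real.sinh w.re * Real.cos w.im := by
      rw [e, add_re, ofReal_re, re_ofReal_mul, I_re]; ring
    have e2 : (sinh w).im = Real.cosh w.re * Real.sin w.im := by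
      rw [e, add_im, ofReal_im, im_ofReal_mul, I_im]; ring
    rw [e1, e2]
    have h1 := Real.cosh_sq w.re
    have h2 := Real.sin_sq_add_cos_sq w.im
    linear_combination Real.sin w.im ^ 2 * h1 + Real.sinh w.re ^ 2 * h2
  have hA : |Real.sinh w.re| ≤ ‖sinh w‖ :=
    abs_le_of_sq_le_sq (by nlinarith [sq_nonneg (Real.sin w.im)]) (norm_nonneg _)
  have hB : |Real.sin w.im| ≤ ‖sinh w‖ :=
    abs_le_of_sq_le_sq (by nlinarith [sq_nonneg (Real.sinh w.re)]) (norm_nonneg _)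
  have hC : |w.im| ≤ 2 * ‖sinh w‖ := by
    have h1 := hsin.trans hB
    have h2 : |w.im| ≤ Real.pi / 2 * ‖sinh w‖ := by
      have := mul_le_mul_of_nonneg_left h1 (by positivity : 0 ≤ Real.pi / 2)
      have e : Real.pi / 2 * (2 / Real.pi * |w.im|) = |w.im| := by field_simp
      rwa [e] at this
    nlinarith [Real.pi_le_four, norm_nonneg (sinh w)]
  have := norm_le_abs_re_add_abs_im w
  linarith [hsinh.trans hA]

end Tools

section Reflection

theorem hasDerivAt_conj_comp_reflect {u : ℂ → ℂ} {l d : ℂ} (hl : l ≠ 0)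
    (hu : HasDerivAt u d (conj l)⁻¹) :
    HasDerivAt (fun w => conj (u (conj w)⁻¹)) (-(conj d) / l ^ 2) l := by
  have e : (conj l)⁻¹ = conj l⁻¹ := (map_inv₀ _ _).symm
  rw [e] at hu
  have h1 : HasDerivAt (conj ∘ u ∘ conj) (conj d) l⁻¹ := by
    have := hu.conj_conj
    rwa [conj_conj] at this
  have h2 := h1.comp l (hasDerivAt_inv hl)
  refine (h2.congr_of_eventuallyEq ?_).congr_deriv ?_
  · exact Eventually.of_forall fun w => by simp
  · field_simp

theorem IsPellPair.reflect {k f : ℂ → ℂ} (h : IsPellPair (aPoly x) (bPoly x) {0}ᶜ k f) :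
    IsPellPair (aPoly x) (bPoly x) {0}ᶜ (fun l => conj (k (conj l)⁻¹))
      (fun l => l / l ^ g * conj (f (conj l)⁻¹)) := by
  have hO : IsOpen ({0}ᶜ : Set ℂ) := isOpen_compl_singleton
  have hmem : ∀ l, l ≠ 0 → (conj l)⁻¹ ∈ ({0}ᶜ : Set ℂ) := by intro l hl; simpa using hl
  have dk := fun l hl => hasDerivAt_conj_comp_reflect hl
      (h.diff_k.differentiableAt (hO.mem_nhds (hmem l hl))).hasDerivAt
  have df : ∀ l, l ≠ 0 → HasDerivAt (fun l => l / l ^ g * conj (f (conj l)⁻¹))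
      ((1 * l ^ g - l * (g * l ^ (g - 1))) / (l ^ g) ^ 2 * conj (f (conj l)⁻¹)
        + l / l ^ g * (-(conj (deriv f (conj l)⁻¹)) / l ^ 2)) l := fun l hl =>
    (((hasDerivAt_id l).div (hasDerivAt_pow g l) (pow_ne_zero g hl))).mul
      (hasDerivAt_conj_comp_reflect hl
        (h.diff_f.differentiableAt (hO.mem_nhds (hmem l hl))).hasDerivAt)
  have hA : ∀ l, l ≠ 0 → (aPoly x).eval l = l ^ (2 * g) * conj ((aPoly x).eval (conj l)⁻¹) :=
    fun l hl => aPoly_reflect x hl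
  refine ⟨fun l hl => (dk l hl).differentiableAt.differentiableWithinAt,
    fun l hl => (df l hl).differentiableAt.differentiableWithinAt, ?_, ?_, ?_⟩
  · intro l hl
    have hl0 : l ≠ 0 := hl
    have e := congrArg conj (h.pell _ (hmem l hl))
    simp at e
    rw [hA l hl]
    rw [pow_mul']
    field_simp
    field_simp at e
    linear_combination e
  · intro l hl
    have hl0 : l ≠ 0 := hl
    have e := congrArg conj (h.deriv_k _ (hmem l hl))
    simp at e
    rw [(dk l hl).deriv, bPoly_reflect x hl0, pow_succ]
    field_simp
    field_simp at e
    linear_combination -(l ^ g) * e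
  · intro l hl
    have hl0 : l ≠ 0 := hl
    have e := congrArg conj (h.deriv_f _ (hmem l hl))
    simp at e
    rw [show conj (2 : ℂ) = 2 from conj_ofNat 2] at e
    have e' := deriv_reflect hA hl
    have hg : g * l ^ (g - 1) * l = g * l ^ g := by
      rcases g with _ | m
      · simp
      · rw [Nat.add_sub_cancel, pow_succ]; ring
    rw [(df l hl).deriv, show l * (g * l ^ (g - 1)) = g * l ^ g by rw [← hg]; ring]
    rw [bPoly_reflect x hl0]
    have hA' := hA l hl
    push_cast at e'
    rw [pow_mul'] at hA' e'
    have hp := pow_ne_zero g hl0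
    set P := l ^ g
    set A := (aPoly x).eval l
    set A' := (derivative (aPoly x)).eval l
    set As := conj ((aPoly x).eval (conj l)⁻¹)
    set A's := conj ((derivative (aPoly x)).eval (conj l)⁻¹)
    have e2 : A's = l * (2 * g * A - l * A') / P ^ 2 := by rw [← e']; field_simp
    rw [e2] at e
    have e3 : As = A / P ^ 2 := by rw [hA']; field_simp
    rw [e3] at e
    field_simp at e ⊢
    linear_combination -e

end Reflection

section NearStar

/-- The points `l` such that the segment from `0` to `l` contains no root of `a`. -/
def nearStar (a : ℂ[X]) : Set ℂ := {l | ∀ α, a.eval α = 0 → ¬((l / α).im = 0 ∧ 1 ≤ (l / α).re)}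

theorem isOpen_nearStar (ha : a ≠ 0) : IsOpen (nearStar a) := by
  have : nearStar a = (⋃ α ∈ {α | a.eval α = 0}, {l : ℂ | (l / α).im = 0 ∧ 1 ≤ (l / α).re})ᶜ := by
    ext l; simp [nearStar]
  rw [this]
  refine ((finite_setOf_eval_eq_zero ha).isClosed_biUnion fun α _ => ?_).isOpen_compl
  exact (isClosed_eq (continuous_im.comp (continuous_id.div_const α))
    continuous_const).inter (isClosed_le continuous_const
    (continuous_re.comp (continuous_id.div_const α)))

theorem zero_mem_nearStar : (0 : ℂ) ∈ nearStar a := by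
  intro α _ h
  rw [zero_div, zero_re] at h
  linarith [h.2]

theorem mul_mem_nearStar (hl : l ∈ nearStar a) {t : ℝ} (h0 : 0 ≤ t) (h1 : t ≤ 1) :
    (t : ℂ) * l ∈ nearStar a := by
  rintro α hα ⟨him, hre⟩
  rw [mul_div_assoc, im_ofReal_mul] at him
  rw [mul_div_assoc, re_ofReal_mul] at hre
  have ht : t ≠ 0 := by rintro rfl; linarith
  refine hl α hα ⟨(mul_eq_zero.1 him).resolve_left ht, ?_⟩
  by_contra! h
  rcases le_or_gt 0 (l / α).re with h' | h' <;> nlinarith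

theorem starConvex_nearStar : StarConvex ℝ 0 (nearStar a) := by
  refine starConvex_zero_iff.2 fun l hl t h0 h1 => ?_
  exact mul_mem_nearStar hl h0 h1

theorem eval_ne_of_mem_nearStar (ha0 : a.eval 0 ≠ 0) (hl : l ∈ nearStar a) : a.eval l ≠ 0 := by
  intro h
  have hl0 : l ≠ 0 := by grind
  exact hl l h (by rw [div_self hl0]; simp)

theorem exists_log_div_nu (ha : a ≠ 0) (ha0 : a.eval 0 ≠ 0) :
    ∃ E : ℂ → ℂ, DifferentiableOn ℂ E (nearStar a) ∧ a.eval 0 * E 0 = -2 * b.eval 0 ∧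
      ∀ l ∈ nearStar a, 2 * l * a.eval l * deriv E l +
        (l * (derivative a).eval l - a.eval l) * E l = 2 * b.eval l := by
  have hO := isOpen_nearStar ha
  have hst := starConvex_nearStar (a := a)
  have h0 := zero_mem_nearStar (a := a)
  obtain ⟨r, hr, hrsq⟩ := exists_sq_eq hO hst h0 (q := fun l => a.eval l)
    a.differentiable.differentiableOn fun l hl => eval_ne_of_mem_nearStar ha0 hl
  have hr0 : ∀ l ∈ nearStar a, r l ≠ 0 := by
    intro l hl h
    have := hrsq l hl
    rw [h] at this; simp at this
    exact eval_ne_of_mem_nearStar ha0 hl this.symm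
  set q : ℂ → ℂ := fun l => 2 * b.eval l / r l with hq
  have hqd : DifferentiableOn ℂ q (nearStar a) :=
    (b.differentiable.differentiableOn.const_mul 2).div hr hr0
  obtain ⟨T, hT, -, hT'⟩ := exists_eq_add_mul_deriv hO hst (q := dslope q 0)
    ((differentiableOn_dslope (hO.mem_nhds h0)).2 hqd) two_ne_zero
  have hds : ∀ l, l * dslope q 0 l = q l - q 0 := by
    intro l
    have := sub_smul_dslope q 0 l
    simpa using this
  refine ⟨fun l => (-q 0 + l * T l) / r l, ?_, ?_, ?_⟩
  · exact ((differentiableOn_const _).add (differentiableOn_id.mul hT)).div hr hr0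
  · have h1 := hr0 0 h0
    grind
  · intro l hl
    have dT := (hT.differentiableAt (hO.mem_nhds hl)).hasDerivAt
    have hrl := hr0 l hl
    have hs := hrsq l hl
    have dr : HasDerivAt r ((derivative a).eval l / (2 * r l)) l := by
      refine hasDerivAt_of_sq (hr.continuousOn.continuousAt (hO.mem_nhds hl)) ?_ hrl
      refine (a.hasDerivAt l).congr_of_eventuallyEq ?_
      filter_upwards [hO.mem_nhds hl] with w hw using hrsq w hw
    have dE := ((((hasDerivAt_id l).mul dT).const_add (-q 0)).div dr hrl).deriv
    have e1 : deriv (fun l => (-q 0 + l * T l) / r l) l = _ := dE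
    rw [e1]
    have e2 := hT' l hl
    have e3 := hds l
    have e4 : q l * r l = 2 * b.eval l := by simp only [hq]; field_simp
    simp at e2 ⊢
    rw [← hs, ← e4]
    field_simp
    have e5 : l * (T l + 2 * l * deriv T l) = q l - q 0 := by rw [e2, e3]
    linear_combination r l ^ 2 * e5

theorem isPellPair_of_log_div_nu {O : Set ℂ} (hO : IsOpen O) (h0 : ∀ l ∈ O, l ≠ 0)
    (ha : ∀ l ∈ O, a.eval l ≠ 0) {E : ℂ → ℂ} (hE : DifferentiableOn ℂ E O)
    (hE' : ∀ l ∈ O, 2 * l * a.eval l * deriv E l +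
        (l * (derivative a).eval l - a.eval l) * E l = 2 * b.eval l) :
    IsPellPair a b O (logCosh a fun p => p.2 * E p.1) (logSinh a fun p => p.2 * E p.1) := by
  refine IsPellPair.of_nhds fun p hp => ?_
  obtain ⟨r, hr, s, _, hs, hsq⟩ := exists_log_of_ne_root (b := b) (h0 p hp) (ha p hp)
  have hO' : IsOpen (ball p r ∩ O) := isOpen_ball.inter hO
  have hs' := hs.mono (inter_subset_left (t := O))
  have hsign : ∀ l ∈ ball p r ∩ O, nuBranch a l = s l ∨ nuBranch a l = -s l := by
    intro l hl
    have h1 := (hsq l hl.1).2.2.1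
    refine sq_eq_sq_iff_eq_or_eq_neg.1 ?_
    rw [nuBranch_sq, ← h1, mul_div_cancel_right₀ _ (hsq l hl.1).1]
  refine ⟨ball p r ∩ O, hO', ⟨mem_ball_self hr, hp⟩, _, _,
    IsPellPair.of_log (H := fun w => s w * E w) hO' hs' (fun l hl => (hsq l hl.1).2.2.1)
      (fun l hl => (hsq l hl.1).1) (fun l hl => (hsq l hl.1).2.1) ?_, ?_, ?_⟩
  · intro l hl
    have d1 := hasDerivAt_branch hO' hs' (fun l hl => (hsq l hl.1).2.2.1) hl (h0 l hl.2) (ha l hl.2)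
    have d2 := (hE.differentiableAt (hO.mem_nhds hl.2)).hasDerivAt
    refine (d1.mul d2).congr_deriv ?_
    grind
  · intro l hl
    rcases hsign l hl with e | e
    · rw [logCosh, e]
    · rw [logCosh, e, neg_mul, cosh_neg]
  · intro l hl
    rcases hsign l hl with e | e
    · rw [logSinh, e]
    · rw [logSinh, e, neg_mul, sinh_neg, neg_div_neg_eq]

theorem exp_mul_eq {k f E l ν : ℂ} (hl : l ≠ 0) (ha : a.eval l ≠ 0) (hν : ν ^ 2 * l = a.eval l)
    {E' : ℂ → ℂ} (hE : E' l = E)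
    (hk : k = logCosh a (fun p => p.2 * E' p.1) l) (hf : f = logSinh a (fun p => p.2 * E' p.1) l) :
    exp (ν * E) = k + f * ν := by
  have hν0 : ν ≠ 0 := by rintro rfl; simp at hν; exact ha hν.symm
  have hs : nuBranch a l = ν ∨ nuBranch a l = -ν := by
    refine sq_eq_sq_iff_eq_or_eq_neg.1 ?_
    rw [nuBranch_sq, ← hν, mul_div_cancel_right₀ _ hl]
  rw [hk, hf, logCosh, logSinh]
  rcases hs with e | e
  · simp only [e, hE]
    rw [div_mul_cancel₀ _ hν0, cosh_add_sinh]
  · simp_all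

theorem IsPellPair.exists_sign (ha : a ≠ 0) (ha0 : a.eval 0 ≠ 0) {k f E : ℂ → ℂ}
    (h : IsPellPair a b {0}ᶜ k f) (hE : DifferentiableOn ℂ E (nearStar a))
    (hE' : ∀ l ∈ nearStar a, 2 * l * a.eval l * deriv E l +
        (l * (derivative a).eval l - a.eval l) * E l = 2 * b.eval l) :
    ∃ p : ℂ, p ^ 2 = 1 ∧ ∀ l ∈ nearStar a \ {0}, k l = p * logCosh a (fun p => p.2 * E p.1) l ∧
        f l = p * logSinh a (fun p => p.2 * E p.1) l := by
  have hS := isOpen_nearStar ha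
  have hO : IsOpen (nearStar a \ {0}) := hS.sdiff isClosed_singleton
  have hl0 : ∀ l ∈ nearStar a \ {0}, l ≠ 0 := fun l hl => hl.2
  have h1 := isPellPair_of_log_div_nu (b := b) hO hl0
    (fun l hl => eval_ne_of_mem_nearStar ha0 hl.1) (hE.mono sdiff_subset) (fun l hl => hE' l hl.1)
  have h' := h.mono (O' := nearStar a \ {0}) (fun l hl => hl.2)
  obtain ⟨p, hp, hq⟩ := h'.exists_const hO
    (isPreconnected_diff_zero hS zero_mem_nearStar starConvex_nearStar) hl0 h1
  obtain ⟨r, hr, hrsq⟩ := exists_sq_eq hS starConvex_nearStar zero_mem_nearStar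
    (q := fun l => a.eval l) a.differentiable.differentiableOn
    fun l hl => eval_ne_of_mem_nearStar ha0 hl
  obtain ⟨ε, hε, hball⟩ := Metric.isOpen_iff.1 hS 0 zero_mem_nearStar
  have hsph : sphere (0 : ℂ) (ε / 2) ⊆ nearStar a \ {0} := by
    intro l hl
    rw [mem_sphere_zero_iff_norm] at hl
    refine ⟨hball (by rw [mem_ball_zero_iff]; linarith), ?_⟩
    rintro rfl
    rw [norm_zero] at hl; linarith
  have hp1 : p ^ 2 - 1 = 0 := by
    set k1 := logCosh a (fun p => p.2 * E p.1)
    set f1 := logSinh a (fun p => p.2 * E p.1)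
    refine eq_zero_of_sq_eq_on_sphere (p := 0) (half_pos hε)
      (R := fun l => (f l * k1 l - k l * f1 l) * r l) ?_ fun l hl => ?_
    · exact ((((h'.diff_f.continuousOn).mul h1.diff_k.continuousOn).sub
        (h'.diff_k.continuousOn.mul h1.diff_f.continuousOn)).mono hsph).mul
        (hr.continuousOn.mono fun l hl => (hsph hl).1)
    · rw [mul_pow, hrsq l (hsph hl).1, sub_zero]
      exact hq l (hsph hl)
  exact ⟨p, by linear_combination hp1, h'.eq_smul ha hO hl0 h1 hp hq (by linear_combination hp1)⟩

end NearStar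

section FarStar

theorem mul_mem_segment (hα : α ≠ 0) {t : ℝ} (ht : t ∈ uIcc 1 (normSq α)⁻¹) :
    (t : ℂ) * α ∈ segment ℝ α (conj α)⁻¹ := by
  have hc : (conj α)⁻¹ = ((normSq α)⁻¹ : ℝ) • α := by
    rw [real_smul]
    push_cast
    rw [normSq_eq_conj_mul_self]
    field_simp
  have h := image_segment ℝ (LinearMap.toSpanSingleton ℝ ℂ α).toAffineMap 1 (normSq α)⁻¹
  simp only [LinearMap.coe_toAffineMap, LinearMap.toSpanSingleton_apply, one_smul] at h
  rw [hc, ← h]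
  exact ⟨t, by rw [segment_eq_uIcc]; exact ht, by simp⟩

theorem mem_nearStar_or_of_mem_cutPlane (x : RealPair g) (ha0 : (aPoly x).eval 0 ≠ 0)
    (hl : l ∈ cutPlane (aPoly x)) :
    l ∈ nearStar (aPoly x) ∨ (conj l)⁻¹ ∈ nearStar (aPoly x) := by
  have hform : ∀ {w α : ℂ}, α ≠ 0 → (w / α).im = 0 → w = ((w / α).re : ℂ) * α := by
    intro w α hα him
    have : w / α = ((w / α).re : ℂ) := ext (by simp) (by simp [him])
    rw [← this, div_mul_cancel₀ _ hα]
  by_contra! hcon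
  obtain ⟨h1, h2⟩ := hcon
  simp only [nearStar, mem_ofPred_eq, not_forall, not_not] at h1 h2
  obtain ⟨α, hα, him, hre⟩ := h1
  obtain ⟨β, hβ, him', hre'⟩ := h2
  have hα0 : α ≠ 0 := by rintro rfl; exact ha0 hα
  have hβ0 : β ≠ 0 := by rintro rfl; exact ha0 hβ
  have e1 := hform hα0 him
  have e2 := hform hβ0 him'
  set t' := ((conj l)⁻¹ / β).re
  have hn1 := norm_pos_iff.2 hα0
  have hn2 := norm_pos_iff.2 hβ0
  have key1 : 1 < ‖l‖ := by
    by_contra! h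
    refine hl.2 α hα ?_
    rw [e1]
    refine mul_mem_segment hα0 ?_
    rw [e1, norm_mul, norm_real, Real.norm_eq_abs, abs_of_pos (by linarith)] at h
    rw [normSq_eq_norm_sq, uIcc_of_le]
    · refine ⟨hre, ?_⟩
      rw [le_inv_comm₀ (by linarith) (by positivity)]
      rw [← one_div, le_div_iff₀ (by linarith)]
      nlinarith
    · rw [one_le_inv₀ (by positivity)]; nlinarith
  have hβ'0 : (conj β)⁻¹ ≠ 0 := by simpa using hβ0
  have hβ' : (aPoly x).eval (conj β)⁻¹ = 0 := by
    rw [aPoly_reflect x hβ'0]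
    have : (conj (conj β)⁻¹)⁻¹ = β := by simp
    rw [this, hβ]; simp
  have e3 : l = ((t'⁻¹ : ℝ) : ℂ) * (conj β)⁻¹ := by
    have := congrArg (fun w => (conj w)⁻¹) e2
    simp only [map_inv₀, conj_conj, inv_inv, map_mul, conj_ofReal, mul_inv] at this
    rw [this]; push_cast; rfl
  have hnb : ‖(conj β)⁻¹‖ = ‖β‖⁻¹ := by rw [norm_inv, RCLike.norm_conj]
  refine hl.2 _ hβ' ?_
  rw [e3]
  refine mul_mem_segment hβ'0 ?_
  have h := key1
  rw [e3, norm_mul, norm_real, Real.norm_eq_abs, abs_of_pos (by positivity), hnb,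
    ← mul_inv, one_lt_inv₀ (by positivity)] at h
  rw [normSq_eq_norm_sq, hnb, inv_pow, inv_inv, uIcc_of_ge (by nlinarith)]
  refine ⟨?_, inv_le_one_of_one_le₀ hre'⟩
  rw [le_inv_comm₀ (by positivity) (by linarith), ← one_div, le_div_iff₀ (by positivity)]
  nlinarith

theorem HasPellData.eval_ne (h : HasPellData x) (hl : ‖l‖ = 1) : (aPoly x).eval l ≠ 0 := by
  obtain ⟨r, hr, e⟩ := h.neg l hl
  intro h0
  rw [h0, zero_div] at e
  exact hr.ne (by exact_mod_cast e.symm)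

/-- The reflected function `l ^ (1 - g) * conj (E (1 / conj l))`. -/
def farLog (g : ℕ) (E : ℂ → ℂ) (l : ℂ) : ℂ := l / l ^ g * conj (E (conj l)⁻¹)

theorem farLog_exp {k f E : ℂ → ℂ} {S : Set ℂ} (hk : ∀ l : ℂ, l ≠ 0 → conj (k (conj l)⁻¹) = k l)
    (hf : ∀ l : ℂ, l ≠ 0 → l / l ^ g * conj (f (conj l)⁻¹) = f l)
    (hE : ∀ l ∈ S, l ≠ 0 → ∀ ν : ℂ, ν ^ 2 * l = (aPoly x).eval l →
      exp (ν * E l) = k l + f l * ν) (hl : l ≠ 0) (hlS : (conj l)⁻¹ ∈ S)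
    {ν : ℂ} (hν : ν ^ 2 * l = (aPoly x).eval l) :
    exp (ν * farLog g E l) = k l + f l * ν := by
  have h1 := hE _ hlS (by simpa using hl) (conj (ν * (l / l ^ g))) (by
    have hr := aPoly_reflect x hl
    have : (aPoly x).eval (conj l)⁻¹ = conj ((aPoly x).eval l / l ^ (2 * g)) := by
      rw [hr, mul_div_cancel_left₀ _ (pow_ne_zero _ hl), conj_conj]
    rw [this, ← hν, ← map_inv₀ conj, ← map_pow, ← map_mul, pow_mul']
    field_simp)
  have h2 := congrArg conj h1
  rw [← exp_conj] at h2
  simp at h2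
  rw [hk l hl] at h2
  rw [← hf l hl, farLog]
  calc _ = exp (ν * (l / l ^ g) * conj (E (conj l)⁻¹)) := by congr 1; ring
    _ = _ := by rw [h2]; ring

theorem sq_dist_of_exp_eq {ν z w : ℂ} (h : exp (ν * z) = exp (ν * w)) :
    ∃ n : ℤ, ‖ν‖ ^ 2 * ‖z - w‖ ^ 2 = 4 * Real.pi ^ 2 * n ^ 2 ∧ ν * (z - w) = n * (2 * Real.pi * I) := by
  obtain ⟨n, hn⟩ := exp_eq_exp_iff_exists_int.1 h
  have e : ν * (z - w) = n * (2 * Real.pi * I) := by linear_combination hn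
  refine ⟨n, ?_, e⟩
  rw [← mul_pow, ← norm_mul, e]
  simp
  rw [mul_pow, mul_pow, sq_abs, sq_abs]; ring

theorem farLog_eq (h : HasPellData x) {k f E : ℂ → ℂ}
    (hk : ∀ l : ℂ, l ≠ 0 → conj (k (conj l)⁻¹) = k l)
    (hf : ∀ l : ℂ, l ≠ 0 → l / l ^ g * conj (f (conj l)⁻¹) = f l)
    (hEc : ContinuousOn E (nearStar (aPoly x)))
    (hE : ∀ l ∈ nearStar (aPoly x), l ≠ 0 → ∀ ν : ℂ, ν ^ 2 * l = (aPoly x).eval l →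
      exp (ν * E l) = k l + f l * ν) (hl : l ≠ 0)
    (h1 : l ∈ nearStar (aPoly x)) (h2 : (conj l)⁻¹ ∈ nearStar (aPoly x)) :
    E l = farLog g E l := by
  have ha0 : (aPoly x).eval 0 ≠ 0 := by
    intro h0; have := h.normalized; rw [h0, norm_zero] at this; norm_num at this
  have hn := norm_pos_iff.2 hl
  set u : ℂ := l / ‖l‖ with hu
  have hnc : (‖l‖ : ℂ) ≠ 0 := by exact_mod_cast hn.ne'
  have hlu : l = (‖l‖ : ℂ) * u := by rw [hu]; field_simp
  have hu1 : ‖u‖ = 1 := by rw [hu, norm_div, norm_real, norm_norm, div_self hn.ne']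
  have hu0 : u ≠ 0 := by rw [← norm_pos_iff, hu1]; exact one_pos
  have hcu : (conj u)⁻¹ = u := by rw [inv_eq_iff_eq_inv, ← inv_eq_conj hu1]
  have href : ∀ t : ℝ, (conj (t * u))⁻¹ = ((t⁻¹ : ℝ) : ℂ) * u := by
    intro t
    rw [map_mul, conj_ofReal, mul_inv, hcu]; push_cast; rfl
  have hclu : (conj l)⁻¹ = ((‖l‖⁻¹ : ℝ) : ℂ) * u := by
    conv_lhs => rw [hlu]
    exact href _
  set J := uIcc ‖l‖ ‖l‖⁻¹ with hJ
  have hnear : ∀ t ∈ J, 0 < t ∧ t * u ∈ nearStar (aPoly x) := by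
    intro t ht
    have hmin := lt_min hn (inv_pos.2 hn)
    have ht0 := hmin.trans_le ht.1
    refine ⟨ht0, ?_⟩
    rcases le_max_iff.1 ht.2 with h3 | h3
    · have := mul_mem_nearStar h1 (div_nonneg ht0.le hn.le) ((div_le_one hn).2 h3)
      have e : ((t / ‖l‖ : ℝ) : ℂ) * l = t * u := by rw [hu]; push_cast; ring
      rwa [e] at this
    · have := mul_mem_nearStar h2 (div_nonneg ht0.le (inv_nonneg.2 hn.le))
        ((div_le_one (inv_pos.2 hn)).2 h3)
      rw [hclu] at this
      convert this using 1
      push_cast; field_simp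
  have hinv : ∀ t ∈ J, t⁻¹ ∈ J := by
    intro t ht
    have ht0 := (hnear t ht).1
    rw [hJ, mem_uIcc] at ht ⊢
    rcases ht with h | h
    · exact Or.inl ⟨by rw [← inv_inv ‖l‖]; exact inv_anti₀ ht0 h.2, inv_anti₀ hn h.1⟩
    · exact Or.inr ⟨inv_anti₀ ht0 h.2, by rw [← inv_inv ‖l‖]; exact inv_anti₀ (inv_pos.2 hn) h.1⟩
  have h1J : 1 ∈ J := by
    rw [hJ, mem_uIcc]
    rcases le_total ‖l‖ 1 with h | h
    · exact Or.inl ⟨h, (one_le_inv₀ hn).2 h⟩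
    · exact Or.inr ⟨inv_le_one_of_one_le₀ h, h⟩
  let D : ℝ → ℝ := fun t => ‖(aPoly x).eval (t * u) / (t * u)‖ *
    ‖E (t * u) - farLog g E (t * u)‖ ^ 2
  have hDc : ContinuousOn D J := by
    have c1 : ContinuousOn (fun t : ℝ => t * u) J := by fun_prop
    have c2 := hEc.comp c1 fun t ht => (hnear t ht).2
    have c3 : ContinuousOn (fun t => E (((t⁻¹ : ℝ) : ℂ) * u)) J := by
      refine hEc.comp ?_ fun t ht => (hnear _ (hinv t ht)).2
      refine ContinuousOn.mul ?_ continuousOn_const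
      exact continuous_ofReal.comp_continuousOn
        (continuousOn_id.inv₀ fun t ht => (hnear t ht).1.ne')
    have hne : ∀ t ∈ J, t * u ≠ 0 := fun t ht =>
      mul_ne_zero (by exact_mod_cast (hnear t ht).1.ne') hu0
    have c4 : ContinuousOn (fun t : ℝ => farLog g E (t * u)) J := by
      have : ContinuousOn (fun t : ℝ => (t * u : ℂ) / (t * u) ^ g * conj (E (((t⁻¹ : ℝ) : ℂ) * u))) J :=
        (c1.div (c1.pow g) fun t ht => pow_ne_zero g (hne t ht)).mul
          (continuous_conj.comp_continuousOn c3)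
      refine this.congr fun t _ => ?_
      rw [farLog, href]
    exact (((aPoly x).continuous.comp_continuousOn c1).div c1 hne).norm.mul ((c2.sub c4).norm.pow 2)
  have hquant : ∀ t ∈ J, ∃ n : ℤ, D t = 4 * Real.pi ^ 2 * n ^ 2 := by
    intro t ht
    have hne : t * u ≠ 0 := mul_ne_zero (by exact_mod_cast (hnear t ht).1.ne') hu0
    set ν := nuBranch (aPoly x) (t * u)
    have hν : ν ^ 2 * (t * u) = (aPoly x).eval (t * u) := by rw [nuBranch_sq, div_mul_cancel₀ _ hne]
    have e1 := hE _ (hnear t ht).2 hne ν hν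
    have e2 := farLog_exp hk hf hE hne (by rw [href]; exact (hnear _ (hinv t ht)).2) hν
    obtain ⟨n, hn, -⟩ := sq_dist_of_exp_eq (e1.trans e2.symm)
    refine ⟨n, ?_⟩
    rw [← hn, ← norm_pow, nuBranch_sq]
  have hD1 : D 1 = 0 := by
    have hne : ((1 : ℝ) : ℂ) * u = u := by simp
    have hmem := (hnear 1 h1J).2
    rw [hne] at hmem
    set ν := nuBranch (aPoly x) u
    have hν : ν ^ 2 * u = (aPoly x).eval u := by rw [nuBranch_sq, div_mul_cancel₀ _ hu0]
    have e1 := hE _ hmem hu0 ν hν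
    have e2 := farLog_exp hk hf hE hu0 (by rw [hcu]; exact hmem) hν
    obtain ⟨n, hn, e3⟩ := sq_dist_of_exp_eq (e1.trans e2.symm)
    obtain ⟨r, hr, hr'⟩ := h.neg u hu1
    have hν0 : ν ≠ 0 := by intro h0; rw [h0] at hν; simp at hν; exact h.eval_ne hu1 hν.symm
    have hνr : ν ^ 2 * u / u ^ g = r := by rw [hν, hr']
    have hnorm : normSq ν = -r := by
      have : ‖ν ^ 2 * u / u ^ g‖ = -r := by rw [hνr, norm_real, Real.norm_eq_abs, abs_of_neg hr]
      rw [← this, norm_div, norm_mul, norm_pow, norm_pow, hu1, normSq_eq_norm_sq]; simp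
    have e4 : ν * (u / u ^ g) = -conj ν := by
      have h5 : ν * (ν * (u / u ^ g) + conj ν) = 0 := by
        have : ν * conj ν = (-r : ℝ) := by rw [mul_comm, ← normSq_eq_conj_mul_self, hnorm]
        rw [mul_add, this, show ν * (ν * (u / u ^ g)) = ν ^ 2 * u / u ^ g by ring, hνr]
        push_cast; ring
      have := (mul_eq_zero.1 h5).resolve_left hν0
      linear_combination this
    have e5 : ν * (E u - farLog g E u) = ((2 * (ν * E u).re : ℝ) : ℂ) := by
      rw [farLog, hcu, mul_sub, ← mul_assoc, e4]
      have := add_conj (ν * E u)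
      rw [map_mul] at this
      rw [← this]; ring
    have hz : E u - farLog g E u = 0 := by
      have : ν * (E u - farLog g E u) = 0 := by
        rw [e5] at e3 ⊢
        have := congrArg re e3
        have h6 : (n * (2 * Real.pi * I)).re = 0 := by simp
        rw [h6, ofReal_re] at this
        rw [this]; simp
      exact (mul_eq_zero.1 this).resolve_left hν0
    simp only [D]
    rw [hne, hz]; simp
  have hlJ : ‖l‖ ∈ J := left_mem_uIcc
  have hDl : D ‖l‖ = 0 := by
    by_contra hne
    obtain ⟨n, hn⟩ := hquant _ hlJ
    have hn0 : n ≠ 0 := by rintro rfl; apply hne; rw [hn]; simp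
    have hn1 : 1 ≤ (n : ℝ) ^ 2 := by
      have : (1 : ℤ) ≤ n ^ 2 := by have : 0 < n ^ 2 := by positivity
                                   omega
      exact_mod_cast this
    obtain ⟨t, htJ, ht⟩ := isPreconnected_uIcc.intermediate_value h1J hlJ hDc
      (show 2 * Real.pi ^ 2 ∈ Icc (D 1) (D ‖l‖) by
        rw [hD1, hn]
        constructor
        · positivity
        · nlinarith [sq_nonneg Real.pi])
    obtain ⟨m, hm⟩ := hquant t htJ
    rw [ht] at hm
    have h7 : (1 : ℝ) = 2 * m ^ 2 := by
      have : Real.pi ^ 2 ≠ 0 := by positivity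
      refine mul_left_cancel₀ (mul_ne_zero two_ne_zero this) ?_
      linear_combination hm
    have h8 : 1 = 2 * m ^ 2 := by exact_mod_cast h7
    omega
  simp only [D] at hDl
  rw [← hlu] at hDl
  rcases mul_eq_zero.1 hDl with h3 | h3
  · rw [norm_eq_zero, div_eq_zero_iff] at h3
    exact absurd h3 (not_or.2 ⟨eval_ne_of_mem_nearStar ha0 h1, hl⟩)
  · exact sub_eq_zero.1 (norm_eq_zero.1 (pow_eq_zero_iff two_ne_zero |>.1 h3))

/-- The functions `k = cosh h`, `f = sinh h / ν` and `E = h / ν` with their reality conditions. -/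
structure IsMonodromy (x : RealPair g) (k f E E0 : ℂ → ℂ) : Prop where
  pell : IsPellPair (aPoly x) (bPoly x) {0}ᶜ k f
  f_one : f 1 = 0
  real_k : ∀ l : ℂ, l ≠ 0 → conj (k (conj l)⁻¹) = k l
  real_f : ∀ l : ℂ, l ≠ 0 → l / l ^ g * conj (f (conj l)⁻¹) = f l
  cont : ContinuousOn E (cutPlane (aPoly x))
  exp_eq : ∀ l ν : ℂ, (l, ν) ∈ cutCurve (aPoly x) → exp (ν * E l) = k l + f l * ν
  diff_near : DifferentiableOn ℂ E0 (nearStar (aPoly x))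
  near_zero : (aPoly x).eval 0 * E0 0 = -2 * (bPoly x).eval 0
  exp_near : ∀ l ∈ nearStar (aPoly x), l ≠ 0 → ∀ ν : ℂ, ν ^ 2 * l = (aPoly x).eval l →
      exp (ν * E0 l) = k l + f l * ν

theorem HasPellData.exists_isMonodromy (ha : aPoly x ≠ 0) (h : HasPellData x) :
    ∃ k f E E0, IsMonodromy x k f E E0 := by
  have ha0 : (aPoly x).eval 0 ≠ 0 := by
    intro h0; have := h.normalized; rw [h0, norm_zero] at this; norm_num at this
  have hO : IsOpen ({0}ᶜ : Set ℂ) := isOpen_compl_singleton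
  obtain ⟨k1, f1, hkf1, hf1⟩ := h.pell
  obtain ⟨E, hE, hE0, hE'⟩ := exists_log_div_nu ha ha0
  obtain ⟨p, hp, heq⟩ := hkf1.exists_sign ha ha0 hE hE'
  obtain ⟨k, f, hkf, hf1, hkE⟩ : ∃ k f, IsPellPair (aPoly x) (bPoly x) {0}ᶜ k f ∧ f 1 = 0 ∧
      ∀ l ∈ nearStar (aPoly x) \ {0}, k l = logCosh (aPoly x) (fun p => p.2 * E p.1) l ∧
        f l = logSinh (aPoly x) (fun p => p.2 * E p.1) l := by
    rcases sq_eq_sq_iff_eq_or_eq_neg.1 (hp.trans (one_pow 2).symm) with rfl | rfl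
    · exact ⟨k1, f1, hkf1, hf1, by simpa using heq⟩
    · refine ⟨_, _, hkf1.neg, by rw [hf1, neg_zero], fun l hl => ?_⟩
      rw [(heq l hl).1, (heq l hl).2]; simp
  have hexp : ∀ l ∈ nearStar (aPoly x), l ≠ 0 → ∀ ν, ν ^ 2 * l = (aPoly x).eval l →
      exp (ν * E l) = k l + f l * ν := fun l hl hl0 ν hν =>
    exp_mul_eq hl0 (eval_ne_of_mem_nearStar ha0 hl) hν rfl (hkE l ⟨hl, hl0⟩).1 (hkE l ⟨hl, hl0⟩).2
  have hreal : ∀ l ∈ ({0}ᶜ : Set ℂ), k l = conj (k (conj l)⁻¹) ∧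
      f l = l / l ^ g * conj (f (conj l)⁻¹) := by
    have hrank : 1 < Module.rank ℝ ℂ := by rw [rank_real_complex]; norm_num
    have hr := hkf.reflect
    obtain ⟨q, hq, hq2⟩ := hkf.exists_const hO
      (isConnected_compl_singleton_of_one_lt_rank hrank 0).isPreconnected (fun l hl => hl) hr
    have hq1 : q = 1 := by
      have e1 := hq 1 one_ne_zero
      have e2 := hkf.pell 1 one_ne_zero
      rw [hf1] at e1 e2
      simp at e1 e2
      rcases e2 with h | h
      · rw [h] at e1; simpa using e1.symm
      · rw [h] at e1; simpa using e1.symm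
    have := hkf.eq_smul ha hO (fun l hl => hl) hr hq hq2 (by rw [hq1, one_pow])
    simpa [hq1] using this
  have hk := fun l hl => (hreal l hl).1.symm
  have hf := fun l hl => (hreal l hl).2.symm
  classical
  let F : ℂ → ℂ := fun l => if l ∈ nearStar (aPoly x) then E l else farLog g E l
  have hSo := isOpen_nearStar ha
  have hFfar : ∀ l, l ≠ 0 → (conj l)⁻¹ ∈ nearStar (aPoly x) → F l = farLog g E l := by
    intro l hl hl'
    by_cases hn : l ∈ nearStar (aPoly x)
    · simp only [F, if_pos hn]
      exact farLog_eq h hk hf hE.continuousOn hexp hl hn hl'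
    · simp only [F, if_neg hn]
  refine ⟨k, f, F, E, hkf, hf1, hk, hf, ?_, ?_, hE, hE0, hexp⟩
  · intro l hl
    refine ContinuousAt.continuousWithinAt ?_
    rcases mem_nearStar_or_of_mem_cutPlane x ha0 hl with hn | hn
    · refine (hE.continuousOn.continuousAt (hSo.mem_nhds hn)).congr ?_
      filter_upwards [hSo.mem_nhds hn] with w hw
      simp only [F, if_pos hw]
    · have hl0 := hl.1
      have hcont := (continuous_conj.continuousAt).inv₀ (by simpa using hl0)
      have c1 := (continuousAt_id.div (continuousAt_id.pow g) (pow_ne_zero g hl0)).mul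
          (continuous_conj.continuousAt.comp
            (ContinuousAt.comp (hE.continuousOn.continuousAt (hSo.mem_nhds hn)) hcont))
      refine c1.congr ?_
      filter_upwards [hcont.eventually (hSo.mem_nhds hn), isOpen_ne.mem_nhds hl0] with w hw hw0
      exact (hFfar w hw0 hw).symm
  · intro l ν hl
    rcases mem_nearStar_or_of_mem_cutPlane x ha0 hl.1 with hn | hn
    · simp only [F, if_pos hn]
      exact hexp l hn hl.1.1 ν hl.2
    · rw [hFfar l hl.1.1 hn]
      exact farLog_exp hk hf hexp hl.1.1 hn hl.2

end FarStar

section SpectralData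

variable {k f E E0 : ℂ → ℂ}

theorem IsMonodromy.isLogMu (ha : aPoly x ≠ 0) (h : IsMonodromy x k f E E0) :
    IsLogMu (aPoly x) (bPoly x) fun p => p.2 * E p.1 := by
  refine ⟨fun l ν _ => by simp, fun V s hV hVc hs hsq l hl => ?_⟩
  have hl0 := (hVc hl).1
  have hal := mem_cutPlane_eval_ne (hVc hl)
  have hO : IsOpen ({0}ᶜ : Set ℂ) := isOpen_compl_singleton
  have hs0 : s l ≠ 0 := by
    intro h0; have := hsq l hl; rw [h0] at this; simp at this; exact hal this.symm
  have hH : ContinuousAt (fun w => s w * E w) l := (hs.continuousAt (hV.mem_nhds hl)).mul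
      (h.cont.continuousAt ((isOpen_cutPlane ha).mem_nhds (hVc hl)))
  have dk := (h.pell.diff_k.differentiableAt (hO.mem_nhds hl0)).hasDerivAt
  have df := (h.pell.diff_f.differentiableAt (hO.mem_nhds hl0)).hasDerivAt
  have ds := hasDerivAt_branch hV hs hsq hl hl0 hal
  have dm := dk.add (df.mul ds)
  have hexp := dm.congr_of_eventuallyEq (by
    filter_upwards [hV.mem_nhds hl] with w hw
    exact h.exp_eq w (s w) ⟨hVc hw, hsq w hw⟩)
  refine (hasDerivAt_of_exp hH hexp).congr_deriv ?_
  have hne := exp_ne_zero (s l * E l)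
  rw [h.exp_eq l (s l) ⟨hVc hl, hsq l hl⟩] at hne ⊢
  have e1 := h.pell.deriv_k l hl0
  have e2 := h.pell.deriv_f l hl0
  have e3 := hsq l hl
  have e4 : deriv k l = f l * (bPoly x).eval l / l ^ 2 := by
    rw [eq_div_iff (pow_ne_zero 2 hl0)]; linear_combination e1
  have e5 : deriv f l = (2 * k l * (bPoly x).eval l - f l *
      (l * (derivative (aPoly x)).eval l - (aPoly x).eval l)) / (2 * l * (s l ^ 2 * l)) := by
    rw [e3, eq_div_iff (mul_ne_zero (mul_ne_zero two_ne_zero hl0) hal)]; linear_combination e2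
  rw [e4, e5]
  field_simp
  ring

theorem tendsto_infDist_of_sinh {h : ℂ × ℂ → ℂ} {u : ℂ → ℂ} (hu : ContinuousAt u α) (hu0 : u α = 0)
    (hs : ∀ p ∈ cutCurve a, sinh (h p) ^ 2 = u p.1) : TakesValuesInIPiZAt a h α := by
  have h1 : Tendsto (fun p => 3 * √‖u p.1‖) (comap Prod.fst (𝓝 α) ⊓ 𝓟 (cutCurve a)) (𝓝 0) := by
    have h2 : Tendsto (fun p => u p.1) (comap Prod.fst (𝓝 α) ⊓ 𝓟 (cutCurve a)) (𝓝 0) := by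
      rw [← hu0]
      exact (hu.tendsto.comp tendsto_comap).mono_left inf_le_left
    have := (h2.norm.sqrt).const_mul 3
    simpa using this
  refine squeeze_zero' (Eventually.of_forall fun p => infDist_nonneg) ?_ h1
  refine eventually_inf_principal.2 (Eventually.of_forall fun p hp => ?_)
  refine (infDist_iPiZ_le (h p)).trans ?_
  rw [← hs p hp, norm_pow, Real.sqrt_sq (norm_nonneg _)]

theorem IsMonodromy.sinh_sq (h : IsMonodromy x k f E E0) {p : ℂ × ℂ} (hp : p ∈ cutCurve (aPoly x)) :
    sinh (p.2 * E p.1) ^ 2 = f p.1 ^ 2 * ((aPoly x).eval p.1 / p.1) := by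
  obtain ⟨l, ν⟩ := p
  have hm' : (l, -ν) ∈ cutCurve (aPoly x) := ⟨hp.1, by have := hp.2; simpa using this⟩
  have e1 := h.exp_eq l ν hp
  have e2 := h.exp_eq l (-ν) hm'
  have e3 := hp.2.symm
  have hl0 := hp.1.1
  rw [neg_mul] at e2
  simp only [sinh]
  rw [e1, e2, e3]
  field_simp
  ring

theorem HasPellData.segmentIntegral (ha : aPoly x ≠ 0) (hx : HasPellData x)
    (h : IsMonodromy x k f E E0) (hα : (aPoly x).eval α = 0) :
    SegmentIntegralReZero (aPoly x) (bPoly x) α := by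
  intro s hs hsq
  have ha0 : (aPoly x).eval 0 ≠ 0 := by
    intro h0; have := hx.normalized; rw [h0, norm_zero] at this; norm_num at this
  have hα0 : α ≠ 0 := by rintro rfl; exact ha0 hα
  have hO : IsOpen ({0}ᶜ : Set ℂ) := isOpen_compl_singleton
  set γ : ℝ → ℂ := fun t => AffineMap.lineMap α (conj α)⁻¹ t with hγ
  have hγe : ∀ t, γ t = α + t * ((conj α)⁻¹ - α) := by
    intro t; rw [hγ]; simp [AffineMap.lineMap_apply]; ring
  have hγ0 : ∀ t ∈ 𝕀, γ t ≠ 0 := by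
    intro t ht
    have : γ t ∈ segment ℝ α (conj α)⁻¹ := by
      rw [segment_eq_image_lineMap]
      exact ⟨t, ht, rfl⟩
    obtain ⟨r, hr, e⟩ := eq_mul_of_mem_segment hα0 this
    rw [e]; exact mul_ne_zero (by exact_mod_cast hr.ne') hα0
  have hγd : ∀ t : ℝ, HasDerivAt γ ((conj α)⁻¹ - α) t := by
    intro t
    have h1 : HasDerivAt (fun z => α + z * ((conj α)⁻¹ - α)) ((conj α)⁻¹ - α) t := by
      simpa using ((hasDerivAt_id (t : ℂ)).mul_const ((conj α)⁻¹ - α)).const_add α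
    rw [show γ = fun t : ℝ => α + t * ((conj α)⁻¹ - α) from funext hγe]
    exact h1.comp_ofReal
  have hd0 : (conj α)⁻¹ - α ≠ 0 := by
    intro h0
    have h1 := sub_eq_zero.1 h0
    have h2 : ‖α‖ = 1 := by
      have := congrArg norm h1
      rw [norm_inv, RCLike.norm_conj, inv_eq_iff_eq_inv] at this
      have hn := norm_pos_iff.2 hα0
      have h3 : ‖α‖ * ‖α‖ = 1 := by nth_rewrite 1 [this]; exact inv_mul_cancel₀ hn.ne'
      nlinarith
    exact hx.eval_ne h2 hα
  have hγinj : Function.Injective γ := by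
    intro t t' htt
    rw [hγe, hγe] at htt
    have := mul_right_cancel₀ hd0 (add_left_cancel htt)
    exact_mod_cast this
  set J : ℝ → ℂ := fun t => (bPoly x).eval (γ t) / (s t * γ t ^ 2) * ((conj α)⁻¹ - α) with hJ
  by_cases hint : IntervalIntegrable J MeasureTheory.volume 0 1
  swap
  · rw [intervalIntegral.integral_undef hint, zero_re]
  set m : ℝ → ℂ := fun t => k (γ t) + f (γ t) * s t with hm
  have hm0 : ∀ t ∈ 𝕀, m t ≠ 0 := by
    intro t ht h0
    have e1 := h.pell.pell (γ t) (hγ0 t ht)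
    have e2 := hsq t ht
    rw [← e2] at e1
    have : γ t * (m t * (k (γ t) - f (γ t) * s t)) = γ t := by simp only [hm]; linear_combination e1
    rw [h0] at this
    simp at this
    exact hγ0 t ht this.symm
  have hγc : ContinuousOn γ 𝕀 := fun t _ => (hγd t).continuousAt.continuousWithinAt
  have hmc := (h.pell.diff_k.continuousOn.comp hγc hγ0).add
      ((h.pell.diff_f.continuousOn.comp hγc hγ0).mul hs)
  have hend : ∀ t ∈ 𝕀, (aPoly x).eval (γ t) = 0 → ‖m t‖ = 1 := by
    intro t ht h0
    have e1 := h.pell.pell (γ t) (hγ0 t ht)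
    have e2 := hsq t ht
    have hs0 : s t = 0 := by
      have := e2.trans h0
      exact pow_eq_zero_iff two_ne_zero |>.1 ((mul_eq_zero.1 this).resolve_right (hγ0 t ht))
    rw [h0, mul_zero, sub_zero] at e1
    have h2 : k (γ t) ^ 2 = 1 := mul_left_cancel₀ (hγ0 t ht) (by rw [e1, mul_one])
    simp only [hm]
    rw [hs0, mul_zero, add_zero]
    have := congrArg norm h2
    rw [norm_pow, norm_one] at this
    exact (pow_eq_one_iff_of_nonneg (norm_nonneg _) two_ne_zero).1 this
  have hder : ∀ t ∈ Ioo 0 1 \ γ ⁻¹' {l | (aPoly x).eval l = 0}, HasDerivAt m (J t * m t) t := by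
    rintro t ⟨ht, hta⟩
    have hti := Ioo_subset_Icc_self ht
    have hat := hta
    have hg0 := hγ0 t hti
    have hnt := Icc_mem_nhds ht.1 ht.2
    have hs0 : s t ≠ 0 := by
      intro h0; have := hsq t hti
      rw [h0] at this; simp at this; exact hat this.symm
    have dk := (h.pell.diff_k.differentiableAt (hO.mem_nhds hg0)).hasDerivAt.comp_of_eq t (hγd t) rfl
    have df := (h.pell.diff_f.differentiableAt (hO.mem_nhds hg0)).hasDerivAt.comp_of_eq t (hγd t) rfl
    have dq : HasDerivAt (fun w => (aPoly x).eval w / w)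
        ((γ t * (derivative (aPoly x)).eval (γ t) - (aPoly x).eval (γ t)) / γ t ^ 2) (γ t) := by
      refine (((aPoly x).hasDerivAt (γ t)).div (hasDerivAt_id (γ t)) hg0).congr_deriv ?_
      simp; ring
    have ds2 := (dq.comp_of_eq t (hγd t) rfl).congr_of_eventuallyEq (by
        filter_upwards [hnt] with w hw
        have := hsq w hw
        simp
        rw [eq_div_iff (hγ0 w hw)]
        exact this)
    have ds := hasDerivAt_of_sq (hs.continuousAt hnt) ds2 hs0
    refine (dk.add (df.mul ds)).congr_deriv ?_
    have e1 := h.pell.deriv_k (γ t) hg0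
    have e2 := h.pell.deriv_f (γ t) hg0
    have e3 := hsq t hti
    have e4 : deriv k (γ t) = f (γ t) * (bPoly x).eval (γ t) / γ t ^ 2 := by
      rw [eq_div_iff (pow_ne_zero 2 hg0)]; linear_combination e1
    have e5 : deriv f (γ t) = (2 * k (γ t) * (bPoly x).eval (γ t) - f (γ t) *
        (γ t * (derivative (aPoly x)).eval (γ t) - (aPoly x).eval (γ t))) /
          (2 * γ t * (s t ^ 2 * γ t)) := by
      rw [e3, eq_div_iff (mul_ne_zero (mul_ne_zero two_ne_zero hg0) hat)]; linear_combination e2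
    simp only [hJ, hm, Function.comp]
    rw [e4, e5]
    field_simp
    ring
  have hL := MeasureTheory.integral_eq_of_hasDerivAt_off_countable_of_le
    (fun t => Real.log (‖m t‖ ^ 2) / 2) (fun t => (J t).re) zero_le_one
    ((finite_setOf_eval_eq_zero ha).preimage hγinj.injOn).countable
    (((hmc.norm.pow 2).log fun t ht => pow_ne_zero 2 (norm_ne_zero_iff.2 (hm0 t ht))).div_const 2)
    (fun t ht => by
      have d := hder t ht
      have hmt := hm0 t (Ioo_subset_Icc_self ht.1)
      have h2 := ((d.norm_sq).log (pow_ne_zero 2 (norm_ne_zero_iff.2 hmt))).div_const 2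
      refine h2.congr_deriv ?_
      have hin : inner ℝ (m t) (J t * m t) = (J t).re * ‖m t‖ ^ 2 := by
        rw [Complex.inner, ← normSq_eq_norm_sq]
        have : J t * m t * conj (m t) = J t * (normSq (m t) : ℂ) := by
          rw [normSq_eq_conj_mul_self]; ring
        rw [this, re_mul_ofReal]
      rw [hin]
      field_simp)
    ⟨hint.1.re, hint.2.re⟩
  have hre : (∫ t in 0..1, J t).re = ∫ t in 0..1, (J t).re := by
    have := reCLM.intervalIntegral_comp_comm hint
    exact this.symm
  rw [hre, hL]
  have g0 : γ 0 = α := by rw [hγe]; simp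
  have g1 : γ 1 = (conj α)⁻¹ := by rw [hγe]; simp
  have hα' : (aPoly x).eval (conj α)⁻¹ = 0 := by
    rw [aPoly_reflect x (by simpa using hα0 : (conj α)⁻¹ ≠ 0)]
    simp [hα]
  rw [hend 1 (right_mem_Icc.2 zero_le_one) (by rw [g1]; exact hα'),
    hend 0 (left_mem_Icc.2 zero_le_one) (by rw [g0]; exact hα)]
  simp

theorem HasPellData.isSpectralData (hreg : IsRegular x) (hx : HasPellData x) :
    IsSpectralData x := by
  obtain ⟨k, f, E, E0, h⟩ := hx.exists_isMonodromy hreg.a_ne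
  have ha0 := hreg.a_zero_ne
  have hO : IsOpen ({0}ᶜ : Set ℂ) := isOpen_compl_singleton
  refine ⟨hx.normalized, hreg.b_zero_ne, fun l hl => ?_, ?_,
    fun α hα => hx.segmentIntegral hreg.a_ne h hα, ?_⟩
  · obtain ⟨r, hr, e⟩ := hx.neg l hl
    exact ⟨r, hr.le, e⟩
  · obtain ⟨r, hr, e⟩ := hx.b_zero
    refine ⟨(-(aPoly x).eval 0).arg, ?_⟩
    set Θ := (-(aPoly x).eval 0).arg
    have hΘ : (aPoly x).eval 0 = -(1 / 16) * exp (Θ * I) := by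
      have := norm_mul_exp_arg_mul_I (-(aPoly x).eval 0)
      rw [norm_neg, hx.normalized] at this
      push_cast at this
      linear_combination this
    have hsq : exp (Θ * I) = exp (Θ / 2 * I) ^ 2 := by rw [← exp_nat_mul]; congr 1; push_cast; ring
    have h1 : (bPoly x).eval 0 ^ 2 = ((√(-r / 16) : ℝ) * exp (Θ / 2 * I)) ^ 2 := by
      rw [mul_pow, ← hsq, ← ofReal_pow, Real.sq_sqrt (by linarith)]
      rw [div_eq_iff ha0, hΘ] at e
      rw [e]; push_cast; ring
    rcases sq_eq_sq_iff_eq_or_eq_neg.1 h1 with h2 | h2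
    · exact ⟨_, hΘ, h2⟩
    · exact ⟨-√(-r / 16), hΘ, by rw [h2]; push_cast; ring⟩
  · refine ⟨fun p => p.2 * E p.1, h.isLogMu hreg.a_ne, fun α hα => ?_, fun _ =>
      ⟨f, k, h.pell.diff_f, h.pell.diff_k, fun l ν hl => by rw [h.exp_eq l ν hl]; ring⟩⟩
    rw [eval_mul, mul_eq_zero] at hα
    have hα0 : α ≠ 0 := by
      rintro rfl
      rcases hα with h | h
      · simp at h
      · exact ha0 h
    refine tendsto_infDist_of_sinh (u := fun l => f l ^ 2 * ((aPoly x).eval l / l)) ?_ ?_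
      fun p hp => h.sinh_sq hp
    · have hc := h.pell.diff_f.continuousOn.continuousAt (hO.mem_nhds hα0)
      exact (hc.pow 2).mul ((aPoly x).continuous.continuousAt.div continuousAt_id hα0)
    · rcases hα with h1 | h1
      · have : α = 1 := by simpa [sub_eq_zero] using h1
        simp [this, h.f_one]
      · simp [h1]

end SpectralData

section Variable

theorem hasDerivWithinAt_sum_mul {φ φ' : Fin n → ℂ → ℂ}
    (hφ : ∀ i z, HasDerivAt (φ i) (φ' i z) z) {v : ℝ → Fin n → ℂ} {v' : Fin n → ℂ}
    {z : ℝ → ℂ} {z' : ℂ} {S : Set ℝ} (hv : HasDerivWithinAt v v' S t)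
    (hz : HasDerivWithinAt z z' S t) :
    HasDerivWithinAt (fun t => ∑ i, v t i * φ i (z t))
      (∑ i, v' i * φ i (z t) + (∑ i, v t i * φ' i (z t)) * z') S t := by
  have h1 := fun i => ((hasDerivWithinAt_pi.1 hv) i).mul ((hφ i (z t)).comp_hasDerivWithinAt t hz)
  refine (HasDerivWithinAt.fun_sum fun i _ => h1 i).congr_deriv ?_
  rw [Finset.sum_add_distrib, Finset.sum_mul]
  grind

theorem polyOf_derivative_eval (v : Fin n → ℂ) (z : ℂ) :
    (derivative (polyOf v)).eval z = ∑ i, v i * ((i : ℕ) * z ^ ((i : ℕ) - 1)) := by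
  simp only [polyOf, derivative_sum, eval_finsetSum]
  refine Finset.sum_congr rfl fun i _ => ?_
  simp only [derivative_C_mul, derivative_X_pow, eval_mul, eval_C, eval_pow, eval_X,
    eval_natCast, map_natCast]

theorem polyOf_derivative_derivative_eval (v : Fin n → ℂ) (z : ℂ) :
    (derivative (derivative (polyOf v))).eval z =
      ∑ i, v i * ((i : ℕ) * (((i : ℕ) - 1 : ℕ) * z ^ ((i : ℕ) - 1 - 1))) := by
  simp only [polyOf, derivative_sum, eval_finsetSum]
  refine Finset.sum_congr rfl fun i _ => ?_
  simp only [derivative_C_mul, derivative_X_pow, eval_mul, eval_C, eval_pow, eval_X,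
    eval_natCast, map_natCast, derivative_natCast_mul]

theorem hasDerivWithinAt_polyOf_eval {v : ℝ → Fin n → ℂ} {v' : Fin n → ℂ}
    {z : ℝ → ℂ} {z' : ℂ} {S : Set ℝ} (hv : HasDerivWithinAt v v' S t)
    (hz : HasDerivWithinAt z z' S t) :
    HasDerivWithinAt (fun t => (polyOf (v t)).eval (z t))
      ((polyOf v').eval (z t) + (derivative (polyOf (v t))).eval (z t) * z') S t := by
  simp only [polyOf_eval, polyOf_derivative_eval]
  exact hasDerivWithinAt_sum_mul (fun i z => hasDerivAt_pow (i : ℕ) z) hv hz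

theorem hasDerivWithinAt_polyOf_derivative_eval {v : ℝ → Fin n → ℂ} {v' : Fin n → ℂ}
    {z : ℝ → ℂ} {z' : ℂ} {S : Set ℝ} (hv : HasDerivWithinAt v v' S t)
    (hz : HasDerivWithinAt z z' S t) :
    HasDerivWithinAt (fun t => (derivative (polyOf (v t))).eval (z t))
      ((derivative (polyOf v')).eval (z t) +
        (derivative (derivative (polyOf (v t)))).eval (z t) * z') S t := by
  simp only [polyOf_derivative_derivative_eval, polyOf_derivative_eval]
  exact hasDerivWithinAt_sum_mul (φ := fun i z => (i : ℕ) * z ^ ((i : ℕ) - 1))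
    (fun i z => (hasDerivAt_pow ((i : ℕ) - 1) z).const_mul _) hv hz

theorem continuousOn_polyOf_eval {X : Type*} [TopologicalSpace X] {v : X → Fin n → ℂ}
    {z : X → ℂ} {S : Set X} (hv : ContinuousOn v S) (hz : ContinuousOn z S) :
    ContinuousOn (fun t => (polyOf (v t)).eval (z t)) S := by
  simp only [polyOf_eval]
  fun_prop

theorem continuousOn_polyOf_derivative_eval {X : Type*} [TopologicalSpace X]
    {v : X → Fin n → ℂ} {z : X → ℂ} {S : Set X} (hv : ContinuousOn v S) (hz : ContinuousOn z S) :
    ContinuousOn (fun t => (derivative (polyOf (v t))).eval (z t)) S := by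
  simp only [polyOf_derivative_eval]
  fun_prop

theorem continuous_aCoeff : Continuous fun x : RealPair g => x.1.1 :=
  continuous_fst.comp continuous_subtype_val

theorem continuous_bCoeff : Continuous fun x : RealPair g => x.1.2 :=
  continuous_snd.comp continuous_subtype_val

theorem continuous_cCoeff : Continuous fun c : RealPoly g => c.1 := continuous_subtype_val

theorem continuous_aPoly_eval (z : ℂ) : Continuous fun x : RealPair g => (aPoly x).eval z :=
  continuousOn_univ.1 (continuousOn_polyOf_eval continuous_aCoeff.continuousOn continuousOn_const)

theorem continuous_bPoly_eval (z : ℂ) : Continuous fun x : RealPair g => (bPoly x).eval z :=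
  continuousOn_univ.1 (continuousOn_polyOf_eval continuous_bCoeff.continuousOn continuousOn_const)

theorem aPoly_leadingCoeff (h : (aPoly x).natDegree = 2 * g) :
    (aPoly x).leadingCoeff = conj ((aPoly x).eval 0) := by
  rw [leadingCoeff, h, aPoly_coeff_rev]

theorem natDegree_aPoly_eq (h0 : (aPoly x).eval 0 ≠ 0) :
    (aPoly x).natDegree = 2 * g ∧ aPoly x ≠ 0 := by
  have h1 : (aPoly x).coeff (2 * g) ≠ 0 := by rw [aPoly_coeff_rev]; simpa using h0
  refine ⟨natDegree_eq_of_le_of_coeff_ne_zero (natDegree_aPoly_le x) h1, ?_⟩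
  intro h; rw [h] at h0; simp at h0

theorem exists_root_near {ε : ℝ} (hε : 0 ≤ ε) (ha : a ≠ 0)
    (h : ‖a.eval p‖ < ‖a.leadingCoeff‖ * ε ^ a.natDegree) :
    ∃ β, a.eval β = 0 ∧ ‖β - p‖ < ε := by
  by_contra! hcon
  have hs := IsAlgClosed.splits a
  have hcard := hs.natDegree_eq_card_roots.symm
  have heq := hs.eq_prod_roots
  have hev : a.eval p = a.leadingCoeff * (a.roots.map fun β => p - β).prod := by
    conv_lhs => rw [heq]
    rw [eval_mul, eval_C, eval_multiset_prod, Multiset.map_map]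
    simp
  have hge : ∀ s : Multiset ℂ, (∀ β ∈ s, ε ≤ ‖β - p‖) →
      ε ^ s.card ≤ ‖(s.map fun β => p - β).prod‖ := by
    intro s
    induction s using Multiset.induction_on with
    | empty => simp
    | cons β s ih =>
      intro h
      rw [Multiset.card_cons, Multiset.map_cons, Multiset.prod_cons, norm_mul, pow_succ']
      have h1 := h β (Multiset.mem_cons_self β s)
      rw [norm_sub_rev] at h1
      exact mul_le_mul h1 (ih fun β' hβ' => h β' (Multiset.mem_cons_of_mem hβ'))
        (pow_nonneg hε _) (norm_nonneg _)
  have h1 := hge a.roots fun β hβ => hcon β ((mem_roots ha).1 hβ)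
  rw [hev, norm_mul, ← hcard] at h
  exact absurd (mul_le_mul_of_nonneg_left h1 (norm_nonneg a.leadingCoeff)) (not_le.2 h)

theorem nodup_roots_of_simple (ha : a ≠ 0)
    (hs : ∀ α, a.eval α = 0 → (derivative a).eval α ≠ 0) : a.roots.Nodup := by
  rw [Multiset.nodup_iff_count_le_one]
  intro α
  rw [count_roots]
  by_contra! h
  have := (one_lt_rootMultiplicity_iff_isRoot ha).1 h
  exact hs α this.1 this.2

theorem simple_of_nodup_roots (ha : a ≠ 0) (h : a.roots.Nodup)
    (hα : a.eval α = 0) : (derivative a).eval α ≠ 0 := by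
  intro h'
  have h1 := (one_lt_rootMultiplicity_iff_isRoot ha).2 ⟨hα, h'⟩
  rw [← count_roots] at h1
  simp_all

theorem eventually_roots_eq {x0 : RealPair g} (h0 : (aPoly x0).eval 0 ≠ 0)
    (hs : ∀ α, (aPoly x0).eval α = 0 → (derivative (aPoly x0)).eval α ≠ 0) {ε : ℝ} (hε : 0 < ε) :
    ∀ᶠ x in 𝓝 x0, (aPoly x).eval 0 ≠ 0 ∧ ∃ β : ℂ → ℂ,
      (∀ p, (aPoly x0).eval p = 0 → ‖β p - p‖ < ε) ∧ (aPoly x).roots.Nodup ∧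
        (aPoly x).roots = (aPoly x0).roots.map β := by
  obtain ⟨hd, ha⟩ := natDegree_aPoly_eq h0
  set A := (aPoly x0).roots.toFinset with hA
  have hmemA : ∀ p, p ∈ A ↔ (aPoly x0).eval p = 0 := by simp_all
  have hnd := nodup_roots_of_simple ha hs
  obtain ⟨δ, hδ, hsep⟩ : ∃ δ > 0, ∀ p ∈ A, ∀ q ∈ A, p ≠ q → 2 * δ < ‖p - q‖ := by
    have : ∀ᶠ δ in 𝓝[>] 0, ∀ p ∈ A, ∀ q ∈ A, p ≠ q → 2 * δ < ‖p - q‖ := by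
      refine (Filter.eventually_all_finset A).2 fun p _ =>
        (Filter.eventually_all_finset A).2 fun q _ => ?_
      by_cases hpq : p = q
      · exact Eventually.of_forall fun δ h => absurd hpq h
      · have hpos := half_pos (norm_pos_iff.2 (sub_ne_zero.2 hpq))
        filter_upwards [Ioo_mem_nhdsGT hpos] with δ hδ _
        linarith [hδ.2]
    obtain ⟨δ, h1, h2⟩ := (this.and self_mem_nhdsWithin).exists
    exact ⟨δ, h2, h1⟩
  set η := min ε δ
  have hη : 0 < η := lt_min hε hδ
  have hev : ∀ᶠ x in 𝓝 x0, ∀ p ∈ A, ‖(aPoly x).eval p‖ < ‖(aPoly x).eval 0‖ * η ^ (2 * g) := by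
    refine (Filter.eventually_all_finset A).2 fun p hp => ?_
    refine ContinuousAt.eventually_lt (continuous_aPoly_eval p).norm.continuousAt
      ((continuous_aPoly_eval 0).norm.mul continuous_const).continuousAt ?_
    simp_all
  have hev0 := (continuous_aPoly_eval 0).continuousAt.eventually_ne h0
  filter_upwards [hev, hev0] with x hx hx0
  refine ⟨hx0, ?_⟩
  obtain ⟨hdx, hax⟩ := natDegree_aPoly_eq hx0
  have hroot : ∀ p ∈ A, ∃ β, (aPoly x).eval β = 0 ∧ ‖β - p‖ < η := by
    intro p hp
    refine exists_root_near hη.le hax ?_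
    rw [aPoly_leadingCoeff hdx, RCLike.norm_conj, hdx]
    exact hx p hp
  choose! β hβ0 hβ using hroot
  have hinj : ∀ p ∈ A, ∀ q ∈ A, β p = β q → p = q := by
    intro p hp q hq h
    by_contra hpq
    have h1 := hsep p hp q hq hpq
    have h2 := hβ p hp
    have h3 := hβ q hq
    rw [h] at h2
    have h4 : ‖p - q‖ ≤ ‖β q - p‖ + ‖β q - q‖ := by
      have : p - q = (β q - q) - (β q - p) := by ring
      rw [this]; linarith [norm_sub_le (β q - q) (β q - p)]
    have h5 : η ≤ δ := min_le_right _ _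
    linarith
  have hndm := hnd.map_on fun p hp q hq h => hinj p (Multiset.mem_toFinset.2 hp) q (Multiset.mem_toFinset.2 hq) h
  have hle : (aPoly x0).roots.map β ≤ (aPoly x).roots := by
    rw [Multiset.le_iff_subset hndm]
    intro w hw
    obtain ⟨p, hp, rfl⟩ := Multiset.mem_map.1 hw
    exact (mem_roots hax).2 (hβ0 p (Multiset.mem_toFinset.2 hp))
  have heq : (aPoly x0).roots.map β = (aPoly x).roots := by
    refine Multiset.eq_of_le_of_card_le hle ?_
    rw [Multiset.card_map]
    refine (card_roots' _).trans ?_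
    rw [hdx, ← hd, (IsAlgClosed.splits (aPoly x0)).natDegree_eq_card_roots]
  exact ⟨β, fun p hp => (hβ p ((hmemA p).2 hp)).trans_le (min_le_left _ _), heq ▸ hndm, heq.symm⟩

end Variable

section Path

theorem forall_mem_Icc_of_isOpen_isClosed {P : ℝ → Prop} (h0 : P 0)
    (hopen : ∀ t ∈ 𝕀, P t → ∀ᶠ s in 𝓝[Icc 0 1] t, P s)
    (hclosed : ∀ t ∈ Ioc (0 : ℝ) 1, (∀ s ∈ Ico 0 t, P s) → P t) : ∀ t ∈ 𝕀, P t := by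
  by_contra! hcon
  set M := {t | t ∈ 𝕀 ∧ ¬P t}
  have hne : M.Nonempty := hcon
  have hbd : BddBelow M := ⟨0, fun t ht => ht.1.1⟩
  have hle : ∀ t ∈ M, sInf M ≤ t := fun t ht => csInf_le hbd ht
  have h0s := le_csInf hne fun t ht => ht.1.1
  have hmem : sInf M ∈ 𝕀 := ⟨h0s, (hle _ hne.some_mem).trans hne.some_mem.1.2⟩
  have hlt : ∀ s ∈ Ico 0 (sInf M), P s := by
    intro s hs
    by_contra h
    exact absurd (hle s ⟨⟨hs.1, hs.2.le.trans hmem.2⟩, h⟩) (not_le.2 hs.2)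
  have hP : P (sInf M) := by
    rcases h0s.eq_or_lt with h | h
    · rw [← h]; exact h0
    · exact hclosed _ ⟨h, hmem.2⟩ hlt
  obtain ⟨ε, hε, hball⟩ := Metric.mem_nhdsWithin_iff.1 (hopen _ hmem hP)
  obtain ⟨t, ht, htlt⟩ := exists_lt_of_csInf_lt hne (lt_add_of_pos_right (sInf M) hε)
  refine ht.2 (hball ⟨?_, ht.1⟩)
  rw [mem_ball, Real.dist_eq, abs_of_nonneg (sub_nonneg.2 (hle t ht))]
  linarith

theorem eq_zero_of_deriv_eq_mul {m u : ℝ → ℂ} (hm : ContinuousOn m 𝕀)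
    (hu : ∀ t ∈ 𝕀, HasDerivWithinAt u (m t * u t) 𝕀 t) (h0 : u 0 = 0) :
    ∀ t ∈ 𝕀, u t = 0 := by
  have hL := (ContinuousLinearMap.mul ℝ ℂ).continuous.comp_continuousOn hm
  refine SolvesOn.eq_of_linear hL hu (fun t ht => ?_) h0
  simpa using hasDerivWithinAt_const t 𝕀 0

/-- A path on `[0, 1]` with velocity `y` that solves the Whitham equation with polynomials `c`
which preserve the closing conditions. -/
structure IsWhithamPath (x y : ℝ → RealPair g) (c : ℝ → RealPoly g) : Prop where
  deriv : ∀ t ∈ 𝕀, HasDerivWithinAt x (y t) 𝕀 t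
  cont_y : ContinuousOn y 𝕀
  cont_c : ContinuousOn c 𝕀
  whitham : ∀ t ∈ 𝕀, IsWhithamVector (x t) (c t) (y t)
  regular : ∀ t ∈ 𝕀, IsRegular (x t)
  c_one : ∀ t ∈ 𝕀, (cPoly (c t)).eval 1 = 0
  c_im : ∀ t ∈ 𝕀, ((cPoly (c t)).eval 0 / (bPoly (x t)).eval 0).im = 0

variable {x y : ℝ → RealPair g} {c : ℝ → RealPoly g}

theorem IsWhithamPath.cont_x (h : IsWhithamPath x y c) : ContinuousOn x 𝕀 :=
  fun t ht => (h.deriv t ht).continuousWithinAt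

theorem IsWhithamVector.smul {x y : RealPair g} {c : RealPoly g} (h : IsWhithamVector x c y)
    (r : ℝ) : IsWhithamVector x (r • c) (r • y) := by
  rw [isWhithamVector_iff] at h ⊢
  simp_all

theorem IsWhithamPath.comp (h : IsWhithamPath x y c) {t1 t2 : ℝ} (h1 : t1 ∈ 𝕀) (h2 : t2 ∈ 𝕀) :
    IsWhithamPath (fun s => x (t1 + s * (t2 - t1))) (fun s => (t2 - t1) • y (t1 + s * (t2 - t1)))
      (fun s => (t2 - t1) • c (t1 + s * (t2 - t1))) := by
  have hmaps : MapsTo (fun s => t1 + s * (t2 - t1)) 𝕀 𝕀 := by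
    intro s hs
    have := (convex_Icc 0 1).add_smul_sub_mem h1 h2 hs
    simpa using this
  have hc : ContinuousOn (fun s => t1 + s * (t2 - t1)) 𝕀 := by fun_prop
  refine ⟨fun s hs => ?_, (h.cont_y.comp hc hmaps).const_smul (t2 - t1),
    (h.cont_c.comp hc hmaps).const_smul (t2 - t1),
    fun s hs => (h.whitham _ (hmaps hs)).smul _, fun s hs => h.regular _ (hmaps hs),
    fun s hs => ?_, fun s hs => ?_⟩
  · have h3 : HasDerivWithinAt (fun s => t1 + s * (t2 - t1)) (t2 - t1) 𝕀 s := by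
      simpa using ((hasDerivWithinAt_id s 𝕀).mul_const (t2 - t1)).const_add t1
    exact (h.deriv _ (hmaps hs)).scomp s h3 hmaps
  · rw [cPoly_smul, eval_mul, h.c_one _ (hmaps hs), mul_zero]
  · rw [cPoly_smul, eval_mul, eval_C, mul_div_assoc, im_ofReal_mul, h.c_im _ (hmaps hs), mul_zero]

theorem IsWhithamVector.eval {x y : RealPair g} {c : RealPoly g} (h : IsWhithamVector x c y)
    (l : ℂ) : -2 * (bPoly y).eval l * (aPoly x).eval l + (bPoly x).eval l * (aPoly y).eval l =
      -2 * l * (aPoly x).eval l * (derivative (cPoly c)).eval l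
      + (aPoly x).eval l * (cPoly c).eval l
      + l * (derivative (aPoly x)).eval l * (cPoly c).eval l := by
  have := congrArg (Polynomial.eval l) h.1
  simpa using this

theorem IsWhithamVector.eval_deriv {x y : RealPair g} {c : RealPoly g}
    (h : IsWhithamVector x c y) (l : ℂ) :
    -2 * (derivative (bPoly y)).eval l * (aPoly x).eval l
      - 2 * (bPoly y).eval l * (derivative (aPoly x)).eval l
      + (derivative (bPoly x)).eval l * (aPoly y).eval l
      + (bPoly x).eval l * (derivative (aPoly y)).eval l =
    -(aPoly x).eval l * (derivative (cPoly c)).eval l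
      - l * (derivative (aPoly x)).eval l * (derivative (cPoly c)).eval l
      - 2 * l * (aPoly x).eval l * (derivative (derivative (cPoly c))).eval l
      + 2 * (derivative (aPoly x)).eval l * (cPoly c).eval l
      + l * (derivative (derivative (aPoly x))).eval l * (cPoly c).eval l := by
  have := congrArg (fun p => Polynomial.eval l (derivative p)) h.1
  simp at this
  linear_combination this

section Root

variable {α : ℝ → ℂ}

theorem IsWhithamPath.root (h : IsWhithamPath x y c) (hb : ∀ t ∈ 𝕀, (bPoly (x t)).eval (α t) ≠ 0)
    (hα : ∀ t ∈ 𝕀, HasDerivWithinAt α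
      (-(α t * (cPoly (c t)).eval (α t)) / (bPoly (x t)).eval (α t)) 𝕀 t)
    (h0 : (aPoly (x 0)).eval (α 0) = 0) : ∀ t ∈ 𝕀, (aPoly (x t)).eval (α t) = 0 := by
  have hαc := fun t ht => (hα t ht).continuousWithinAt
  have cb := continuousOn_polyOf_eval (continuous_bCoeff.comp_continuousOn h.cont_x) hαc
  have cby := continuousOn_polyOf_eval (continuous_bCoeff.comp_continuousOn h.cont_y) hαc
  have cc := continuousOn_polyOf_eval (continuous_cCoeff.comp_continuousOn h.cont_c) hαc
  have cc' := continuousOn_polyOf_derivative_eval (continuous_cCoeff.comp_continuousOn h.cont_c) hαc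
  refine eq_zero_of_deriv_eq_mul (m := fun t => (2 * (bPoly (y t)).eval (α t)
    - 2 * α t * (derivative (cPoly (c t))).eval (α t) + (cPoly (c t)).eval (α t))
      / (bPoly (x t)).eval (α t)) ?_ (fun t ht => ?_) h0
  · exact (((continuousOn_const.mul cby).sub ((continuousOn_const.mul hαc).mul cc')).add cc).div
      cb hb
  · have hx := (((ContinuousLinearMap.fst ℝ _ _).comp (RealPair g).subtypeL).hasFDerivAt).comp_hasDerivWithinAt t
        (h.deriv t ht)
    refine (hasDerivWithinAt_polyOf_eval hx (hα t ht)).congr_deriv ?_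
    have e := (h.whitham t ht).eval (α t)
    have hbt := hb t ht
    change (aPoly (y t)).eval (α t) + (derivative (aPoly (x t))).eval (α t) * _ = _
    field_simp
    linear_combination e

theorem IsWhithamPath.double_root (h : IsWhithamPath x y c)
    (hb : ∀ t ∈ 𝕀, (bPoly (x t)).eval (α t) ≠ 0)
    (hα : ∀ t ∈ 𝕀, HasDerivWithinAt α
      (-(α t * (cPoly (c t)).eval (α t)) / (bPoly (x t)).eval (α t)) 𝕀 t)
    (h0 : (aPoly (x 0)).eval (α 0) = 0) (h0' : (derivative (aPoly (x 0))).eval (α 0) = 0) :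
    ∀ t ∈ 𝕀, (derivative (aPoly (x t))).eval (α t) = 0 := by
  have hA := h.root hb hα h0
  have hαc : ContinuousOn α 𝕀 := fun t ht => (hα t ht).continuousWithinAt
  have cb := continuousOn_polyOf_eval (continuous_bCoeff.comp_continuousOn h.cont_x) hαc
  have cb' := continuousOn_polyOf_derivative_eval (continuous_bCoeff.comp_continuousOn h.cont_x) hαc
  have cby := continuousOn_polyOf_eval (continuous_bCoeff.comp_continuousOn h.cont_y) hαc
  have cc := continuousOn_polyOf_eval (continuous_cCoeff.comp_continuousOn h.cont_c) hαc
  have cc' := continuousOn_polyOf_derivative_eval (continuous_cCoeff.comp_continuousOn h.cont_c) hαc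
  refine eq_zero_of_deriv_eq_mul (m := fun t => (2 * (bPoly (y t)).eval (α t)
    - α t * (derivative (cPoly (c t))).eval (α t) + 2 * (cPoly (c t)).eval (α t)
    - (derivative (bPoly (x t))).eval (α t) * α t * (cPoly (c t)).eval (α t)
      / (bPoly (x t)).eval (α t)) / (bPoly (x t)).eval (α t)) ?_ (fun t ht => ?_) h0'
  · exact ((((continuousOn_const.mul cby).sub (hαc.mul cc')).add (continuousOn_const.mul cc)).sub
      (((cb'.mul hαc).mul cc).div cb hb)).div cb hb
  · have hx := (((ContinuousLinearMap.fst ℝ _ _).comp (RealPair g).subtypeL).hasFDerivAt).comp_hasDerivWithinAt t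
        (h.deriv t ht)
    refine (hasDerivWithinAt_polyOf_derivative_eval hx (hα t ht)).congr_deriv ?_
    have e := (h.whitham t ht).eval (α t)
    have e' := (h.whitham t ht).eval_deriv (α t)
    rw [hA t ht] at e e'
    have hbt := hb t ht
    change (derivative (aPoly (y t))).eval (α t)
      + (derivative (derivative (aPoly (x t)))).eval (α t) * _ = _
    field_simp
    linear_combination (bPoly (x t)).eval (α t) * e' - (derivative (bPoly (x t))).eval (α t) * e

end Root

theorem IsWhithamPath.exists_characteristic (h : IsWhithamPath x y c)
    (hp : (bPoly (x 0)).eval p ≠ 0) :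
    ∃ ε ∈ Ioc (0 : ℝ) 1, ∃ α : ℝ → ℂ, α 0 = p ∧ ∀ t ∈ Icc 0 ε, (bPoly (x t)).eval (α t) ≠ 0 ∧
      HasDerivWithinAt α (-(α t * (cPoly (c t)).eval (α t)) / (bPoly (x t)).eval (α t))
        (Icc 0 ε) t := by
  have m1 : MapsTo Prod.fst (𝕀 ×ˢ (univ : Set ℂ)) 𝕀 := fun q hq => hq.1
  have cfst : ContinuousOn Prod.fst (𝕀 ×ˢ (univ : Set ℂ)) := continuous_fst.continuousOn
  have csnd : ContinuousOn Prod.snd (𝕀 ×ˢ (univ : Set ℂ)) := continuous_snd.continuousOn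
  have cb := continuousOn_polyOf_eval
    ((continuous_bCoeff.comp_continuousOn h.cont_x).comp cfst m1) csnd
  have cb' := continuousOn_polyOf_derivative_eval
    ((continuous_bCoeff.comp_continuousOn h.cont_x).comp cfst m1) csnd
  have cc := continuousOn_polyOf_eval
    ((continuous_cCoeff.comp_continuousOn h.cont_c).comp cfst m1) csnd
  have cc' := continuousOn_polyOf_derivative_eval
    ((continuous_cCoeff.comp_continuousOn h.cont_c).comp cfst m1) csnd
  obtain ⟨r, hr, hr1, hball⟩ : ∃ r > 0, r ≤ (1 : ℝ) ∧ ∀ t ∈ 𝕀, t ≤ r →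
      ∀ l ∈ closedBall p r, (bPoly (x t)).eval l ≠ 0 := by
    have h1 := (cb (0, p) ⟨by simp, mem_univ _⟩).eventually_ne hp
    obtain ⟨r, hr, hsub⟩ := Metric.mem_nhdsWithin_iff.1 h1
    refine ⟨min (r / 2) 1, by positivity, min_le_right _ _, fun t ht htr l hl =>
      @hsub (t, l) ⟨?_, ht, mem_univ _⟩⟩
    rw [mem_closedBall] at hl
    have hm : min (r / 2) 1 < r := (min_le_left _ _).trans_lt (half_lt_self hr)
    refine max_lt ?_ (hl.trans_lt hm)
    rw [Real.dist_eq, sub_zero, abs_of_nonneg ht.1]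
    exact htr.trans_lt hm
  set F : ℝ → ℂ → ℂ := fun t l => -(l * (cPoly (c t)).eval l) / (bPoly (x t)).eval l with hF
  set F' : ℝ → ℂ → ℂ := fun t l => (-((cPoly (c t)).eval l + l * (derivative (cPoly (c t))).eval l)
    * (bPoly (x t)).eval l - -(l * (cPoly (c t)).eval l) * (derivative (bPoly (x t))).eval l)
      / (bPoly (x t)).eval l ^ 2 with hF'
  set Q := Icc (0 : ℝ) r ×ˢ closedBall p r with hQ
  have hsub : Q ⊆ 𝕀 ×ˢ univ := fun q hq => ⟨⟨hq.1.1, hq.1.2.trans hr1⟩, mem_univ _⟩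
  have hne : ∀ q ∈ Q, (bPoly (x q.1)).eval q.2 ≠ 0 := fun q hq => hball _ (hsub hq).1 hq.1.2 _ hq.2
  have hQc : IsCompact Q := isCompact_Icc.prod (isCompact_closedBall p r)
  have cF := ((csnd.mul cc).neg.mono hsub).div (cb.mono hsub) hne
  have cF' := ((((cc.add (csnd.mul cc')).neg.mul cb).sub ((csnd.mul cc).neg.mul cb')).mono hsub).div
      ((cb.pow 2).mono hsub) fun q hq => pow_ne_zero 2 (hne q hq)
  obtain ⟨C0, hC0⟩ := hQc.exists_bound_of_continuousOn cF
  obtain ⟨K0, hK0⟩ := hQc.exists_bound_of_continuousOn cF'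
  set L : ℝ≥0 := (max C0 0).toNNReal
  have hL : (L : ℝ) = max C0 0 := Real.coe_toNNReal _ (le_max_right _ _)
  set ε := min r (r / (L + 1)) with hε
  have hε0 : 0 < ε := by positivity
  have hεr : ε ≤ r := min_le_left _ _
  have hPL : IsPicardLindelof F (tmin := 0) (tmax := ε) ⟨0, by simp [hε0.le]⟩ p r.toNNReal 0 L
      K0.toNNReal := by
    refine ⟨fun t ht => ?_, fun l hl => ?_, fun t ht l hl => ?_, ?_⟩
    · rw [Real.coe_toNNReal _ hr.le]
      refine (convex_closedBall p r).lipschitzOnWith_of_nnnorm_hasDerivWithin_le (f' := F' t)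
        (fun l hl => HasDerivAt.hasDerivWithinAt ?_) fun l hl => ?_
      · have hl' := hne (t, l) ⟨⟨ht.1, ht.2.trans hεr⟩, hl⟩
        refine (((hasDerivAt_id l).mul ((cPoly (c t)).hasDerivAt l)).neg.div
          ((bPoly (x t)).hasDerivAt l) hl').congr_deriv ?_
        simp [hF']
      · rw [← NNReal.coe_le_coe, coe_nnnorm]
        exact (hK0 (t, l) ⟨⟨ht.1, ht.2.trans hεr⟩, hl⟩).trans (Real.le_coe_toNNReal _)
    · rw [Real.coe_toNNReal _ hr.le] at hl
      exact cF.comp (f := fun t => (t, l)) (by fun_prop) fun t ht => ⟨⟨ht.1, ht.2.trans hεr⟩, hl⟩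
    · rw [Real.coe_toNNReal _ hr.le] at hl
      rw [hL]
      exact (hC0 (t, l) ⟨⟨ht.1, ht.2.trans hεr⟩, hl⟩).trans (le_max_left _ _)
    · simp only [sub_zero, sub_self, NNReal.coe_zero]
      rw [max_eq_left hε0.le, Real.coe_toNNReal _ hr.le]
      have h1 : ε ≤ r / (L + 1) := min_le_right _ _
      rw [le_div_iff₀ (by positivity)] at h1
      nlinarith
  obtain ⟨α, hα0, hα⟩ := hPL.exists_eq_forall_mem_Icc_hasDerivWithinAt₀
  have h1 : ∀ᶠ t in 𝓝[Icc 0 ε] (0 : ℝ), α t ∈ closedBall p r := by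
    have hc := (hα 0 (left_mem_Icc.2 hε0.le)).continuousWithinAt
    refine hc.eventually_mem ?_
    rw [show α 0 = p from hα0]
    exact closedBall_mem_nhds p hr
  obtain ⟨δ, hδ, hsubδ⟩ := Metric.mem_nhdsWithin_iff.1 h1
  refine ⟨min (δ / 2) ε, ⟨by positivity, (min_le_right _ _).trans (hεr.trans hr1)⟩, α, hα0,
    fun t ht => ?_⟩
  have htε : t ∈ Icc 0 ε := ⟨ht.1, ht.2.trans (min_le_right _ _)⟩
  refine ⟨hne (t, α t) ⟨⟨ht.1, htε.2.trans hεr⟩, hsubδ ⟨?_, htε⟩⟩,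
    (hα t htε).mono (Icc_subset_Icc le_rfl (min_le_right _ _))⟩
  rw [mem_ball, Real.dist_eq, sub_zero, abs_of_nonneg ht.1]
  exact (ht.2.trans (min_le_left _ _)).trans_lt (half_lt_self hδ)

theorem IsWhithamPath.eventually_not_simple (h : IsWhithamPath x y c)
    (h0 : (aPoly (x 0)).eval p = 0) (h0' : (derivative (aPoly (x 0))).eval p = 0) :
    ∃ ε ∈ Ioc (0 : ℝ) 1, ∀ t ∈ Icc 0 ε, ∃ α, (aPoly (x t)).eval α = 0 ∧
      (derivative (aPoly (x t))).eval α = 0 := by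
  obtain ⟨ε, hε, α, hα0, hα⟩ := h.exists_characteristic (p := p)
    fun hb => (h.regular 0 (by simp)).coprime p ⟨h0, hb⟩
  refine ⟨ε, hε, fun t ht => ⟨α t, ?_⟩⟩
  have hp := h.comp (t1 := 0) (t2 := t) (by simp) ⟨ht.1, ht.2.trans hε.2⟩
  simp at hp
  have hmaps : MapsTo (fun s => s * t) 𝕀 (Icc 0 ε) := fun s hs =>
    ⟨mul_nonneg hs.1 ht.1, (mul_le_of_le_one_left ht.1 hs.2).trans ht.2⟩
  have hb : ∀ s ∈ 𝕀, (bPoly (x (s * t))).eval (α (s * t)) ≠ 0 := fun s hs => (hα _ (hmaps hs)).1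
  have hd : ∀ s ∈ 𝕀, HasDerivWithinAt (fun s => α (s * t))
      (-(α (s * t) * (cPoly (t • c (s * t))).eval (α (s * t))) / (bPoly (x (s * t))).eval (α (s * t)))
      𝕀 s := by
    intro s hs
    have h3 : HasDerivWithinAt (fun s : ℝ => s * t) t 𝕀 s := by
      simpa using (hasDerivWithinAt_id s 𝕀).mul_const t
    refine ((hα _ (hmaps hs)).2.scomp s h3 hmaps).congr_deriv ?_
    rw [cPoly_smul, eval_mul, eval_C, real_smul]
    ring
  have e0 : (aPoly (x (0 * t))).eval (α (0 * t)) = 0 := by rw [zero_mul, hα0]; exact h0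
  have e0' : (derivative (aPoly (x (0 * t)))).eval (α (0 * t)) = 0 := by
    rw [zero_mul, hα0]; exact h0'
  have r1 := hp.root hb hd e0 1 (by simp)
  have r2 := hp.double_root hb hd e0 e0' 1 (by simp)
  simp only [one_mul] at r1 r2
  exact ⟨r1, r2⟩

theorem eventually_simple {x0 : RealPair g} (h0 : (aPoly x0).eval 0 ≠ 0)
    (hs : ∀ α, (aPoly x0).eval α = 0 → (derivative (aPoly x0)).eval α ≠ 0) :
    ∀ᶠ x in 𝓝 x0, ∀ α, (aPoly x).eval α = 0 → (derivative (aPoly x)).eval α ≠ 0 := by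
  filter_upwards [eventually_roots_eq h0 hs one_pos] with x ⟨hx0, β, _, hnd, _⟩ α hα
  exact simple_of_nodup_roots (natDegree_aPoly_eq hx0).2 hnd hα

theorem IsWhithamPath.simple (h : IsWhithamPath x y c)
    (h0 : ∀ α, (aPoly (x 0)).eval α = 0 → (derivative (aPoly (x 0))).eval α ≠ 0) :
    ∀ t ∈ 𝕀, ∀ α, (aPoly (x t)).eval α = 0 → (derivative (aPoly (x t))).eval α ≠ 0 := by
  refine forall_mem_Icc_of_isOpen_isClosed h0 (fun t ht hs => ?_) fun t ht hs => ?_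
  · exact (h.cont_x t ht).eventually (eventually_simple (h.regular t ht).a_zero_ne hs)
  · by_contra! hcon
    obtain ⟨p, hp, hp'⟩ := hcon
    have hc := h.comp (t2 := 0) (Ioc_subset_Icc_self ht) (by simp)
    obtain ⟨ε, hε, hε'⟩ := hc.eventually_not_simple (by simpa using hp) (by simpa using hp')
    obtain ⟨α, h1, h2⟩ := hε' ε (right_mem_Icc.2 hε.1.le)
    refine hs _ ⟨?_, ?_⟩ α h1 h2 <;> nlinarith [hε.1, hε.2, ht.1]

theorem exists_real_eq_div_pow (x : RealPair g) (hl : ‖l‖ = 1) :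
    ∃ r : ℝ, (aPoly x).eval l / l ^ g = r := by
  have hl0 : l ≠ 0 := by rintro rfl; simp at hl
  have hcl : (conj l)⁻¹ = l := by rw [inv_eq_iff_eq_inv, ← inv_eq_conj hl]
  have h1 := aPoly_reflect x hl0
  rw [hcl] at h1
  refine ⟨((aPoly x).eval l / l ^ g).re, (conj_eq_iff_re.1 ?_).symm⟩
  rw [map_div₀, map_pow, ← inv_eq_conj hl, inv_pow, div_inv_eq_mul, eq_div_iff (pow_ne_zero _ hl0)]
  conv_rhs => rw [h1]
  ring

theorem IsWhithamPath.neg (h : IsWhithamPath x y c)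
    (h0 : ∀ α, (aPoly (x 0)).eval α = 0 → (derivative (aPoly (x 0))).eval α ≠ 0)
    (hn : ∀ l : ℂ, ‖l‖ = 1 → ∃ r : ℝ, r < 0 ∧ (aPoly (x 0)).eval l / l ^ g = r) :
    ∀ t ∈ 𝕀, ∀ l : ℂ, ‖l‖ = 1 → ∃ r : ℝ, r < 0 ∧ (aPoly (x t)).eval l / l ^ g = r := by
  set φ : ℝ × ℂ → ℝ := fun q => ((aPoly (x q.1)).eval q.2 / q.2 ^ g).re with hφ
  have hS0 : ∀ l ∈ sphere (0 : ℂ) 1, l ≠ 0 := by rintro l hl rfl; simp at hl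
  have hc : ContinuousOn φ (𝕀 ×ˢ sphere (0 : ℂ) 1) := by
    refine continuous_re.comp_continuousOn (ContinuousOn.div ?_ (by fun_prop) ?_)
    · exact continuousOn_polyOf_eval ((continuous_aCoeff.comp_continuousOn h.cont_x).comp
        continuous_fst.continuousOn fun q hq => hq.1) continuous_snd.continuousOn
    · exact fun q hq => pow_ne_zero _ (hS0 _ hq.2)
  have key : ∀ t ∈ 𝕀, ∀ l ∈ sphere (0 : ℂ) 1, φ (t, l) < 0 := by
    refine forall_mem_Icc_of_isOpen_isClosed (fun l hl => ?_) (fun t ht hs => ?_) fun t ht hs => ?_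
    · obtain ⟨r, hr, e⟩ := hn l (by simpa using hl)
      simp_all
    · have := (isCompact_sphere 0 1).eventually_forall_of_forall_eventually (x₀ := t)
        (P := fun s l => s ∈ 𝕀 → l ∈ sphere 0 1 → φ (s, l) < 0) fun l hl => ?_
      · exact eventually_nhdsWithin_iff.2 (this.mono fun s h1 hs l hl => h1 l hl hs hl)
      · have h1 := (hc (t, l) ⟨ht, hl⟩).eventually_lt_const (hs l hl)
        exact (eventually_nhdsWithin_iff.1 h1).mono fun q h1 h2 h3 => h1 ⟨h2, h3⟩
    · have htI := Ioc_subset_Icc_self ht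
      have hle : ∀ l ∈ sphere (0 : ℂ) 1, φ (t, l) ≤ 0 := by
        intro l hl
        have h1 := (hc (t, l) ⟨htI, hl⟩).comp (f := fun s : ℝ => (s, l)) (by fun_prop) fun s hs => ⟨hs, hl⟩
        have h2 : ContinuousWithinAt (fun s => φ (s, l)) (Ico 0 t) t :=
          h1.mono fun s hs => ⟨hs.1, hs.2.le.trans ht.2⟩
        have : (𝓝[Ico 0 t] t).NeBot := by
          rw [← mem_closure_iff_nhdsWithin_neBot, closure_Ico ht.1.ne]
          exact right_mem_Icc.2 ht.1.le
        refine le_of_tendsto h2 ?_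
        filter_upwards [self_mem_nhdsWithin] with s hs' using (hs s hs' l hl).le
      intro l hl
      refine lt_of_le_of_ne (hle l hl) fun h0' => ?_
      have hl1 : ‖l‖ = 1 := by simpa using hl
      refine eval_ne_zero_of_nonpos (g := g) (h.simple h0 t htI) (fun w hw => ?_) hl1 ?_
      · obtain ⟨r, hr⟩ := exists_real_eq_div_pow (x t) hw
        refine ⟨r, ?_, hr⟩
        have := hle w (by simpa using hw)
        simp only [hφ, hr] at this
        simpa using this
      · obtain ⟨r, hr⟩ := exists_real_eq_div_pow (x t) hl1
        simp only [hφ, hr, ofReal_re] at h0'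
        rw [h0', ofReal_zero, div_eq_zero_iff] at hr
        exact hr.resolve_right (pow_ne_zero _ (hS0 l hl))
  intro t ht l hl
  obtain ⟨r, hr⟩ := exists_real_eq_div_pow (x t) hl
  refine ⟨r, ?_, hr⟩
  have := key t ht l (by simpa using hl)
  simp only [hφ, hr] at this
  simpa using this

theorem IsWhithamVector.eval_zero {x y : RealPair g} {c : RealPoly g} (hx : IsRegular x)
    (h : IsWhithamVector x c y) :
    ∃ r : ℝ, (aPoly y).eval 0 = r * I * (aPoly x).eval 0 ∧
      2 * (bPoly y).eval 0 = (bPoly x).eval 0 * (r * I) - (cPoly c).eval 0 := by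
  have ha := hx.a_zero_ne
  have hq : ((aPoly y).eval 0 / (aPoly x).eval 0).re = 0 := by
    rw [div_eq_mul_inv, inv_def, ← mul_assoc, re_mul_ofReal, h.2, zero_mul]
  have e : (((aPoly y).eval 0 / (aPoly x).eval 0).im : ℂ) * I =
      (aPoly y).eval 0 / (aPoly x).eval 0 := ext (by simp [hq]) (by simp)
  refine ⟨((aPoly y).eval 0 / (aPoly x).eval 0).im, ?_, ?_⟩
  · rw [e, div_mul_cancel₀ _ ha]
  · rw [e]
    have h1 := h.eval 0
    field_simp
    linear_combination -h1

theorem IsWhithamPath.hasDerivWithinAt_a (h : IsWhithamPath x y c) (l : ℂ) (ht : t ∈ 𝕀) :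
    HasDerivWithinAt (fun t => (aPoly (x t)).eval l) ((aPoly (y t)).eval l) 𝕀 t := by
  have hx := (((ContinuousLinearMap.fst ℝ _ _).comp (RealPair g).subtypeL).hasFDerivAt).comp_hasDerivWithinAt t
      (h.deriv t ht)
  refine (hasDerivWithinAt_polyOf_eval hx (hasDerivWithinAt_const t _ l)).congr_deriv ?_
  rw [mul_zero, add_zero]; rfl

theorem IsWhithamPath.hasDerivWithinAt_b (h : IsWhithamPath x y c) (l : ℂ) (ht : t ∈ 𝕀) :
    HasDerivWithinAt (fun t => (bPoly (x t)).eval l) ((bPoly (y t)).eval l) 𝕀 t := by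
  have hx := (((ContinuousLinearMap.snd ℝ _ _).comp (RealPair g).subtypeL).hasFDerivAt).comp_hasDerivWithinAt t
      (h.deriv t ht)
  refine (hasDerivWithinAt_polyOf_eval hx (hasDerivWithinAt_const t _ l)).congr_deriv ?_
  rw [mul_zero, add_zero]; rfl

theorem IsWhithamPath.norm_a_zero (h : IsWhithamPath x y c) :
    ∀ t ∈ 𝕀, ‖(aPoly (x t)).eval 0‖ = ‖(aPoly (x 0)).eval 0‖ := by
  intro t ht
  have hd : ∀ t ∈ 𝕀, HasDerivWithinAt (fun t => ‖(aPoly (x t)).eval 0‖ ^ 2) 0 𝕀 t := by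
    intro t ht
    refine (h.hasDerivWithinAt_a 0 ht).norm_sq.congr_deriv ?_
    rw [Complex.inner, (h.whitham t ht).2, mul_zero]
  have h1 := constant_of_derivWithin_zero (f := fun t => ‖(aPoly (x t)).eval 0‖ ^ 2)
    (fun t ht => (hd t ht).differentiableWithinAt)
    (fun t ht => (hd t (Ico_subset_Icc_self ht)).derivWithin (uniqueDiffOn_Icc_zero_one t
      (Ico_subset_Icc_self ht))) t ht
  exact (sq_eq_sq₀ (norm_nonneg _) (norm_nonneg _)).1 h1

theorem IsWhithamPath.b_zero (h : IsWhithamPath x y c)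
    (h0 : ∃ r : ℝ, r < 0 ∧ (bPoly (x 0)).eval 0 ^ 2 / (aPoly (x 0)).eval 0 = r) :
    ∀ t ∈ 𝕀, ∃ r : ℝ, r < 0 ∧ (bPoly (x t)).eval 0 ^ 2 / (aPoly (x t)).eval 0 = r := by
  set m : ℝ → ℝ := fun t => -((cPoly (c t)).eval 0 / (bPoly (x t)).eval 0).re with hm
  have cc : ContinuousOn (fun t => (cPoly (c t)).eval 0) 𝕀 := continuousOn_polyOf_eval
    (continuous_cCoeff.comp_continuousOn h.cont_c) continuousOn_const
  have cb := (continuous_bPoly_eval 0).comp_continuousOn h.cont_x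
  have hmc : ContinuousOn m 𝕀 := (continuous_re.comp_continuousOn
    (cc.div cb fun t ht => (h.regular t ht).b_zero_ne)).neg
  obtain ⟨p, hp, hpt⟩ := eq_exp_smul_of_deriv hmc
    (u := fun t => (bPoly (x t)).eval 0 ^ 2 / (aPoly (x t)).eval 0) (fun t ht => by
      have ha := (h.regular t ht).a_zero_ne
      refine (((h.hasDerivWithinAt_b 0 ht).pow 2).div (h.hasDerivWithinAt_a 0 ht) ha).congr_deriv ?_
      obtain ⟨r, e1, e2⟩ := (h.whitham t ht).eval_zero (h.regular t ht)
      have e3 : (m t : ℂ) = -((cPoly (c t)).eval 0 / (bPoly (x t)).eval 0) :=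
        ext (by simp [hm]) (by simp [h.c_im t ht])
      simp
      rw [e3, e1]
      field_simp
      linear_combination (bPoly (x t)).eval 0 * e2)
  intro t ht
  obtain ⟨r, hr, e⟩ := h0
  refine ⟨p t * r, mul_neg_of_pos_of_neg (hp t) hr, ?_⟩
  rw [hpt t ht, e, real_smul, ofReal_mul]

end Path

section Transport

/-- The linear map `(k, f) ↦ (p f, q k + r f)`. -/
def transportMap (p q r : ℂ) : ℂ × ℂ →L[ℂ] ℂ × ℂ :=
  p • (ContinuousLinearMap.inl ℂ ℂ ℂ ∘L ContinuousLinearMap.snd ℂ ℂ ℂ)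
    + q • (ContinuousLinearMap.inr ℂ ℂ ℂ ∘L ContinuousLinearMap.fst ℂ ℂ ℂ)
    + r • (ContinuousLinearMap.inr ℂ ℂ ℂ ∘L ContinuousLinearMap.snd ℂ ℂ ℂ)

theorem transportMap_apply (p q r : ℂ) (v : ℂ × ℂ) :
    transportMap p q r v = (p * v.2, q * v.1 + r * v.2) := by
  ext <;> simp [transportMap]

theorem continuousOn_transportMap {X : Type*} [TopologicalSpace X] {p q r : X → ℂ} {S : Set X}
    (hp : ContinuousOn p S) (hq : ContinuousOn q S) (hr : ContinuousOn r S) :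
    ContinuousOn (fun t => transportMap (p t) (q t) (r t)) S :=
  ((hp.smul continuousOn_const).add (hq.smul continuousOn_const)).add (hr.smul continuousOn_const)

theorem hasDerivAt_transportMap {p q r : ℂ → ℂ} {p' q' r' l : ℂ} (hp : HasDerivAt p p' l)
    (hq : HasDerivAt q q' l) (hr : HasDerivAt r r' l) :
    HasDerivAt (fun t => transportMap (p t) (q t) (r t)) (transportMap p' q' r') l :=
  ((hp.smul_const _).add (hq.smul_const _)).add (hr.smul_const _)

variable {x y : ℝ → RealPair g} {c : ℝ → RealPoly g}

theorem IsWhithamPath.exists_transport (h : IsWhithamPath x y c) (hU : IsOpen U)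
    (h0 : ∀ l ∈ U, l ≠ 0) (ha : ∀ t ∈ 𝕀, ∀ l ∈ U, (aPoly (x t)).eval l ≠ 0)
    {k0 f0 : ℂ → ℂ} (hp : IsPellPair (aPoly (x 0)) (bPoly (x 0)) U k0 f0) :
    ∃ k f, IsPellPair (aPoly (x 1)) (bPoly (x 1)) U k f ∧ (1 ∈ U → f0 1 = 0 → f 1 = 0) := by
  set L : ℝ → ℂ → ℂ × ℂ →L[ℂ] ℂ × ℂ := fun t l => transportMap ((cPoly (c t)).eval l / l)
    ((cPoly (c t)).eval l / (aPoly (x t)).eval l)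
    (-((aPoly (y t)).eval l / (2 * (aPoly (x t)).eval l))) with hL
  set L' : ℝ → ℂ → ℂ × ℂ →L[ℂ] ℂ × ℂ := fun t l => transportMap
    (((derivative (cPoly (c t))).eval l * l - (cPoly (c t)).eval l) / l ^ 2)
    (((derivative (cPoly (c t))).eval l * (aPoly (x t)).eval l
      - (cPoly (c t)).eval l * (derivative (aPoly (x t))).eval l) / (aPoly (x t)).eval l ^ 2)
    (-(((derivative (aPoly (y t))).eval l * (2 * (aPoly (x t)).eval l)
      - (aPoly (y t)).eval l * (2 * (derivative (aPoly (x t))).eval l))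
        / (2 * (aPoly (x t)).eval l) ^ 2)) with hL'
  have m1 : MapsTo Prod.fst (𝕀 ×ˢ U) 𝕀 := fun q hq => hq.1
  have cfst : ContinuousOn Prod.fst (𝕀 ×ˢ U) := continuous_fst.continuousOn
  have csnd : ContinuousOn Prod.snd (𝕀 ×ˢ U) := continuous_snd.continuousOn
  have cax := (continuous_aCoeff.comp_continuousOn h.cont_x).comp cfst m1
  have cay := (continuous_aCoeff.comp_continuousOn h.cont_y).comp cfst m1
  have ccc := (continuous_cCoeff.comp_continuousOn h.cont_c).comp cfst m1
  have ca := continuousOn_polyOf_eval cax csnd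
  have ca' := continuousOn_polyOf_derivative_eval cax csnd
  have cy := continuousOn_polyOf_eval cay csnd
  have cy' := continuousOn_polyOf_derivative_eval cay csnd
  have cc := continuousOn_polyOf_eval ccc csnd
  have cc' := continuousOn_polyOf_derivative_eval ccc csnd
  have hLcont := continuousOn_transportMap (cc.div csnd fun q hq => h0 _ hq.2)
      (cc.div ca fun q hq => ha _ hq.1 _ hq.2)
      ((cy.div (continuousOn_const.mul ca)
        fun q hq => mul_ne_zero two_ne_zero (ha _ hq.1 _ hq.2)).neg)
  have hL'cont : ContinuousOn (fun p => L' p.1 p.2) (Icc 0 1 ×ˢ U) :=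
    continuousOn_transportMap (((cc'.mul csnd).sub cc).div (csnd.pow 2)
        fun q hq => pow_ne_zero 2 (h0 _ hq.2))
      (((cc'.mul ca).sub (cc.mul ca')).div (ca.pow 2) fun q hq => pow_ne_zero 2 (ha _ hq.1 _ hq.2))
      ((((cy'.mul (continuousOn_const.mul ca)).sub (cy.mul (continuousOn_const.mul ca'))).div
        ((continuousOn_const.mul ca).pow 2)
        fun q hq => pow_ne_zero 2 (mul_ne_zero two_ne_zero (ha _ hq.1 _ hq.2))).neg)
  have hLc := fun l hl => hLcont.comp (f := fun s => (s, l)) (by fun_prop) fun s hs => ⟨hs, hl⟩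
  have hLd : ∀ s ∈ 𝕀, ∀ l ∈ U, HasDerivAt (L s) (L' s l) l := by
    intro s hs l hl
    refine hasDerivAt_transportMap ?_ (((cPoly (c s)).hasDerivAt l).div
      ((aPoly (x s)).hasDerivAt l) (ha s hs l hl)) ((((aPoly (y s)).hasDerivAt l).div
      (((aPoly (x s)).hasDerivAt l).const_mul 2) (mul_ne_zero two_ne_zero (ha s hs l hl))).neg)
    refine (((cPoly (c s)).hasDerivAt l).div (hasDerivAt_id l) (h0 l hl)).congr_deriv ?_
    simp
  have hex : ∀ l ∈ U, ∃ u, u 0 = (k0 l, f0 l) ∧ SolvesOn (fun s v => L s l v) u := by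
    intro l hl
    obtain ⟨u, hu0, hu⟩ := exists_solvesOn_linear (fun s => (L s l).restrictScalars ℝ)
      ((ContinuousLinearMap.restrictScalarsL ℂ (ℂ × ℂ) (ℂ × ℂ) ℝ ℝ).continuous.comp_continuousOn
        (hLc l hl)) (k0 l, f0 l)
    exact ⟨u, hu0, hu⟩
  choose! u hu0 hu using hex
  have dk : ∀ l ∈ U, ∀ t ∈ 𝕀, HasDerivWithinAt (fun t => (u l t).1)
      ((cPoly (c t)).eval l / l * (u l t).2) 𝕀 t := by
    intro l hl t ht
    have := (ContinuousLinearMap.fst ℝ ℂ ℂ).hasFDerivAt.comp_hasDerivWithinAt t (hu l hl t ht)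
    refine this.congr_deriv ?_
    simp [hL, transportMap_apply]
  have df : ∀ l ∈ U, ∀ t ∈ 𝕀, HasDerivWithinAt (fun t => (u l t).2)
      ((cPoly (c t)).eval l / (aPoly (x t)).eval l * (u l t).1 +
        -((aPoly (y t)).eval l / (2 * (aPoly (x t)).eval l)) * (u l t).2) 𝕀 t := by
    intro l hl t ht
    have := (ContinuousLinearMap.snd ℝ ℂ ℂ).hasFDerivAt.comp_hasDerivWithinAt t (hu l hl t ht)
    refine this.congr_deriv ?_
    simp [hL, transportMap_apply]
  set D : ℂ → ℝ → ℂ × ℂ := fun l t => ((u l t).2 * (bPoly (x t)).eval l / l ^ 2,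
    (2 * (u l t).1 * (bPoly (x t)).eval l - (u l t).2 *
      (l * (derivative (aPoly (x t))).eval l - (aPoly (x t)).eval l)) /
        (2 * l * (aPoly (x t)).eval l)) with hD
  have hDs : ∀ l ∈ U, SolvesOn (fun s v => L s l v + L' s l (u l s)) (D l) := by
    intro l hl t ht
    have hl0 := h0 l hl
    have hat := ha t ht l hl
    have hb := h.hasDerivWithinAt_b l ht
    have hA := h.hasDerivWithinAt_a l ht
    have hA' : HasDerivWithinAt (fun t => (derivative (aPoly (x t))).eval l)
        ((derivative (aPoly (y t))).eval l) 𝕀 t := by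
      have hx := (((ContinuousLinearMap.fst ℝ _ _).comp
          (RealPair g).subtypeL).hasFDerivAt).comp_hasDerivWithinAt t (h.deriv t ht)
      refine (hasDerivWithinAt_polyOf_derivative_eval hx
        (hasDerivWithinAt_const t _ l)).congr_deriv ?_
      rw [mul_zero, add_zero]; rfl
    have e := (h.whitham t ht).eval l
    have h1 := ((df l hl t ht).mul hb).div_const (l ^ 2)
    have h2 := ((((dk l hl t ht).const_mul 2).mul hb).sub ((df l hl t ht).mul
      ((hA'.const_mul l).sub hA))).div (hA.const_mul (2 * l))
        (mul_ne_zero (mul_ne_zero two_ne_zero hl0) hat)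
    refine (h1.prodMk h2).congr_deriv ?_
    simp only [hL, hL', hD, transportMap_apply, Prod.mk_add_mk, Prod.mk.injEq]
    constructor
    · field_simp
      linear_combination (-(u l t).2) * e
    · simp
      field_simp
      linear_combination (-2 * l * (u l t).1) * e
  have hder : ∀ l ∈ U, HasDerivAt (fun l => u l 1) (D l 1) l := by
    intro l hl
    refine hasDerivAt_of_linear_ode hU hLd hLc hL'cont hu hl (hDs l hl) ?_ 1 (by simp)
    have e : (fun l => u l 0) =ᶠ[𝓝 l] fun l => (k0 l, f0 l) := by
      filter_upwards [hU.mem_nhds hl] with w hw using hu0 w hw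
    refine HasDerivAt.congr_of_eventuallyEq ?_ e
    have h1 := (hp.diff_k.differentiableAt (hU.mem_nhds hl)).hasDerivAt
    have h2 := (hp.diff_f.differentiableAt (hU.mem_nhds hl)).hasDerivAt
    refine (h1.prodMk h2).congr_deriv ?_
    have hl0 := h0 l hl
    have hat := ha 0 (by simp) l hl
    simp only [hD, hu0 l hl, Prod.mk.injEq]
    constructor
    · rw [eq_div_iff (pow_ne_zero 2 hl0), ← hp.deriv_k l hl]; ring
    · rw [eq_div_iff (mul_ne_zero (mul_ne_zero two_ne_zero hl0) hat), ← hp.deriv_f l hl]; ring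
  have hk' : ∀ l ∈ U, HasDerivAt (fun l => (u l 1).1) (D l 1).1 l := fun l hl =>
    (ContinuousLinearMap.fst ℂ ℂ ℂ).hasFDerivAt.comp_hasDerivAt l (hder l hl)
  have hf' : ∀ l ∈ U, HasDerivAt (fun l => (u l 1).2) (D l 1).2 l := fun l hl =>
    (ContinuousLinearMap.snd ℂ ℂ ℂ).hasFDerivAt.comp_hasDerivAt l (hder l hl)
  refine ⟨fun l => (u l 1).1, fun l => (u l 1).2, ⟨fun l hl =>
    (hk' l hl).differentiableAt.differentiableWithinAt, fun l hl =>
    (hf' l hl).differentiableAt.differentiableWithinAt, fun l hl => ?_, fun l hl => ?_,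
    fun l hl => ?_⟩, fun h1 hf1 => ?_⟩
  · have hd : ∀ t ∈ 𝕀, HasDerivWithinAt (fun t => l * (u l t).1 ^ 2 -
        (u l t).2 ^ 2 * (aPoly (x t)).eval l) 0 𝕀 t := by
      intro t ht
      have hl0 := h0 l hl
      have hat := ha t ht l hl
      refine ((((dk l hl t ht).pow 2).const_mul l).sub (((df l hl t ht).pow 2).mul
        (h.hasDerivWithinAt_a l ht))).congr_deriv ?_
      simp
      field_simp
      ring
    have h1 := constant_of_derivWithin_zero (fun t ht => (hd t ht).differentiableWithinAt)
      (fun t ht => (hd t (Ico_subset_Icc_self ht)).derivWithin (uniqueDiffOn_Icc_zero_one t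
        (Ico_subset_Icc_self ht))) 1 (by simp)
    rw [h1, hu0 l hl]
    exact hp.pell l hl
  · rw [(hk' l hl).deriv]
    exact mul_div_cancel₀ _ (pow_ne_zero 2 (h0 l hl))
  · rw [(hf' l hl).deriv]
    exact mul_div_cancel₀ _ (mul_ne_zero (mul_ne_zero two_ne_zero (h0 l hl)) (ha 1 (by simp) l hl))
  · have hl1 := hLc 1 h1
    refine eq_zero_of_deriv_eq_mul (m := fun t => -((aPoly (y t)).eval 1 /
      (2 * (aPoly (x t)).eval 1))) (u := fun t => (u 1 t).2) ?_ (fun t ht => ?_) ?_ 1 (by simp)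
    · have c1 := (continuous_aPoly_eval 1).comp_continuousOn h.cont_y
      have c2 := (continuous_aPoly_eval 1).comp_continuousOn h.cont_x
      exact (c1.div (continuousOn_const.mul c2)
        fun t ht => mul_ne_zero two_ne_zero (ha t ht 1 h1)).neg
    · refine (df 1 h1 t ht).congr_deriv ?_
      rw [h.c_one t ht]; ring
    · rw [hu0 1 h1]; exact hf1

end Transport

section Extension

variable {k f : ℂ → ℂ} {r R : ℝ}

/-- The complement of `0` and of closed discs around the roots of `a`. -/
def awayFromRoots (a : ℂ[X]) (r : ℝ) : Set ℂ := {l | l ≠ 0 ∧ ∀ α, a.eval α = 0 → r < ‖l - α‖}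

theorem isOpen_awayFromRoots (ha : a ≠ 0) (r : ℝ) : IsOpen (awayFromRoots a r) := by
  have e : awayFromRoots a r = {0}ᶜ ∩ (⋃ α ∈ {α | a.eval α = 0}, {l : ℂ | ‖l - α‖ ≤ r})ᶜ := by
    ext l; simp [awayFromRoots]
  rw [e]
  exact isOpen_compl_singleton.inter ((finite_setOf_eval_eq_zero ha).isClosed_biUnion fun α _ =>
    isClosed_le (by fun_prop) continuous_const).isOpen_compl

theorem IsPellPair.exists_local_extension (ha : a ≠ 0) (hr : 0 < r) (hrR : r < R)
    (hp : IsPellPair a b (awayFromRoots a r) k f) (h0 : ∀ α, a.eval α = 0 → R ≤ ‖α‖)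
    (hsep : ∀ α β, a.eval α = 0 → a.eval β = 0 → α ≠ β → 2 * R ≤ ‖α - β‖)
    (hα : a.eval α = 0) (hs : (derivative a).eval α ≠ 0) :
    ∃ k1 f1, IsPellPair a b (ball α R) k1 f1 ∧
      ∀ l ∈ awayFromRoots a r, ‖l - α‖ < R → k l = k1 l ∧ f l = f1 l := by
  have hR : 0 < R := hr.trans hrR
  obtain ⟨u, hu⟩ := dvd_iff_isRoot.2 (show a.IsRoot α from hα)
  have hconv : StarConvex ℝ α (ball α R) := (convex_ball α R).starConvex (mem_ball_self hR)
  have hl0 : ∀ l ∈ ball α R, l ≠ 0 := by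
    rintro l hl rfl
    rw [mem_ball, dist_eq_norm, zero_sub, norm_neg] at hl
    exact absurd (h0 α hα) (not_le.2 hl)
  have hu0 : ∀ l ∈ ball α R, u.eval l ≠ 0 := by
    intro l hl h
    have hal : a.eval l = 0 := by rw [hu, eval_mul, h, mul_zero]
    by_cases e : l = α
    · apply hs; rw [hu]; simp [← e, h]
    · have := hsep l α hal hα e
      rw [mem_ball, dist_eq_norm] at hl
      linarith
  obtain ⟨k1, f1, h₁⟩ := exists_pellPair_of_starConvex (b := b) isOpen_ball hconv
    (mem_ball_self hR) hu fun l hl => ⟨hl0 l hl, hu0 l hl⟩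
  obtain ⟨v, hv, hvsq⟩ := exists_sq_eq isOpen_ball hconv (mem_ball_self hR)
    (q := fun l => u.eval l / l)
    (u.differentiable.differentiableOn.div differentiableOn_id hl0)
    (fun l hl => div_ne_zero (hu0 l hl) (hl0 l hl))
  set A := ball α R ∩ (closedBall α r)ᶜ with hA
  have hAO : IsOpen A := isOpen_ball.inter isClosed_closedBall.isOpen_compl
  have hmemA : ∀ {l}, l ∈ A ↔ ‖l - α‖ < R ∧ r < ‖l - α‖ := by intro l; simp [hA, dist_eq_norm]
  have hAsub : A ⊆ awayFromRoots a r := by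
    intro l hl
    refine ⟨hl0 l hl.1, fun β hβ => ?_⟩
    have h1 := hmemA.1 hl
    by_cases e : β = α
    · rw [e]; exact h1.2
    · have h2 := hsep β α hβ hα e
      have h3 : ‖β - α‖ ≤ ‖l - α‖ + ‖l - β‖ := by
        rw [show β - α = (l - α) - (l - β) by ring]; exact norm_sub_le _ _
      linarith
  set ε := (r + R) / 2 with hε
  have hε0 : 0 < ε := by positivity
  have hsph : sphere α ε ⊆ A := by
    intro l hl
    rw [mem_sphere, dist_eq_norm] at hl
    rw [hmemA, hl]; constructor <;> linarith
  have hconn : IsPreconnected A := by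
    refine isPreconnected_of_radial hε0 hsph (fun h => ?_) fun y hy t ht => ?_
    · have := (hmemA.1 h).2; rw [sub_self, norm_zero] at this; linarith
    · have hy' := hmemA.1 hy
      have hy0 : 0 < ‖y - α‖ := hr.trans hy'.2
      rw [hmemA, add_sub_cancel_left, norm_mul, norm_real, Real.norm_eq_abs]
      have h1 : min 1 (ε / ‖y - α‖) ≤ t := ht.1
      have h2 : t ≤ max 1 (ε / ‖y - α‖) := ht.2
      have hpos : 0 < ε / ‖y - α‖ := by positivity
      rw [abs_of_nonneg ((le_min zero_le_one hpos.le).trans h1)]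
      have e3 : ε / ‖y - α‖ * ‖y - α‖ = ε := div_mul_cancel₀ _ hy0.ne'
      constructor
      · rcases le_max_iff.1 h2 with h | h
        · nlinarith
        · nlinarith
      · rcases min_le_iff.1 h1 with h | h
        · nlinarith
        · nlinarith
  have hpA := hp.mono hAsub
  have h1A := h₁.mono (inter_subset_left : A ⊆ ball α R)
  have hA0 : ∀ l ∈ A, l ≠ 0 := fun l hl => hl0 l hl.1
  obtain ⟨p, hp1, hp2⟩ := hpA.exists_const hAO hconn hA0 h1A
  have hpsq : p ^ 2 - 1 = 0 := by
    refine eq_zero_of_sq_eq_on_sphere hε0 (p := α)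
      (R := fun l => (f l * k1 l - k l * f1 l) * v l * (l - α)) ?_ fun l hl => ?_
    · have c1 := hpA.diff_k.continuousOn.mono hsph
      have c2 := hpA.diff_f.continuousOn.mono hsph
      have c3 := h1A.diff_k.continuousOn.mono hsph
      have c4 := h1A.diff_f.continuousOn.mono hsph
      have c5 := hv.continuousOn.mono (hsph.trans inter_subset_left)
      fun_prop
    · have e1 := hp2 l (hsph hl)
      have e2 := hvsq l (hsph hl).1
      have e3 := hl0 l (hsph hl).1
      rw [eq_div_iff e3] at e2
      rw [hu, eval_mul, eval_sub, eval_X, eval_C] at e1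
      rw [← mul_left_inj' e3]
      linear_combination (f l * k1 l - k l * f1 l) ^ 2 * (l - α) ^ 2 * e2 + (l - α) * e1
  have hp1' : p ^ 2 = 1 := sub_eq_zero.1 hpsq
  have heq := hpA.eq_smul ha hAO hA0 h1A hp1 hp2 hp1'
  rcases sq_eq_sq_iff_eq_or_eq_neg.1 (hp1'.trans (one_pow 2).symm) with rfl | rfl
  · refine ⟨k1, f1, h₁, fun l hl hlR => ?_⟩
    have := heq l (hmemA.2 ⟨hlR, hl.2 α hα⟩)
    simpa using this
  · refine ⟨_, _, h₁.neg, fun l hl hlR => ?_⟩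
    have := heq l (hmemA.2 ⟨hlR, hl.2 α hα⟩)
    simpa using this

theorem IsPellPair.exists_extension (ha : a ≠ 0) (hr : 0 < r) (hrR : r < R)
    (hp : IsPellPair a b (awayFromRoots a r) k f) (h0 : ∀ α, a.eval α = 0 → R ≤ ‖α‖)
    (hsep : ∀ α β, a.eval α = 0 → a.eval β = 0 → α ≠ β → 2 * R ≤ ‖α - β‖)
    (hs : ∀ α, a.eval α = 0 → (derivative a).eval α ≠ 0) :
    ∃ k2 f2, IsPellPair a b {0}ᶜ k2 f2 ∧ ∀ l ∈ awayFromRoots a r, k2 l = k l ∧ f2 l = f l := by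
  have hloc := fun α (hα : a.eval α = 0) => hp.exists_local_extension ha hr hrR h0 hsep hα (hs α hα)
  choose! k1 f1 h₁ heq using hloc
  classical
  let P : ℂ → Prop := fun l => ∃ α, a.eval α = 0 ∧ ‖l - α‖ < R
  let k2 : ℂ → ℂ := fun l => if h : P l then k1 h.choose l else k l
  let f2 : ℂ → ℂ := fun l => if h : P l then f1 h.choose l else f l
  have hin : ∀ α l, a.eval α = 0 → ‖l - α‖ < R → k2 l = k1 α l ∧ f2 l = f1 α l := by
    intro α l hα hl
    have h : P l := ⟨α, hα, hl⟩
    have e : h.choose = α := by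
      by_contra hne
      have h1 := hsep _ α h.choose_spec.1 hα hne
      have h2 := h.choose_spec.2
      have h3 : ‖h.choose - α‖ ≤ ‖l - α‖ + ‖l - h.choose‖ := by
        rw [show h.choose - α = (l - α) - (l - h.choose) by ring]; exact norm_sub_le _ _
      linarith
    simp only [k2, f2, dif_pos h, e, and_self]
  have hout : ∀ l ∈ awayFromRoots a r, k2 l = k l ∧ f2 l = f l := by
    intro l hl
    by_cases h : P l
    · obtain ⟨α, hα, hlα⟩ := h
      rw [(hin α l hα hlα).1, (hin α l hα hlα).2, (heq α hα l hl hlα).1, (heq α hα l hl hlα).2]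
      simp
    · simp only [k2, f2, dif_neg h, and_self]
  refine ⟨k2, f2, IsPellPair.of_nhds fun l hl => ?_, hout⟩
  by_cases h : P l
  · obtain ⟨α, hα, hlα⟩ := h
    exact ⟨ball α R, isOpen_ball, by rwa [mem_ball, dist_eq_norm], k1 α, f1 α, h₁ α hα,
      fun w hw => (hin α w hα (by rwa [← dist_eq_norm])).1,
      fun w hw => (hin α w hα (by rwa [← dist_eq_norm])).2⟩
  · refine ⟨awayFromRoots a r, isOpen_awayFromRoots ha r, ⟨hl, fun α hα => ?_⟩, k, f, hp,
      fun w hw => (hout w hw).1, fun w hw => (hout w hw).2⟩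
    have : ¬‖l - α‖ < R := fun h' => h ⟨α, hα, h'⟩
    linarith

end Extension

section Flow

variable {x y : ℝ → RealPair g} {c : ℝ → RealPoly g}

def HasPell (x : RealPair g) : Prop :=
  ∃ k f : ℂ → ℂ, IsPellPair (aPoly x) (bPoly x) {0}ᶜ k f ∧ f 1 = 0

theorem IsWhithamPath.exists_hasPell_iff (h : IsWhithamPath x y c) {t0 : ℝ} (ht0 : t0 ∈ 𝕀)
    (hs : ∀ t ∈ 𝕀, ∀ α, (aPoly (x t)).eval α = 0 → (derivative (aPoly (x t))).eval α ≠ 0)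
    (h1 : (aPoly (x t0)).eval 1 ≠ 0) :
    ∃ δ > 0, ∀ t1 ∈ 𝕀 ∩ ball t0 δ, ∀ t2 ∈ 𝕀 ∩ ball t0 δ, HasPell (x t1) → HasPell (x t2) := by
  have ha0 := (h.regular t0 ht0).a_zero_ne
  have ha := (h.regular t0 ht0).a_ne
  obtain ⟨R, hR, hR0⟩ : ∃ R > 0, ∀ α, (aPoly (x t0)).eval α = 0 → 4 * R < ‖α‖ ∧
      4 * R < ‖1 - α‖ ∧ ∀ β, (aPoly (x t0)).eval β = 0 → α ≠ β → 4 * R < ‖α - β‖ := by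
    have hfin := finite_setOf_eval_eq_zero ha
    have hpos : ∀ q : ℝ, 0 < q → ∀ᶠ R in 𝓝[>] 0, 4 * R < q := by
      intro q hq
      filter_upwards [Ioo_mem_nhdsGT (show 0 < q / 4 by positivity)] with R hR
      linarith [hR.2]
    have : ∀ᶠ R in 𝓝[>] 0, ∀ α ∈ {α | (aPoly (x t0)).eval α = 0}, 4 * R < ‖α‖ ∧
        4 * R < ‖1 - α‖ ∧ ∀ β ∈ {α | (aPoly (x t0)).eval α = 0}, α ≠ β → 4 * R < ‖α - β‖ := by
      refine (Filter.eventually_all_finite hfin).2 fun α hα => ?_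
      refine (hpos _ (norm_pos_iff.2 ?_)).and ((hpos _ (norm_pos_iff.2 (sub_ne_zero.2 ?_))).and
        ((Filter.eventually_all_finite hfin).2 fun β hβ => ?_))
      · rintro rfl; exact ha0 hα
      · rintro rfl; exact h1 hα
      · by_cases e : α = β
        · exact Eventually.of_forall fun R h => absurd e h
        · exact (hpos _ (norm_pos_iff.2 (sub_ne_zero.2 e))).mono fun R h _ => h
    obtain ⟨R, h1, h2⟩ := (this.and self_mem_nhdsWithin).exists
    exact ⟨R, h2, h1⟩
  have hev := (h.cont_x t0 ht0).eventually
    (eventually_roots_eq ha0 (hs t0 ht0) (ε := R / 4) (by positivity))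
  have hgood : ∀ᶠ t in 𝓝[Icc 0 1] t0,
      (∀ α, (aPoly (x t)).eval α = 0 → ∃ p, (aPoly (x t0)).eval p = 0 ∧ ‖α - p‖ < R / 4) ∧
      (∀ p, (aPoly (x t0)).eval p = 0 → ∃ α, (aPoly (x t)).eval α = 0 ∧ ‖α - p‖ < R / 4) ∧
      ∀ α β, (aPoly (x t)).eval α = 0 → (aPoly (x t)).eval β = 0 → α ≠ β → 2 * R ≤ ‖α - β‖ := by
    filter_upwards [hev] with t ⟨hx0, β, hβ, _, hroots⟩
    have hax := (natDegree_aPoly_eq hx0).2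
    have hmem : ∀ α, (aPoly (x t)).eval α = 0 ↔ ∃ p, (aPoly (x t0)).eval p = 0 ∧ β p = α := by
      intro α
      rw [← IsRoot.def, ← mem_roots hax, hroots, Multiset.mem_map]
      simp only [mem_roots ha, IsRoot.def]
    refine ⟨fun α hα => ?_, fun p hp => ⟨β p, (hmem _).2 ⟨p, hp, rfl⟩, hβ p hp⟩,
      fun α α' hα hα' hne => ?_⟩
    · obtain ⟨p, hp, rfl⟩ := (hmem α).1 hα
      exact ⟨p, hp, hβ p hp⟩
    · obtain ⟨p, hp, rfl⟩ := (hmem α).1 hα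
      obtain ⟨q, hq, rfl⟩ := (hmem α').1 hα'
      have hpq : p ≠ q := fun e => hne (by rw [e])
      have e1 := (hR0 p hp).2.2 q hq hpq
      have e2 := hβ p hp
      have e3 := hβ q hq
      have e4 : ‖p - q‖ ≤ ‖β p - β q‖ + ‖β p - p‖ + ‖β q - q‖ := by
        rw [show p - q = (β p - β q) - (β p - p) + (β q - q) by ring]
        exact (norm_add_le _ _).trans (add_le_add (norm_sub_le _ _) le_rfl)
      linarith
  obtain ⟨δ, hδ, hsub⟩ := Metric.mem_nhdsWithin_iff.1 hgood
  have hgt := fun t (ht : t ∈ 𝕀 ∩ ball t0 δ) => hsub ⟨ht.2, ht.1⟩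
  refine ⟨δ, hδ, fun t1 ht1 t2 ht2 hpell => ?_⟩
  obtain ⟨k, f, hkf, hf1⟩ := hpell
  have hpath := h.comp ht1.1 ht2.1
  have hseg : ∀ s ∈ 𝕀, t1 + s * (t2 - t1) ∈ 𝕀 ∩ ball t0 δ := by
    intro s hs
    have := ((convex_Icc 0 1).inter (convex_ball t0 δ)).add_smul_sub_mem ht1 ht2 hs
    simpa using this
  set O := awayFromRoots (aPoly (x t0)) (R / 4)
  have hne : ∀ s ∈ 𝕀, ∀ l ∈ O, (aPoly (x (t1 + s * (t2 - t1)))).eval l ≠ 0 := by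
    intro s hs l hl h0
    obtain ⟨p, hp, hpl⟩ := (hgt _ (hseg s hs)).1 l h0
    exact absurd (hl.2 p hp) (not_lt.2 hpl.le)
  obtain ⟨k1, f1, hkf1, hf₁⟩ := hpath.exists_transport (isOpen_awayFromRoots ha (R / 4))
    (fun l hl => hl.1) hne (by
      simp
      exact hkf.mono fun l hl => hl.1)
  simp at hkf1
  have hsubO : awayFromRoots (aPoly (x t2)) (R / 2) ⊆ O := by
    intro l hl
    refine ⟨hl.1, fun p hp => ?_⟩
    obtain ⟨α, hα, hαp⟩ := (hgt t2 ht2).2.1 p hp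
    have h2 := hl.2 α hα
    have h3 : ‖l - α‖ ≤ ‖l - p‖ + ‖α - p‖ := by
      rw [show l - α = (l - p) - (α - p) by ring]; exact norm_sub_le _ _
    linarith
  have hRα : ∀ α, (aPoly (x t2)).eval α = 0 → R ≤ ‖α‖ ∧ R / 2 < ‖1 - α‖ := by
    intro α hα
    obtain ⟨p, hp, hαp⟩ := (hgt t2 ht2).1 α hα
    obtain ⟨e1, e2, -⟩ := hR0 p hp
    have e3 : ‖p‖ ≤ ‖α‖ + ‖α - p‖ := by
      conv_lhs => rw [show p = α - (α - p) by ring]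
      exact norm_sub_le _ _
    have e4 : ‖1 - p‖ ≤ ‖1 - α‖ + ‖α - p‖ := by
      rw [show 1 - p = (1 - α) + (α - p) by ring]; exact norm_add_le _ _
    constructor <;> linarith
  obtain ⟨k2, f2, hkf2, heq⟩ := (hkf1.mono hsubO).exists_extension (h.regular t2 ht2.1).a_ne
    (by positivity : 0 < R / 2) (by linarith : R / 2 < R) (fun α hα => (hRα α hα).1)
    (hgt t2 ht2).2.2 (hs t2 ht2.1)
  have h1mem : 1 ∈ awayFromRoots (aPoly (x t2)) (R / 2) := ⟨one_ne_zero, fun α hα => (hRα α hα).2⟩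
  exact ⟨k2, f2, hkf2, by rw [(heq 1 h1mem).2]; exact hf₁ (hsubO h1mem) hf1⟩

theorem IsWhithamPath.hasPellData (h : IsWhithamPath x y c) (h0 : HasPellData (x 0)) :
    ∀ t ∈ 𝕀, HasPellData (x t) := by
  have hs := h.simple h0.simple
  have hn := h.neg h0.simple h0.neg
  have ha1 : ∀ t ∈ 𝕀, (aPoly (x t)).eval 1 ≠ 0 := by
    intro t ht h'
    obtain ⟨r, hr, e⟩ := hn t ht 1 (by simp)
    rw [h', zero_div] at e
    exact hr.ne (by exact_mod_cast e.symm)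
  have hp : ∀ t ∈ 𝕀, HasPell (x t) := by
    refine forall_mem_Icc_of_isOpen_isClosed h0.pell (fun t ht hpt => ?_) fun t ht hlt => ?_
    · obtain ⟨δ, hδ, hiff⟩ := h.exists_hasPell_iff ht hs (ha1 t ht)
      exact Metric.mem_nhdsWithin_iff.2 ⟨δ, hδ, fun s hs' =>
        hiff t ⟨ht, mem_ball_self hδ⟩ s ⟨hs'.2, hs'.1⟩ hpt⟩
    · have htI := Ioc_subset_Icc_self ht
      obtain ⟨δ, hδ, hiff⟩ := h.exists_hasPell_iff htI hs (ha1 t htI)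
      have hmax : max 0 (t - δ / 2) < t := max_lt ht.1 (by linarith)
      refine hiff (max 0 (t - δ / 2)) ⟨⟨le_max_left _ _, hmax.le.trans ht.2⟩, ?_⟩ t
        ⟨htI, mem_ball_self hδ⟩ (hlt _ ⟨le_max_left _ _, hmax⟩)
      rw [mem_ball, Real.dist_eq, abs_sub_comm, abs_of_pos (sub_pos.2 hmax)]
      linarith [le_max_right 0 (t - δ / 2)]
  exact fun t ht => ⟨(h.norm_a_zero t ht).trans h0.normalized, hs t ht, hn t ht,
    h.b_zero h0.b_zero t ht, hp t ht⟩

end Flow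

section Field

theorem cPoly_eval_zero (c : RealPoly g) : (cPoly c).eval 0 = c.1 0 := polyOf_eval_zero _

theorem bPoly_eval_zero (x : RealPair g) : (bPoly x).eval 0 = x.1.2 0 := polyOf_eval_zero _

theorem cPoly_eval_one_im (c : RealPoly g) : ((cPoly c).eval 1).im = 0 := by
  have := cPoly_reflect c one_ne_zero
  simp at this
  exact conj_eq_iff_im.1 this.symm

def evalOne (g : ℕ) : RealPoly g →ₗ[ℝ] ℝ where
  toFun c := ((cPoly c).eval 1).re
  map_add' c d := by rw [cPoly_add, eval_add, add_re]
  map_smul' r c := by simp [cPoly_smul]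

/-- The polynomial with lowest coefficient `i * b 0` and all coefficients zero except the lowest
and the highest one. -/
def rotated (g : ℕ) : RealPair g →ₗ[ℝ] RealPoly g where
  toFun x := ⟨fun i => if i = 0 then I * x.1.2 0 else
    if i = Fin.last (g + 1) then conj (I * x.1.2 0) else 0, by
      intro i
      rcases eq_or_ne i 0 with rfl | h0
      · simp
      · rcases eq_or_ne i (Fin.last (g + 1)) with rfl | h1
        · simp
        · have h2 : i.rev ≠ 0 := fun h => h1 (by rw [← Fin.rev_rev i, h, Fin.rev_zero])
          have h3 : i.rev ≠ Fin.last (g + 1) := fun h => h0 (by rw [← Fin.rev_rev i, h, Fin.rev_last])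
          simp [h0, h1, h2, h3]⟩
  map_add' x y := by
    ext i
    simp only [Submodule.coe_add, Prod.snd_add, Pi.add_apply, mul_add, map_add]
    split_ifs <;> simp
  map_smul' r x := by
    ext i
    simp only [Submodule.coe_smul, Prod.smul_snd, Pi.smul_apply, RingHom.id_apply, real_smul,
      map_mul, conj_ofReal]
    split_ifs <;> ring

/-- The polynomial `X + X ^ g`, respectively `X` if `g = 1`. -/
def middle (g : ℕ) : RealPoly g := ⟨fun i => if (i : ℕ) = 1 ∨ (i : ℕ) = g then 1 else 0, by
    intro i
    have h : ((i.rev : ℕ) = 1 ∨ (i.rev : ℕ) = g) ↔ ((i : ℕ) = 1 ∨ (i : ℕ) = g) := by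
      rw [Fin.val_rev]; omega
    simp only [h]
    split_ifs <;> simp⟩

theorem evalOne_middle_ne (g : ℕ) : evalOne g (middle g) ≠ 0 := by
  have : (cPoly (middle g)).eval 1 =
      ((Finset.univ.filter fun i : Fin (g + 2) => (i : ℕ) = 1 ∨ (i : ℕ) = g).card : ℂ) := by
    rw [cPoly, polyOf_eval]
    simp [middle, Finset.sum_boole]
  change ((cPoly (middle g)).eval 1).re ≠ 0
  rw [this, natCast_re, Nat.cast_ne_zero, Finset.card_ne_zero]
  exact ⟨1, by simp⟩

/-- A smooth family `c` of polynomials on an open set `W` of regular pairs, which on the spectral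
data in `W` preserves the closing conditions. -/
structure IsClosingFamily (W : Set (RealPair g)) (c : RealPair g → RealPoly g) : Prop where
  isOpen : IsOpen W
  regular : ∀ x ∈ W, IsRegular x
  smooth : ContDiffOn ℝ ∞ c W
  c_one : ∀ x ∈ W ∩ spectralData g, (cPoly (c x)).eval 1 = 0
  c_im : ∀ x ∈ W ∩ spectralData g, ((cPoly (c x)).eval 0 / (bPoly x).eval 0).im = 0

variable {W : Set (RealPair g)} {c : RealPair g → RealPoly g}

theorem IsClosingFamily.exists_correction (h : IsClosingFamily W c) :
    ∃ d : RealPair g → RealPoly g, ContDiffOn ℝ ∞ d W ∧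
      (∀ x ∈ W, (cPoly (d x)).eval 1 = 0 ∧ ((cPoly (d x)).eval 0 / (bPoly x).eval 0).im = 0) ∧
      ∀ x ∈ W ∩ spectralData g, d x = c x := by
  rcases Nat.eq_zero_or_pos g with rfl | hg
  · refine ⟨fun _ => 0, contDiffOn_const, fun x _ => by simp [cPoly, polyOf], fun x hx => ?_⟩
    have hreg := h.regular x hx.1
    have hp := IsSpectralData.hasPellData hreg hx.2
    have hb0 := hreg.b_zero_ne
    obtain ⟨r, hr, e⟩ := hp.b_zero
    obtain ⟨s, hs, e'⟩ := hp.neg 1 (by simp)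
    rw [pow_zero, div_one] at e'
    have ea : (aPoly x).eval 0 = s := by
      rw [← e', eq_C_of_natDegree_le_zero ((natDegree_aPoly_le x).trans (by simp))]; simp
    have hb2 : (bPoly x).eval 0 ^ 2 = ((r * s : ℝ) : ℂ) := by
      rw [ea, div_eq_iff (by exact_mod_cast hs.ne)] at e
      rw [e]; push_cast; ring
    have hbim : ((bPoly x).eval 0).im = 0 := by
      have h1 := congrArg re hb2
      have h2 := congrArg im hb2
      simp only [sq, mul_re, mul_im, ofReal_re, ofReal_im] at h1 h2
      have h3 : 0 < r * s := mul_pos_of_neg_of_neg hr hs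
      by_contra hne
      have h4 : ((bPoly x).eval 0).re = 0 := by grind
      rw [h4] at h1
      nlinarith [mul_self_nonneg ((bPoly x).eval 0).im]
    have hc0 : (cPoly (c x)).eval 0 = (cPoly (c x)).eval 0 / (bPoly x).eval 0 * (bPoly x).eval 0 :=
      (div_mul_cancel₀ _ hb0).symm
    have him : ((c x).1 0).im = 0 := by rw [← cPoly_eval_zero, hc0, mul_im, h.c_im x hx, hbim]; ring
    have h1 : (c x).1 1 = conj ((c x).1 0) := (c x).2 0
    have hre : ((c x).1 0).re = 0 := by
      have := h.c_one x hx
      rw [cPoly, polyOf_eval, Fin.sum_univ_two, h1] at this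
      have := congrArg re this
      simp at this
      linarith
    have hz : (c x).1 0 = 0 := ext hre him
    symm
    ext i
    fin_cases i
    · exact hz
    · change (c x).1 1 = 0
      grind
  · set m : RealPair g → ℝ := fun x => ((c x).1 0 / x.1.2 0).im with hm
    set d1 : RealPair g → RealPoly g := fun x => c x - m x • rotated g x with hd1
    set s : RealPair g → ℝ := fun x => evalOne g (d1 x) / evalOne g (middle g) with hs
    have hcoef : ContDiffOn ℝ ∞ (fun x => (c x).1 0) W :=
      ((ContinuousLinearMap.proj (R := ℝ) (φ := fun _ : Fin (g + 2) => ℂ) 0).comp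
        (RealPoly g).subtypeL).contDiff.comp_contDiffOn h.smooth
    have hb : ContDiff ℝ ∞ (fun x : RealPair g => x.1.2 0) :=
      ((ContinuousLinearMap.proj (R := ℝ) (φ := fun _ : Fin (g + 2) => ℂ) 0).comp
        ((ContinuousLinearMap.snd ℝ _ _).comp (RealPair g).subtypeL)).contDiff
    have hb0 : ∀ x ∈ W, x.1.2 0 ≠ 0 := fun x hx => by
      rw [← bPoly_eval_zero]; exact (h.regular x hx).b_zero_ne
    have hms : ContDiffOn ℝ ∞ m W :=
      imCLM.contDiff.comp_contDiffOn (hcoef.mul ((hb.contDiffOn).inv hb0))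
    have hd₁s : ContDiffOn ℝ ∞ d1 W := h.smooth.sub
      (hms.smul (LinearMap.toContinuousLinearMap (rotated g)).contDiff.contDiffOn)
    have hss : ContDiffOn ℝ ∞ s W :=
      ((LinearMap.toContinuousLinearMap (evalOne g)).contDiff.comp_contDiffOn hd₁s).div_const _
    have hmid : (middle g).1 0 = 0 := by simp [middle, hg.ne]
    refine ⟨fun x => d1 x - s x • middle g, hd₁s.sub (hss.smul contDiffOn_const),
      fun x hx => ⟨?_, ?_⟩, fun x hx => ?_⟩
    · refine ext ?_ (cPoly_eval_one_im _)
      change evalOne g _ = 0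
      rw [map_sub, map_smul, smul_eq_mul, div_mul_cancel₀ _ (evalOne_middle_ne g), sub_self]
    · have e : (d1 x - s x • middle g).1 0 = (c x).1 0 - m x * (I * x.1.2 0) := by
        simp [hd1, rotated, hmid]
      have aux : ∀ (z w : ℂ) (r : ℝ), w ≠ 0 → ((z - r * (I * w)) / w).im = (z / w).im - r := by
        intro z w r hw
        rw [_root_.sub_div, ← mul_assoc, mul_div_cancel_right₀ _ hw]
        simp
      rw [cPoly_eval_zero, bPoly_eval_zero, e]
      exact (aux _ _ _ (hb0 x hx)).trans (sub_self _)
    · have hm0 : m x = 0 := by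
        have := h.c_im x hx
        rwa [cPoly_eval_zero, bPoly_eval_zero] at this
      have hd : d1 x = c x := by simp [hd1, hm0]
      have hs0 : s x = 0 := by
        simp only [hs, hd]
        rw [show evalOne g (c x) = 0 by
          change ((cPoly (c x)).eval 1).re = 0
          rw [h.c_one x hx]; rfl, zero_div]
      simp only [hd, hs0, zero_smul, sub_zero]

theorem isWhithamPath_of_field {d : RealPair g → RealPoly g} (hW : IsOpen W)
    (hreg : ∀ x ∈ W, IsRegular x) (hd : ContDiffOn ℝ ∞ d W) {x : ℝ → RealPair g} {r : ℝ}
    (hxW : ∀ t ∈ 𝕀, x t ∈ W)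
    (hx : ∀ t ∈ 𝕀, HasDerivWithinAt x (r • whithamField d (x t)) 𝕀 t)
    (h1 : ∀ t ∈ 𝕀, (cPoly (d (x t))).eval 1 = 0)
    (h2 : ∀ t ∈ 𝕀, ((cPoly (d (x t))).eval 0 / (bPoly (x t)).eval 0).im = 0) :
    IsWhithamPath x (fun t => r • whithamField d (x t)) (fun t => r • d (x t)) := by
  have hxc := fun t ht => (hx t ht).continuousWithinAt
  refine ⟨hx, ((contDiffOn_whithamField hW hreg hd).continuousOn.comp hxc hxW).const_smul r,
    (hd.continuousOn.comp hxc hxW).const_smul r,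
    fun t ht => (isWhithamVector_whithamField (hreg _ (hxW t ht)) d).smul r,
    fun t ht => hreg _ (hxW t ht), fun t ht => ?_, fun t ht => ?_⟩
  · rw [cPoly_smul, eval_mul, h1 t ht, mul_zero]
  · rw [cPoly_smul, eval_mul, eval_C, mul_div_assoc, im_ofReal_mul, h2 t ht, mul_zero]

theorem IsClosingFamily.exists_integralCurve (h : IsClosingFamily W c) {x0 : RealPair g}
    (hx0 : x0 ∈ W ∩ spectralData g) :
    ∃ ε > 0, ∃ γ : ℝ → RealPair g, γ 0 = x0 ∧ ∀ t ∈ Ioo (-ε) ε,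
      γ t ∈ W ∩ spectralData g ∧ HasDerivAt γ (whithamField c (γ t)) t := by
  obtain ⟨d, hd, hd1, hdc⟩ := h.exists_correction
  have hV := contDiffOn_whithamField h.isOpen h.regular hd
  have hVat : ContDiffAt ℝ 1 (whithamField d) x0 :=
    ((hV x0 hx0.1).contDiffAt (h.isOpen.mem_nhds hx0.1)).of_le (by exact_mod_cast le_top)
  obtain ⟨α, hα0, ε, hε, hα⟩ :=
    hVat.exists_forall_mem_closedBall_exists_eq_forall_mem_Ioo_hasDerivAt₀ 0
  rw [zero_sub, zero_add] at hα
  have hα0c := (hα 0 (by simp [hε])).continuousAt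
  have hev := hα0c.eventually_mem (h.isOpen.mem_nhds (by rw [hα0]; exact hx0.1))
  obtain ⟨η, hη, hball⟩ := Metric.eventually_nhds_iff_ball.1 hev
  have hmem : ∀ t ∈ Ioo (-min ε η) (min ε η), α t ∈ W ∩ spectralData g := by
    intro t ht
    have habs := abs_lt.2 ht
    have hst : ∀ s ∈ 𝕀, |s * t| < min ε η := by
      intro s hs
      rw [abs_mul, abs_of_nonneg hs.1]
      exact (mul_le_of_le_one_left (abs_nonneg t) hs.2).trans_lt habs
    have hW' := fun s hs => hball _ (by
      rw [mem_ball, Real.dist_eq, sub_zero]; exact (hst s hs).trans_le (min_le_right _ _))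
    have hp := isWhithamPath_of_field h.isOpen h.regular hd hW' (fun s hs => by
        have h3 : HasDerivWithinAt (fun s => s * t) t 𝕀 s := by
          simpa using (hasDerivWithinAt_id s 𝕀).mul_const t
        exact (hα _ (abs_lt.1 ((hst s hs).trans_le (min_le_left _ _)))).scomp_hasDerivWithinAt s h3)
      (fun s hs => (hd1 _ (hW' s hs)).1) (fun s hs => (hd1 _ (hW' s hs)).2)
    have := hp.hasPellData (by
      simp only [zero_mul, hα0]
      exact IsSpectralData.hasPellData (h.regular _ hx0.1) hx0.2) 1 (by simp)
    simp at this
    have hWt : α t ∈ W := by simpa using hW' 1 (by simp)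
    exact ⟨hWt, this.isSpectralData (h.regular _ hWt)⟩
  refine ⟨min ε η, lt_min hε hη, α, hα0, fun t ht => ⟨hmem t ht, ?_⟩⟩
  have hx := hmem t ht
  have e : whithamField c (α t) = whithamField d (α t) := by
    have h1 := isWhithamVector_whithamField (h.regular _ hx.1) d
    rw [hdc _ hx] at h1
    exact (isWhithamVector_whithamField (h.regular _ hx.1) c).unique (h.regular _ hx.1) h1
  rw [e]
  exact hα t ⟨(neg_le_neg (min_le_left _ _)).trans_lt ht.1, ht.2.trans_le (min_le_left _ _)⟩

theorem IsClosingFamily.mem_spectralData_one (h : IsClosingFamily W c) {x : ℝ → RealPair g} {r : ℝ}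
    (hxW : ∀ t ∈ 𝕀, x t ∈ W)
    (hx : ∀ t ∈ 𝕀, HasDerivWithinAt x (r • whithamField c (x t)) 𝕀 t)
    (h0 : x 0 ∈ spectralData g) : ∀ t ∈ 𝕀, x t ∈ spectralData g := by
  have hxc : ContinuousOn x 𝕀 := fun t ht => (hx t ht).continuousWithinAt
  have hseg : ∀ {s t : ℝ}, s ∈ 𝕀 → t ∈ 𝕀 → MapsTo (fun σ : ℝ => s + σ * (t - s)) 𝕀 𝕀 := by
    intro s t hs ht σ hσ
    simpa using (convex_Icc 0 1).add_smul_sub_mem hs ht hσ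
  have hder : ∀ {s t : ℝ}, s ∈ 𝕀 → t ∈ 𝕀 → ∀ σ ∈ 𝕀,
      HasDerivWithinAt (fun σ : ℝ => x (s + σ * (t - s)))
        (((t - s) * r) • whithamField c (x (s + σ * (t - s)))) 𝕀 σ := by
    intro s t hs ht σ hσ
    have h3 : HasDerivWithinAt (fun σ : ℝ => s + σ * (t - s)) (t - s) 𝕀 σ := by
      simpa using ((hasDerivWithinAt_id σ 𝕀).mul_const (t - s)).const_add s
    rw [mul_smul]
    exact (hx _ (hseg hs ht hσ)).scomp σ h3 (hseg hs ht)
  refine forall_mem_Icc_of_isOpen_isClosed h0 (fun s hs hPs => ?_) fun t ht hlt => ?_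
  · obtain ⟨ε, hε, γ, hγ0, hγ⟩ := h.exists_integralCurve ⟨hxW s hs, hPs⟩
    have hV := contDiffOn_whithamField h.isOpen h.regular h.smooth
    have hVat : ContDiffAt ℝ 1 (whithamField c) (x s) :=
      ((hV _ (hxW s hs)).contDiffAt (h.isOpen.mem_nhds (hxW s hs))).of_le (by exact_mod_cast le_top)
    obtain ⟨K, S, hS, hK⟩ := hVat.exists_lipschitzOnWith
    have hγc : ContinuousAt γ 0 := (hγ 0 (by simp [hε])).2.continuousAt
    have hev1 : ∀ᶠ t in 𝓝 (0 : ℝ), γ t ∈ S := hγc.eventually_mem (by rwa [hγ0])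
    obtain ⟨η, hη, hη'⟩ := Metric.eventually_nhds_iff_ball.1 hev1
    obtain ⟨δ, hδ, hδ'⟩ := Metric.mem_nhdsWithin_iff.1 ((hxc s hs).eventually_mem hS)
    have hρ : 0 < min δ (min ε η / (|r| + 1)) := by positivity
    refine Metric.mem_nhdsWithin_iff.2 ⟨_, hρ, fun t ht => ?_⟩
    have htI := ht.2
    have hdist : |t - s| < min δ (min ε η / (|r| + 1)) := by
      have := ht.1; rwa [mem_ball, Real.dist_eq] at this
    have hsc : ∀ σ ∈ 𝕀, |σ * ((t - s) * r)| < min ε η := by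
      intro σ hσ
      have h2 := (hdist.trans_le (min_le_right _ _))
      rw [lt_div_iff₀ (by positivity)] at h2
      rw [abs_mul, abs_of_nonneg hσ.1, abs_mul]
      refine (mul_le_of_le_one_left (by positivity) hσ.2).trans_lt (lt_of_le_of_lt ?_ h2)
      gcongr; linarith
    have heq := SolvesOn.unique (f := fun _ z => ((t - s) * r) • whithamField c z)
      (u := fun σ => x (s + σ * (t - s))) (v := fun σ => γ (σ * ((t - s) * r)))
      (K := ‖(t - s) * r‖₊ * K) (S := S) (hder hs htI) (fun σ hσ => by
        have h3 : HasDerivWithinAt (fun σ : ℝ => σ * ((t - s) * r)) ((t - s) * r) 𝕀 σ := by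
          simpa using (hasDerivWithinAt_id σ 𝕀).mul_const ((t - s) * r)
        exact (hγ _ (abs_lt.1 ((hsc σ hσ).trans_le (min_le_left _ _)))).2.scomp_hasDerivWithinAt σ h3)
      (fun σ _ => (lipschitzWith_smul ((t - s) * r)).comp_lipschitzOnWith hK)
      (fun σ hσ => hδ' ⟨?_, hseg hs htI hσ⟩) (fun σ hσ => hη' _ ?_) (by simp [hγ0])
      (show (1 : ℝ) ∈ Icc 0 1 by simp)
    · simp only [one_mul, add_sub_cancel] at heq
      show x t ∈ spectralData g
      rw [heq]
      have := hsc 1 (by simp)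
      rw [one_mul] at this
      exact (hγ _ (abs_lt.1 (this.trans_le (min_le_left _ _)))).1.2
    · rw [mem_ball, Real.dist_eq, add_sub_cancel_left, abs_mul, abs_of_nonneg hσ.1]
      exact (mul_le_of_le_one_left (abs_nonneg _) hσ.2).trans_lt (hdist.trans_le (min_le_left _ _))
    · rw [mem_ball, Real.dist_eq, sub_zero]
      exact (hsc σ hσ).trans_le (min_le_right _ _)
  · have htI := Ioc_subset_Icc_self ht
    have h0I : (0 : ℝ) ∈ 𝕀 := by simp
    have hlim : ∀ φ : RealPair g → ℂ, ContinuousOn φ W → (∀ s ∈ Ico 0 t, φ (x s) = 0) →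
        ∀ s ∈ Icc 0 t, φ (x s) = 0 := by
      intro φ hφ hz s hs
      rcases hs.2.lt_or_eq with h1 | rfl
      · exact hz s ⟨hs.1, h1⟩
      · have hc : ContinuousWithinAt (fun s => φ (x s)) (Ico 0 s) s :=
          ((hφ.comp hxc hxW) s htI).mono fun u hu => ⟨hu.1, hu.2.le.trans ht.2⟩
        have : (𝓝[Ico 0 s] s).NeBot := by
          rw [← mem_closure_iff_nhdsWithin_neBot, closure_Ico ht.1.ne]
          exact right_mem_Icc.2 ht.1.le
        refine tendsto_nhds_unique hc (tendsto_const_nhds.congr' ?_)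
        filter_upwards [self_mem_nhdsWithin] with u hu using (hz u hu).symm
    have hcc : ∀ l, ContinuousOn (fun z => (cPoly (c z)).eval l) W := fun l =>
      continuousOn_polyOf_eval (continuous_cCoeff.comp_continuousOn h.smooth.continuousOn)
        continuousOn_const
    have hsub : Icc 0 t ⊆ 𝕀 := Icc_subset_Icc le_rfl ht.2
    have hc1 := hlim _ (hcc 1) fun s hs => h.c_one _ ⟨hxW s (hsub ⟨hs.1, hs.2.le⟩), hlt s hs⟩
    have hc2 := hlim (fun z => (((cPoly (c z)).eval 0 / (bPoly z).eval 0).im : ℂ))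
      (continuous_ofReal.comp_continuousOn (continuous_im.comp_continuousOn
        ((hcc 0).div (continuous_bPoly_eval 0).continuousOn
          fun z hz => (h.regular z hz).b_zero_ne))) fun s hs => by
        simp only [h.c_im _ ⟨hxW s (hsub ⟨hs.1, hs.2.le⟩), hlt s hs⟩, ofReal_zero]
    have hm : ∀ σ ∈ 𝕀, 0 + σ * (t - 0) ∈ Icc 0 t := by
      intro σ hσ
      rw [zero_add, sub_zero]
      exact ⟨mul_nonneg hσ.1 ht.1.le, mul_le_of_le_one_left ht.1.le hσ.2⟩
    have hp := isWhithamPath_of_field h.isOpen h.regular h.smooth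
      (x := fun σ => x (0 + σ * (t - 0))) (fun σ hσ => hxW _ (hseg h0I htI hσ)) (hder h0I htI)
      (fun σ hσ => hc1 _ (hm σ hσ)) (fun σ hσ => by exact_mod_cast hc2 _ (hm σ hσ))
    have := hp.hasPellData (by
      simp only [zero_mul, add_zero]
      exact IsSpectralData.hasPellData (h.regular _ (hxW 0 h0I)) h0) 1 (by simp)
    simp only [one_mul, zero_add, sub_zero] at this
    exact this.isSpectralData (h.regular _ (hxW t htI))

theorem IsClosingFamily.mem_spectralData (h : IsClosingFamily W c) {I : Set ℝ} (hI : I.OrdConnected)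
    {γ : ℝ → RealPair g} (hγ : IsIntegralCurveIn (whithamField c) W I γ) {t0 : ℝ} (ht0 : t0 ∈ I)
    (h0 : γ t0 ∈ spectralData g) : ∀ t ∈ I, γ t ∈ spectralData g := by
  intro t ht
  have hm : MapsTo (fun σ => t0 + σ * (t - t0)) 𝕀 I := by
    intro σ hσ
    simpa using hI.convex.add_smul_sub_mem ht0 ht hσ
  have := h.mem_spectralData_one (x := fun σ => γ (t0 + σ * (t - t0)))
    (fun σ hσ => (hγ _ (hm hσ)).1) (fun σ hσ => by
      have h3 : HasDerivWithinAt (fun σ => t0 + σ * (t - t0)) (t - t0) 𝕀 σ := by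
        simpa using ((hasDerivWithinAt_id σ 𝕀).mul_const (t - t0)).const_add t0
      exact (hγ _ (hm hσ)).2.scomp σ h3 hm) (by simpa using h0) 1 (by simp)
  simpa using this

end Field

open scoped Matrix
open Matrix (mul_apply smul_mul trace_fin_two trace_smul trace_sub trace_add det_fin_two
  conjTranspose_smul conjTranspose_mul conjTranspose_apply conjTranspose_add conjTranspose_sub
  conjTranspose_one conjTranspose_conjTranspose)

section Lax

theorem exists_trilinear {V A : Type*} [NormedAddCommGroup V] [NormedSpace ℝ V]
    [FiniteDimensional ℝ V] [NormedAddCommGroup A] [NormedSpace ℝ A] [FiniteDimensional ℝ A]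
    (f : V → A → A → A) (h1 : ∀ x y, IsLinearMap ℝ fun v => f v x y)
    (h2 : ∀ v y, IsLinearMap ℝ fun x => f v x y) (h3 : ∀ v x, IsLinearMap ℝ fun y => f v x y) :
    ∃ B : V →L[ℝ] A →L[ℝ] A →L[ℝ] A, ∀ v x y, B v x y = f v x y := by
  let B1 : V → A → (A →L[ℝ] A) := fun v x => LinearMap.toContinuousLinearMap ((h3 v x).mk' _)
  let B2 : V → (A →L[ℝ] A →L[ℝ] A) := fun v => LinearMap.toContinuousLinearMap
    { toFun := B1 v
      map_add' := fun x x' => ContinuousLinearMap.ext fun y => (h2 v y).map_add x x'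
      map_smul' := fun r x => ContinuousLinearMap.ext fun y => (h2 v y).map_smul r x }
  exact ⟨LinearMap.toContinuousLinearMap
    { toFun := B2
      map_add' := fun v v' => ContinuousLinearMap.ext fun x => ContinuousLinearMap.ext fun y =>
        (h1 x y).map_add v v'
      map_smul' := fun r v => ContinuousLinearMap.ext fun x => ContinuousLinearMap.ext fun y =>
        (h1 x y).map_smul r v }, fun v x y => rfl⟩

def comm (X Y : M2) : M2 := X * Y - Y * X

theorem comm_smul (r : ℂ) (X Y : M2) : comm X (r • Y) = r • comm X Y := by
  rw [comm, comm, Matrix.mul_smul, smul_mul, smul_sub]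

theorem smul_comm' (r : ℂ) (X Y : M2) : comm (r • X) Y = r • comm X Y := by
  rw [comm, comm, Matrix.mul_smul, smul_mul, smul_sub]

theorem comm_neg (X Y : M2) : comm X (-Y) = -comm X Y := by rw [comm, comm]; noncomm_ring

theorem neg_comm (X Y : M2) : comm (-X) Y = -comm X Y := by rw [comm, comm]; noncomm_ring

theorem comm_add (X Y Z : M2) : comm X (Y + Z) = comm X Y + comm X Z := by
  rw [comm, comm, comm]; noncomm_ring

theorem comm_sub (X Y Z : M2) : comm X (Y - Z) = comm X Y - comm X Z := by
  rw [comm, comm, comm]; noncomm_ring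

theorem sub_comm' (X Y Z : M2) : comm (X - Y) Z = comm X Z - comm Y Z := by
  rw [comm, comm, comm]; noncomm_ring

theorem trace_comm (X Y : M2) : (comm X Y).trace = 0 := by
  rw [comm, trace_sub, Matrix.trace_mul_comm, sub_self]

def laxZero (v : ℂ) (ζ : Fin (g + 2) → M2) : M2 :=
  !![(v * ζ 1 0 0 - conj v * conj (ζ 1 0 0)) / 2, -(conj v * conj (ζ 1 1 0));
     v * ζ 1 1 0, -((v * ζ 1 0 0 - conj v * conj (ζ 1 0 0)) / 2)]

def laxPole (v : ℂ) (ζ : Fin (g + 2) → M2) : M2 := !![0, v * ζ 0 0 1; 0, 0]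

/-- The connection form `α_l` in terms of the coefficients of the polynomial Killing field. -/
def laxU (l v : ℂ) (ζ : Fin (g + 2) → M2) : M2 :=
  l⁻¹ • laxPole v ζ + laxZero v ζ - l • (laxPole v ζ)ᴴ

theorem laxU_eq (l v : ℂ) (ζ : Fin (g + 2) → M2) : laxU l v ζ =
    !![(v * ζ 1 0 0 - conj v * conj (ζ 1 0 0)) / 2, l⁻¹ * (v * ζ 0 0 1) - conj v * conj (ζ 1 1 0);
      v * ζ 1 1 0 - l * (conj v * conj (ζ 0 0 1)),
        -((v * ζ 1 0 0 - conj v * conj (ζ 1 0 0)) / 2)] := by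
  ext i j; fin_cases i <;> fin_cases j <;>
    simp [laxU, laxPole, laxZero, conjTranspose_apply, sub_eq_add_neg]

def shiftDown (ζ : Fin (g + 2) → M2) : Fin (g + 2) → M2 :=
  Fin.snoc (α := fun _ => M2) (fun i : Fin (g + 1) => ζ i.succ) 0

def shiftUp (ζ : Fin (g + 2) → M2) : Fin (g + 2) → M2 :=
  Fin.cons (α := fun _ => M2) 0 fun i : Fin (g + 1) => ζ i.castSucc

/-- The coefficients of the commutator of `ζ` with the connection form of `η`. -/
def laxField (v : ℂ) (ζ η : Fin (g + 2) → M2) : Fin (g + 2) → M2 := fun j =>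
  comm (ζ j) (laxZero v η) + comm (shiftDown ζ j) (laxPole v η) -
    comm (shiftUp ζ j) ((laxPole v η)ᴴ)

theorem laurent_eq (ζ : Fin (g + 2) → M2) (hl : l ≠ 0) :
    laurent ζ l = l⁻¹ • ∑ j : Fin (g + 2), l ^ (j : ℕ) • ζ j := by
  rw [laurent, Finset.smul_sum]
  refine Finset.sum_congr rfl fun j _ => ?_
  rw [smul_smul, zpow_sub_one₀ hl, zpow_natCast, mul_comm]

theorem laurent_shiftDown (ζ : Fin (g + 2) → M2) (hl : l ≠ 0) :
    laurent (shiftDown ζ) l = l⁻¹ • (laurent ζ l - l⁻¹ • ζ 0) := by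
  rw [laurent_eq _ hl, laurent_eq _ hl, Fin.sum_univ_castSucc, Fin.sum_univ_succ (n := g + 1)]
  simp only [shiftDown, Fin.snoc_castSucc, Fin.snoc_last, smul_zero, add_zero, Fin.val_castSucc,
    Fin.val_succ, Fin.val_zero, pow_zero, one_smul, smul_add, add_sub_cancel_left, pow_succ',
    mul_smul, ← Finset.smul_sum, inv_smul_smul₀ hl]

theorem laurent_shiftUp (ζ : Fin (g + 2) → M2) (hl : l ≠ 0) :
    laurent (shiftUp ζ) l = l • (laurent ζ l - l ^ g • ζ (Fin.last (g + 1))) := by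
  rw [laurent_eq _ hl, laurent_eq _ hl, Fin.sum_univ_succ, Fin.sum_univ_castSucc (n := g + 1)]
  simp only [shiftUp, Fin.cons_succ, Fin.cons_zero, smul_zero, zero_add, Fin.val_castSucc,
    Fin.val_succ, Fin.val_last, smul_add, pow_succ', mul_smul, ← Finset.smul_sum,
    inv_smul_smul₀ hl, smul_inv_smul₀ hl, add_sub_cancel_right]

theorem laurent_comm (ζ : Fin (g + 2) → M2) (l : ℂ) (X : M2) :
    laurent (fun j => comm (ζ j) X) l = comm (laurent ζ l) X := by
  simp only [laurent, comm, Finset.sum_mul, Finset.mul_sum, ← Finset.sum_sub_distrib, smul_sub,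
    Matrix.mul_smul, smul_mul]

theorem laurent_add (ζ η : Fin (g + 2) → M2) (l : ℂ) :
    laurent (ζ + η) l = laurent ζ l + laurent η l := by
  simp [laurent, Finset.sum_add_distrib]

theorem laurent_sub (ζ η : Fin (g + 2) → M2) (l : ℂ) :
    laurent (ζ - η) l = laurent ζ l - laurent η l := by
  simp [laurent, smul_sub]

theorem laurent_laxField {ζ η : Fin (g + 2) → M2} {v : ℂ} (h0 : comm (ζ 0) (laxPole v η) = 0)
    (h1 : comm (ζ (Fin.last (g + 1))) ((laxPole v η)ᴴ) = 0) (hl : l ≠ 0) :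
    laurent (laxField v ζ η) l = comm (laurent ζ l) (laxU l v η) := by
  have e : laxField v ζ η = (fun j => comm (ζ j) (laxZero v η)) +
      (fun j => comm (shiftDown ζ j) (laxPole v η)) -
      fun j => comm (shiftUp ζ j) ((laxPole v η)ᴴ) := rfl
  rw [e, laurent_sub, laurent_add, laurent_comm, laurent_comm, laurent_comm, laurent_shiftDown _ hl,
    laurent_shiftUp _ hl, laxU]
  simp only [smul_comm', sub_comm', comm_smul, comm_add, comm_sub, h0, h1, smul_zero, sub_zero]
  abel

/-- The space of coefficients with the symmetries of potentials. -/
def potentialSpace (g : ℕ) : Submodule ℝ (Fin (g + 2) → M2) where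
  carrier := {ζ | (∀ j, ζ j = -(ζ j.rev)ᴴ) ∧ (∀ j, (ζ j).trace = 0) ∧ ζ 0 0 0 = 0 ∧ ζ 0 1 0 = 0 ∧
    (ζ 0 0 1).re = 0}
  add_mem' := by
    rintro ζ η ⟨h1, h2, h3, h4, h5⟩ ⟨k1, k2, k3, k4, k5⟩
    refine ⟨fun j => ?_, fun j => ?_, ?_, ?_, ?_⟩
    · rw [Pi.add_apply, Pi.add_apply, conjTranspose_add, neg_add, ← h1, ← k1]
    · rw [Pi.add_apply, trace_add, h2, k2, add_zero]
    · simp [h3, k3]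
    · simp [h4, k4]
    · simp [h5, k5]
  zero_mem' := by simp
  smul_mem' := by
    rintro r ζ ⟨h1, h2, h3, h4, h5⟩
    refine ⟨fun j => ?_, fun j => ?_, ?_, ?_, ?_⟩
    · rw [Pi.smul_apply, Pi.smul_apply, conjTranspose_smul, star_trivial, ← smul_neg, ← h1]
    · rw [Pi.smul_apply, trace_smul, h2, smul_zero]
    · simp [h3]
    · simp [h4]
    · simp [h5]

section K

variable {ζ η : Fin (g + 2) → M2}

theorem zero_eq_of_mem (hζ : ζ ∈ potentialSpace g) : ζ 0 = !![0, ζ 0 0 1; 0, 0] := by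
  obtain ⟨-, h2, h3, h4, -⟩ := hζ
  have h := h2 0
  rw [trace_fin_two, h3, zero_add] at h
  ext i j; fin_cases i <;> fin_cases j <;> simp [h3, h4, h]

theorem laurent_laxField_of_mem (hζ : ζ ∈ potentialSpace g) (η : Fin (g + 2) → M2) (v : ℂ) (hl : l ≠ 0) : laurent (laxField v ζ η) l = comm (laurent ζ l) (laxU l v η) := by
  have h0 : comm (ζ 0) (laxPole v η) = 0 := by
    rw [zero_eq_of_mem hζ, laxPole, comm]
    ext i j; fin_cases i <;> fin_cases j <;> simp
  refine laurent_laxField h0 ?_ hl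
  rw [hζ.1, Fin.rev_last, neg_comm, comm, ← conjTranspose_mul,
    ← conjTranspose_mul, ← conjTranspose_sub, ← neg_sub, ← comm, h0]
  simp

theorem one_eq_of_mem (hζ : ζ ∈ potentialSpace g) :
    ζ 1 = !![ζ 1 0 0, ζ 1 0 1; ζ 1 1 0, -ζ 1 0 0] := by
  have h := hζ.2.1 1
  rw [trace_fin_two] at h
  ext i j; fin_cases i <;> fin_cases j <;> simp
  linear_combination h

theorem shiftDown_zero (ζ : Fin (g + 2) → M2) : shiftDown ζ 0 = ζ 1 := by
  rw [← Fin.castSucc_zero, shiftDown, Fin.snoc_castSucc, Fin.succ_zero_eq_one]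

theorem shiftUp_one (ζ : Fin (g + 2) → M2) : shiftUp ζ 1 = ζ 0 := by
  rw [← Fin.succ_zero_eq_one, shiftUp, Fin.cons_succ, Fin.castSucc_zero]

theorem laxField_zero_of_mem (hζ : ζ ∈ potentialSpace g) (v : ℂ) : laxField v ζ ζ 0 =
    !![0, -(ζ 0 0 1 * (v * ζ 1 0 0 + -conj v * conj (ζ 1 0 0))) + 2 * (ζ 1 0 0 * (v * ζ 0 0 1));
      0, 0] := by
  have e1 := one_eq_of_mem hζ
  have e2 := zero_eq_of_mem hζ
  rw [laxField, shiftDown_zero, show shiftUp ζ 0 = 0 from rfl,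
    show comm 0 (laxPole v ζ)ᴴ = 0 by simp [comm], sub_zero, laxZero,
    laxPole]
  generalize ζ 1 0 0 = A at *
  generalize ζ 1 1 0 = C at *
  generalize ζ 1 0 1 = B at *
  generalize ζ 0 0 1 = β at *
  rw [e1, e2]
  ext i j; fin_cases i <;> fin_cases j <;> simp [comm] <;> ring

theorem laxField_one_of_mem (hζ : ζ ∈ potentialSpace g) (v : ℂ) :
    laxField v ζ ζ 1 0 0 = v * (ζ 1 0 1 * ζ 1 1 0 - ζ 0 0 1 * shiftDown ζ 1 1 0)
        + conj v * (conj (ζ 1 1 0) * ζ 1 1 0 - ζ 0 0 1 * conj (ζ 0 0 1)) ∧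
      laxField v ζ ζ 1 1 0 = ζ 1 1 0 * (v * ζ 1 0 0 - conj v * conj (ζ 1 0 0))
        - 2 * ζ 1 0 0 * (v * ζ 1 1 0) := by
  have e1 := one_eq_of_mem hζ
  have e2 := zero_eq_of_mem hζ
  rw [laxField, shiftUp_one, laxZero, laxPole]
  generalize ζ 1 0 0 = A at *
  generalize ζ 1 1 0 = C at *
  generalize ζ 1 0 1 = B at *
  generalize ζ 0 0 1 = β at *
  rw [e1, e2]
  constructor <;> simp [comm, mul_apply, Fin.sum_univ_two, conjTranspose_apply,
      Matrix.vecMul, dotProduct] <;> ring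

theorem laxU_flat (hζ : ζ ∈ potentialSpace g) (v w : ℂ) (hl : l ≠ 0) :
    laxU l w (laxField v ζ ζ) + laxU l v ζ * laxU l w ζ =
      laxU l v (laxField w ζ ζ) + laxU l w ζ * laxU l v ζ := by
  rw [laxU_eq, laxU_eq, laxU_eq, laxU_eq]
  rw [laxField_zero_of_mem hζ, laxField_zero_of_mem hζ, (laxField_one_of_mem hζ v).1,
    (laxField_one_of_mem hζ v).2, (laxField_one_of_mem hζ w).1, (laxField_one_of_mem hζ w).2]
  generalize ζ 1 0 0 = A at *
  generalize ζ 1 1 0 = C at *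
  generalize ζ 1 0 1 = B at *
  generalize ζ 0 0 1 = β at *
  generalize shiftDown ζ 1 1 0 = D at *
  ext i j; fin_cases i <;> fin_cases j <;> simp <;> field_simp <;> ring

theorem laxZero_conjTranspose (v : ℂ) (ζ : Fin (g + 2) → M2) : (laxZero v ζ)ᴴ = -laxZero v ζ := by
  ext i j; fin_cases i <;> fin_cases j <;> simp [laxZero, conjTranspose_apply] <;> ring

theorem conjTranspose_comm (X Y : M2) : (comm X Y)ᴴ = -comm Xᴴ Yᴴ := by
  simp [comm, conjTranspose_sub, conjTranspose_mul]

theorem shiftDown_rev (hζ : ζ ∈ potentialSpace g) (j : Fin (g + 2)) :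
    (shiftDown ζ j.rev)ᴴ = -shiftUp ζ j ∧ (shiftUp ζ j.rev)ᴴ = -shiftDown ζ j := by
  constructor
  · induction j using Fin.cases with
    | zero => rw [Fin.rev_zero, shiftDown, Fin.snoc_last]; simp [shiftUp]
    | succ i =>
      rw [Fin.rev_succ, shiftDown, Fin.snoc_castSucc, shiftUp, Fin.cons_succ, hζ.1 i.castSucc,
        Fin.rev_castSucc, neg_neg]
  · induction j using Fin.lastCases with
    | last => rw [Fin.rev_last, shiftDown, Fin.snoc_last]; simp [shiftUp]
    | cast i =>
      rw [Fin.rev_castSucc, shiftDown, Fin.snoc_castSucc, shiftUp, Fin.cons_succ, hζ.1 i.succ,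
        Fin.rev_succ, neg_neg]

theorem laxField_mem (hζ : ζ ∈ potentialSpace g) (v : ℂ) : laxField v ζ ζ ∈ potentialSpace g := by
  have h0 := laxField_zero_of_mem hζ v
  refine ⟨fun j => ?_, fun j => ?_, by rw [h0]; rfl, by rw [h0]; rfl, ?_⟩
  · have h1 : (ζ j.rev)ᴴ = -ζ j := by rw [hζ.1 j, neg_neg]
    simp only [laxField, conjTranspose_add, conjTranspose_sub, conjTranspose_comm,
      (shiftDown_rev hζ j).1, (shiftDown_rev hζ j).2, h1, laxZero_conjTranspose,
      conjTranspose_conjTranspose, comm_neg, neg_comm, neg_neg]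
    abel
  · simp only [laxField, trace_add, trace_sub, trace_comm, add_zero, sub_zero]
  · have h := hζ.2.2.2.2
    have h' : (laxField v ζ ζ 0 0 1) = ζ 0 0 1 * (v * ζ 1 0 0 + conj (v * ζ 1 0 0)) := by
      rw [h0, map_mul]; simp; ring
    rw [h', add_conj, mul_re, h, ofReal_im]
    simp

end K

end Lax

section LaxFlow

/-- The points at which Laurent polynomials are evaluated. -/
def node (g : ℕ) (i : Fin (g + 2)) : ℂ := exp (2 * Real.pi * I / (g + 2 : ℕ)) ^ (i : ℕ)

theorem norm_node (i : Fin (g + 2)) : ‖node g i‖ = 1 := by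
  rw [node, norm_pow, (isPrimitiveRoot_exp (g + 2) (by omega)).norm'_eq_one (by omega), one_pow]

theorem node_ne_zero (i : Fin (g + 2)) : node g i ≠ 0 :=
  norm_ne_zero_iff.1 (by rw [norm_node]; exact one_ne_zero)

theorem node_injective : Function.Injective (node g) := fun i j h =>
  Fin.ext ((isPrimitiveRoot_exp (g + 2) (by omega)).pow_inj i.2 j.2 h)

theorem laurent_apply (ζ : Fin (g + 2) → M2) (l : ℂ) (i j : Fin 2) :
    laurent ζ l i j = ∑ k : Fin (g + 2), l ^ ((k : ℤ) - 1) * ζ k i j := by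
  simp [laurent, Matrix.sum_apply]

theorem eq_zero_of_laurent_node {ζ : Fin (g + 2) → M2} (h : ∀ i, laurent ζ (node g i) = 0) :
    ζ = 0 := by
  have h2 : ∀ p q, (fun k => ζ k p q) = 0 := fun p q => by
    refine Matrix.eq_zero_of_forall_index_sum_pow_mul_eq_zero node_injective fun j => ?_
    have := congrFun (congrFun (h j) p) q
    rw [laurent_eq _ (node_ne_zero j)] at this
    simpa [Matrix.sum_apply, node_ne_zero] using this
  funext k
  ext p q
  exact congrFun (h2 p q) k

theorem eq_of_laurent {ζ η : Fin (g + 2) → M2} (h : ∀ l ≠ 0, laurent ζ l = laurent η l) : ζ = η :=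
  sub_eq_zero.1 (eq_zero_of_laurent_node fun i => by
    rw [laurent_sub, h _ (node_ne_zero i), sub_self])

/-- Pairs of the coefficients of a polynomial Killing field and a frame. -/
abbrev LaxState (g : ℕ) := (Fin (g + 2) → Fin 2 → Fin 2 → ℂ) × (Fin 2 → Fin 2 → ℂ)

abbrev mulM2 (X Y : M2) : M2 := X * Y

abbrev oneM2 : Fin 2 → Fin 2 → ℂ := (1 : M2)

theorem laurent_smul (r : ℝ) (ζ : Fin (g + 2) → M2) (l : ℂ) :
    laurent (r • ζ) l = r • laurent ζ l := by
  simp only [laurent, Finset.smul_sum, Pi.smul_apply]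
  exact Finset.sum_congr rfl fun k _ => smul_comm _ _ _

theorem exists_norm_le_nodes (g : ℕ) : ∃ K : ℝ, 0 ≤ K ∧
    ∀ (ζ : Fin (g + 2) → Fin 2 → Fin 2 → ℂ) (M : ℝ), 0 ≤ M →
    (∀ i p q, ‖laurent ζ (node g i) p q‖ ≤ M) → ‖ζ‖ ≤ K * M := by
  let T : (Fin (g + 2) → Fin 2 → Fin 2 → ℂ) →ₗ[ℝ] (Fin (g + 2) → Fin 2 → Fin 2 → ℂ) :=
    { toFun := fun ζ i p q => laurent ζ (node g i) p q
      map_add' := fun ζ η => by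
        funext i p q
        exact congrFun (congrFun (laurent_add ζ η (node g i)) p) q
      map_smul' := fun r ζ => by
        funext i p q
        exact congrFun (congrFun (laurent_smul r ζ (node g i)) p) q }
  obtain ⟨K, -, hK⟩ := T.exists_antilipschitzWith (LinearMap.ker_eq_bot'.2 fun ζ hζ =>
    eq_zero_of_laurent_node fun i => by ext p q; exact congrFun (congrFun (congrFun hζ i) p) q)
  refine ⟨K, K.2, fun ζ M hM h => ?_⟩
  have := hK.le_mul_dist ζ 0
  rw [dist_zero_right, map_zero, dist_zero_right] at this
  refine this.trans (mul_le_mul_of_nonneg_left ?_ K.2)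
  simp only [pi_norm_le_iff_of_nonneg hM]
  exact h

theorem laurent_conjTranspose {ζ : Fin (g + 2) → M2} (hζ : ζ ∈ potentialSpace g) {l : ℂ}
    (hl : l ≠ 0) : (laurent ζ (conj l)⁻¹)ᴴ = -(l ^ (1 - (g : ℤ)) • laurent ζ l) := by
  rw [laurent, laurent, Matrix.conjTranspose_sum, ← Equiv.sum_comp Fin.revPerm, Finset.smul_sum,
    ← Finset.sum_neg_distrib]
  refine Finset.sum_congr rfl fun j _ => ?_
  have h1 : ((Fin.rev j : Fin (g + 2)) : ℤ) = g + 1 - j := by rw [Fin.val_rev]; omega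
  rw [Fin.revPerm_apply, conjTranspose_smul, hζ.1 j, smul_neg, smul_neg, neg_neg, smul_smul,
    ← zpow_add₀ hl, h1]
  rw [starRingEnd_apply, ← star_inv₀, ← star_zpow₀, star_star, inv_zpow', ]
  ring

theorem trace_laurent {ζ : Fin (g + 2) → M2} (hζ : ζ ∈ potentialSpace g) (l : ℂ) :
    (laurent ζ l).trace = 0 := by
  simp only [laurent, Matrix.trace_sum, trace_smul, hζ.2.1, smul_zero, Finset.sum_const_zero]

theorem norm_laurent_le {ζ : Fin (g + 2) → M2} (hζ : ζ ∈ potentialSpace g) (hl : ‖l‖ = 1)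
    (p q : Fin 2) : ‖laurent ζ l p q‖ ≤ 1 + ‖(laurent ζ l).det‖ := by
  have hl0 := norm_ne_zero_iff.1 (by rw [hl]; exact one_ne_zero)
  have h1 := inv_eq_of_mul_eq_one_left (by rw [mul_conj', hl]; simp)
  have h := laurent_conjTranspose hζ hl0
  have ht := trace_laurent hζ l
  rw [h1] at h
  generalize laurent ζ l = X at *
  set ε := l ^ (1 - (g : ℤ)) with hε
  have hε1 : ‖ε‖ = 1 := by rw [hε, norm_zpow, hl, one_zpow]
  have e (i j) : conj (X j i) = -(ε * X i j) := congrFun (congrFun h i) j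
  rw [trace_fin_two] at ht
  have ht' : X 1 1 = -X 0 0 := by linear_combination ht
  have hd : ‖X.det‖ = ‖X 0 0‖ ^ 2 + ‖X 0 1‖ ^ 2 := by
    have : ε * X.det = ((‖X 0 0‖ ^ 2 + ‖X 0 1‖ ^ 2 : ℝ) : ℂ) := by
      push_cast
      rw [← mul_conj', ← mul_conj', e, e, det_fin_two, ht']
      ring
    have h2 := congrArg norm this
    rw [norm_mul, hε1, one_mul, norm_real, Real.norm_of_nonneg (by positivity)] at h2
    exact h2
  have h10 : ‖X 1 0‖ = ‖X 0 1‖ := by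
    have := congrArg norm (e 0 1)
    simpa [hε1] using this
  have h11 : ‖X 1 1‖ = ‖X 0 0‖ := by rw [ht', norm_neg]
  have b0 : ‖X 0 0‖ ≤ 1 + ‖X.det‖ := by nlinarith [sq_nonneg (‖X 0 0‖ - 1), sq_nonneg ‖X 0 1‖]
  have b1 : ‖X 0 1‖ ≤ 1 + ‖X.det‖ := by nlinarith [sq_nonneg (‖X 0 1‖ - 1), sq_nonneg ‖X 0 0‖]
  fin_cases p <;> fin_cases q
  · exact b0
  · exact b1
  · exact h10.trans_le b1
  · exact h11.trans_le b0

theorem exists_laxForm (g : ℕ) (l : ℂ) : ∃ B : ℂ →L[ℝ] LaxState g →L[ℝ] LaxState g →L[ℝ] LaxState g,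
      ∀ v x y, B v x y = (laxField v x.1 y.1, mulM2 x.2 (laxU l v y.1)) := by
  have Z1 (v w : ℂ) (ζ : Fin (g + 2) → M2) : laxZero (v + w) ζ = laxZero v ζ + laxZero w ζ := by
    ext i j; fin_cases i <;> fin_cases j <;> simp [laxZero] <;> ring
  have Z2 (r : ℝ) v (ζ : Fin (g + 2) → M2) : laxZero (r • v) ζ = r • laxZero v ζ := by
    ext i j; fin_cases i <;> fin_cases j <;> simp [laxZero] <;> ring
  have Z3 v (ζ η : Fin (g + 2) → M2) : laxZero v (ζ + η) = laxZero v ζ + laxZero v η := by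
    ext i j; fin_cases i <;> fin_cases j <;> simp [laxZero] <;> ring
  have Z4 (r : ℝ) v (ζ : Fin (g + 2) → M2) : laxZero v (r • ζ) = r • laxZero v ζ := by
    ext i j; fin_cases i <;> fin_cases j <;> simp [laxZero] <;> ring
  have P1 (v w : ℂ) (ζ : Fin (g + 2) → M2) : laxPole (v + w) ζ = laxPole v ζ + laxPole w ζ := by
    ext i j; fin_cases i <;> fin_cases j <;> simp [laxPole, add_mul]
  have P2 (r : ℝ) v (ζ : Fin (g + 2) → M2) : laxPole (r • v) ζ = r • laxPole v ζ := by
    ext i j; fin_cases i <;> fin_cases j <;> simp [laxPole] <;> ring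
  have P3 v (ζ η : Fin (g + 2) → M2) : laxPole v (ζ + η) = laxPole v ζ + laxPole v η := by
    ext i j; fin_cases i <;> fin_cases j <;> simp [laxPole] <;> ring
  have P4 (r : ℝ) v (ζ : Fin (g + 2) → M2) : laxPole v (r • ζ) = r • laxPole v ζ := by
    ext i j; fin_cases i <;> fin_cases j <;> simp [laxPole] <;> ring
  have D1 (ζ η : Fin (g + 2) → M2) : shiftDown (ζ + η) = shiftDown ζ + shiftDown η := by
    funext j; induction j using Fin.lastCases <;> simp [shiftDown]
  have D2 (r : ℝ) (ζ : Fin (g + 2) → M2) : shiftDown (r • ζ) = r • shiftDown ζ := by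
    funext j; induction j using Fin.lastCases <;> simp [shiftDown]
  have U1 (ζ η : Fin (g + 2) → M2) : shiftUp (ζ + η) = shiftUp ζ + shiftUp η := by
    funext j; induction j using Fin.cases <;> simp [shiftUp]
  have U2 (r : ℝ) (ζ : Fin (g + 2) → M2) : shiftUp (r • ζ) = r • shiftUp ζ := by
    funext j; induction j using Fin.cases <;> simp [shiftUp]
  have C1 (r : ℝ) (X Y : M2) : comm (r • X) Y = r • comm X Y := by
    rw [comm, comm, smul_mul_assoc, mul_smul_comm, smul_sub]
  have C2 (r : ℝ) (X Y : M2) : comm X (r • Y) = r • comm X Y := by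
    rw [comm, comm, smul_mul_assoc, mul_smul_comm, smul_sub]
  have C3 (X Y Z : M2) : comm (X + Y) Z = comm X Z + comm Y Z := by
    rw [comm, comm, comm]; noncomm_ring
  have S1 (r : ℝ) (X : M2) : l⁻¹ • r • X = r • l⁻¹ • X := smul_comm _ _ _
  have S2 (r : ℝ) (X : M2) : l • r • X = r • l • X := smul_comm _ _ _
  let f : ℂ → (Fin (g + 2) → M2) × M2 → (Fin (g + 2) → M2) × M2 → (Fin (g + 2) → M2) × M2 :=
    fun v x y => (laxField v x.1 y.1, mulM2 x.2 (laxU l v y.1))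
  have h1 : ∀ x y, IsLinearMap ℝ fun v => f v x y := by
    refine fun x y => ⟨fun v w => ?_, fun r v => ?_⟩
    · refine Prod.ext (funext fun j => ?_) ?_
      · simp only [f, laxField, Prod.fst_add, Pi.add_apply, Z1, P1, conjTranspose_add, comm_add]
        abel
      · simp only [f, laxU, Prod.snd_add, Z1, P1, conjTranspose_add, smul_add, mul_add, mul_sub]
        abel
    · refine Prod.ext (funext fun j => ?_) ?_
      · simp only [f, laxField, Prod.smul_fst, Pi.smul_apply, Z2, P2, conjTranspose_smul,
          star_trivial, C2, smul_add, smul_sub]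
      · simp only [f, laxU, Prod.smul_snd, Z2, P2, conjTranspose_smul, star_trivial, S1, S2,
          ← smul_add, ← smul_sub, mul_smul_comm]
  have h2 : ∀ v y, IsLinearMap ℝ fun x => f v x y := by
    refine fun v y => ⟨fun x x' => ?_, fun r x => ?_⟩
    · refine Prod.ext (funext fun j => ?_) ?_
      · simp only [f, laxField, Prod.fst_add, Pi.add_apply, D1, U1, C3]
        abel
      · simp only [f, Prod.snd_add, add_mul]
    · refine Prod.ext (funext fun j => ?_) ?_
      · simp only [f, laxField, Prod.smul_fst, Pi.smul_apply, D2, U2, C1, smul_add, smul_sub]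
      · simp only [f, Prod.smul_snd, smul_mul_assoc]
  have h3 : ∀ v x, IsLinearMap ℝ fun y => f v x y := by
    refine fun v x => ⟨fun y y' => ?_, fun r y => ?_⟩
    · refine Prod.ext (funext fun j => ?_) ?_
      · simp only [f, laxField, Prod.fst_add, Pi.add_apply, Z3, P3, conjTranspose_add, comm_add]
        abel
      · simp only [f, laxU, Prod.fst_add, Prod.snd_add, Z3, P3, conjTranspose_add, smul_add,
          mul_add, mul_sub]
        abel
    · refine Prod.ext (funext fun j => ?_) ?_
      · simp only [f, laxField, Prod.smul_fst, Pi.smul_apply, Z4, P4, conjTranspose_smul,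
          star_trivial, C2, smul_add, smul_sub]
      · simp only [f, laxU, Prod.smul_fst, Prod.smul_snd, Z4, P4, conjTranspose_smul,
          star_trivial, S1, S2, ← smul_add, ← smul_sub, mul_smul_comm]
  exact exists_trilinear (A := LaxState g) f h1 h2 h3

/-- The right-hand side of the Lax equation and of the frame equation. -/
def laxForm (g : ℕ) (l : ℂ) : ℂ →L[ℝ] LaxState g →L[ℝ] LaxState g →L[ℝ] LaxState g :=
  (exists_laxForm g l).choose

theorem laxForm_apply (l v : ℂ) (x y : LaxState g) :
    laxForm g l v x y = (laxField v x.1 y.1, mulM2 x.2 (laxU l v y.1)) :=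
  (exists_laxForm g l).choose_spec v x y

theorem lax_comm (hl : l ≠ 0) (v w : ℂ) {ζ : Fin (g + 2) → M2}
    (hu : ζ ∈ potentialSpace g) (F : M2) :
    laxField w (laxField v ζ ζ) ζ + laxField w ζ (laxField v ζ ζ) =
      laxField v (laxField w ζ ζ) ζ + laxField v ζ (laxField w ζ ζ) ∧
    F * laxU l v ζ * laxU l w ζ + F * laxU l w (laxField v ζ ζ) =
      F * laxU l w ζ * laxU l v ζ + F * laxU l v (laxField w ζ ζ) := by
  constructor
  · refine eq_of_laurent fun m hm => ?_
    simp only [laurent_add, laurent_laxField_of_mem (laxField_mem hu _) _ _ hm,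
      laurent_laxField_of_mem hu _ _ hm]
    have := laxU_flat hu v w hm
    generalize laurent ζ m = X at *
    have e (P Q R S : M2) (h : P + Q * R = S + R * Q) :
        comm (comm X Q) R + comm X P = comm (comm X R) Q + comm X S := by
      have h' := eq_sub_of_add_eq h
      rw [h', comm, comm, comm, comm, comm, comm]
      noncomm_ring
    exact e _ _ _ _ this
  · have := laxU_flat hu v w hl
    simp only [mul_assoc, ← mul_add]
    grind

theorem laxForm_comm (hl : l ≠ 0) (v w : ℂ) {u : LaxState g} (hu : u.1 ∈ potentialSpace g) :
    laxForm g l w (laxForm g l v u u) u + laxForm g l w u (laxForm g l v u u) =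
      laxForm g l v (laxForm g l w u u) u + laxForm g l v u (laxForm g l w u u) := by
  obtain ⟨h1, h2⟩ := lax_comm hl v w hu u.2
  refine (congrArg₂ (· + ·) (laxForm_apply l w _ u) (laxForm_apply l w u _)).trans
    (Eq.trans ?_ (congrArg₂ (· + ·) (laxForm_apply l v _ u) (laxForm_apply l v u _)).symm)
  rw [laxForm_apply l v u u, laxForm_apply l w u u]
  exact Prod.ext h1 h2

theorem hasDerivWithinAt_det {X : ℝ → M2} {X' : M2} {s : Set ℝ}
    (h : ∀ i j, HasDerivWithinAt (fun t => X t i j) (X' i j) s t) :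
    HasDerivWithinAt (fun t => (X t).det)
      (X' 0 0 * X t 1 1 + X t 0 0 * X' 1 1 - (X' 0 1 * X t 1 0 + X t 0 1 * X' 1 0)) s t := by
  simp only [det_fin_two]
  exact ((h 0 0).mul (h 1 1)).sub ((h 0 1).mul (h 1 0))

/-- An upper bound for the initial value of the conserved quantities. -/
def laxEnergy (ξ : Fin (g + 2) → M2) : ℝ := ∑ i, ‖(laurent ξ (node g i)).det‖

theorem exists_laxBound (g : ℕ) : ∃ K : ℝ, 0 ≤ K ∧ ∀ (l : ℂ) (ξ : Fin (g + 2) → M2) (ρ : ℝ)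
    (v : ℂ), ‖v‖ ≤ ρ → ∀ χ : ℝ → ℝ, (∀ s, 0 ≤ χ s ∧ χ s ≤ 1) →
    ∀ u : ℝ → LaxState g, u 0 = (ξ, oneM2) → (∀ t ∈ 𝕀, (u t).1 ∈ potentialSpace g) →
      SolvesOn (fun t x => χ t • laxForm g l v x x) u → ∀ t ∈ 𝕀,
      ‖u t‖ ≤ K * (1 + laxEnergy ξ) + ‖oneM2‖ *
        Real.exp (max 1 (‖laxForm g l‖ * ρ * (K * (1 + laxEnergy ξ)))) := by
  obtain ⟨K, hK0, hK⟩ := exists_norm_le_nodes g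
  refine ⟨K, hK0, fun l ξ ρ v hv χ hχ u h0 hmem hu => ?_⟩
  have hE : 0 ≤ laxEnergy ξ := Finset.sum_nonneg fun i _ => norm_nonneg _
  have hdet : ∀ i, ∀ t ∈ 𝕀, (laurent (u t).1 (node g i)).det = (laurent ξ (node g i)).det := by
    intro i
    have hX : ∀ t ∈ 𝕀, ∀ p q, HasDerivWithinAt (fun t => laurent (u t).1 (node g i) p q)
        (χ t * comm (laurent (u t).1 (node g i)) (laxU (node g i) v (u t).1) p q)
        𝕀 t := by
      intro t ht p q
      refine ((HasDerivWithinAt.fun_sum fun k _ => (hasDerivWithinAt_pi.1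
        (hasDerivWithinAt_pi.1 (hasDerivWithinAt_pi.1 (hu t ht).fst k) p) q).const_mul
        (node g i ^ ((k : ℤ) - 1))).congr_deriv ?_).congr_of_mem
        (fun t _ => laurent_apply _ _ _ _) ht
      refine Eq.trans ?_ (congrArg (fun M : M2 => (χ t : ℂ) * M p q)
        (laurent_laxField_of_mem (hmem t ht) (u t).1 v (node_ne_zero i)))
      refine Eq.trans ?_ (congrArg ((χ t : ℂ) * ·) (laurent_apply _ _ _ _)).symm
      rw [Finset.mul_sum]
      refine Finset.sum_congr rfl fun k _ => ?_
      have e : (χ t • laxForm g l v (u t) (u t)).1 k p q =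
          χ t * laxField v (u t).1 (u t).1 k p q := by
        rw [laxForm_apply]; exact real_smul
      grind
    have hd : ∀ t ∈ 𝕀, HasDerivWithinAt (fun t => (laurent (u t).1 (node g i)).det) 0 𝕀 t := by
      intro t ht
      refine (hasDerivWithinAt_det (X' := (χ t : ℂ) • comm (laurent (u t).1 (node g i))
        (laxU (node g i) v (u t).1)) (hX t ht)).congr_deriv ?_
      generalize laurent (u t).1 (node g i) = X
      generalize laxU (node g i) v (u t).1 = U
      simp only [comm, Matrix.smul_apply, Matrix.sub_apply, mul_apply, Fin.sum_univ_two,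
        smul_eq_mul]
      ring
    intro t ht
    have := constant_of_derivWithin_zero (fun t ht => (hd t ht).differentiableWithinAt)
      (fun t ht => (hd t (Ico_subset_Icc_self ht)).derivWithin
        (uniqueDiffOn_Icc one_pos t (Ico_subset_Icc_self ht))) t ht
    rw [this, h0]
  have hζ : ∀ t ∈ 𝕀, ‖(u t).1‖ ≤ K * (1 + laxEnergy ξ) := by
    refine fun t ht => hK _ _ (by positivity) fun i p q => ?_
    refine (norm_laurent_le (hmem t ht) (norm_node i) p q).trans ?_
    have h3 := congrArg norm (hdet i t ht)
    have := Finset.single_le_sum (f := fun i => ‖(laurent ξ (node g i)).det‖)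
      (fun i _ => norm_nonneg _) (Finset.mem_univ i)
    have h2 : laxEnergy ξ = ∑ i, ‖(laurent ξ (node g i)).det‖ := rfl
    linarith
  have hρ : 0 ≤ ρ := (norm_nonneg v).trans hv
  set N := ‖laxForm g l‖ * ρ * (K * (1 + laxEnergy ξ)) with hN
  have hF : ∀ t ∈ 𝕀, ‖(u t).2‖ ≤ (‖oneM2‖ + 0) * Real.exp (max 1 N) := by
    refine norm_le_exp_of_deriv (u' := fun t => χ t • (laxForm g l v (u t) (u t)).2)
      (le_max_left _ _) (norm_nonneg _) le_rfl (fun t ht => (hu t ht).snd) (by rw [h0]) ?_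
    intro t ht
    have e : (laxForm g l v (u t) (u t)).2 = (laxForm g l v (0, (u t).2) ((u t).1, 0)).2 := by
      simp only [laxForm_apply]
      rfl
    rw [norm_smul, e, add_zero]
    calc ‖χ t‖ * ‖(laxForm g l v (0, (u t).2) ((u t).1, 0)).2‖
        ≤ 1 * (‖laxForm g l‖ * ‖v‖ * ‖((0, (u t).2) : LaxState g)‖ *
            ‖(((u t).1, 0) : LaxState g)‖) := by
          refine mul_le_mul ?_ ((norm_snd_le _).trans (norm_trilinear_le _ _ _ _))
            (norm_nonneg _) zero_le_one
          rw [Real.norm_of_nonneg (hχ t).1]; exact (hχ t).2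
      _ ≤ ‖laxForm g l‖ * ρ * ‖(u t).2‖ * (K * (1 + laxEnergy ξ)) := by
          rw [one_mul, Prod.norm_mk, Prod.norm_mk, norm_zero, norm_zero,
            max_eq_right (norm_nonneg _), max_eq_left (norm_nonneg _)]
          gcongr
          exact hζ t ht
      _ = N * ‖(u t).2‖ := by rw [hN]; ring
      _ ≤ _ := by gcongr; exact le_max_right _ _
  intro t ht
  have h1 := hζ t ht
  have h2 := hF t ht
  rw [add_zero] at h2
  rw [Prod.norm_def]
  refine max_le ?_ ?_
  · exact h1.trans (le_add_of_nonneg_right (by positivity))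
  · exact h2.trans (le_add_of_nonneg_left (by positivity))

/-- `ζ` is the polynomial Killing field with the initial value `ξ` and `F l` the solution of the
frame equation. -/
structure IsLaxFlow (ξ : Fin (g + 2) → M2) (ζ : ℂ → Fin (g + 2) → M2) (F : ℂ → ℂ → M2) :
    Prop where
  init : ζ 0 = ξ
  mem : ∀ z, ζ z ∈ potentialSpace g
  frame_init : ∀ l ≠ 0, F l 0 = 1
  lax : ∀ k, HasMatrixDifferential (fun z => ζ z k) fun z v => laxField v (ζ z) (ζ z) k
  frame : ∀ l ≠ 0, HasMatrixDifferential (F l) fun z v => F l z * laxU l v (ζ z)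

theorem hasFDerivAt_laxForm_iff {Z : ℂ → LaxState g} :
    (∀ z, HasFDerivAt Z (((laxForm g l).flip (Z z)).flip (Z z)) z) ↔
    (∀ k, HasMatrixDifferential (fun z => (Z z).1 k) fun z v => laxField v (Z z).1 (Z z).1 k) ∧
    HasMatrixDifferential (fun z => (Z z).2) fun z v => mulM2 (Z z).2 (laxU l v (Z z).1) := by
  constructor
  · intro h
    have h1 z (k : Fin (g + 2)) (i j : Fin 2) := hasFDerivAt_pi'.1 (hasFDerivAt_pi'.1
      (hasFDerivAt_pi'.1 (h z).fst k) i) j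
    have h2 z (i j : Fin 2) := hasFDerivAt_pi'.1 (hasFDerivAt_pi'.1 (h z).snd i) j
    refine ⟨fun k i j => ⟨fun z => (h1 z k i j).differentiableAt, fun z v => ?_⟩,
      fun i j => ⟨fun z => (h2 z i j).differentiableAt, fun z v => ?_⟩⟩
    · rw [(h1 z k i j).fderiv]
      simp [laxForm_apply]
      rfl
    · rw [(h2 z i j).fderiv]
      simp [laxForm_apply]
      rfl
  · rintro ⟨h1, h2⟩ z
    have d1 := differentiableAt_pi.2 fun k =>
      differentiableAt_pi.2 fun i => differentiableAt_pi.2 fun j => (h1 k i j).1 z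
    have d2 := differentiableAt_pi.2 fun i => differentiableAt_pi.2 fun j => (h2 i j).1 z
    refine (d1.hasFDerivAt.prodMk d2.hasFDerivAt).congr_fderiv ?_
    ext v : 1
    refine Prod.ext (funext fun k => funext fun i => funext fun j => ?_)
      (funext fun i => funext fun j => ?_)
    · refine Eq.trans ?_ (((h1 k i j).2 z v).trans ?_)
      · exact (congrArg (fun L => L v) ((hasFDerivAt_pi'.1 (hasFDerivAt_pi'.1
          (hasFDerivAt_pi'.1 d1.hasFDerivAt k) i) j).fderiv)).symm
      · simp [laxForm_apply]
    · refine Eq.trans ?_ (((h2 i j).2 z v).trans ?_)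
      · exact (congrArg (fun L => L v) ((hasFDerivAt_pi'.1
          (hasFDerivAt_pi'.1 d2.hasFDerivAt i) j).fderiv)).symm
      · simp [laxForm_apply]

theorem killingField_unique {ζ ζ' : ℂ → Fin (g + 2) → M2}
    (h : ∀ k, HasMatrixDifferential (fun z => ζ z k) fun z v => laxField v (ζ z) (ζ z) k)
    (h' : ∀ k, HasMatrixDifferential (fun z => ζ' z k) fun z v => laxField v (ζ' z) (ζ' z) k)
    (h0 : ζ 0 = ζ' 0) : ζ = ζ' := by
  have hz (η : ℂ → Fin (g + 2) → M2) : HasMatrixDifferential (fun _ => 0)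
      fun z v => mulM2 0 (laxU 1 v (η z)) := fun i j => by simp
  have := quadratic_flow_unique (laxForm g 1) (Z := fun z => (ζ z, (0 : M2))) (Z' := fun z => (ζ' z, (0 : M2)))
    (hasFDerivAt_laxForm_iff.2 ⟨h, hz ζ⟩)
    (hasFDerivAt_laxForm_iff.2 ⟨h', hz ζ'⟩) (by rw [h0])
  funext z
  exact congrArg Prod.fst (congrFun this z)

theorem exists_isLaxFlow (g : ℕ) : ∃ R : ℝ → ℝ → ℝ, (∀ ρ, Continuous (R ρ)) ∧
    ∀ ξ ∈ potentialSpace g, ∃ ζ F, IsLaxFlow ξ ζ F ∧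
      ∀ ρ z, ‖z‖ ≤ ρ → ‖((ζ z, F 1 z) : LaxState g)‖ ≤ R ρ (laxEnergy ξ) := by
  obtain ⟨K, hK0, hK⟩ := exists_laxBound g
  refine ⟨fun ρ E => K * (1 + E) + ‖oneM2‖ *
    Real.exp (max 1 (‖laxForm g 1‖ * ρ * (K * (1 + E)))), fun ρ => by fun_prop, fun ξ hξ => ?_⟩
  have hex : ∀ l, l ≠ 0 → ∃ Z : ℂ → LaxState g, Z 0 = (ξ, oneM2) ∧
      (∀ z, (Z z).1 ∈ potentialSpace g) ∧ (∀ ρ z, ‖z‖ ≤ ρ → ‖Z z‖ ≤ K * (1 + laxEnergy ξ) +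
        ‖oneM2‖ * Real.exp (max 1 (‖laxForm g l‖ * ρ * (K * (1 + laxEnergy ξ))))) ∧
      ∀ z, HasFDerivAt Z (((laxForm g l).flip (Z z)).flip (Z z)) z := by
    intro l hl
    let P : Submodule ℝ (Fin (g + 2) → Fin 2 → Fin 2 → ℂ) := potentialSpace g
    let Q : Submodule ℝ (LaxState g) := P.comap
      (LinearMap.fst ℝ (Fin (g + 2) → Fin 2 → Fin 2 → ℂ) (Fin 2 → Fin 2 → ℂ))
    obtain ⟨Z, h0, hm, hb, hd⟩ := exists_commuting_flow Q (laxForm g l) (fun v u hu => by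
        rw [laxForm_apply]; exact laxField_mem hu v)
      (fun v w u hu => laxForm_comm hl v w (show u.1 ∈ potentialSpace g from hu)) hξ _ (hK l ξ)
    exact ⟨Z, h0, hm, hb, hd⟩
  choose! Z h0 hm hb hd using hex
  have hd' l (hl : l ≠ 0) := hasFDerivAt_laxForm_iff.1 (hd l hl)
  have hZ := fun l hl => killingField_unique (hd' l hl).1 (hd' 1 one_ne_zero).1
      (by simp [h0 l hl, h0 1 one_ne_zero])
  refine ⟨fun z => (Z 1 z).1, fun l z => (Z l z).2, ⟨by rw [h0 1 one_ne_zero],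
    hm 1 one_ne_zero, fun l hl => by rw [h0 l hl], (hd' 1 one_ne_zero).1, fun l hl => ?_⟩,
    hb 1 one_ne_zero⟩
  simpa only [congrFun (hZ l hl)] using (hd' l hl).2

end LaxFlow

section Frame

section Calculus

variable {X Y : ℂ → M2} {X' Y' : ℂ → ℂ → M2}

theorem HasMatrixDifferential.mul (hX : HasMatrixDifferential X X')
    (hY : HasMatrixDifferential Y Y') :
    HasMatrixDifferential (fun z => X z * Y z) fun z v => X' z v * Y z + X z * Y' z v := by
  have e (i j : Fin 2) : (fun z => (X z * Y z) i j) =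
      fun z => X z i 0 * Y z 0 j + X z i 1 * Y z 1 j := by
    funext z; rw [mul_apply, Fin.sum_univ_two]
  have d (i j : Fin 2) z := (((hX i 0).1 z).hasFDerivAt.mul ((hY 0 j).1 z).hasFDerivAt).add
    (((hX i 1).1 z).hasFDerivAt.mul ((hY 1 j).1 z).hasFDerivAt)
  refine fun i j => ⟨fun z => ?_, fun z v => ?_⟩
  · rw [e]; exact (d i j z).differentiableAt
  · rw [e]
    refine (congrArg (fun L => L v) (d i j z).fderiv).trans ?_
    simp only [add_apply, smul_apply, (hX _ _).2, (hY _ _).2, smul_eq_mul, Matrix.add_apply,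
      mul_apply, Fin.sum_univ_two]
    ring

theorem HasMatrixDifferential.conjTranspose (hX : HasMatrixDifferential X X') :
    HasMatrixDifferential (fun z => (X z)ᴴ) fun z v => (X' z v)ᴴ := fun i j => by
  have d z := conjCLE.toContinuousLinearMap.hasFDerivAt.comp z ((hX j i).1 z).hasFDerivAt
  refine ⟨fun z => (d z).differentiableAt, fun z v => ?_⟩
  refine (congrArg (fun L => L v) (d z).fderiv).trans ?_
  exact congrArg conj ((hX j i).2 z v)

theorem hasMatrixDifferential_const (M : M2) :
    HasMatrixDifferential (fun _ => M) fun _ _ => 0 := fun i j => by simp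

theorem HasMatrixDifferential.congr (hX : HasMatrixDifferential X X')
    (h : ∀ z v, X' z v = Y' z v) : HasMatrixDifferential X Y' := fun i j =>
  ⟨(hX i j).1, fun z v => by rw [(hX i j).2, h]⟩

theorem HasMatrixDifferential.eq_of_zero (hX : HasMatrixDifferential X X')
    (h : ∀ z v, X' z v = 0) (z w : ℂ) : X z = X w := by
  ext i j
  refine is_const_of_fderiv_eq_zero (hX i j).1 (fun z => ?_) z w
  ext v : 1
  rw [(hX i j).2, h]
  rfl

theorem HasMatrixDifferential.laurent {ζ : ℂ → Fin (g + 2) → M2} {ζ' : ℂ → ℂ → Fin (g + 2) → M2}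
    (h : ∀ k, HasMatrixDifferential (fun z => ζ z k) fun z v => ζ' z v k) (l : ℂ) :
    HasMatrixDifferential (fun z => Whitham.laurent (ζ z) l)
      fun z v => Whitham.laurent (ζ' z v) l := fun i j => by
  simp only [laurent_apply]
  have d z := HasFDerivAt.fun_sum (u := Finset.univ) fun k _ =>
    ((h k i j).1 z).hasFDerivAt.const_mul (l ^ ((k : ℤ) - 1))
  refine ⟨fun z => (d z).differentiableAt, fun z v => ?_⟩
  rw [(d z).fderiv]
  simp [(h _ i j).2]

theorem HasMatrixDifferential.comp_add (hX : HasMatrixDifferential X X') (w : ℂ) :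
    HasMatrixDifferential (fun z => X (z + w)) fun z => X' (z + w) := fun i j =>
  ⟨(hX i j).1.comp (differentiable_id.add_const w), fun z v => by
    rw [fderiv_comp_add_right (f := fun z => X z i j), (hX i j).2]⟩

theorem HasMatrixDifferential.hasDerivAt (hX : HasMatrixDifferential X X') (τ : ℂ) (s : ℝ)
    (i j : Fin 2) : HasDerivAt (fun s : ℝ => X (s * τ) i j) (X' (s * τ) τ i j) s := by
  have h1 : HasDerivAt (fun s : ℝ => s * τ) τ s := by simpa using (ofRealCLM.hasDerivAt).mul_const τ
  have := ((hX i j).1 (s * τ)).hasFDerivAt.comp_hasDerivAt s h1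
  rwa [(hX i j).2] at this

end Calculus

section Flow

variable {ξ : Fin (g + 2) → M2} {ζ : ℂ → Fin (g + 2) → M2} {F : ℂ → ℂ → M2}

theorem IsPotential.mem (hξ : IsPotential ξ) : ξ ∈ potentialSpace g := by
  obtain ⟨r, hr, h⟩ := hξ.residue
  exact ⟨hξ.symm, hξ.traceless, by simp [h], by simp [h], by simp [h]⟩

theorem fderiv_zero (h : IsLaxFlow ξ ζ F) (z v : ℂ) : fderiv ℝ (fun z => ζ z 0 0 1) z v =
    ζ z 0 0 1 * (v * ζ z 1 0 0 + conj (v * ζ z 1 0 0)) := by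
  refine ((h.lax 0 0 1).2 z v).trans ?_
  beta_reduce
  rw [laxField_zero_of_mem (h.mem z), map_mul]
  simp
  ring

theorem fderiv_one (h : IsLaxFlow ξ ζ F) (z v : ℂ) : fderiv ℝ (fun z => ζ z 1 1 0) z v =
    -(ζ z 1 1 0 * (v * ζ z 1 0 0 + conj (v * ζ z 1 0 0))) := by
  refine (((h.lax 1 1 0).2 z v).trans (laxField_one_of_mem (h.mem z) v).2).trans ?_
  grind

theorem IsLaxFlow.mul_eq (h : IsLaxFlow ξ ζ F) (z : ℂ) :
    ζ z 0 0 1 * ζ z 1 1 0 = ξ 0 0 1 * ξ 1 1 0 := by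
  have h1 := (h.lax 0 0 1).1
  have h2 := (h.lax 1 1 0).1
  rw [← h.init]
  refine is_const_of_fderiv_eq_zero (h1.mul h2) (fun z => ?_) z 0
  ext v : 1
  refine (congrArg (fun L => L v) ((h1 z).hasFDerivAt.mul (h2 z).hasFDerivAt).fderiv).trans ?_
  simp only [add_apply, smul_apply, smul_eq_mul, fderiv_zero h, fderiv_one h, zero_apply]
  ring

theorem IsLaxFlow.residue_pos (h : IsLaxFlow ξ ζ F) (hξ : IsPotential ξ)
    (hne : ξ 0 0 1 * ξ 1 1 0 ≠ 0) (z : ℂ) :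
    0 < (ζ z 0 0 1).im ∧ ζ z 0 0 1 = (ζ z 0 0 1).im * I := by
  have hI z : ζ z 0 0 1 = (ζ z 0 0 1).im * I := by
    have := (h.mem z).2.2.2.2
    apply Complex.ext <;> simp [this]
  refine ⟨?_, hI z⟩
  have hc : Continuous fun z => (ζ z 0 0 1).im := continuous_im.comp (h.lax 0 0 1).1.continuous
  have h0 : 0 < (ζ 0 0 0 1).im := by
    obtain ⟨r, hr, e⟩ := hξ.residue
    rw [h.init, e]
    simpa using hr
  by_contra hneg
  obtain ⟨w, hw⟩ := mem_range_of_exists_le_of_exists_ge hc ⟨z, not_lt.1 hneg⟩ ⟨0, h0.le⟩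
  refine hne ?_
  beta_reduce at hw
  rw [← h.mul_eq w, hI w, hw]
  simp

theorem IsLaxFlow.contDiff (h : IsLaxFlow ξ ζ F) (k : Fin (g + 2)) (i j : Fin 2) :
    ContDiff ℝ ∞ fun z => ζ z k i j := by
  suffices H : ∀ n : ℕ, ∀ k i j, ContDiff ℝ n fun z => ζ z k i j from
    contDiff_infty.2 fun n => H n k i j
  intro n
  induction n with
  | zero => exact fun k i j => contDiff_zero.2 (h.lax k i j).1.continuous
  | succ n ih =>
    intro k i j
    push_cast
    refine contDiff_succ_iff_fderiv_apply.2 ⟨(h.lax k i j).1, fun hn => by simp at hn, fun v => ?_⟩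
    simp only [(h.lax k i j).2]
    have hc (k i j) : ContDiff ℝ n fun z => conj (ζ z k i j) :=
      conjCLE.toContinuousLinearMap.contDiff.comp (ih k i j)
    have hD (i' j') : ContDiff ℝ n fun z => shiftDown (ζ z) k i' j' := by
      induction k using Fin.lastCases with
      | last => simpa [shiftDown] using contDiff_const
      | cast k => simpa [shiftDown] using ih k.succ i' j'
    have hU (i' j') : ContDiff ℝ n fun z => shiftUp (ζ z) k i' j' := by
      induction k using Fin.cases with
      | zero => simpa [shiftUp] using contDiff_const
      | succ k => simpa [shiftUp] using ih k.castSucc i' j'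
    have hZ (i' j') : ContDiff ℝ n fun z => laxZero v (ζ z) i' j' := by
      fin_cases i' <;> fin_cases j' <;> simp [laxZero] <;> fun_prop
    have hP (i' j') : ContDiff ℝ n fun z => laxPole v (ζ z) i' j' := by
      fin_cases i' <;> fin_cases j' <;> simp [laxPole] <;> fun_prop
    have hP' (i' j') : ContDiff ℝ n fun z => conj (laxPole v (ζ z) i' j') :=
      conjCLE.toContinuousLinearMap.contDiff.comp (hP i' j')
    simp only [laxField, comm, Matrix.sub_apply, Matrix.add_apply, mul_apply,
      Fin.sum_univ_two, conjTranspose_apply, RCLike.star_def]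
    fun_prop

theorem dz_eq (h : IsLaxFlow ξ ζ F) (hξ : IsPotential ξ) (hne : ξ 0 0 1 * ξ 1 1 0 ≠ 0) :
    ContDiff ℝ ∞ (fun z => Real.log (4 * (ζ z 0 0 1).im)) ∧
      ∀ z, dz (fun z => Real.log (4 * (ζ z 0 0 1).im)) z = ζ z 1 0 0 := by
  have hp z := h.residue_pos hξ hne z
  have hd : ContDiff ℝ ∞ fun z => 4 * (ζ z 0 0 1).im :=
    contDiff_const.mul (imCLM.contDiff.comp (h.contDiff 0 0 1))
  refine ⟨hd.log fun z => by linarith [(hp z).1], fun z => ?_⟩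
  have d := ((imCLM.hasFDerivAt.comp z ((h.lax 0 0 1).1 z).hasFDerivAt).const_mul
    4).log (by simpa using (hp z).1.ne')
  have e v : fderiv ℝ (fun z => Real.log (4 * (ζ z 0 0 1).im)) z v = 2 * (v * ζ z 1 0 0).re := by
    refine (congrArg (fun L => L v) d.fderiv).trans ?_
    have := (hp z).1.ne'
    simp only [smul_apply, ContinuousLinearMap.comp_apply, fderiv_zero h, add_conj,
      imCLM_apply, smul_eq_mul, Function.comp_apply]
    rw [im_mul_ofReal]
    field_simp
  rw [dz, e, e]
  apply Complex.ext <;> simp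

theorem laxU_eq_alphaForm (h : IsLaxFlow ξ ζ F) (hξ : IsPotential ξ) {κ : ℂ}
    (hκ : ‖κ‖ = 1) (hm : ξ 0 0 1 * ξ 1 1 0 = -(1 / 16) * κ) (l z v : ℂ) :
    laxU l v (ζ z) = alphaForm κ (fun z => Real.log (4 * (ζ z 0 0 1).im)) l z v := by
  have hne : ξ 0 0 1 * ξ 1 1 0 ≠ 0 := by
    rw [hm]
    exact mul_ne_zero (by norm_num) (norm_ne_zero_iff.1 (by rw [hκ]; exact one_ne_zero))
  obtain ⟨hpos, hβ⟩ := h.residue_pos hξ hne z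
  have hC := h.mul_eq z
  rw [hm] at hC
  rw [alphaForm, (dz_eq h hξ hne).2, Real.exp_neg, Real.exp_log (by linarith), laxU_eq]
  set r := (ζ z 0 0 1).im
  have hr : r ≠ 0 := by exact_mod_cast hpos.ne'
  have hC' : ζ z 1 1 0 = I * κ / (16 * r) := by
    rw [hβ] at hC
    rw [eq_div_iff (by simpa using hr)]
    linear_combination (-16 * I) * hC + (16 * r * ζ z 1 1 0) * I_sq
  rw [hC', hβ]
  ext i j; fin_cases i <;> fin_cases j <;> simp [map_ofNat] <;> field_simp <;> ring

theorem IsLaxFlow.isExtendedFrame (h : IsLaxFlow ξ ζ F) (hξ : IsPotential ξ) {κ : ℂ}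
    (hκ : ‖κ‖ = 1) (hm : ξ 0 0 1 * ξ 1 1 0 = -(1 / 16) * κ) :
    IsExtendedFrame κ ξ (fun z => Real.log (4 * (ζ z 0 0 1).im)) ζ F := by
  have hne : ξ 0 0 1 * ξ 1 1 0 ≠ 0 := by
    rw [hm]
    exact mul_ne_zero (by norm_num) (norm_ne_zero_iff.1 (by rw [hκ]; exact one_ne_zero))
  refine ⟨(dz_eq h hξ hne).1, fun z => ⟨⟨(ζ z 0 0 1).im, (h.residue_pos hξ hne z).1, ?_⟩, ?_,
    (h.mem z).1, (h.mem z).2.1⟩, h.init, fun z => ?_, fun l hl => ?_, h.frame_init,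
    fun l hl => (h.frame l hl).congr fun z v => by rw [laxU_eq_alphaForm h hξ hκ hm]⟩
  · rw [← (h.residue_pos hξ hne z).2]
    exact zero_eq_of_mem (h.mem z)
  · rw [zero_eq_of_mem (h.mem z), trace_fin_two, mul_apply, mul_apply]
    simpa [Fin.sum_univ_two, h.mul_eq z] using hne
  · rw [Real.exp_log (by linarith [(h.residue_pos hξ hne z).1])]
    nth_rewrite 1 [(h.residue_pos hξ hne z).2]
    push_cast
    ring
  · refine (HasMatrixDifferential.laurent h.lax l).congr fun z v => ?_
    rw [laurent_laxField_of_mem (h.mem z) _ _ hl, laxU_eq_alphaForm h hξ hκ hm, comm]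

end Flow

end Frame

section LinearODE

variable {E : Type*} [NormedAddCommGroup E] [NormedSpace ℂ E] [CompleteSpace E]

theorem exists_variation {A A' : ℝ → E →L[ℂ] E} (hA : ContinuousOn A 𝕀)
    (hA' : ContinuousOn A' 𝕀) {u : ℝ → E} (hu : SolvesOn (fun s x => A s x) u) (w0 : E) :
    ∃ w : ℝ → E, w 0 = w0 ∧ SolvesOn (fun s x => A s x + A' s (u s)) w := by
  obtain ⟨w, hw0, hw⟩ := exists_solvesOn_linear
    (fun s => ((ContinuousLinearMap.inl ℂ E E ∘L (A s ∘L ContinuousLinearMap.fst ℂ E E +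
          A' s ∘L ContinuousLinearMap.snd ℂ E E) +
      ContinuousLinearMap.inr ℂ E E ∘L (A s ∘L ContinuousLinearMap.snd ℂ E E))).restrictScalars ℝ)
    ((ContinuousLinearMap.restrictScalarsL ℂ (E × E) (E × E) ℝ ℝ).continuous.comp_continuousOn
      ((continuousOn_const.clm_comp ((hA.clm_comp continuousOn_const).add
        (hA'.clm_comp continuousOn_const))).add
        (continuousOn_const.clm_comp (hA.clm_comp continuousOn_const))))
    (w0, u 0)
  have h1 : EqOn (fun s => (w s).2) u 𝕀 := by
    refine SolvesOn.eq_of_linear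
      ((ContinuousLinearMap.restrictScalarsL ℂ E E ℝ ℝ).continuous.comp_continuousOn hA)
      (fun s hs => ?_) hu (by simp [hw0])
    refine HasDerivWithinAt.congr_deriv ((hw s hs).hasFDerivWithinAt.snd.hasDerivWithinAt) ?_
    simp
  refine ⟨fun s => (w s).1, congrArg Prod.fst hw0, fun s hs => ?_⟩
  refine HasDerivWithinAt.congr_deriv ((hw s hs).hasFDerivWithinAt.fst.hasDerivWithinAt) ?_
  beta_reduce
  rw [← h1 hs]
  simp

theorem differentiableOn_linear_ode {ι : Type*} [Fintype ι] (hU : IsOpen U)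
    {φ : ι → ℂ → ℂ} (hφ : ∀ k, DifferentiableOn ℂ (φ k) U) {m : ι → ℝ → E →L[ℂ] E}
    (hm : ∀ k, ContinuousOn (m k) 𝕀) {u : ℂ → ℝ → E}
    (hu : ∀ l ∈ U, SolvesOn (fun s x => (∑ k, φ k l • m k s) x) (u l))
    (h0 : DifferentiableOn ℂ (fun l => u l 0) U) : DifferentiableOn ℂ (fun l => u l 1) U := by
  have hL' : ContinuousOn (fun p => ∑ k, deriv (φ k) p.2 • m k p.1) (Icc 0 1 ×ˢ U) :=
    continuousOn_finsetSum _ fun k _ => (((hφ k).deriv hU).continuousOn.comp continuousOn_snd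
      fun p hp => hp.2).smul ((hm k).comp continuousOn_fst fun p hp => hp.1)
  have hLc l : ContinuousOn (fun s => ∑ k, φ k l • m k s) 𝕀 :=
    continuousOn_finsetSum _ fun k _ => (hm k).const_smul (φ k l)
  intro l0 hl0
  have hLc' : ContinuousOn (fun s => ∑ k, deriv (φ k) l0 • m k s) 𝕀 :=
    continuousOn_finsetSum _ fun k _ => (hm k).const_smul (deriv (φ k) l0)
  have hd := ((h0 l0 hl0).differentiableAt (hU.mem_nhds hl0)).hasDerivAt
  obtain ⟨w, hw0, hw⟩ := exists_variation (hLc l0) hLc' (hu l0 hl0) (deriv (fun l => u l 0) l0)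
  have := hasDerivAt_of_linear_ode (L := fun s l => ∑ k, φ k l • m k s) hU (fun s hs l hl =>
      HasDerivAt.fun_sum fun k _ => (((hφ k l hl).differentiableAt
        (hU.mem_nhds hl)).hasDerivAt).smul_const _)
    (fun l hl => hLc l) hL' hu hl0 hw (by rw [hw0]; exact hd) 1 (by simp)
  exact this.differentiableAt.differentiableWithinAt

end LinearODE

section Monodromy

variable {ξ : Fin (g + 2) → M2} {ζ : ℂ → Fin (g + 2) → M2} {F : ℂ → ℂ → M2}

theorem laxU_conjTranspose (l v : ℂ) (ζ : Fin (g + 2) → M2) :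
    (laxU (conj l)⁻¹ v ζ)ᴴ = -laxU l v ζ := by
  rw [laxU, laxU, conjTranspose_sub, conjTranspose_add, laxZero_conjTranspose,
    conjTranspose_smul, conjTranspose_smul, conjTranspose_conjTranspose]
  simp
  abel

theorem inv_conj_ne_zero (hl : l ≠ 0) : (conj l)⁻¹ ≠ 0 := inv_ne_zero ((_root_.map_ne_zero _).2 hl)

theorem IsLaxFlow.star_frame (h : IsLaxFlow ξ ζ F) (hl : l ≠ 0) :
    HasMatrixDifferential (fun z => (F (conj l)⁻¹ z)ᴴ)
      fun z v => -(laxU l v (ζ z) * (F (conj l)⁻¹ z)ᴴ) :=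
  (h.frame _ (inv_conj_ne_zero hl)).conjTranspose.congr fun z v => by
    rw [conjTranspose_mul, laxU_conjTranspose, neg_mul]

theorem IsLaxFlow.frame_mul_star (h : IsLaxFlow ξ ζ F) (hl : l ≠ 0) (z : ℂ) :
    F l z * (F (conj l)⁻¹ z)ᴴ = 1 := by
  rw [((h.frame l hl).mul (h.star_frame hl)).eq_of_zero (fun z v => by noncomm_ring) z 0,
    h.frame_init l hl, h.frame_init _ (inv_conj_ne_zero hl), conjTranspose_one, one_mul]

theorem IsLaxFlow.frame_conj (h : IsLaxFlow ξ ζ F) (hl : l ≠ 0) (z : ℂ) :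
    F l z * laurent (ζ z) l = laurent ξ l * F l z := by
  have h1 := (((h.frame l hl).mul (HasMatrixDifferential.laurent h.lax l)).mul
    (h.star_frame hl)).eq_of_zero (fun z v => by
      rw [laurent_laxField_of_mem (h.mem z) _ _ hl, comm]; noncomm_ring) z 0
  rw [h.frame_init l hl, h.frame_init _ (inv_conj_ne_zero hl), conjTranspose_one, one_mul,
    mul_one, h.init] at h1
  rw [← h1, mul_assoc, mul_eq_one_comm.1 (h.frame_mul_star hl z), mul_one]

theorem laurent_sq {a : ℂ[X]} (hξ : ξ ∈ isospectral g a) (hl : l ≠ 0) :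
    laurent ξ l * laurent ξ l = (a.eval l / l) • (1 : M2) := by
  have h1 := trace_laurent hξ.1.mem l
  have h2 := hξ.2.1 l hl
  generalize laurent ξ l = X at *
  rw [trace_fin_two] at h1
  rw [det_fin_two] at h2
  have e1 : X 1 1 = -X 0 0 := by linear_combination h1
  have e2 : a.eval l / l = X 0 0 * X 0 0 + X 0 1 * X 1 0 := by
    rw [div_eq_iff hl]
    rw [e1] at h2
    linear_combination h2
  rw [e2]
  ext i j; fin_cases i <;> fin_cases j <;> simp [mul_apply, Fin.sum_univ_two, e1] <;> ring

/-- The expected value of the monodromy. -/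
def monodromy (ξ : Fin (g + 2) → M2) (k f : ℂ → ℂ) (l : ℂ) : M2 := k l • 1 - f l • laurent ξ l

variable {k f E E0 : ℂ → ℂ}

theorem monodromy_star (hξ : ξ ∈ isospectral g (aPoly x)) (hm : IsMonodromy x k f E E0)
    (hl : l ≠ 0) : (monodromy ξ k f (conj l)⁻¹)ᴴ * monodromy ξ k f l = 1 := by
  have h1 : (monodromy ξ k f (conj l)⁻¹)ᴴ = k l • (1 : M2) + f l • laurent ξ l := by
    rw [monodromy, conjTranspose_sub, conjTranspose_smul, conjTranspose_smul,
      conjTranspose_one, laurent_conjTranspose hξ.1.mem hl, ← hm.real_k l hl,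
      ← hm.real_f l hl, smul_neg, sub_neg_eq_add, smul_smul, zpow_sub₀ hl, zpow_one, zpow_natCast,
      mul_comm]
    rfl
  have h2 := hm.pell.pell l hl
  rw [h1, monodromy]
  have h3 := laurent_sq hξ hl
  simp only [add_mul, mul_sub, smul_mul, Matrix.mul_smul, one_mul, mul_one, h3, smul_smul]
  have h4 : k l * k l - f l * (f l * (eval l (aPoly x) / l)) = 1 := by
    field_simp
    linear_combination h2
  have h5 : (1 : M2) = (k l * k l - f l * (f l * (eval l (aPoly x) / l))) • (1 : M2) := by
    rw [h4, one_smul]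
  conv_rhs => rw [h5, sub_smul]
  rw [mul_comm (f l) (k l)]
  abel

theorem differentiableOn_monodromy (hm : IsMonodromy x k f E E0) (i j : Fin 2) :
    DifferentiableOn ℂ (fun l => monodromy ξ k f l i j) {0}ᶜ := by
  have h1 : DifferentiableOn ℂ (fun l => laurent ξ l i j) {0}ᶜ := by
    simp only [laurent_apply]
    refine DifferentiableOn.fun_sum fun n _ => DifferentiableOn.mul_const ?_ _
    exact fun l hl => (differentiableAt_zpow.2 (Or.inl hl)).differentiableWithinAt
  exact (hm.pell.diff_k.mul_const _).sub (hm.pell.diff_f.mul h1)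

def leftMul : (Fin 2 → Fin 2 → ℂ) →ₗ[ℂ] (Fin 2 → Fin 2 → ℂ) →L[ℂ] (Fin 2 → Fin 2 → ℂ) where
  toFun M := LinearMap.toContinuousLinearMap
    { toFun := fun X => mulM2 M X
      map_add' := fun X Y => Matrix.mul_add (M : M2) X Y
      map_smul' := fun r X => Matrix.mul_smul (M : M2) r X }
  map_add' M N := ContinuousLinearMap.ext fun X => Matrix.add_mul (M : M2) N X
  map_smul' r M := ContinuousLinearMap.ext fun X => smul_mul r (M : M2) X

theorem continuous_leftMul {m : ℝ → M2} (h : ∀ i j, Continuous fun s => m s i j) :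
    Continuous fun s => leftMul (m s) :=
  (LinearMap.continuous_of_finiteDimensional leftMul).comp
    (continuous_pi fun i => continuous_pi fun j => h i j)

theorem exists_matrix_ode {m : ℝ → M2} (hm : ∀ i j, Continuous fun s => m s i j) :
    ∃ u : ℝ → M2, u 0 = 1 ∧ ∀ s ∈ 𝕀, ∀ i j,
      HasDerivWithinAt (fun s => u s i j) ((m s * u s) i j) 𝕀 s := by
  obtain ⟨u, h0, hu⟩ := exists_solvesOn_linear (fun s => (leftMul (m s)).restrictScalars ℝ)
    (((ContinuousLinearMap.restrictScalarsL ℂ _ _ ℝ ℝ).continuous.comp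
      (continuous_leftMul hm)).continuousOn) oneM2
  exact ⟨u, h0, fun s hs i j => hasDerivWithinAt_pi.1 (hasDerivWithinAt_pi.1 (hu s hs) i) j⟩

theorem differentiableOn_matrix_ode {ι : Type*} [Fintype ι] (hU : IsOpen U)
    {φ : ι → ℂ → ℂ} (hφ : ∀ k, DifferentiableOn ℂ (φ k) U) {m : ι → ℝ → M2}
    (hm : ∀ k i j, Continuous fun s => m k s i j) {u : ℂ → ℝ → M2}
    (hu : ∀ l ∈ U, ∀ s ∈ 𝕀, ∀ i j, HasDerivWithinAt (fun s => u l s i j)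
      (((∑ k, φ k l • m k s) * u l s) i j) 𝕀 s)
    (h0 : ∀ i j, DifferentiableOn ℂ (fun l => u l 0 i j) U) (i j : Fin 2) :
    DifferentiableOn ℂ (fun l => u l 1 i j) U := by
  have := differentiableOn_linear_ode hU hφ (fun k => (continuous_leftMul (hm k)).continuousOn)
    (fun l hl s hs => ?_)
    (differentiableOn_pi.2 fun i => differentiableOn_pi.2 fun j => h0 i j)
  · exact differentiableOn_pi.1 (differentiableOn_pi.1 this i) j
  · have e : (∑ k, φ k l • leftMul (m k s)) = leftMul (∑ k, φ k l • m k s : M2) := by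
      refine Eq.trans ?_ (map_sum leftMul _ _).symm
      exact Finset.sum_congr rfl fun k _ => (map_smul leftMul _ _).symm
    exact HasDerivWithinAt.congr_deriv (hasDerivWithinAt_pi.2 fun i =>
      hasDerivWithinAt_pi.2 fun j => hu l hl s hs i j) (DFunLike.congr_fun e (u l s)).symm

theorem continuous_killingField (h : IsLaxFlow ξ ζ F) (τ : ℂ) (n : Fin (g + 2)) (i j : Fin 2) :
    Continuous fun s : ℝ => ζ (s * τ) n i j :=
  (h.lax n i j).1.continuous.comp (by fun_prop)

theorem continuous_lax (h : IsLaxFlow ξ ζ F) (τ : ℂ) (i j : Fin 2) :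
    Continuous (fun s : ℝ => laxZero τ (ζ (s * τ)) i j) ∧
    Continuous (fun s : ℝ => laxPole τ (ζ (s * τ)) i j) ∧
    Continuous (fun s : ℝ => (laxPole τ (ζ (s * τ)))ᴴ i j) := by
  have h1 := continuous_killingField h τ 1 0 0
  have h2 := continuous_killingField h τ 1 1 0
  have h3 := continuous_killingField h τ 0 0 1
  have c := continuous_conj
  have h1' := c.comp h1
  have h2' := c.comp h2
  have h3' := c.comp h3
  simp only [laxZero, laxPole]
  have h4 := ((continuous_const (y := τ).mul h1).sub
    (continuous_const (y := conj τ).mul h1')).div_const 2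
  refine ⟨?_, ?_, ?_⟩ <;> fin_cases i <;> fin_cases j <;> simp <;>
    first | fun_prop | exact h4 | exact h4.neg | exact continuous_const.mul h2 |
      exact continuous_const.mul h3

/-- The function whose constancy determines the monodromy. -/
def quotientFrame (ξ : Fin (g + 2) → M2) (F : ℂ → ℂ → M2) (τ : ℂ) (k f : ℂ → ℂ) (l : ℂ) (s : ℝ) :
    M2 := (F (conj l)⁻¹ (s * τ))ᴴ * monodromy ξ k f l

theorem differentiableOn_quotientFrame (h : IsLaxFlow ξ ζ F) (hm : IsMonodromy x k f E E0)
    (τ : ℂ) (i j : Fin 2) :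
    DifferentiableOn ℂ (fun l => quotientFrame ξ F τ k f l 1 i j) {0}ᶜ := by
  refine differentiableOn_matrix_ode isOpen_compl_singleton
    (φ := ![fun l => -l⁻¹, fun _ => -1, fun l => l]) (fun k => ?_)
    (m := ![fun s => laxPole τ (ζ (s * τ)), fun s => laxZero τ (ζ (s * τ)),
      fun s => (laxPole τ (ζ (s * τ)))ᴴ]) (fun k i j => ?_)
    (fun l hl s _ i j => ?_) (fun i j => ?_) i j
  · fin_cases k
    · exact (differentiableOn_id.inv fun l hl => hl).neg
    · simp
    · exact differentiableOn_id
  · fin_cases k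
    · exact (continuous_lax h τ i j).2.1
    · exact (continuous_lax h τ i j).1
    · exact (continuous_lax h τ i j).2.2
  · refine ((((h.star_frame hl).mul (hasMatrixDifferential_const
      (monodromy ξ k f l))).hasDerivAt τ s i j).hasDerivWithinAt).congr_deriv ?_
    rw [quotientFrame, Fin.sum_univ_three]
    generalize (F (conj l)⁻¹ (s * τ))ᴴ = Q
    have e : -(laxU l τ (ζ (s * τ)) * Q) * monodromy ξ k f l + Q * 0 =
        ((-l⁻¹) • laxPole τ (ζ (s * τ)) + (-1 : ℂ) • laxZero τ (ζ (s * τ)) +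
          l • (laxPole τ (ζ (s * τ)))ᴴ) * (Q * monodromy ξ k f l) := by
      rw [show (-l⁻¹) • laxPole τ (ζ (s * τ)) + (-1 : ℂ) • laxZero τ (ζ (s * τ)) +
          l • (laxPole τ (ζ (s * τ)))ᴴ = -laxU l τ (ζ (s * τ)) by
        rw [laxU, neg_smul, neg_smul, one_smul]; abel]
      noncomm_ring
    exact congrFun (congrFun e i) j
  · refine (differentiableOn_monodromy (ξ := ξ) hm i j).congr fun l hl => ?_
    simp only [quotientFrame, ofReal_zero, zero_mul]
    rw [h.frame_init _ (inv_conj_ne_zero hl), conjTranspose_one, one_mul]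

theorem exists_extension_quotientFrame (h : IsLaxFlow ξ ζ F) (hξ : ξ ∈ isospectral g (aPoly x))
    (hm : IsMonodromy x k f E E0) (ha0 : (aPoly x).eval 0 ≠ 0) :
    ∃ u : ℂ → M2, (∀ i j, DifferentiableOn ℂ (fun l => u l i j) (nearStar (aPoly x))) ∧
      (∀ l ∈ nearStar (aPoly x), l ≠ 0 → u l = quotientFrame ξ F (period x) k f l 1) ∧
      ∃ p r : ℝ, 0 < p ∧ 0 < r ∧ u 0 0 0 = p ∧ u 0 1 0 = 0 ∧ u 0 1 1 = r := by
  have ha : aPoly x ≠ 0 := fun h => ha0 (by rw [h, eval_zero])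
  set τ := period x with hτ
  have hE0 : E0 0 = -τ := by
    have := hm.near_zero
    rw [hτ, period]
    field_simp
    linear_combination this
  have hU := isOpen_nearStar ha
  set e := dslope E0 0 with he
  have hde : DifferentiableOn ℂ e (nearStar (aPoly x)) :=
    (differentiableOn_dslope (hU.mem_nhds zero_mem_nearStar)).2 hm.diff_near
  have hle (l : ℂ) : l * e l = E0 l + τ := by
    have := sub_smul_dslope E0 0 l
    rw [hE0, smul_eq_mul] at this
    linear_combination this
  let φ : Fin (g + 2) ⊕ Fin 2 → ℂ → ℂ := Sum.elim
    (Fin.cases (fun l => -e l) fun i l => -(E0 l * l ^ (i : ℕ))) ![fun _ => -1, fun l => l]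
  let m : Fin (g + 2) ⊕ Fin 2 → ℝ → M2 := Sum.elim (fun n s => ζ (s * τ) n)
    ![fun s => laxZero τ (ζ (s * τ)), fun s => (laxPole τ (ζ (s * τ)))ᴴ]
  have hφ : ∀ n, DifferentiableOn ℂ (φ n) (nearStar (aPoly x)) := by
    rintro (n | n)
    · refine Fin.cases hde.neg (fun i => ?_) n
      exact (hm.diff_near.mul (differentiableOn_id.pow _)).neg
    · fin_cases n
      · exact differentiableOn_const _
      · exact differentiableOn_id
  have hmc : ∀ n i j, Continuous fun s => m n s i j := by
    rintro (n | n) i j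
    · exact continuous_killingField h τ n i j
    · fin_cases n
      · exact (continuous_lax h τ i j).1
      · exact (continuous_lax h τ i j).2.2
  have hYe (l : ℂ) (s : ℝ) : ∑ n, φ n l • m n s = (-e l) • ζ (s * τ) 0 +
      ∑ i : Fin (g + 1), (-(E0 l * l ^ (i : ℕ))) • ζ (s * τ) i.succ +
      (-laxZero τ (ζ (s * τ)) + l • (laxPole τ (ζ (s * τ)))ᴴ) := by
    rw [Fintype.sum_sum_type, Fin.sum_univ_succ, Fin.sum_univ_two]
    simp [φ, m]
  have hex : ∀ l : ℂ, ∃ u : ℝ → M2, u 0 = 1 ∧ ∀ s ∈ 𝕀, ∀ i j, HasDerivWithinAt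
      (fun s => u s i j) (((∑ n, φ n l • m n s) * u s) i j) 𝕀 s := fun l =>
    exists_matrix_ode fun i j => by
      simp only [Matrix.sum_apply, Matrix.smul_apply]
      exact continuous_finsetSum _ fun n _ => continuous_const.mul (hmc n i j)
  choose u hu0 hu using hex
  refine ⟨fun l => u l 1, differentiableOn_matrix_ode hU hφ hmc (fun l _ => hu l)
    (by simp only [hu0]; exact fun i j => differentiableOn_const _), fun l hl hl0 => ?_, ?_⟩
  · have hYl (s : ℝ) : ∑ n, φ n l • m n s =
        -(E0 l • laurent (ζ (s * τ)) l) - laxU l τ (ζ (s * τ)) := by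
      have e1 : laxPole τ (ζ (s * τ)) = τ • ζ (s * τ) 0 := by
        conv_rhs => rw [zero_eq_of_mem (h.mem _)]
        ext i j; fin_cases i <;> fin_cases j <;> simp [laxPole]
      have e2 : laurent (ζ (s * τ)) l = l⁻¹ • ζ (s * τ) 0 +
          ∑ i : Fin (g + 1), l ^ (i : ℕ) • ζ (s * τ) i.succ := by
        rw [laurent_eq _ hl0, Fin.sum_univ_succ, smul_add, Finset.smul_sum]
        simp only [Fin.val_zero, pow_zero, one_smul, Fin.val_succ, pow_succ', mul_smul,
          inv_smul_smul₀ hl0]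
      have e3 : -e l = -(E0 l * l⁻¹) - l⁻¹ * τ := by
        field_simp
        linear_combination -hle l
      rw [hYe, laxU, e1, e2, e3, smul_add, Finset.smul_sum]
      simp only [sub_smul, neg_smul, mul_smul, Finset.sum_neg_distrib]
      abel
    obtain ⟨ν, hν⟩ : ∃ ν : ℂ, ν ^ 2 = (aPoly x).eval l / l :=
      IsAlgClosed.exists_pow_nat_eq _ two_pos
    have hν0 : ν ≠ 0 := by
      rintro rfl
      rw [zero_pow two_ne_zero, eq_comm, div_eq_zero_iff] at hν
      exact hν.elim (eval_ne_of_mem_nearStar ha0 hl) hl0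
    have hproj : ∀ ν : ℂ, ν ^ 2 = (aPoly x).eval l / l → (ν • 1 + laurent ξ l) * (F l τ * u l 1) =
          (k l - f l * ν) • (ν • (1 : M2) + laurent ξ l) := by
      intro ν hν
      have hexp := hm.exp_near l hl hl0 (-ν) (by rw [neg_sq, hν]; field_simp)
      set P : M2 := ν • 1 + laurent ξ l with hP
      have hPξ : P * laurent ξ l = ν • P := by
        rw [hP, add_mul, laurent_sq hξ hl0, ← hν, smul_mul, one_mul, smul_add, smul_smul,
          pow_two, add_comm]
      have hder : ∀ s ∈ 𝕀, ∀ i j, HasDerivWithinAt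
          (fun s : ℝ => exp (E0 l * ν * s) * (P * (F l (s * τ) * u l s)) i j) 0
          𝕀 s := by
        intro s hs i j
        have d1 : HasDerivAt (fun s : ℝ => exp (E0 l * ν * s))
            (exp (E0 l * ν * s) * (E0 l * ν)) s := by
          have := ((ofRealCLM.hasDerivAt (x := s)).const_mul (E0 l * ν)).cexp
          simpa using this
        have d2 (p q : Fin 2) := ((h.frame l hl0).hasDerivAt τ s p q).hasDerivWithinAt (s := 𝕀)
        have d3 := fun p q => (((d2 p 0).mul (hu l s hs 0 q)).add ((d2 p 1).mul (hu l s hs 1 q)))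
        have d4 := ((d3 0 j).const_mul (P i 0)).add ((d3 1 j).const_mul (P i 1))
        refine ((d1.hasDerivWithinAt.mul d4).congr_deriv ?_).congr_of_mem (fun s _ => ?_) hs
        · have key : P * (F l (s * τ) * laxU l τ (ζ (s * τ)) * u l s +
              F l (s * τ) * ((∑ n, φ n l • m n s) * u l s)) =
              -((E0 l * ν) • (P * (F l (s * τ) * u l s))) := by
            rw [hYl]
            have e4 : P * (F l (s * τ) * laxU l τ (ζ (s * τ)) * u l s + F l (s * τ) *
                ((-(E0 l • laurent (ζ (s * τ)) l) - laxU l τ (ζ (s * τ))) * u l s)) =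
                -(P * (F l (s * τ) * (E0 l • laurent (ζ (s * τ)) l) * u l s)) := by
              noncomm_ring
            rw [e4, Matrix.mul_smul, h.frame_conj hl0, smul_mul, Matrix.mul_smul, mul_assoc,
              ← mul_assoc P, hPξ, smul_mul, smul_smul]
          have key' := congrFun (congrFun key i) j
          simp only [mul_apply, Fin.sum_univ_two, Matrix.add_apply, Matrix.neg_apply,
            Matrix.smul_apply, smul_eq_mul, Pi.add_apply, Pi.mul_apply] at key' ⊢
          linear_combination exp (E0 l * ν * s) * key'
        · simp only [mul_apply, Fin.sum_univ_two]
          rfl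
      have hconst : ∀ i j, exp (E0 l * ν) * (P * (F l τ * u l 1)) i j = P i j := by
        intro i j
        have := constant_of_derivWithin_zero (fun s hs => (hder s hs i j).differentiableWithinAt)
          (fun s hs => (hder s (Ico_subset_Icc_self hs) i j).derivWithin
            (uniqueDiffOn_Icc one_pos s (Ico_subset_Icc_self hs))) 1 (by simp)
        simpa [hu0, h.frame_init l hl0] using this
      have hinv : exp (E0 l * ν) * (k l - f l * ν) = 1 := by
        rw [show k l - f l * ν = exp (-ν * E0 l) by rw [hexp]; ring, ← exp_add]
        simp [mul_comm]
      ext i j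
      rw [Matrix.smul_apply, smul_eq_mul, ← hconst i j]
      linear_combination (-(P * (F l τ * u l 1)) i j) * hinv
    have h1 := hproj ν hν
    have h2 := hproj (-ν) (by rw [neg_sq, hν])
    have h3 : F l τ * u l 1 = monodromy ξ k f l := by
      have h4 : (2 * ν) • (F l τ * u l 1) = (2 * ν) • monodromy ξ k f l := by
        have := congrArg₂ (· - ·) h1 h2
        simp only [← sub_mul] at this
        rw [show ν • (1 : M2) + laurent ξ l - (-ν • 1 + laurent ξ l) = (2 * ν) • 1 by module,
          smul_mul, one_mul] at this
        rw [this, monodromy]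
        module
      exact smul_right_injective _ (mul_ne_zero two_ne_zero hν0) h4
    rw [quotientFrame, ofReal_one, one_mul, ← h3, ← mul_assoc,
      mul_eq_one_comm.1 (h.frame_mul_star hl0 τ), one_mul]
  · have hY0 (s : ℝ) : ∑ n, φ n 0 • m n s = (-e 0) • ζ (s * τ) 0 + τ • ζ (s * τ) 1
        - laxZero τ (ζ (s * τ)) := by
      rw [hYe, hE0, Fin.sum_univ_succ]
      simp
      abel
    have h00 := fun s : ℝ => zero_eq_of_mem (h.mem (s * τ))
    have h11 := fun s : ℝ => one_eq_of_mem (h.mem (s * τ))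
    set q : ℝ → ℝ := fun s => (τ * ζ (s * τ) 1 0 0).re with hq
    have hqc : Continuous q :=
      continuous_re.comp (continuous_const.mul (continuous_killingField h τ 1 0 0))
    have hq2 (s : ℝ) : (q s : ℂ) = (τ * ζ (s * τ) 1 0 0 + conj τ * conj (ζ (s * τ) 1 0 0)) / 2 := by
      rw [hq, ← map_mul, add_conj]; simp
    have hY (s : ℝ) : (∑ n, φ n 0 • m n s) 0 0 = q s ∧ (∑ n, φ n 0 • m n s) 1 0 = 0 ∧
        (∑ n, φ n 0 • m n s) 1 1 = -(q s : ℂ) := by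
      rw [hY0, h00, hq2]
      refine ⟨?_, ?_, ?_⟩
      · simp [laxZero]; ring
      · simp [laxZero]
      · have := congrFun (congrFun (h11 s) 1) 1
        simp [laxZero, this]; ring
    have d (s : ℝ) (hs : s ∈ 𝕀) (i j : Fin 2) := hu 0 s hs i j
    simp only [mul_apply, Fin.sum_univ_two] at d
    obtain ⟨p2, -, hp2⟩ := eq_exp_smul_of_deriv (m := fun s => -q s) hqc.neg.continuousOn
      fun s hs => (d s hs 1 0).congr_deriv (by
        show _ = (-q s) • u 0 s 1 0
        rw [(hY s).2.1, (hY s).2.2, real_smul]; push_cast; ring)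
    have h10 : ∀ s ∈ 𝕀, u 0 s 1 0 = 0 := fun s hs => by rw [hp2 s hs, hu0]; simp
    obtain ⟨p1, hp1, hp₁'⟩ := eq_exp_smul_of_deriv (m := q) hqc.continuousOn
      fun s hs => (d s hs 0 0).congr_deriv (by
        show _ = (q s) • u 0 s 0 0
        rw [(hY s).1, h10 s hs, real_smul]; ring)
    obtain ⟨p3, hp3, hp₃'⟩ := eq_exp_smul_of_deriv (m := fun s => -q s) hqc.neg.continuousOn
      fun s hs => (d s hs 1 1).congr_deriv (by
        show _ = (-q s) • u 0 s 1 1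
        rw [(hY s).2.1, (hY s).2.2, real_smul]; push_cast; ring)
    refine ⟨p1 1, p3 1, hp1 1, hp3 1, ?_, h10 1 (by simp), ?_⟩
    · show u 0 1 0 0 = _
      rw [hp₁' 1 (by simp), hu0]; simp
    · show u 0 1 1 1 = _
      rw [hp₃' 1 (by simp), hu0]; simp

theorem eq_apply_zero_of_unitary {H : ℂ → M2} (hH : ∀ i j, Differentiable ℂ fun l => H l i j)
    (hdet : ∀ l, (H l).det ≠ 0) (hstar : ∀ l ≠ 0, (H (conj l)⁻¹)ᴴ * H l = 1) (l : ℂ) :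
    H l = H 0 := by
  ext i j
  refine (hH i j).apply_eq_apply_of_bounded ?_ l 0
  have hc : Continuous fun l => (H l)⁻¹ j i := by
    have h1 : Continuous fun l => (H l).det := by
      simp only [det_fin_two]
      exact ((hH 0 0).continuous.mul (hH 1 1).continuous).sub
        ((hH 0 1).continuous.mul (hH 1 0).continuous)
    have h2 : Continuous fun l => (H l).adjugate j i := by
      simp only [Matrix.adjugate_fin_two]
      fin_cases i <;> fin_cases j <;> simp
      exacts [(hH 1 1).continuous, (hH 1 0).continuous.neg, (hH 0 1).continuous.neg, (hH 0 0).continuous]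
    simp only [Matrix.inv_def, Ring.inverse_eq_inv', Matrix.smul_apply, smul_eq_mul]
    exact (h1.inv₀ hdet).mul h2
  obtain ⟨C, hC⟩ := (isCompact_closedBall 0 1).exists_bound_of_continuousOn
    ((hH i j).continuous.continuousOn)
  obtain ⟨D, hD⟩ := (isCompact_closedBall 0 1).exists_bound_of_continuousOn hc.continuousOn
  refine (isBounded_closedBall (x := 0) (r := max C D)).subset ?_
  rintro _ ⟨l, rfl⟩
  rw [mem_closedBall_zero_iff]
  rcases le_or_gt ‖l‖ 1 with hl | hl
  · exact (hC l (mem_closedBall_zero_iff.2 hl)).trans (le_max_left _ _)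
  · have hl0 := norm_pos_iff.1 (one_pos.trans hl)
    have e : H l = ((H (conj l)⁻¹)⁻¹)ᴴ := by
      rw [Matrix.conjTranspose_nonsing_inv]
      exact (Matrix.inv_eq_right_inv (hstar l hl0)).symm
    show ‖H l i j‖ ≤ _
    rw [e, conjTranspose_apply, norm_star]
    refine (hD _ (mem_closedBall_zero_iff.2 ?_)).trans (le_max_right _ _)
    rw [norm_inv, RCLike.norm_conj]
    exact inv_le_one_of_one_le₀ hl.le

theorem IsLaxFlow.frame_period (h : IsLaxFlow ξ ζ F) (hξ : ξ ∈ isospectral g (aPoly x))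
    (hm : IsMonodromy x k f E E0) (ha0 : (aPoly x).eval 0 ≠ 0) (hl : l ≠ 0) :
    F l (period x) = monodromy ξ k f l := by
  have ha : aPoly x ≠ 0 := fun h => ha0 (by rw [h, eval_zero])
  obtain ⟨u, hu, hul, p, r, hp, hr, u00, u10, u11⟩ := exists_extension_quotientFrame h hξ hm ha0
  set Q : ℂ → M2 := fun l => quotientFrame ξ F (period x) k f l 1 with hQ
  set H : ℂ → M2 := fun l => if l = 0 then u 0 else Q l with hH
  have hH0 : H 0 = u 0 := if_pos rfl
  have hHl {l : ℂ} (hl : l ≠ 0) : H l = (F (conj l)⁻¹ (period x))ᴴ * monodromy ξ k f l := by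
    rw [hH]
    simp [hl, hQ, quotientFrame]
  have hstar : ∀ l ≠ 0, (H (conj l)⁻¹)ᴴ * H l = 1 := fun l hl => by
    rw [hHl hl, hHl (inv_conj_ne_zero hl), map_inv₀, conj_conj, inv_inv,
      conjTranspose_mul, conjTranspose_conjTranspose, mul_assoc,
      ← mul_assoc (F l (period x)), h.frame_mul_star hl, one_mul, monodromy_star hξ hm hl]
  have hdet : ∀ l, (H l).det ≠ 0 := fun l => by
    by_cases hl : l = 0
    · rw [hl, hH0, det_fin_two, u00, u10, u11]
      simp [hp.ne', hr.ne']
    · intro h0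
      have := congrArg Matrix.det (hstar l hl)
      rw [Matrix.det_mul, h0] at this
      simp at this
  have hdiff : ∀ i j, Differentiable ℂ fun l => H l i j := fun i j l => by
    by_cases hl : l = 0
    · have hU := (isOpen_nearStar ha).mem_nhds (zero_mem_nearStar)
      rw [hl]
      refine ((hu i j).differentiableAt hU).congr_of_eventuallyEq ?_
      filter_upwards [hU] with l hl
      by_cases hl0 : l = 0
      · rw [hl0, hH0]
      · rw [hul l hl hl0]
        simp [hH, hl0, hQ]
    · have hU := (isOpen_compl_singleton).mem_nhds hl
      refine ((differentiableOn_quotientFrame h hm (period x) i j).differentiableAt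
        hU).congr_of_eventuallyEq ?_
      filter_upwards [hU] with l hl0
      have hl0 : l ≠ 0 := hl0
      simp [hH, hl0, hQ]
  have hconst := eq_apply_zero_of_unitary hdiff hdet hstar
  have h1 : (u 0)ᴴ * u 0 = 1 := by
    have := hstar 1 one_ne_zero
    rwa [hconst, hconst 1, hH0] at this
  have e00 := congrFun (congrFun h1 0) 0
  have e01 := congrFun (congrFun h1 0) 1
  have e11 := congrFun (congrFun h1 1) 1
  simp only [mul_apply, Fin.sum_univ_two, conjTranspose_apply, u00, u10, u11] at e00 e01 e11
  have hp1 : p = 1 := by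
    have : p * p = 1 := by
      simp at e00
      exact_mod_cast e00
    nlinarith
  have h01 : u 0 0 1 = 0 := by simpa [hp1] using e01
  have hr1 : r = 1 := by
    have : r * r = 1 := by
      simp [h01] at e11
      exact_mod_cast e11
    nlinarith
  have hu1 : u 0 = 1 := by
    ext i j
    fin_cases i <;> fin_cases j <;> simp [u00, u10, u11, h01, hp1, hr1]
  have h2 := hconst l
  rw [hH0, hu1, hHl hl] at h2
  calc F l (period x) = F l (period x) * ((F (conj l)⁻¹ (period x))ᴴ * monodromy ξ k f l) := by
        rw [h2, mul_one]
    _ = _ := by rw [← mul_assoc, h.frame_mul_star hl, one_mul]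

theorem IsLaxFlow.killingField_period (h : IsLaxFlow ξ ζ F) (hξ : ξ ∈ isospectral g (aPoly x))
    (hm : IsMonodromy x k f E E0) (ha0 : (aPoly x).eval 0 ≠ 0) (z : ℂ) :
    ζ (z + period x) = ζ z := by
  have h1 : ζ (period x) = ξ := eq_of_laurent fun l hl => by
    have h1 := h.frame_conj hl (period x)
    have h2 : laurent ξ l * F l (period x) = F l (period x) * laurent ξ l := by
      rw [h.frame_period hξ hm ha0 hl, monodromy]
      simp [mul_sub, sub_mul]
    have h3 := mul_eq_one_comm.1 (h.frame_mul_star hl (period x))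
    rw [h2] at h1
    have := congrArg ((F (conj l)⁻¹ (period x))ᴴ * ·) h1
    simpa only [← mul_assoc, h3, one_mul] using this
  exact congrFun (killingField_unique (fun n => (h.lax n).comp_add (period x)) h.lax
    (by rw [zero_add, h1, h.init])) z

theorem IsLaxFlow.frame_one_period (h : IsLaxFlow ξ ζ F) (hξ : ξ ∈ isospectral g (aPoly x))
    (hm : IsMonodromy x k f E E0) (ha0 : (aPoly x).eval 0 ≠ 0) (z : ℂ) :
    F 1 (z + period x) = F 1 z ∨ F 1 (z + period x) = -F 1 z := by
  have e1 : (conj (1 : ℂ))⁻¹ = 1 := by simp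
  have h1 := (((h.frame 1 one_ne_zero).comp_add (period x)).mul
    (h.star_frame one_ne_zero)).eq_of_zero (fun z v => by
      rw [h.killingField_period hξ hm ha0]; noncomm_ring) z 0
  rw [zero_add, h.frame_init _ (inv_conj_ne_zero one_ne_zero), conjTranspose_one, mul_one,
    h.frame_period hξ hm ha0 one_ne_zero, monodromy, hm.f_one, zero_smul, sub_zero, e1] at h1
  have h3 := mul_eq_one_comm.1 (h.frame_mul_star one_ne_zero z)
  rw [e1] at h3
  have h2 : F 1 (z + period x) = k 1 • F 1 z := by
    have := congrArg (· * F 1 z) h1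
    simpa only [mul_assoc, h3, mul_one, smul_mul, one_mul] using this
  have h4 := hm.pell.pell 1 one_ne_zero
  rw [hm.f_one] at h4
  rw [h2]
  have h5 : (k 1 - 1) * (k 1 + 1) = 0 := by linear_combination h4
  rcases mul_eq_zero.1 h5 with h5 | h5
  · left; rw [sub_eq_zero.1 h5, one_smul]
  · right; rw [eq_neg_of_add_eq_zero_left h5, neg_smul, one_smul]

theorem IsLaxFlow.trace_period (h : IsLaxFlow ξ ζ F) (hξ : ξ ∈ isospectral g (aPoly x))
    (hm : IsMonodromy x k f E E0) (ha0 : (aPoly x).eval 0 ≠ 0) {l ν : ℂ}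
    (hp : (l, ν) ∈ cutCurve (aPoly x)) :
    (F l (period x)).trace = exp (ν * E l) + exp (-(ν * E l)) := by
  have hl := hp.1.1
  rw [h.frame_period hξ hm ha0 hl, monodromy, trace_sub, trace_smul,
    trace_smul, trace_laurent hξ.1.mem, ← neg_mul, hm.exp_eq l ν hp,
    hm.exp_eq l (-ν) ⟨hp.1, by rw [neg_sq]; exact hp.2⟩]
  simp
  ring

end Monodromy

section Geometry

theorem toE3_add (X Y : M2) : toE3 (X + Y) = toE3 X + toE3 Y := by
  ext i; fin_cases i <;> simp [toE3]; ring

theorem toE3_smul (r : ℝ) (X : M2) : toE3 ((r : ℂ) • X) = r • toE3 X := by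
  ext i; fin_cases i <;> simp [toE3]

def toE3L : (Fin 2 → Fin 2 → ℂ) →L[ℝ] E3 := LinearMap.toContinuousLinearMap
  { toFun := fun X => toE3 X
    map_add' := fun X Y => toE3_add X Y
    map_smul' := fun r X => toE3_smul r X }

theorem HasMatrixDifferential.toE3 {X : ℂ → M2} {X' : ℂ → ℂ → M2} (h : HasMatrixDifferential X X') :
    Differentiable ℝ (fun z => toE3 (X z)) ∧
      ∀ z v, fderiv ℝ (fun z => Whitham.toE3 (X z)) z v = Whitham.toE3 (X' z v) := by
  have hd z := differentiableAt_pi.2 fun i => differentiableAt_pi.2 fun j => (h i j).1 z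
  have hf z := toE3L.hasFDerivAt.comp z (hd z).hasFDerivAt
  refine ⟨fun z => (hf z).differentiableAt, fun z v => ?_⟩
  refine (congrArg (fun L => L v) (hf z).fderiv).trans ?_
  refine congrArg toE3L ?_
  funext i j
  rw [← (h i j).2, fderiv_pi fun i => differentiableAt_pi.2 fun j => (h i j).1 z]
  show fderiv ℝ (fun z => (fun j => X z i j : Fin 2 → ℂ)) z v j = _
  rw [fderiv_pi fun j => (h i j).1 z]
  rfl

theorem inner_toE3 {X Y : M2} (hX : Xᴴ = -X) (hX' : X.trace = 0) (hY : Yᴴ = -Y)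
    (hY' : Y.trace = 0) : inner ℝ (toE3 X) (toE3 Y) = -(X * Y).trace.re / 2 := by
  have a00 := congrFun (congrFun hX 0) 0
  have a01 := congrFun (congrFun hX 0) 1
  have b00 := congrFun (congrFun hY 0) 0
  have b01 := congrFun (congrFun hY 0) 1
  rw [trace_fin_two] at hX' hY'
  have a11 : X 1 1 = -X 0 0 := by linear_combination hX'
  have b11 : Y 1 1 = -Y 0 0 := by linear_combination hY'
  have a01 : X 0 1 = -conj (X 1 0) := by simp at a01; rw [a01, neg_neg]
  have b01 : Y 0 1 = -conj (Y 1 0) := by simp at b01; rw [b01, neg_neg]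
  have a00 : (X 0 0).re = 0 := by
    have := congrArg re a00
    simp at this; linarith
  have b00 : (Y 0 0).re = 0 := by
    have := congrArg re b00
    simp at this; linarith
  rw [trace_fin_two]
  simp [toE3, PiLp.inner_apply, Fin.sum_univ_three, mul_apply, Fin.sum_univ_two, a01, b01,
    a11, b11, a00, b00]
  ring

theorem inner_toE3_conj {X Y Q : M2} (hQ : Qᴴ * Q = 1) (hX : Xᴴ = -X) (hX' : X.trace = 0)
    (hY : Yᴴ = -Y) (hY' : Y.trace = 0) :
    inner ℝ (toE3 (Q * X * Qᴴ)) (toE3 (Q * Y * Qᴴ)) = -(X * Y).trace.re / 2 := by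
  have hs {X : M2} (hX : Xᴴ = -X) : (Q * X * Qᴴ)ᴴ = -(Q * X * Qᴴ) := by
    rw [conjTranspose_mul, conjTranspose_mul, conjTranspose_conjTranspose, hX]
    noncomm_ring
  have ht (X : M2) : (Q * X * Qᴴ).trace = X.trace := by
    rw [Matrix.trace_mul_comm, ← mul_assoc, hQ, one_mul]
  rw [inner_toE3 (hs hX) (by rw [ht, hX']) (hs hY) (by rw [ht, hY']),
    show Q * X * Qᴴ * (Q * Y * Qᴴ) = Q * (X * (Qᴴ * Q) * Y) * Qᴴ by noncomm_ring, hQ, mul_one, ht]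

theorem laplacian_eq_fderiv {H : Type*} [NormedAddCommGroup H] [NormedSpace ℝ H] {f : ℂ → H}
    (hf : ContDiff ℝ ∞ f) (z : ℂ) : Laplacian.laplacian f z =
      fderiv ℝ (fun z => fderiv ℝ f z 1) z 1 +
      fderiv ℝ (fun z => fderiv ℝ f z I) z I := by
  have hd := ((hf.fderiv_right (m := ∞) (by simp)).differentiable (by simp)) z
  have e v : fderiv ℝ (fun z => fderiv ℝ f z v) z v = fderiv ℝ (fderiv ℝ f) z v v := by
    rw [fderiv_clm_apply hd (differentiableAt_const v)]
    simp
  rw [InnerProductSpace.laplacian_eq_iteratedFDeriv_complexPlane, e, e]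
  simp [iteratedFDeriv_two_apply]

variable {ξ : Fin (g + 2) → M2} {ζ : ℂ → Fin (g + 2) → M2} {F : ℂ → ℂ → M2}

/-- The unit normal, as a matrix. -/
def normal (F : ℂ → ℂ → M2) (z : ℂ) : M2 := F 1 z * sigma3 * (F 1 z)ᴴ

/-- The entry of the connection form at `l = 1` off the diagonal. -/
def laxQ (ζ : ℂ → Fin (g + 2) → M2) (v z : ℂ) : ℂ := v * ζ z 0 0 1 - conj v * conj (ζ z 1 1 0)

/-- The derivative of the normal in the moving frame. -/
def normalD (q : ℂ) : M2 := !![0, -2 * I * q; -2 * I * conj q, 0]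

theorem comm_sigma3 (v z : ℂ) : comm (laxU 1 v (ζ z)) sigma3 = normalD (laxQ ζ v z) := by
  rw [laxU_eq, comm, sigma3, normalD, laxQ]
  ext i j; fin_cases i <;> fin_cases j <;> simp <;> ring

theorem comm_normalD (v z q : ℂ) : comm (laxU 1 v (ζ z)) (normalD q) =
    !![-2 * I * (laxQ ζ v z * conj q + conj (laxQ ζ v z) * q),
        -2 * I * q * (v * ζ z 1 0 0 - conj v * conj (ζ z 1 0 0));
      2 * I * conj q * (v * ζ z 1 0 0 - conj v * conj (ζ z 1 0 0)),
        2 * I * (laxQ ζ v z * conj q + conj (laxQ ζ v z) * q)] := by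
  rw [laxU_eq, comm, normalD, laxQ]
  ext i j; fin_cases i <;> fin_cases j <;> simp <;> ring

theorem IsLaxFlow.frame_one (h : IsLaxFlow ξ ζ F) (z : ℂ) :
    F 1 z * (F 1 z)ᴴ = 1 ∧ (F 1 z)ᴴ * F 1 z = 1 := by
  have h1 := h.frame_mul_star one_ne_zero z
  rw [map_one, inv_one] at h1
  exact ⟨h1, mul_eq_one_comm.1 h1⟩

theorem IsLaxFlow.hasMatrixDifferential_conj (h : IsLaxFlow ξ ζ F) {X : ℂ → M2} {X' : ℂ → ℂ → M2}
    (hX : HasMatrixDifferential X X') : HasMatrixDifferential (fun z => F 1 z * X z * (F 1 z)ᴴ)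
      fun z v => F 1 z * (comm (laxU 1 v (ζ z)) (X z) + X' z v) * (F 1 z)ᴴ := by
  have h1 := h.star_frame one_ne_zero
  simp at h1
  refine (((h.frame 1 one_ne_zero).mul hX).mul h1).congr fun z v => ?_
  rw [comm]
  noncomm_ring

theorem IsLaxFlow.normal_diff (h : IsLaxFlow ξ ζ F) : HasMatrixDifferential (normal F)
    fun z v => F 1 z * normalD (laxQ ζ v z) * (F 1 z)ᴴ :=
  (h.hasMatrixDifferential_conj (hasMatrixDifferential_const sigma3)).congr fun z v => by
    rw [comm_sigma3, add_zero]

theorem IsLaxFlow.laxQ_diff (h : IsLaxFlow ξ ζ F) (v : ℂ) :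
    HasMatrixDifferential (fun z => normalD (laxQ ζ v z)) fun z u =>
      normalD ((v * ζ z 0 0 1 + conj v * conj (ζ z 1 1 0)) * (u * ζ z 1 0 0 + conj (u * ζ z 1 0 0)))
    := by
  have hq z := (((h.lax 0 0 1).1 z).hasFDerivAt.const_mul v).sub
      ((conjCLE.toContinuousLinearMap.hasFDerivAt.comp z
        ((h.lax 1 1 0).1 z).hasFDerivAt).const_mul (conj v))
  have hq' z := conjCLE.toContinuousLinearMap.hasFDerivAt.comp z (hq z)
  have e (z u : ℂ) : (v • fderiv ℝ (fun z => ζ z 0 0 1) z - conj v •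
      conjCLE.toContinuousLinearMap ∘L fderiv ℝ (fun z => ζ z 1 1 0) z) u =
      (v * ζ z 0 0 1 + conj v * conj (ζ z 1 1 0)) * (u * ζ z 1 0 0 + conj (u * ζ z 1 0 0)) := by
    simp [fderiv_zero h, fderiv_one h]
    ring
  have hc a z := (hq z).const_mul a
  have hc' a z := (hq' z).const_mul a
  intro i j
  fin_cases i <;> fin_cases j
  · exact ⟨differentiable_const _, fun z u => by simp [normalD]⟩
  · refine ⟨fun z => (hc _ z).differentiableAt, fun z u => ?_⟩
    refine (congrArg (fun L => L u) (hc _ z).fderiv).trans ?_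
    exact congrArg (fun q => -2 * I * q) (e z u)
  · refine ⟨fun z => (hc' _ z).differentiableAt, fun z u => ?_⟩
    refine (congrArg (fun L => L u) (hc' _ z).fderiv).trans ?_
    exact congrArg (fun q => -2 * I * conj q) (e z u)
  · exact ⟨differentiable_const _, fun z u => by simp [normalD]⟩

theorem normalD_conjTranspose (q : ℂ) : (normalD q)ᴴ = -normalD q := by
  ext i j; fin_cases i <;> fin_cases j <;> simp [normalD]

theorem IsLaxFlow.contDiff_frame (h : IsLaxFlow ξ ζ F) (i j : Fin 2) :
    ContDiff ℝ ∞ fun z => F 1 z i j := by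
  suffices H : ∀ n : ℕ, ∀ i j, ContDiff ℝ n fun z => F 1 z i j from contDiff_infty.2 fun n => H n i j
  intro n
  induction n with
  | zero => exact fun i j => contDiff_zero.2 (h.frame 1 one_ne_zero i j).1.continuous
  | succ n ih =>
    intro i j
    push_cast
    refine contDiff_succ_iff_fderiv_apply.2 ⟨(h.frame 1 one_ne_zero i j).1, fun hn => by simp at hn,
      fun v => ?_⟩
    simp only [(h.frame 1 one_ne_zero i j).2]
    have hz (k i j) : ContDiff ℝ n fun z => ζ z k i j :=
      (h.contDiff k i j).of_le (by exact_mod_cast le_top)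
    have hc (k i j) : ContDiff ℝ n fun z => conj (ζ z k i j) :=
      conjCLE.toContinuousLinearMap.contDiff.comp (hz k i j)
    have hU (i' j') : ContDiff ℝ n fun z => laxU 1 v (ζ z) i' j' := by
      simp only [laxU_eq]
      fin_cases i' <;> fin_cases j' <;> simp <;> fun_prop
    simp only [mul_apply, Fin.sum_univ_two]
    fun_prop

theorem IsLaxFlow.contDiff_normal (h : IsLaxFlow ξ ζ F) :
    ContDiff ℝ ∞ fun z => toE3 (normal F z) := by
  have hF (i j : Fin 2) := h.contDiff_frame i j
  have hF' (i j : Fin 2) : ContDiff ℝ ∞ fun z => conj (F 1 z i j) :=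
    conjCLE.toContinuousLinearMap.contDiff.comp (hF i j)
  have hN (i j : Fin 2) : ContDiff ℝ ∞ fun z => normal F z i j := by
    simp only [normal, mul_apply, Fin.sum_univ_two, conjTranspose_apply, RCLike.star_def]
    fun_prop
  exact toE3L.contDiff.comp (contDiff_pi.2 fun i => contDiff_pi.2 fun j => hN i j)

theorem IsLaxFlow.fderiv_normal (h : IsLaxFlow ξ ζ F) (z v : ℂ) :
    fderiv ℝ (fun z => toE3 (normal F z)) z v =
      toE3 (F 1 z * normalD (laxQ ζ v z) * (F 1 z)ᴴ) := h.normal_diff.toE3.2 z v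

theorem IsLaxFlow.inner_fderiv (h : IsLaxFlow ξ ζ F) (z v w : ℂ) :
    inner ℝ (fderiv ℝ (fun z => toE3 (normal F z)) z v)
      (fderiv ℝ (fun z => toE3 (normal F z)) z w) = 4 * (laxQ ζ v z * conj (laxQ ζ w z)).re := by
  rw [h.fderiv_normal, h.fderiv_normal, inner_toE3_conj (h.frame_one z).2 (normalD_conjTranspose _)
    (by simp [normalD, trace_fin_two]) (normalD_conjTranspose _)
    (by simp [normalD, trace_fin_two])]
  simp [normalD, trace_fin_two]
  ring

theorem IsLaxFlow.norm_normal (h : IsLaxFlow ξ ζ F) (z : ℂ) : ‖toE3 (normal F z)‖ = 1 := by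
  have hs : sigma3ᴴ = -sigma3 := by ext i j; fin_cases i <;> fin_cases j <;> simp [sigma3]
  have ht : sigma3.trace = 0 := by simp [sigma3, trace_fin_two]
  rw [← sq_eq_sq₀ (norm_nonneg _) zero_le_one, ← real_inner_self_eq_norm_sq, normal,
    inner_toE3_conj (h.frame_one z).2 hs ht hs ht]
  simp [sigma3, trace_fin_two]

theorem IsLaxFlow.laplacian_normal (h : IsLaxFlow ξ ζ F) (z : ℂ) :
    Laplacian.laplacian (fun z => toE3 (normal F z)) z =
      -(‖fderiv ℝ (fun z => toE3 (normal F z)) z 1‖ ^ 2 +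
        ‖fderiv ℝ (fun z => toE3 (normal F z)) z I‖ ^ 2) • toE3 (normal F z) := by
  have hd v := ((h.hasMatrixDifferential_conj (h.laxQ_diff v)).toE3.2 z v)
  rw [laplacian_eq_fderiv h.contDiff_normal, ← real_inner_self_eq_norm_sq,
    ← real_inner_self_eq_norm_sq, h.inner_fderiv, h.inner_fderiv]
  simp only [h.fderiv_normal]
  rw [hd, hd, ← toE3_add, ← toE3_smul, normal, ← add_mul, ← mul_add, ← smul_mul, ← Matrix.mul_smul]
  congr 3
  rw [comm_normalD, comm_normalD]
  have hc q : (((q * conj q).re : ℝ) : ℂ) = q * conj q := by rw [mul_conj, ofReal_re]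
  push_cast
  rw [hc, hc]
  simp only [laxQ, normalD, sigma3]
  generalize ζ z 1 0 0 = A
  generalize ζ z 1 1 0 = C
  generalize ζ z 0 0 1 = β
  ext i j; fin_cases i <;> fin_cases j <;> simp
  · ring
  · ring_nf; simp; ring
  · ring_nf; simp; ring
  · ring

def height (e z : ℂ) : ℝ := (-I * e * z).re

theorem height_eq (e : ℂ) : height e =
    (reCLM ∘L (ContinuousLinearMap.mul ℝ ℂ (-I * e)) : ℂ →L[ℝ] ℝ) := rfl

theorem fderiv_height (e z v : ℂ) : fderiv ℝ (height e) z v = (-I * e * v).re := by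
  rw [height_eq, ContinuousLinearMap.fderiv]
  rfl

theorem IsLaxFlow.pullbackMetric_eq (h : IsLaxFlow ξ ζ F) (hξ : IsPotential ξ) {e : ℂ}
    (he : ‖e‖ = 1) (hm : ξ 0 0 1 * ξ 1 1 0 = -(1 / 16) * e ^ 2) (z : ℂ) :
    ∃ m : ℝ, 0 < m ∧ ∀ v w, pullbackMetric (fun z => toE3 (normal F z)) (height e) z v w =
      m * (v * conj w).re := by
  have he0 := norm_ne_zero_iff.1 (by rw [he]; exact one_ne_zero)
  have hne : ξ 0 0 1 * ξ 1 1 0 ≠ 0 := by grind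
  obtain ⟨hpos, hβ⟩ := h.residue_pos hξ hne z
  have hC := h.mul_eq z
  rw [hm] at hC
  set r := (ζ z 0 0 1).im
  have hr : (r : ℂ) ≠ 0 := by exact_mod_cast hpos.ne'
  set s : ℝ := 1 / (16 * r) with hs
  have hrs : r * s = 1 / 16 := by rw [hs]; field_simp
  have hC' : ζ z 1 1 0 = I * e ^ 2 * s := by
    rw [hβ] at hC
    rw [hs]
    push_cast
    rw [← mul_right_inj' (mul_ne_zero hr I_ne_zero), hC]
    field_simp
    linear_combination -I_sq
  refine ⟨4 * (r + s) ^ 2, by positivity, fun v w => ?_⟩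
  rw [pullbackMetric, h.inner_fderiv, fderiv_height, fderiv_height, laxQ, laxQ, hβ, hC']
  have h1 : e.re * e.re + e.im * e.im = 1 := by rw [← normSq_apply, normSq_eq_norm_sq, he, one_pow]
  simp [pow_two]
  linear_combination (4 * s ^ 2 * (e.re * e.re + e.im * e.im + 1) + 1 / 2) *
    (v.re * w.re + v.im * w.im) * h1 + 8 * ((e.re * e.re - e.im * e.im) *
    (v.re * w.re - v.im * w.im) - 2 * e.re * e.im * (v.re * w.im + v.im * w.re) -
    (v.re * w.re + v.im * w.im)) * hrs

variable {k f E E0 : ℂ → ℂ}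

theorem IsSpectralData.period_mul_im (hs : IsSpectralData x) {e : ℂ}
    (he : (aPoly x).eval 0 = -(1 / 16) * e ^ 2) (h0 : (aPoly x).eval 0 ≠ 0) :
    (e * period x).im = 0 := by
  obtain ⟨Θ, r, h1, h2⟩ := hs.b_zero
  have he0 : e ≠ 0 := by rintro rfl; exact h0 (by rw [he]; simp)
  have h3 : (e * period x) ^ 2 = ((32 * r : ℝ) : ℂ) ^ 2 := by
    have e1 : exp (Θ / 2 * I) ^ 2 = e ^ 2 := by
      rw [← exp_nat_mul, show ((2 : ℕ) : ℂ) * (Θ / 2 * I) = Θ * I by push_cast; ring]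
      linear_combination 16 * (h1 - he)
    rw [period, he, h2, mul_pow, div_pow, mul_pow, mul_pow, e1]
    field_simp
    norm_num
    ring
  rcases sq_eq_sq_iff_eq_or_eq_neg.1 h3 with h | h
  · rw [h, ofReal_im]
  · rw [h, neg_im, ofReal_im, neg_zero]

theorem IsLaxFlow.isMinimalAnnulus (h : IsLaxFlow ξ ζ F) (hξ : ξ ∈ isospectral g (aPoly x))
    (hs : IsSpectralData x) (hm : IsMonodromy x k f E E0) (ha0 : (aPoly x).eval 0 ≠ 0) {e : ℂ}
    (he1 : ‖e‖ = 1) (he : (aPoly x).eval 0 = -(1 / 16) * e ^ 2) :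
    IsMinimalAnnulus (period x) (fun z => Whitham.toE3 (normal F z)) (height e) := by
  have hmet := h.pullbackMetric_eq hξ.1 he1 (hξ.2.2.trans he)
  have hsm : ContDiff ℝ ∞ (height e) := by rw [height_eq]; exact ContinuousLinearMap.contDiff _
  refine ⟨?_, h.contDiff_normal, hsm, by simpa using h.norm_normal, h.laplacian_normal,
    fun z => ?_, fun z => ?_, fun z => ?_, fun z v hv => ?_, fun z => ?_, fun z => ?_⟩
  · exact div_ne_zero (mul_ne_zero two_ne_zero hs.b_zero_ne) ha0
  · rw [laplacian_eq_fderiv hsm]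
    simp [fderiv_height]
  · obtain ⟨m, -, hm⟩ := hmet z
    rw [hm, hm]
    simp
  · obtain ⟨m, -, hm⟩ := hmet z
    rw [hm]
    simp
  · obtain ⟨m, hm0, hm⟩ := hmet z
    rw [hm, mul_conj, ofReal_re]
    exact mul_pos hm0 (normSq_pos.2 hv)
  · rcases h.frame_one_period hξ hm ha0 z with h1 | h1 <;> rw [normal, normal, h1]
    rw [Matrix.conjTranspose_neg]
    noncomm_ring
  · rw [height, height, show -I * e * (z + period x) = -I * e * z +
      -(I * (e * period x)) by ring, add_re, neg_re, I_mul_re,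
      hs.period_mul_im he ha0, neg_zero, neg_zero, add_zero]

theorem IsLaxFlow.abs_verticalFlux (h : IsLaxFlow ξ ζ F) (hξ : ξ ∈ isospectral g (aPoly x))
    (hs : IsSpectralData x) (ha0 : (aPoly x).eval 0 ≠ 0) {e : ℂ}
    (he1 : ‖e‖ = 1) (he : (aPoly x).eval 0 = -(1 / 16) * e ^ 2) :
    |verticalFlux (period x) (fun z => Whitham.toE3 (normal F z)) (height e)| =
      32 * ‖(bPoly x).eval 0‖ := by
  have hτ := div_ne_zero (mul_ne_zero two_ne_zero hs.b_zero_ne) ha0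
  have h1 s : fderiv ℝ (height e) (s * period x) (I * period x) /
      √(pullbackMetric (fun z => Whitham.toE3 (normal F z)) (height e) (s * period x)
        (I * period x) (I * period x)) *
      √(pullbackMetric (fun z => Whitham.toE3 (normal F z)) (height e) (s * period x)
        (period x) (period x)) = (e * period x).re := by
    obtain ⟨m, hm0, hm⟩ := h.pullbackMetric_eq hξ.1 he1 (hξ.2.2.trans he) (s * period x)
    have e1 : I * period x * conj (I * period x) = period x * conj (period x) := by
      rw [map_mul, conj_I]
      linear_combination -(period x * conj (period x)) * I_sq
    have h2 : 0 < m * (period x * conj (period x)).re := by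
      rw [mul_conj, ofReal_re]
      exact mul_pos hm0 (normSq_pos.2 hτ)
    rw [hm, hm, e1, div_mul_cancel₀ _ (Real.sqrt_pos.2 h2).ne', fderiv_height]
    congr 1
    linear_combination -(e * period x) * I_sq
  rw [verticalFlux]
  simp only [h1]
  rw [intervalIntegral.integral_const, sub_zero, one_smul]
  have h3 : ‖e * period x‖ = |(e * period x).re| := by
    conv_lhs => rw [← re_add_im (e * period x), hs.period_mul_im he ha0]
    rw [ofReal_zero, zero_mul, add_zero, norm_real, Real.norm_eq_abs]
  rw [← h3, norm_mul, he1, one_mul, period, norm_div, norm_mul, hs.normalized]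
  norm_num
  ring

theorem IsLaxFlow.hasSpectralData (h : IsLaxFlow ξ ζ F) (hξ : ξ ∈ isospectral g (aPoly x))
    (hreg : IsRegular x) (hs : IsSpectralData x) {Θ : ℝ}
    (hΘ : (aPoly x).eval 0 = -(1 / 16) * exp (Θ * I)) :
    HasSpectralData x Θ ξ (fun z => Whitham.toE3 (normal F z)) (height (exp (Θ / 2 * I))) ∧
    |verticalFlux (period x) (fun z => Whitham.toE3 (normal F z))
      (height (exp (Θ / 2 * I)))| = 32 * ‖(bPoly x).eval 0‖ := by
  have ha0 := hreg.a_zero_ne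
  obtain ⟨k, f, E, E0, hm⟩ := (hs.hasPellData hreg).exists_isMonodromy hreg.a_ne
  have he : (aPoly x).eval 0 = -(1 / 16) * exp (Θ / 2 * I) ^ 2 := by
    rw [hΘ, ← exp_nat_mul, show ((2 : ℕ) : ℂ) * (Θ / 2 * I) = Θ * I by push_cast; ring]
  have he1 : ‖exp (Θ / 2 * I)‖ = 1 := by
    have := norm_exp_ofReal_mul_I (Θ / 2)
    push_cast at this
    exact this
  refine ⟨⟨h.isMinimalAnnulus hξ hs hm ha0 he1 he, hΘ, hξ, ?_⟩, h.abs_verticalFlux hξ hs ha0 he1 he⟩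
  refine ⟨_, ζ, F, h.isExtendedFrame hξ.1 (norm_exp_ofReal_mul_I Θ) (hξ.2.2.trans hΘ),
    fun z => ?_, fun z => rfl, h.killingField_period hξ hm ha0, _, hm.isLogMu hreg.a_ne,
    fun l ν hp => h.trace_period hξ hm ha0 hp⟩
  rw [normal, Matrix.inv_eq_right_inv (h.frame_one z).1]

end Geometry

section Potential

/-- The roots of `a` in the unit disc. -/
def innerRoots (x : RealPair g) : Multiset ℂ := (aPoly x).roots.filter (‖·‖ < 1)

/-- The monic polynomial with the roots of `a` in the unit disc. -/
def innerPoly (x : RealPair g) : ℂ[X] := ((innerRoots x).map fun α => X - C α).prod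

theorem innerPoly_eval (x : RealPair g) (l : ℂ) :
    (innerPoly x).eval l = ((innerRoots x).map fun α => l - α).prod := by
  rw [innerPoly, eval_multiset_prod, Multiset.map_map]
  simp

theorem innerPoly_monic (x : RealPair g) : (innerPoly x).Monic :=
  monic_multiset_prod_of_monic _ _ fun α _ => monic_X_sub_C α

theorem HasPellData.a_zero_ne (h : HasPellData x) : (aPoly x).eval 0 ≠ 0 := fun h0 => by
  have := h.normalized
  simp_all

theorem HasPellData.a_ne_zero (h : HasPellData x) : aPoly x ≠ 0 := (natDegree_aPoly_eq h.a_zero_ne).2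

theorem HasPellData.norm_ne_one (h : HasPellData x) (hα : (aPoly x).eval α = 0) :
    ‖α‖ ≠ 1 := fun h1 => by
  obtain ⟨r, hr, e⟩ := h.neg α h1
  rw [hα, zero_div, eq_comm, ofReal_eq_zero] at e
  exact hr.ne e

theorem continuousAt_innerPoly_eval (h : HasPellData x) (l : ℂ) :
    ContinuousAt (fun y => (innerPoly y).eval l) x := by
  set s := (innerRoots x).toFinset with hs
  have hnd : (innerRoots x).Nodup := (nodup_roots_of_simple h.a_ne_zero h.simple).filter _
  have hprod (β : ℂ → ℂ) : ((innerRoots x).map fun α => l - β α).prod = ∏ α : s, (l - β α) := by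
    rw [Finset.prod_coe_sort s fun α => l - β α, Finset.prod, hs, Multiset.toFinset_val, hnd.dedup]
  have hΦ : Continuous fun v : s → ℂ => ∏ α : s, (l - v α) := by fun_prop
  rw [Metric.continuousAt_iff']
  intro ε hε
  obtain ⟨δ, hδ, hδ'⟩ := Metric.continuousAt_iff.1 (hΦ.continuousAt) ε hε
  obtain ⟨η, hη, hη'⟩ : ∃ η > 0, ∀ α ∈ (aPoly x).roots.toFinset, η < |‖α‖ - 1| := by
    have : ∀ᶠ η in 𝓝[>] 0, ∀ α ∈ (aPoly x).roots.toFinset, η < |‖α‖ - 1| := by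
      refine (Filter.eventually_all_finset _).2 fun α hα => ?_
      rw [Multiset.mem_toFinset, mem_roots h.a_ne_zero] at hα
      filter_upwards [Ioo_mem_nhdsGT (abs_pos.2 (sub_ne_zero.2 (h.norm_ne_one hα)))] with η hη
      exact hη.2
    obtain ⟨η, h1, h2⟩ := (this.and self_mem_nhdsWithin).exists
    exact ⟨η, h2, h1⟩
  filter_upwards [eventually_roots_eq h.a_zero_ne h.simple (lt_min hδ hη)] with y hy
  obtain ⟨-, β, hβ, -, hroots⟩ := hy
  have hmem {α : ℂ} (hα : α ∈ (aPoly x).roots) : ‖β α - α‖ < min δ η :=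
    hβ α ((mem_roots h.a_ne_zero).1 hα)
  have e : innerRoots y = (innerRoots x).map β := by
    rw [innerRoots, hroots, Multiset.filter_map, innerRoots]
    refine congrArg _ (Multiset.filter_congr fun α hα => ?_)
    have h3 := (abs_le.1 (abs_norm_sub_norm_le (β α) α))
    grind
  rw [innerPoly_eval, innerPoly_eval, e, Multiset.map_map, hprod fun α => α]
  simp
  rw [hprod β]
  refine hδ' ((dist_pi_lt_iff hδ).2 fun α => ?_)
  rw [dist_eq_norm]
  exact (hmem (Multiset.mem_of_le (Multiset.filter_le _ _)
    (Multiset.mem_toFinset.1 α.2))).trans_le (min_le_left _ _)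

theorem aPoly_root_star (hα : α ≠ 0) (h : (aPoly x).eval α = 0) :
    (aPoly x).eval (conj α)⁻¹ = 0 := by
  rw [aPoly_reflect x (inv_conj_ne_zero hα), map_inv₀, conj_conj, inv_inv, h, map_zero, mul_zero]

theorem HasPellData.exists_factorization (h : HasPellData x) : ∃ m : ℂ,
    (innerPoly x).natDegree = g ∧ (aPoly x).eval 0 = m * (innerPoly x).eval 0 ∧ ∀ l ≠ 0,
      (aPoly x).eval l = m * (innerPoly x).eval l * (l ^ g * conj ((innerPoly x).eval (conj l)⁻¹)) := by
  have ha := h.a_ne_zero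
  have hnd := nodup_roots_of_simple ha h.simple
  have h0 {α : ℂ} (hα : α ∈ (aPoly x).roots) : α ≠ 0 := by
    rintro rfl
    exact h.a_zero_ne ((mem_roots ha).1 hα)
  have hin {α : ℂ} (hα : α ∈ innerRoots x) : α ∈ (aPoly x).roots ∧ ‖α‖ < 1 :=
    Multiset.mem_filter.1 hα
  have hinj : Function.Injective fun α => (conj α)⁻¹ := fun α β hαβ =>
    (starRingEnd ℂ).injective (inv_injective hαβ)
  have hout : (aPoly x).roots.filter (¬‖·‖ < 1) = (innerRoots x).map fun α => (conj α)⁻¹ := by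
    refine (Multiset.Nodup.ext (hnd.filter _) ((hnd.filter _).map hinj)).2 fun β => ?_
    rw [Multiset.mem_filter, Multiset.mem_map]
    constructor
    · rintro ⟨hβ, hβ1⟩
      refine ⟨(conj β)⁻¹, Multiset.mem_filter.2 ⟨(mem_roots ha).2
        (aPoly_root_star (h0 hβ) ((mem_roots ha).1 hβ)), ?_⟩, by simp⟩
      rw [norm_inv, RCLike.norm_conj]
      exact inv_lt_one_of_one_lt₀ (lt_of_le_of_ne (not_lt.1 hβ1)
        (h.norm_ne_one ((mem_roots ha).1 hβ)).symm)
    · rintro ⟨α, hα, rfl⟩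
      refine ⟨(mem_roots ha).2 (aPoly_root_star (h0 (hin hα).1) ((mem_roots ha).1 (hin hα).1)), ?_⟩
      rw [norm_inv, RCLike.norm_conj, not_lt]
      exact (one_le_inv₀ (norm_pos_iff.2 (h0 (hin hα).1))).2 (hin hα).2.le
  have hroots : innerRoots x + (innerRoots x).map (fun α => (conj α)⁻¹) = (aPoly x).roots := by
    rw [← hout]
    exact Multiset.filter_add_not _ _
  have hsplit := IsAlgClosed.splits (aPoly x)
  have hcard : Multiset.card (innerRoots x) = g := by
    have h1 := congrArg Multiset.card hroots
    rw [Multiset.card_add, Multiset.card_map, ← hsplit.natDegree_eq_card_roots,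
      (natDegree_aPoly_eq h.a_zero_ne).1] at h1
    omega
  have heval l : (aPoly x).eval l = (aPoly x).leadingCoeff * ((innerPoly x).eval l *
      ((innerRoots x).map fun α => l - (conj α)⁻¹).prod) := by
    conv_lhs => rw [hsplit.eq_prod_roots, eval_mul, eval_C, eval_multiset_prod, Multiset.map_map,
      ← hroots, Multiset.map_add, Multiset.prod_add, Multiset.map_map]
    rw [innerPoly_eval]
    simp
  refine ⟨(aPoly x).leadingCoeff * ((innerRoots x).map fun α => -(conj α)⁻¹).prod, ?_, ?_,
    fun l hl => ?_⟩
  · rw [innerPoly, natDegree_multiset_prod_X_sub_C_eq_card, hcard]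
  · rw [heval]
    grind
  · rw [heval, innerPoly_eval x (conj l)⁻¹, map_multiset_prod, Multiset.map_map]
    have h1 : l ^ g = ((innerRoots x).map fun _ => l).prod := by simp [hcard]
    have h2 : ((innerRoots x).map fun α => l - (conj α)⁻¹).prod =
        ((innerRoots x).map fun α => -(conj α)⁻¹).prod * (((innerRoots x).map fun _ => l).prod *
          ((innerRoots x).map (conj ∘ fun α => (conj l)⁻¹ - α)).prod) := by
      rw [← Multiset.prod_map_mul, ← Multiset.prod_map_mul]
      refine congrArg _ (Multiset.map_congr rfl fun α hα => ?_)
      have := (_root_.map_ne_zero (starRingEnd ℂ)).2 (h0 (hin hα).1)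
      simp
      field_simp
      ring
    rw [h1, h2]
    ring

/-- The off-diagonal Laurent polynomial with lower entry `Γ`. -/
def offDiagonal (g : ℕ) (Γ : ℂ[X]) : Fin (g + 2) → M2 := fun j =>
  !![0, -conj ((Γ * X).coeff j.rev); (Γ * X).coeff j, 0]

theorem offDiagonal_symm (Γ : ℂ[X]) (j : Fin (g + 2)) :
    offDiagonal g Γ j = -(offDiagonal g Γ j.rev).conjTranspose := by
  ext p q; fin_cases p <;> fin_cases q <;> simp [offDiagonal]

theorem laurent_offDiagonal {Γ : ℂ[X]} (hΓ : Γ.natDegree ≤ g) {l : ℂ} (hl : l ≠ 0) :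
    laurent (offDiagonal g Γ) l = !![0, -(l ^ g / l * conj (Γ.eval (conj l)⁻¹)); Γ.eval l, 0] := by
  have hsum {l : ℂ} (hl : l ≠ 0) : ∑ j : Fin (g + 2), l ^ ((j : ℤ) - 1) * (Γ * X).coeff j =
      Γ.eval l := by
    have hd : (Γ * X).natDegree < g + 2 := by
      refine (natDegree_mul_le).trans_lt ?_
      rw [natDegree_X]; omega
    have h1 : (Γ * X).eval l = l * Γ.eval l := by rw [eval_mul, eval_X, mul_comm]
    rw [eval_eq_sum_range' hd, Finset.sum_range] at h1
    rw [← mul_right_inj' hl, ← h1, Finset.mul_sum]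
    refine Finset.sum_congr rfl fun j _ => ?_
    rw [zpow_sub_one₀ hl, zpow_natCast]
    field_simp
  ext p q
  rw [laurent_apply]
  fin_cases p <;> fin_cases q
  · simp [offDiagonal]
  · rw [← hsum (inv_conj_ne_zero hl), ← Equiv.sum_comp Fin.revPerm, map_sum]
    simp only [offDiagonal]
    simp only [Fin.zero_eta, Fin.mk_one, Matrix.of_apply, Matrix.cons_val_zero, Matrix.cons_val_one,
      Fin.revPerm_apply, Fin.rev_rev]
    rw [Finset.mul_sum, ← Finset.sum_neg_distrib]
    refine Finset.sum_congr rfl fun j _ => ?_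
    have e1 : (((j.rev : Fin (g + 2)) : ℕ) : ℤ) - 1 = g - 1 - (j - 1) := by
      rw [Fin.val_rev]; have := j.2; omega
    rw [e1, map_mul, map_zpow₀, map_inv₀, conj_conj, zpow_sub₀ hl, zpow_sub_one₀ hl,
      zpow_natCast, inv_zpow]
    ring
  · rw [← hsum hl]; rfl
  · simp [offDiagonal]

def potentialScale (x : RealPair g) : ℝ := √(-((aPoly x).eval 1).re) / ‖(innerPoly x).eval 1‖

/-- A potential in the isospectral set that depends continuously on the spectral data. -/
def rootPotential (x : RealPair g) : Fin (g + 2) → M2 :=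
  offDiagonal g (C (potentialScale x * I) * innerPoly x)

theorem innerPoly_one_ne (x : RealPair g) : (innerPoly x).eval 1 ≠ 0 := by
  rw [innerPoly_eval]
  refine Multiset.prod_ne_zero fun h0 => ?_
  obtain ⟨α, hα, e⟩ := Multiset.mem_map.1 h0
  have := (Multiset.mem_filter.1 hα).2
  rw [← sub_eq_zero.1 e, norm_one] at this
  exact this.false

theorem HasPellData.potentialScale_spec (h : HasPellData x) : 0 < potentialScale x ∧
    (innerPoly x).natDegree = g ∧ (aPoly x).eval 0 = -(potentialScale x : ℂ) ^ 2 *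
      (innerPoly x).eval 0 ∧ ∀ l ≠ 0, (aPoly x).eval l = -(potentialScale x : ℂ) ^ 2 *
        (innerPoly x).eval l * (l ^ g * conj ((innerPoly x).eval (conj l)⁻¹)) := by
  obtain ⟨r, hr, e⟩ := h.neg 1 norm_one
  rw [one_pow, div_one] at e
  have hP := norm_pos_iff.2 (innerPoly_one_ne x)
  have hr' : 0 < √(-r) := Real.sqrt_pos.2 (by linarith)
  obtain ⟨m, hd, h1, h2⟩ := h.exists_factorization
  have hm : m = -(potentialScale x : ℂ) ^ 2 := by
    have h3 := h2 1 one_ne_zero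
    rw [e, map_one, inv_one, one_pow, one_mul, mul_assoc, mul_conj, normSq_eq_norm_sq] at h3
    have h4 : ((potentialScale x : ℂ)) ^ 2 = ((-r / ‖(innerPoly x).eval 1‖ ^ 2 : ℝ) : ℂ) := by
      rw [potentialScale, e, ← ofReal_pow, div_pow, ofReal_re, Real.sq_sqrt (by linarith)]
    have hP' : ((‖(innerPoly x).eval 1‖ : ℝ) : ℂ) ≠ 0 := by exact_mod_cast hP.ne'
    rw [h4]
    push_cast at h3 ⊢
    rw [h3]
    field_simp
  refine ⟨?_, hd, hm ▸ h1, hm ▸ h2⟩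
  rw [potentialScale, e, ofReal_re]
  positivity

theorem HasPellData.laurent_rootPotential (h : HasPellData x) (hl : l ≠ 0) :
    laurent (rootPotential x) l =
      !![0, l ^ g / l * (potentialScale x * I * conj ((innerPoly x).eval (conj l)⁻¹));
        potentialScale x * I * (innerPoly x).eval l, 0] := by
  rw [rootPotential, laurent_offDiagonal ((natDegree_C_mul_le _ _).trans
    h.potentialScale_spec.2.1.le) hl]
  simp

theorem HasPellData.rootPotential_mem (h : HasPellData x) :
    rootPotential x ∈ isospectral g (aPoly x) := by
  obtain ⟨hs, hd, ha0, hal⟩ := h.potentialScale_spec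
  have e01 : rootPotential x 0 0 1 = potentialScale x * I := by
    have h1 : (innerPoly x).coeff g = 1 := by
      have := innerPoly_monic x
      rwa [Monic, leadingCoeff, hd] at this
    simp [rootPotential, offDiagonal, mul_assoc, coeff_C_mul, h1, coeff_mul_X]
  have e10 : rootPotential x 1 1 0 = potentialScale x * I * (innerPoly x).eval 0 := by
    rw [← coeff_zero_eq_eval_zero]
    simp only [rootPotential, offDiagonal]
    simp
  have e0 : rootPotential x 0 = !![0, potentialScale x * I; 0, 0] := by
    rw [← e01]
    ext p q; fin_cases p <;> fin_cases q <;> simp [rootPotential, offDiagonal]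
  have hprod : rootPotential x 0 0 1 * rootPotential x 1 1 0 = (aPoly x).eval 0 := by
    rw [e01, e10, ha0]
    linear_combination (potentialScale x : ℂ) ^ 2 * (innerPoly x).eval 0 * I_sq
  refine ⟨⟨⟨_, hs, e0⟩, ?_, offDiagonal_symm _, fun j => ?_⟩, fun l hl => ?_, hprod⟩
  · have : (rootPotential x 0 * rootPotential x 1).trace =
        rootPotential x 0 0 1 * rootPotential x 1 1 0 := by
      rw [trace_fin_two, e0]
      simp [mul_apply]
    rw [this, hprod]
    exact h.a_zero_ne
  · simp [rootPotential, offDiagonal, trace_fin_two]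
  · rw [h.laurent_rootPotential hl, det_fin_two, hal l hl]
    generalize conj ((innerPoly x).eval (conj l)⁻¹) = P
    simp
    field_simp
    linear_combination (-(potentialScale x : ℂ) ^ 2 * (innerPoly x).eval l * P) * I_sq

theorem continuousOn_rootPotential :
    ContinuousOn (rootPotential : RealPair g → Fin (g + 2) → M2) {x | HasPellData x} := by
  obtain ⟨K, hK, hK'⟩ := exists_norm_le_nodes g
  intro x hx
  have hscale := ((continuous_re.comp (continuous_aPoly_eval 1)).neg.sqrt.continuousAt).div
      (continuousAt_innerPoly_eval hx 1).norm (norm_ne_zero_iff.2 (innerPoly_one_ne x))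
  have hnode (i : Fin (g + 2)) (p q : Fin 2) : ContinuousWithinAt
      (fun y => laurent (rootPotential y) (node g i) p q) {x | HasPellData x} x := by
    have h1 : ContinuousAt (fun y => (!![0, node g i ^ g / node g i *
        (potentialScale y * I * conj ((innerPoly y).eval (conj (node g i))⁻¹));
        potentialScale y * I * (innerPoly y).eval (node g i), 0] : M2) p q) x := by
      have h2 := continuousAt_innerPoly_eval hx (node g i)
      have h3 := continuous_conj.continuousAt.comp
        (continuousAt_innerPoly_eval hx (conj (node g i))⁻¹)
      have h4 := (continuous_ofReal.continuousAt.comp hscale).mul (continuousAt_const (y := I))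
      fin_cases p <;> fin_cases q
      · exact continuousAt_const
      · exact continuousAt_const.mul (h4.mul h3)
      · exact h4.mul h2
      · exact continuousAt_const
    refine h1.continuousWithinAt.congr (fun y hy => ?_) ?_
    · rw [HasPellData.laurent_rootPotential hy (node_ne_zero i)]
    · rw [HasPellData.laurent_rootPotential hx (node_ne_zero i)]
  let Ξ : RealPair g → Fin (g + 2) → Fin 2 → Fin 2 → ℂ := rootPotential
  have hfun : ContinuousWithinAt Ξ {x | HasPellData x} x := by
    refine Metric.continuousWithinAt_iff'.2 fun ε hε => ?_
    have hK1 : 0 < K + 1 := by linarith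
    have hev := eventually_all.2 fun i => eventually_all.2 fun p => eventually_all.2 fun q =>
        Metric.continuousWithinAt_iff'.1 (hnode i p q) _ (div_pos hε hK1)
    filter_upwards [hev] with y hy
    have h1 := hK' (rootPotential y - rootPotential x) (ε / (K + 1)) (div_pos hε hK1).le
      fun i p q => by
        have := (hy i p q).le
        rw [dist_eq_norm] at this
        have e : laurent (rootPotential y - rootPotential x) (node g i) =
          laurent (rootPotential y) (node g i) - laurent (rootPotential x) (node g i) :=
          laurent_sub _ _ _
        rw [e]
        exact this
    rw [dist_eq_norm]
    refine h1.trans_lt ?_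
    rw [mul_div_assoc', div_lt_iff₀ hK1]
    linarith
  exact hfun

end Potential

section Phase

theorem exists_continuousOn_phase (hJ : J.OrdConnected) {u : ℝ → ℂ}
    (hu : ContinuousOn u J) (h1 : ∀ t ∈ J, ‖u t‖ = 1) : ∃ Θ : ℝ → ℝ, ContinuousOn Θ J ∧
      ∀ t ∈ J, u t = exp (Θ t * I) := by
  rcases J.eq_empty_or_nonempty with rfl | ⟨t0, ht0⟩
  · exact ⟨fun _ => 0, continuousOn_empty _, by simp⟩
  have hmem (s : unitInterval) (t : J) : t0 + (s : ℝ) * (t - t0) ∈ J := by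
    simpa using hJ.convex.add_smul_sub_mem ht0 t.2 s.2
  have hne (t : ℝ) (ht : t ∈ J) : u t ≠ 0 := norm_ne_zero_iff.1 (by rw [h1 t ht]; exact one_ne_zero)
  let H : C(unitInterval × J, {z : ℂ // z ≠ 0}) :=
    ⟨fun p => ⟨u (t0 + (p.1 : ℝ) * (p.2 - t0)), hne _ (hmem p.1 p.2)⟩,
      (hu.comp_continuous (f := fun p : unitInterval × J => t0 + (p.1 : ℝ) * (p.2 - t0))
        (by fun_prop) fun p => hmem p.1 p.2).subtype_mk _⟩
  obtain ⟨e0, he0⟩ : ∃ e0, exp e0 = u t0 := ⟨_, exp_log (hne t0 ht0)⟩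
  let L := isCoveringMap_exp.liftHomotopy H (ContinuousMap.const J e0)
    fun a => Subtype.ext (by simp [H, he0])
  have hL (t : J) : exp (L (1, t)) = u t := by
    have := congrArg Subtype.val (congrFun (isCoveringMap_exp.liftHomotopy_lifts H
      (ContinuousMap.const J e0) fun a => Subtype.ext (by simp [H, he0])) (1, t))
    change exp (L (1, t)) = u (t0 + (1 : ℝ) * (t - t0)) at this
    rw [this, one_mul, add_sub_cancel]
  classical
  refine ⟨fun t => if h : t ∈ J then (L (1, ⟨t, h⟩)).im else 0, ?_, fun t ht => ?_⟩
  · rw [continuousOn_iff_continuous_domRestrict]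
    refine (continuous_im.comp (L.continuous.comp
      ((continuous_const (y := (1 : unitInterval))).prodMk continuous_id))).congr fun t => ?_
    simp [t.2]
  · have h2 := hL ⟨t, ht⟩
    have h3 := congrArg norm h2
    rw [norm_exp, h1 t ht, Real.exp_eq_one_iff] at h3
    beta_reduce
    rw [dif_pos ht, ← h2]
    congr 1
    apply Complex.ext <;> simp [h3]

end Phase

section Continuity

theorem continuousOn_laxState {T : Type*} [TopologicalSpace T] {S : Set T}
    {Z : T → ℂ → LaxState g} (hZ : ∀ t ∈ S, ∀ z,
      HasFDerivAt (Z t) (((laxForm g 1).flip (Z t z)).flip (Z t z)) z) {R : ℝ → T → ℝ}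
    (hR : ∀ ρ, ContinuousOn (R ρ) S) (hb : ∀ t ∈ S, ∀ ρ z, ‖z‖ ≤ ρ → ‖Z t z‖ ≤ R ρ t)
    (h0 : ContinuousOn (fun t => Z t 0) S) :
    ContinuousOn (fun p : T × ℂ => Z p.1 p.2) (S ×ˢ univ) := by
  rintro ⟨t0, z0⟩ ⟨ht0, -⟩
  set ρ := ‖z0‖ + 1 with hρ
  set M := R ρ t0 + 1 with hM
  have hM0 : 0 ≤ M := by
    have := (norm_nonneg _).trans (hb t0 ht0 ρ 0 (by rw [norm_zero]; positivity))
    linarith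
  have hfst : Tendsto (Prod.fst : T × ℂ → T) (𝓝[S ×ˢ univ] (t0, z0)) (𝓝[S] t0) := by
    rw [nhdsWithin_prod_eq]; exact tendsto_fst
  have hsnd : Tendsto (Prod.snd : T × ℂ → ℂ) (𝓝[S ×ˢ univ] (t0, z0)) (𝓝 z0) := by
    rw [nhdsWithin_prod_eq, nhdsWithin_univ]; exact tendsto_snd
  have hS := hfst.eventually self_mem_nhdsWithin
  have hRp : ∀ᶠ p in 𝓝[S ×ˢ univ] (t0, z0), R ρ p.1 < M :=
    hfst.eventually ((hR ρ t0 ht0).eventually_lt continuousWithinAt_const (by rw [hM]; linarith))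
  have hzp : ∀ᶠ p in 𝓝[S ×ˢ univ] (t0, z0), ‖p.2‖ < ρ :=
    (hsnd.norm).eventually (Iio_mem_nhds (by rw [hρ]; linarith))
  refine tendsto_iff_norm_sub_tendsto_zero.2 ?_
  have hlim : Tendsto (fun p => (‖Z p.1 0 - Z t0 0‖ + ‖laxForm g 1‖ * M * M * ‖p.2 - z0‖)
      * Real.exp (max 1 (‖laxForm g 1‖ * ρ * (M + M)))) (𝓝[S ×ˢ univ] (t0, z0)) (𝓝 0) := by
    have e1 := ((h0 t0 ht0).sub_const (Z t0 0)).norm.comp hfst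
    have e2 := (tendsto_iff_norm_sub_tendsto_zero.1 hsnd).const_mul (‖laxForm g 1‖ * M * M)
    have := (e1.add e2).mul_const (Real.exp (max 1 (‖laxForm g 1‖ * ρ * (M + M))))
    simpa using this
  refine squeeze_zero' (Eventually.of_forall fun p => norm_nonneg _) ?_ hlim
  filter_upwards [hS, hRp, hzp] with p h1 h2 h3
  exact quadratic_flow_close (laxForm g 1) (hZ p.1 h1) (hZ t0 ht0) hM0 h3.le
    (by rw [hρ]; linarith) (fun w hw => (hb p.1 h1 ρ w hw).trans h2.le)
    fun w hw => (hb t0 ht0 ρ w hw).trans (by rw [hM]; linarith)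

end Continuity

section Family

theorem continuous_laxEnergy : Continuous (laxEnergy : (Fin (g + 2) → M2) → ℝ) := by
  have h l (p q : Fin 2) : Continuous fun ξ : Fin (g + 2) → M2 => laurent ξ l p q := by
    simp only [laurent_apply]
    exact continuous_finsetSum _ fun j _ =>
      continuous_const.mul ((continuous_apply j).matrix_elem p q)
  refine continuous_finsetSum _ fun i _ => Continuous.norm ?_
  simp only [det_fin_two]
  exact ((h _ 0 0).mul (h _ 1 1)).sub ((h _ 0 1).mul (h _ 1 0))

theorem continuousOn_normal {T : Type*} [TopologicalSpace T] {S : Set T} {F : T → ℂ → ℂ → M2}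
    {z : T → ℂ} (h : ∀ i j, ContinuousOn (fun p => F p 1 (z p) i j) S) :
    ContinuousOn (fun p => toE3 (normal (F p) (z p))) S := by
  have h' (i j : Fin 2) := continuous_conj.comp_continuousOn (h i j)
  have hN (i j : Fin 2) : ContinuousOn (fun p => normal (F p) (z p) i j) S := by
    refine ((((h i 0).mul continuousOn_const).mul (h' j 0)).add
      (((h i 1).mul continuousOn_const).mul (h' j 1))).congr fun p _ =>
      show normal (F p) (z p) i j = F p 1 (z p) i 0 * I * conj (F p 1 (z p) j 0) +
        F p 1 (z p) i 1 * -I * conj (F p 1 (z p) j 1) from ?_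
    simp [normal, mul_apply, Fin.sum_univ_two, sigma3]
  exact toE3L.continuous.comp_continuousOn
    (continuousOn_pi.2 fun i => continuousOn_pi.2 fun j => hN i j)

theorem continuousOn_frame {J : Set ℝ} {ξ : ℝ → Fin (g + 2) → M2}
    {ζ : ℝ → ℂ → Fin (g + 2) → M2} {F : ℝ → ℂ → ℂ → M2}
    (hF : ∀ t ∈ J, IsLaxFlow (ξ t) (ζ t) (F t)) (hξ : ContinuousOn ξ J) {R : ℝ → ℝ → ℝ}
    (hR : ∀ ρ, Continuous (R ρ)) (hb : ∀ t ∈ J, ∀ ρ z, ‖z‖ ≤ ρ →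
      ‖((ζ t z, F t 1 z) : LaxState g)‖ ≤ R ρ (laxEnergy (ξ t))) (i j : Fin 2) :
    ContinuousOn (fun p : ℝ × ℂ => F p.1 1 p.2 i j) (J ×ˢ univ) := by
  let Z : ℝ → ℂ → LaxState g := fun t z => (ζ t z, F t 1 z)
  have h0 : ContinuousOn (fun t => Z t 0) J := by
    have h1 : ContinuousOn (fun t => ((ξ t, oneM2) : LaxState g)) J := hξ.prodMk continuousOn_const
    refine h1.congr fun t ht => ?_
    exact Prod.ext (hF t ht).init ((hF t ht).frame_init 1 one_ne_zero)
  have hd : ∀ t ∈ J, ∀ z, HasFDerivAt (Z t) (((laxForm g 1).flip (Z t z)).flip (Z t z)) z :=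
    fun t ht => hasFDerivAt_laxForm_iff.2 ⟨(hF t ht).lax, (hF t ht).frame 1 one_ne_zero⟩
  have hZ := continuousOn_laxState hd (R := fun ρ t => R ρ (laxEnergy (ξ t)))
    (fun ρ => (hR ρ).comp_continuousOn (continuous_laxEnergy.comp_continuousOn hξ)) hb h0
  exact continuousOn_pi.1 (continuousOn_pi.1 hZ.snd i) j

theorem exists_isContinuousFamily (hJ : J.OrdConnected) {γ : ℝ → RealPair g}
    (hγ : ContinuousOn γ J) (hreg : ∀ t ∈ J, IsRegular (γ t))
    (hs : ∀ t ∈ J, γ t ∈ spectralData g) :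
    ∃ Θ ξ G h, IsContinuousFamily J γ Θ ξ G h ∧ ∀ t ∈ J,
      |verticalFlux (period (γ t)) (G t) (h t)| = 32 * ‖(bPoly (γ t)).eval 0‖ := by
  have hp t (ht : t ∈ J) := IsSpectralData.hasPellData (hreg t ht) (hs t ht)
  obtain ⟨Θ, hΘ, hΘ'⟩ := exists_continuousOn_phase hJ (u := fun t => -16 * (aPoly (γ t)).eval 0)
    (continuousOn_const.mul ((continuous_aPoly_eval 0).comp_continuousOn hγ)) fun t ht => by
      rw [norm_mul, (hp t ht).normalized]; norm_num
  have hΘa t (ht : t ∈ J) : (aPoly (γ t)).eval 0 = -(1 / 16) * exp (Θ t * I) := by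
    linear_combination (-(1 / 16 : ℂ)) * hΘ' t ht
  obtain ⟨R, hR, hex⟩ := exists_isLaxFlow g
  choose! ζ F hF hb using hex
  have hmem t (ht : t ∈ J) := (hp t ht).rootPotential_mem
  have hflow t (ht : t ∈ J) := hF (rootPotential (γ t)) (hmem t ht).1.mem
  have hξc := continuousOn_rootPotential.comp hγ hp
  have hdata t (ht : t ∈ J) :=
    (hflow t ht).hasSpectralData (hmem t ht) (hreg t ht) (hs t ht) (hΘa t ht)
  refine ⟨Θ, fun t => rootPotential (γ t), fun t z => toE3 (normal (F (rootPotential (γ t))) z),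
    fun t => height (exp (Θ t / 2 * I)),
    ⟨hs, fun t ht => (hdata t ht).1, hΘ, hξc, ?_, ?_⟩, fun t ht => (hdata t ht).2⟩
  · exact continuousOn_normal (T := ℝ × ℂ) (F := fun p => F (rootPotential (γ p.1))) fun i j =>
        continuousOn_frame hflow hξc hR (fun t ht => hb _ (hmem t ht).1.mem) i j
  · have h1 : ContinuousOn (fun p : ℝ × ℂ => Θ p.1) (J ×ˢ univ) :=
      hΘ.comp continuousOn_fst fun p hp => hp.1
    refine continuous_re.comp_continuousOn (.mul (.mul continuousOn_const
      (continuous_exp.comp_continuousOn (.mul (.div_const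
        (continuous_ofReal.comp_continuousOn h1) _) continuousOn_const))) continuousOn_snd)

theorem IsIntegralCurveIn.norm_b_le {W : Set (RealPair g)} {c : RealPair g → RealPoly g} (hJ : J.OrdConnected) {γ : ℝ → RealPair g}
    (hγ : IsIntegralCurveIn (whithamField c) W J γ) (hreg : ∀ x ∈ W, IsRegular x)
    (hre : ∀ t ∈ J, ((cPoly (c (γ t))).eval 0 / (bPoly (γ t)).eval 0).re < 0) {t0 t : ℝ}
    (ht0 : t0 ∈ J) (ht : t ∈ J) (h : t0 ≤ t) :
    ‖(bPoly (γ t0)).eval 0‖ ≤ ‖(bPoly (γ t)).eval 0‖ := by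
  have hsub := hJ.out ht0 ht
  have hd : ∀ s ∈ J, HasDerivWithinAt (fun s => ‖(bPoly (γ s)).eval 0‖ ^ 2)
      (-(‖(bPoly (γ s)).eval 0‖ ^ 2 * ((cPoly (c (γ s))).eval 0 / (bPoly (γ s)).eval 0).re)) J s := by
    intro s hs
    have hr := hreg _ (hγ s hs).1
    have hx := (((ContinuousLinearMap.snd ℝ _ _).comp
        (RealPair g).subtypeL).hasFDerivAt).comp_hasDerivWithinAt s (hγ s hs).2
    have hb : HasDerivWithinAt (fun s => (bPoly (γ s)).eval 0)
        ((bPoly (whithamField c (γ s))).eval 0) J s := by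
      refine (hasDerivWithinAt_polyOf_eval hx (hasDerivWithinAt_const s _ 0)).congr_deriv ?_
      rw [mul_zero, add_zero]; rfl
    refine hb.norm_sq.congr_deriv ?_
    obtain ⟨r, -, e⟩ := (isWhithamVector_whithamField hr c).eval_zero hr
    have e' : (bPoly (whithamField c (γ s))).eval 0 = (bPoly (γ s)).eval 0 *
        (r * I - (cPoly (c (γ s))).eval 0 / (bPoly (γ s)).eval 0) / 2 := by
      have := hr.b_zero_ne
      field_simp
      linear_combination e
    rw [Complex.inner, e', ← normSq_eq_norm_sq, normSq_apply]
    generalize (cPoly (c (γ s))).eval 0 / (bPoly (γ s)).eval 0 = q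
    simp
    ring
  have hmono : MonotoneOn (fun s => ‖(bPoly (γ s)).eval 0‖ ^ 2) (Icc t0 t) := by
    have hat := fun s hs => (hd s (hsub (interior_subset hs))).hasDerivAt
        (mem_of_superset (mem_interior_iff_mem_nhds.1 hs) hsub)
    refine monotoneOn_of_deriv_nonneg (convex_Icc _ _)
      (fun s hs => ((hd s (hsub hs)).continuousWithinAt).mono hsub)
      (fun s hs => (hat s hs).differentiableAt.differentiableWithinAt) fun s hs => ?_
    rw [(hat s hs).deriv]
    nlinarith [hre s (hsub (interior_subset hs)), sq_nonneg ‖(bPoly (γ s)).eval 0‖]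
  exact (sq_le_sq₀ (norm_nonneg _) (norm_nonneg _)).1
    (hmono (left_mem_Icc.2 h) (right_mem_Icc.2 h) h)

end Family

end Whitham

end

theorem mainTheorem6 (g : ℕ) (W : Set (Whitham.RealPair g)) (hW : IsOpen W)
    (hdeg : ∀ x ∈ W, (Whitham.aPoly x).natDegree = 2 * g ∧ Whitham.aPoly x ≠ 0 ∧
      (Whitham.bPoly x).natDegree = g + 1)
    (hroots : ∀ x ∈ W, ∀ l : ℂ, ¬((Whitham.aPoly x).eval l = 0 ∧ (Whitham.bPoly x).eval l = 0)) :
    (∃ c : Whitham.RealPoly g, (Whitham.cPoly c).natDegree = g + 1) ∧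
    ∀ c : Whitham.RealPair g → Whitham.RealPoly g, ContDiffOn ℝ ∞ c W →
      ∃ V : Whitham.RealPair g → Whitham.RealPair g, ContDiffOn ℝ ∞ V W ∧
        (∀ x ∈ W, ∀ y, Whitham.IsWhithamVector x (c x) y ↔ y = V x) ∧
        ((∀ x ∈ W ∩ Whitham.spectralData g, (Whitham.cPoly (c x)).eval 1 = 0 ∧
            ((Whitham.cPoly (c x)).eval 0 / (Whitham.bPoly x).eval 0).im = 0) →
          (∀ x ∈ W ∩ Whitham.spectralData g, ∃ ε > 0, ∃ γ : ℝ → Whitham.RealPair g, γ 0 = x ∧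
            Whitham.IsIntegralCurveIn V (W ∩ Whitham.spectralData g) (Ioo (-ε) ε) γ) ∧
          ∀ (I : Set ℝ) (γ : ℝ → Whitham.RealPair g), I.OrdConnected →
            Whitham.IsIntegralCurveIn V W I γ → (∃ t₀ ∈ I, γ t₀ ∈ Whitham.spectralData g) →
            ∃ (Θ : ℝ → ℝ) (ξ : ℝ → Fin (g + 2) → Whitham.M2)
              (G : ℝ → ℂ → Whitham.E3) (h : ℝ → ℂ → ℝ),
              Whitham.IsContinuousFamily I γ Θ ξ G h ∧
              ((∀ x ∈ W ∩ Whitham.spectralData g,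
                  ((Whitham.cPoly (c x)).eval 0 / (Whitham.bPoly x).eval 0).re < 0) →
                ∀ t₀ ∈ I, ∃ δ > 0, ∀ t ∈ I, t₀ ≤ t →
                  δ ≤ |Whitham.verticalFlux (Whitham.period (γ t)) (G t) (h t)|)) := by
  open Whitham in
  have hreg : ∀ x ∈ W, IsRegular x := fun x hx =>
    ⟨(hdeg x hx).1, (hdeg x hx).2.1, (hdeg x hx).2.2, hroots x hx⟩
  refine ⟨exists_natDegree_cPoly g, fun c hc => ⟨whithamField c,
    contDiffOn_whithamField hW hreg hc, fun x hx y => ⟨fun h => h.unique (hreg x hx)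
      (isWhithamVector_whithamField (hreg x hx) c), fun h => h ▸
      isWhithamVector_whithamField (hreg x hx) c⟩, fun hclose => ?_⟩⟩
  have hfam : IsClosingFamily W c :=
    ⟨hW, hreg, hc, fun x hx => (hclose x hx).1, fun x hx => (hclose x hx).2⟩
  refine ⟨fun x hx => ?_, fun I γ hI hγ ⟨t₀, ht₀, h0⟩ => ?_⟩
  · obtain ⟨ε, hε, γ, h1, h2⟩ := hfam.exists_integralCurve hx
    exact ⟨ε, hε, γ, h1, fun t ht => ⟨(h2 t ht).1, (h2 t ht).2.hasDerivWithinAt⟩⟩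
  · have hs := hfam.mem_spectralData hI hγ ht₀ h0
    obtain ⟨Θ, ξ, G, h, h1, h2⟩ := exists_isContinuousFamily hI
      (fun t ht => (hγ t ht).2.continuousWithinAt) (fun t ht => hreg _ (hγ t ht).1) hs
    refine ⟨Θ, ξ, G, h, h1, fun hre t₁ ht₁ => ⟨32 * ‖(bPoly (γ t₁)).eval 0‖, ?_,
      fun t ht hle => ?_⟩⟩
    · exact mul_pos (by norm_num) (norm_pos_iff.2 (hreg _ (hγ t₁ ht₁).1).b_zero_ne)
    · rw [h2 t ht]
      exact mul_le_mul_of_nonneg_left (IsIntegralCurveIn.norm_b_le hI hγ hreg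
        (fun s hs' => hre _ ⟨(hγ s hs').1, hs s hs'⟩) ht₁ ht hle) (by norm_num)
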